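/- **Setting.** Let $\mathcal V$ be a symmetric monoidal closed category with all small limits such that $\mathcal V(\mathbf 1,-)$ is faithful (so that a $\mathcal V$-functor is determined by its underlying functor). Let $(\mathbb I,\otimes,\mathbf 1)$ be a small strict monoidal $\mathcal V$-category, and let $\mathfrak M$ be a category enriched in $\mathcal V$-categories, i.e. a strict 2-category whose hom-categories $[A,B]$ are $\mathcal V$-categories and whose composition is $\mathcal V$-functorial. **$\mathbb I$-objects.** An $\mathbb I$-object $A_\alpha$ is an object $A$ of $\mathfrak M$ with a strict two-sided action $\alpha(u,v)$ of $\mathbb I$ (covariant for $\otimes$ in the left variable, contravariant for $\otimes$ in the right variable, enriched in $\mathcal V$) that is trivial ("mute") on at least one side; it is a left action if it is mute on the right, i.e. $\alpha(\mathbf 1,u)=\mathrm{id}$, and a right action if it is mute on the left. An equivariant morphism $A_\alpha\to B_\beta$ is a pair $(f,\tau)$ of a morphism $f:A\to B$ and isomorphisms $$\tau(u):\beta(\mathbf 1,u)\,f\,\alpha(u,\mathbf 1)\cong\beta(u,\mathbf 1)\,f\,\alpha(\mathbf 1,u),$$ natural in $u$, with $\tau(\mathbf 1)=\mathrm{id}$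 and $\tau(u\otimes v)$ equal to $\tau(u)$ followed by $\tau(v)$ (suitably whiskered). With the 2-cells $f\Rightarrow f'$ compatible with $\tau,\tau'$ these form a $\mathcal V$-category $\mathrm{Fun}_{\mathbb I}(A_\alpha,B_\beta)$. The composite of $(f,\tau_f):A_\alpha\to B_\beta$ and $(g,\tau_g):B_\beta\to C_\gamma$ is $gf$ with $\tau_f$ followed by $\tau_g$ if $\beta$ is a left action, and $\tau_g$ followed by $\tau_f$ if $\beta$ is a right action. An $\mathbb I$-object with a left (resp. right) action is *stable* if it is equivalent, through equivariant morphisms and invertible 2-cells of these categories, to an $\mathbb I$-object with a right (resp. left) action. A *stabilization* of $A_\alpha$ is a stable $S$ with an equivariant $\epsilon:S\to A_\alpha$ such that $\epsilon_*:\mathrm{Fun}_{\mathbb I}(B_\beta,S)\to\mathrm{Fun}_{\mathbb I}(B_\beta,A_\alpha)$ is an equivalence of $\mathcal V$-categories for every stable $B_\beta$. **$\mathrm{Inv}_r$ and $\mathrm{Inv}_l$.** For an object $Z$ of $\mathfrak M$ let $W_r(Z,A_\alpha)$ (resp. $W_l(Z,A_\alpha)$) be the $\mathcal V$-category of $\mathcal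 V$-functors $e:\mathbb I\to[Z,A]$ with isomorphisms, natural in $u$ and $v$, $$\alpha(\mathbf 1,u)\,e(v)\cong\alpha(u,\mathbf 1)\,e(v\otimes u)\qquad(\text{resp. }\alpha(\mathbf 1,u)\,e(u\otimes v)\cong\alpha(u,\mathbf 1)\,e(v)),$$ compatible with the product and the unit of $\mathbb I$ in $u$; its morphisms are the natural transformations compatible with these isomorphisms. $\mathrm{Inv}_s(A_\alpha)$, for $s\in\{l,r\}$, is an object with a universal such wedge: composition with it gives equivalences of $\mathcal V$-categories $[Z,\mathrm{Inv}_s(A_\alpha)]\simeq W_s(Z,A_\alpha)$ for all $Z$. It carries the strict action of $\mathbb I$ on the side $s$ induced by $e\mapsto e(y\otimes-)$ for $s=r$ and by $e\mapsto e(-\otimes y)$ for $s=l$ (up to coherent isomorphism), and evaluation at $\mathbf 1$ is an equivariant morphism $\epsilon_s:\mathrm{Inv}_s(A_\alpha)\to A_\alpha$. Assume that $\mathrm{Inv}_l$ and $\mathrm{Inv}_r$ of every $\mathbb I$-object exist. **The tower.** Put $\mathrm{Inv}_{\mathbb I}=\mathrm{Inv}_l\circ\mathrm{Inv}_r$ with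 $\epsilon=\epsilon_r\circ\epsilon_l:\mathrm{Inv}_{\mathbb I}(X)\to X$, $\mathrm{Inv}^1_{\mathbb I}(A_\alpha)=\mathrm{Inv}_l(A_\alpha)$ and $\mathrm{Inv}^{n+1}_{\mathbb I}(A_\alpha)=\mathrm{Inv}_{\mathbb I}(\mathrm{Inv}^{n}_{\mathbb I}(A_\alpha))$. Let $\mathrm{Inv}^\infty_{\mathbb I}(A_\alpha)$ be the weak limit of $\cdots\to\mathrm{Inv}^2_{\mathbb I}(A_\alpha)\to\mathrm{Inv}^1_{\mathbb I}(A_\alpha)$, computed pointwise: a left $\mathbb I$-object with equivariant projections, commuting with the maps $\epsilon$ up to coherent equivariant invertible 2-cells, whose underlying cone is a weak limit (bilimit, in the $\mathcal V$-enriched sense) in $\mathfrak M$. Let $\epsilon^\infty:\mathrm{Inv}^\infty_{\mathbb I}(A_\alpha)\to A_\alpha$ be the projection to $\mathrm{Inv}^1_{\mathbb I}(A_\alpha)=\mathrm{Inv}_l(A_\alpha)$ followed by $\epsilon_l$. **Theorem.** Let $A_\alpha$ be an $\mathbb I$-object for which $\mathrm{Inv}^\infty_{\mathbb I}(A_\alpha)$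 exists. Then $\mathrm{Inv}^\infty_{\mathbb I}(A_\alpha)$ is stable, and together with $\epsilon^\infty$ it is a stabilization of $A_\alpha$: for every stable $\mathbb I$-object $B_\beta$, composition with $\epsilon^\infty$ is an equivalence of $\mathcal V$-categories $$\mathrm{Fun}_{\mathbb I}(B_\beta,\mathrm{Inv}^\infty_{\mathbb I}(A_\alpha))\simeq\mathrm{Fun}_{\mathbb I}(B_\beta,A_\alpha).$$ -/

import Mathlib

/-
Actions of an enriched strict monoidal category `I` on the objects of a `VCat`-category `M`,
equivariant morphisms, stable objects, the objects `Inv_l`, `Inv_r`, the tower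
`Inv_I^n` and its weak limit.
-/

universe w v' u' v₁ u₁ v₂ u₂ v₃ u₃ w₂

namespace StabAct

open CategoryTheory Limits

noncomputable section

/-! ### `V`-functors and equivalences of `V`-categories -/

section Enriched

open MonoidalCategory

variable (V : Type u') [Category.{v'} V] [MonoidalCategory V]

/-- The functor `V(𝟙, -) : V ⥤ Type` is faithful, so that a `V`-functor is determined by its
underlying functor, and a natural transformation between `V`-functors is `V`-natural. -/
class IsBase : Prop where
  faithful : (coyoneda.obj (Opposite.op (𝟙_ V))).Faithful

variable {C : Type u₁} [Category.{v₁} C] [EnrichedOrdinaryCategory V C]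
  {D : Type u₂} [Category.{v₂} D] [EnrichedOrdinaryCategory V D]
  {E : Type u₃} [Category.{v₃} E] [EnrichedOrdinaryCategory V E]

/-- A lift of a functor `F` between the underlying categories of two `V`-categories to a
`V`-functor. -/
structure VLift (F : C ⥤ D) where
  map (X Y : C) : (X ⟶[V] Y) ⟶ (F.obj X ⟶[V] F.obj Y)
  map_id (X : C) : eId V X ≫ map X X = eId V (F.obj X)
  map_comp (X Y Z : C) :
    eComp V X Y Z ≫ map X Z = (map X Y ⊗ₘ map Y Z) ≫ eComp V (F.obj X) (F.obj Y) (F.obj Z)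
  eHomEquiv_map {X Y : C} (f : X ⟶ Y) : eHomEquiv V f ≫ map X Y = eHomEquiv V (F.map f)

/-- `F` is (the underlying functor of) a `V`-functor. -/
def IsVFunctor (F : C ⥤ D) : Prop := Nonempty (VLift V F)

/-- `F` is an equivalence of `V`-categories, i.e. an equivalence in the `2`-category of
`V`-categories. -/
def IsVEquivalence (F : C ⥤ D) : Prop :=
  IsVFunctor V F ∧ ∃ G : D ⥤ C, IsVFunctor V G ∧
    Nonempty (F ⋙ G ≅ 𝟭 C) ∧ Nonempty (G ⋙ F ≅ 𝟭 D)

variable {V}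

theorem unit_ext [IsBase V] {X Y : V} {f g : X ⟶ Y} (h : ∀ x : 𝟙_ V ⟶ X, x ≫ f = x ≫ g) :
    f = g :=
  (IsBase.faithful (V := V)).map_injective (by ext x; exact h x)

theorem tensor_ext [IsBase V] [MonoidalClosed V] {X Y Z : V} {f g : X ⊗ Y ⟶ Z}
    (h : ∀ (x : 𝟙_ V ⟶ X) (y : 𝟙_ V ⟶ Y),
      (λ_ (𝟙_ V)).inv ≫ (x ⊗ₘ y) ≫ f = (λ_ (𝟙_ V)).inv ≫ (x ⊗ₘ y) ≫ g) : f = g := by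
  apply MonoidalClosed.curry_injective
  apply unit_ext
  intro y
  rw [← MonoidalClosed.curry_natural_left, ← MonoidalClosed.curry_natural_left]
  congr 1
  rw [← cancel_epi (ρ_ X).inv]
  apply unit_ext
  intro x
  have := h x y
  rw [MonoidalCategory.tensorHom_def, Category.assoc, unitors_inv_equal] at this
  simpa using this

set_option linter.checkUnivs false in
variable (V) in
/-- A presentation of the morphisms of a category `D` as families of morphisms in `V`-categories
`K j` satisfying equations which make sense in `V`. -/
structure HomPresentation (D : Type u₂) [Category.{v₂} D] where
  Sh : MulticospanShape.{w, w}
  K : Sh.L → Type u₃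
  cat : ∀ j, Category.{v₃} (K j)
  enr : ∀ j, EnrichedOrdinaryCategory V (K j)
  U : ∀ j, D ⥤ K j
  W : D → D → Sh.R → V
  a : ∀ (d d' : D) (t : Sh.R),
    ((U (Sh.fst t)).obj d ⟶[V] (U (Sh.fst t)).obj d') ⟶ W d d' t
  b : ∀ (d d' : D) (t : Sh.R),
    ((U (Sh.snd t)).obj d ⟶[V] (U (Sh.snd t)).obj d') ⟶ W d d' t
  rel : ∀ {d d' : D} (f : d ⟶ d') (t : Sh.R),
    eHomEquiv V ((U (Sh.fst t)).map f) ≫ a d d' t = eHomEquiv V ((U (Sh.snd t)).map f) ≫ b d d' t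
  faithful : ∀ {d d' : D} (f g : d ⟶ d'), (∀ j, (U j).map f = (U j).map g) → f = g
  full : ∀ {d d' : D} (θ : ∀ j, (U j).obj d ⟶ (U j).obj d'),
    (∀ t, eHomEquiv V (θ (Sh.fst t)) ≫ a d d' t = eHomEquiv V (θ (Sh.snd t)) ≫ b d d' t) →
      ∃ f : d ⟶ d', ∀ j, (U j).map f = θ j

namespace HomPresentation

attribute [instance] HomPresentation.cat HomPresentation.enr

variable {D : Type u₂} [Category.{v₂} D] (P : HomPresentation.{w, v', u', v₂, u₂, v₃, u₃} V D)

/-- The diagram in `V` whose limit is the hom-object. -/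
abbrev index (d d' : D) : MulticospanIndex P.Sh V where
  left j := (P.U j).obj d ⟶[V] (P.U j).obj d'
  right t := P.W d d' t
  fst t := P.a d d' t
  snd t := P.b d d' t

variable [HasLimitsOfSize.{w, w} V]

/-- The hom-object: the subobject of `∏ j, K j (U j d, U j d')` cut out by the equations. -/
abbrev hom (d d' : D) : V := multiequalizer (P.index d d')

/-- The element of the hom-object given by a morphism. -/
def toHom {d d' : D} (f : d ⟶ d') : 𝟙_ V ⟶ P.hom d d' :=
  Multiequalizer.lift _ _ (fun j => eHomEquiv V ((P.U j).map f)) (P.rel f)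

@[simp]
theorem toHom_ι {d d' : D} (f : d ⟶ d') (j : P.Sh.L) :
    P.toHom f ≫ Multiequalizer.ι (P.index d d') j = eHomEquiv V ((P.U j).map f) :=
  Multiequalizer.lift_ι _ _ _ _ _

theorem toHom_bijective (d d' : D) : Function.Bijective (P.toHom (d := d) (d' := d')) := by
  constructor
  · intro f g h
    refine P.faithful f g fun j => (eHomEquiv V).injective ?_
    rw [← toHom_ι, ← toHom_ι, h]
  · intro x
    obtain ⟨f, hf⟩ := P.full
      (fun j => (eHomEquiv V).symm (x ≫ Multiequalizer.ι (P.index d d') j)) (by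
        intro t
        have := Multiequalizer.condition (P.index d d') t
        simp only [Equiv.apply_symm_apply, Category.assoc]
        exact congrArg (x ≫ ·) this)
    refine ⟨f, Multiequalizer.hom_ext _ _ _ fun j => ?_⟩
    rw [toHom_ι, hf j, Equiv.apply_symm_apply]

variable [IsBase V] [MonoidalClosed V]

/-- The composition of hom-objects. -/
def comp (d d' d'' : D) : P.hom d d' ⊗ P.hom d' d'' ⟶ P.hom d d'' :=
  Multiequalizer.lift _ _
    (fun j => (Multiequalizer.ι (P.index d d') j ⊗ₘ Multiequalizer.ι (P.index d' d'') j) ≫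
      eComp V _ _ _) (by
    intro t
    apply tensor_ext
    intro x y
    obtain ⟨f, rfl⟩ := (P.toHom_bijective d d').2 x
    obtain ⟨g, rfl⟩ := (P.toHom_bijective d' d'').2 y
    have h := P.rel (f ≫ g) t
    simp only [Functor.map_comp, eHomEquiv_comp, Category.assoc] at h
    simpa using h)

theorem comp_ι (d d' d'' : D) (j : P.Sh.L) :
    P.comp d d' d'' ≫ Multiequalizer.ι (P.index d d'') j =
      (Multiequalizer.ι (P.index d d') j ⊗ₘ Multiequalizer.ι (P.index d' d'') j) ≫ eComp V _ _ _ :=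
  Multiequalizer.lift_ι _ _ _ _ _

/-- The `V`-category structure with underlying category `D` whose hom-objects are the limits
`P.hom d d'`. -/
@[reducible]
def enriched : EnrichedOrdinaryCategory V D where
  Hom d d' := P.hom d d'
  id d := P.toHom (𝟙 d)
  comp d d' d'' := P.comp d d' d''
  id_comp d d' := by
    refine Multiequalizer.hom_ext _ _ _ fun j => ?_
    simp only [Category.assoc, comp_ι, Category.id_comp]
    rw [← tensorHom_id, tensorHom_comp_tensorHom_assoc, toHom_ι, CategoryTheory.Functor.map_id,
      eHomEquiv_id, Category.id_comp, MonoidalCategory.tensorHom_def', Category.assoc,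
      ← leftUnitor_inv_naturality_assoc]
    simp
  comp_id d d' := by
    refine Multiequalizer.hom_ext _ _ _ fun j => ?_
    simp only [Category.assoc, comp_ι, Category.id_comp]
    rw [← id_tensorHom, tensorHom_comp_tensorHom_assoc, toHom_ι, CategoryTheory.Functor.map_id,
      eHomEquiv_id, Category.id_comp, MonoidalCategory.tensorHom_def, Category.assoc,
      ← rightUnitor_inv_naturality_assoc]
    simp
  assoc d₁ d₂ d₃ d₄ := by
    refine Multiequalizer.hom_ext _ _ _ fun j => ?_
    simp only [Category.assoc, comp_ι]
    rw [← tensorHom_id, tensorHom_comp_tensorHom_assoc, comp_ι, Category.id_comp,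
      ← id_tensorHom, tensorHom_comp_tensorHom_assoc, comp_ι, Category.id_comp]
    rw [← Category.comp_id (Multiequalizer.ι (P.index d₃ d₄) j), ← tensorHom_comp_tensorHom,
      Category.comp_id, tensorHom_id, Category.assoc, ← associator_inv_naturality_assoc, e_assoc]
    nth_rw 2 [← Category.comp_id (Multiequalizer.ι (P.index d₁ d₂) j)]
    rw [← tensorHom_comp_tensorHom, id_tensorHom, Category.assoc]
  homEquiv := Equiv.ofBijective _ (P.toHom_bijective _ _)
  homEquiv_id _ := rfl
  homEquiv_comp {X Y Z} f g := by
    refine Multiequalizer.hom_ext _ _ _ fun j => ?_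
    change P.toHom (f ≫ g) ≫ _ = ((λ_ _).inv ≫ (P.toHom f ⊗ₘ P.toHom g) ≫ P.comp _ _ _) ≫ _
    simp [comp_ι, eHomEquiv_comp]

end HomPresentation

end Enriched

section Sides

open MonoidalCategory

/-- The two sides of an action. -/
inductive Side
  | l
  | r

/-- The other side. -/
@[reducible]
def Side.op : Side → Side
  | .l => .r
  | .r => .l

variable (V : Type u') [Category.{v'} V] [MonoidalCategory V]
variable {I : Type u₁} [Category.{v₁} I] [MonoidalCategory I]

variable (I) in
/-- The unit object of `I`. -/
abbrev tunit : I := 𝟙_ I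

variable (I) in
/-- The monoidal category `I` is strict. -/
class IsStrictMonoidal : Prop where
  tensor_assoc (u v w : I) : (u ⊗ v) ⊗ w = u ⊗ (v ⊗ w)
  unit_tensor (u : I) : 𝟙_ I ⊗ u = u
  tensor_unit (u : I) : u ⊗ 𝟙_ I = u
  associator_eq (u v w : I) : α_ u v w = eqToIso (tensor_assoc u v w)
  leftUnitor_eq (u : I) : λ_ u = eqToIso (unit_tensor u)
  rightUnitor_eq (u : I) : ρ_ u = eqToIso (tensor_unit u)

variable (I) in
/-- The monoidal category `I` is `V`-enriched: its tensor product is a `V`-functor in each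
variable. -/
class IsVMonoidal [EnrichedOrdinaryCategory V I] : Prop where
  tensorLeft (u : I) : IsVFunctor V (tensorLeft u)
  tensorRight (u : I) : IsVFunctor V (tensorRight u)

namespace Side

/-- The product of `I`, in the usual order on the right side and in the opposite order on the left
side: `F (s.mul u v) = F u ≫ F v` (first `F u`, then `F v`) is the multiplicativity of an action
`F` on the side `s`. -/
@[reducible]
def mul : Side → I → I → I
  | .r, u, v => u ⊗ v
  | .l, u, v => v ⊗ u

/-- `Side.mul` on morphisms. -/
@[reducible]
def mulMap : (s : Side) → {u u' v v' : I} → (u ⟶ u') → (v ⟶ v') → (s.mul u v ⟶ s.mul u' v')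
  | .r, _, _, _, _, f, g => f ⊗ₘ g
  | .l, _, _, _, _, f, g => g ⊗ₘ f

/-- The associativity of `Side.mul` (an identity when `I` is strict). -/
@[reducible]
def assoc : (s : Side) → (u v w : I) → (s.mul (s.mul u v) w ≅ s.mul u (s.mul v w))
  | .r, u, v, w => α_ u v w
  | .l, u, v, w => (α_ w v u).symm

/-- The left unit law of `Side.mul` (an identity when `I` is strict). -/
@[reducible]
def one_mul : (s : Side) → (u : I) → (s.mul (𝟙_ I) u ≅ u)
  | .r, u => λ_ u
  | .l, u => ρ_ u

/-- The right unit law of `Side.mul` (an identity when `I` is strict). -/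
@[reducible]
def mul_one : (s : Side) → (u : I) → (s.mul u (𝟙_ I) ≅ u)
  | .r, u => ρ_ u
  | .l, u => λ_ u

/-- `Side.mul` by an object on the right, on isomorphisms. -/
@[reducible]
def mulIsoRight (s : Side) {u u' : I} (f : u ≅ u') (v : I) : s.mul u v ≅ s.mul u' v where
  hom := s.mulMap f.hom (𝟙 v)
  inv := s.mulMap f.inv (𝟙 v)
  hom_inv_id := by cases s <;> simp
  inv_hom_id := by cases s <;> simp

theorem unit_nat (s : Side) {u v : I} (h : u ⟶ v) :
    s.mulMap h (𝟙 (𝟙_ I)) ≫ (s.mul_one v ≪≫ (s.one_mul v).symm).hom =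
      (s.mul_one u ≪≫ (s.one_mul u).symm).hom ≫ s.mulMap (𝟙 (𝟙_ I)) h := by
  cases s <;> simp

theorem unit_coh (s : Side) (u v : I) :
    (s.assoc u v (𝟙_ I)).inv ≫ (s.mul_one (s.mul u v)).hom ≫ (s.one_mul (s.mul u v)).inv =
      s.mulMap (𝟙 u) ((s.mul_one v).hom ≫ (s.one_mul v).inv) ≫ (s.assoc u (𝟙_ I) v).inv ≫
        s.mulMap ((s.mul_one u).hom ≫ (s.one_mul u).inv) (𝟙 v) ≫ (s.assoc (𝟙_ I) u v).hom := by
  cases s <;> simp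

theorem unit_unit (s : Side) :
    (s.one_mul (𝟙_ I)).inv ≫ (s.mul_one (𝟙_ I)).hom ≫ (s.one_mul (𝟙_ I)).inv =
      (s.mul_one (𝟙_ I)).inv := by
  cases s <;> simp [unitors_equal, unitors_inv_equal]

end Side

end Sides

/-! ### Calculus of 2-cells in a bicategory -/

section Coherence

open Bicategory

variable {M : Type u₂} [Bicategory.{w₂, v₂} M]

/-- The pasting of two equivariance cells `t₁`, `t₂` of `f` along the multiplicativity of the
actions on `a` and `b` and the commutation of the actions of the two sides. -/
def triPaste {a b : M} {af af₁ af₂ an an₁ an₂ : a ⟶ a} {bf bf₁ bf₂ bn bn₁ bn₂ : b ⟶ b}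
    {f : a ⟶ b} (mA' : af ≅ af₂ ≫ af₁) (mA : an ≅ an₁ ≫ an₂)
    (mB' : bf ≅ bf₂ ≫ bf₁) (mB : bn ≅ bn₁ ≫ bn₂)
    (cA : af₂ ≫ an₁ ≅ an₁ ≫ af₂) (cB : bf₁ ≫ bn₂ ≅ bn₂ ≫ bf₁)
    (t₁ : af₁ ≫ f ≫ bn₁ ⟶ an₁ ≫ f ≫ bf₁) (t₂ : af₂ ≫ f ≫ bn₂ ⟶ an₂ ≫ f ≫ bf₂) :
    af ≫ f ≫ bn ⟶ an ≫ f ≫ bf :=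
  mA'.hom ▷ (f ≫ bn) ≫ (af₂ ≫ af₁) ◁ f ◁ mB.hom ⊗≫
    af₂ ◁ t₁ ▷ bn₂ ⊗≫ cA.hom ▷ (f ≫ bf₁ ≫ bn₂) ≫ (an₁ ≫ af₂) ◁ f ◁ cB.hom ⊗≫
    an₁ ◁ t₂ ▷ bf₁ ⊗≫ (an₁ ≫ an₂) ◁ f ◁ mB'.inv ≫ mA.inv ▷ (f ≫ bf)

theorem tri_flip {a b : M} {af af₁ af₂ an an₁ an₂ : a ⟶ a} {bf bf₁ bf₂ bn bn₁ bn₂ : b ⟶ b}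
    {f : a ⟶ b} (mA' : af ≅ af₂ ≫ af₁) (mA : an ≅ an₁ ≫ an₂)
    (mB' : bf ≅ bf₂ ≫ bf₁) (mB : bn ≅ bn₁ ≫ bn₂)
    (cA : af₂ ≫ an₁ ≅ an₁ ≫ af₂) (cB : bf₁ ≫ bn₂ ≅ bn₂ ≫ bf₁)
    (t : af ≫ f ≫ bn ≅ an ≫ f ≫ bf) (t₁ : af₁ ≫ f ≫ bn₁ ≅ an₁ ≫ f ≫ bf₁)
    (t₂ : af₂ ≫ f ≫ bn₂ ≅ an₂ ≫ f ≫ bf₂)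
    (h : t.hom = triPaste mA' mA mB' mB cA cB t₁.hom t₂.hom) :
    t.inv = triPaste mA mA' mB mB' cA.symm cB.symm t₂.inv t₁.inv := by
  unfold triPaste at h ⊢
  rw [← cancel_epi t.hom, Iso.hom_inv_id, h]
  have e := whisker_exchange cA.inv (f ◁ cB.inv)
  simp only [bicategoricalComp, Iso.symm_hom]
  rw [← reassoc_of% e]
  simp
theorem tri_comp {a b c : M} {af af₁ af₂ an an₁ an₂ : a ⟶ a} {bf bf₁ bf₂ : b ⟶ b}
    {cf cf₁ cf₂ cn cn₁ cn₂ : c ⟶ c}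
    {f : a ⟶ b} {g : b ⟶ c} (mA' : af ≅ af₂ ≫ af₁) (mA : an ≅ an₁ ≫ an₂)
    (mB' : bf ≅ bf₂ ≫ bf₁) 
    (mC' : cf ≅ cf₂ ≫ cf₁) (mC : cn ≅ cn₁ ≫ cn₂)
    (cA : af₂ ≫ an₁ ≅ an₁ ≫ af₂) 
    (cC : cf₁ ≫ cn₂ ≅ cn₂ ≫ cf₁)
    (t : af ≫ f ⟶ an ≫ f ≫ bf) (t₁ : af₁ ≫ f ⟶ an₁ ≫ f ≫ bf₁)
    (t₂ : af₂ ≫ f ⟶ an₂ ≫ f ≫ bf₂)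
    (r : bf ≫ g ≫ cn ⟶ g ≫ cf) (r₁ : bf₁ ≫ g ≫ cn₁ ⟶ g ≫ cf₁)
    (r₂ : bf₂ ≫ g ≫ cn₂ ⟶ g ≫ cf₂)
    (h : t =
      mA'.hom ▷ f ⊗≫ af₂ ◁ t₁ ⊗≫ cA.hom ▷ (f ≫ bf₁) ⊗≫
      an₁ ◁ t₂ ▷ bf₁ ⊗≫ (an₁ ≫ an₂) ◁ f ◁ mB'.inv ≫ mA.inv ▷ (f ≫ bf))
    (k : r =
      mB'.hom ▷ (g ≫ cn) ≫ (bf₂ ≫ bf₁) ◁ g ◁ mC.hom ⊗≫ bf₂ ◁ r₁ ▷ cn₂ ⊗≫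
      bf₂ ◁ g ◁ cC.hom ⊗≫ r₂ ▷ cf₁ ⊗≫ g ◁ mC'.inv) :
    t ▷ (g ≫ cn) ⊗≫ an ◁ f ◁ r =
      mA'.hom ▷ f ▷ (g ≫ cn) ⊗≫ (af₂ ≫ af₁ ≫ f ≫ g) ◁ mC.hom ⊗≫
      af₂ ◁ (t₁ ▷ (g ≫ cn₁) ⊗≫ an₁ ◁ f ◁ r₁) ▷ cn₂ ⊗≫
      cA.hom ▷ (f ≫ g ≫ cf₁ ≫ cn₂) ≫ (an₁ ≫ af₂) ◁ f ◁ g ◁ cC.hom ⊗≫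
      an₁ ◁ (t₂ ▷ (g ≫ cn₂) ⊗≫ an₂ ◁ f ◁ r₂) ▷ cf₁ ⊗≫ (an₁ ≫ an₂) ◁ f ◁ g ◁ mC'.inv ≫
      mA.inv ▷ (f ≫ g ≫ cf) := by
  subst h k
  calc
    _ = mA'.hom ▷ f ▷ (g ≫ cn) ⊗≫ af₂ ◁ t₁ ▷ (g ≫ cn) ⊗≫ cA.hom ▷ (f ≫ bf₁ ≫ g ≫ cn) ⊗≫
      an₁ ◁ t₂ ▷ (bf₁ ≫ g ≫ cn) ⊗≫ (an₁ ≫ an₂) ◁ f ◁ mB'.inv ▷ (g ≫ cn) ⊗≫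
      (mA.inv ▷ (f ≫ bf ≫ g ≫ cn) ≫ an ◁ f ◁ (mB'.hom ▷ (g ≫ cn) ≫ (bf₂ ≫ bf₁) ◁ g ◁ mC.hom ⊗≫
      bf₂ ◁ r₁ ▷ cn₂ ⊗≫ bf₂ ◁ g ◁ cC.hom ⊗≫ r₂ ▷ cf₁ ⊗≫ g ◁ mC'.inv)) := by
      bicategory
    _ = mA'.hom ▷ f ▷ (g ≫ cn) ⊗≫ af₂ ◁ t₁ ▷ (g ≫ cn) ⊗≫ cA.hom ▷ (f ≫ bf₁ ≫ g ≫ cn) ⊗≫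
      (an₁ ◁ t₂ ▷ (bf₁ ≫ g ≫ cn) ⊗≫
      (an₁ ≫ an₂ ≫ f ≫ bf₂) ◁ (bf₁ ◁ g ◁ mC.hom ⊗≫ r₁ ▷ cn₂ ≫ 𝟙 _)) ⊗≫
      (an₁ ≫ an₂) ◁ (f ◁ bf₂ ◁ g ◁ cC.hom ⊗≫ f ◁ r₂ ▷ cf₁ ⊗≫ f ◁ g ◁ mC'.inv) ⊗≫
      mA.inv ▷ (f ≫ g ≫ cf) := by
      rw [← whisker_exchange]; simp [bicategoricalComp]
    _ = mA'.hom ▷ f ▷ (g ≫ cn) ⊗≫ af₂ ◁ t₁ ▷ (g ≫ cn) ⊗≫ cA.hom ▷ (f ≫ bf₁ ≫ g ≫ cn) ⊗≫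
      an₁ ◁ (t₂ ▷ (bf₁ ≫ g ≫ cn) ≫
      (an₂ ≫ f ≫ bf₂) ◁ (bf₁ ◁ g ◁ mC.hom ⊗≫ r₁ ▷ cn₂ ⊗≫ g ◁ cC.hom)) ⊗≫
      (an₁ ≫ an₂) ◁ (f ◁ r₂ ▷ cf₁ ⊗≫ f ◁ g ◁ mC'.inv) ⊗≫
      mA.inv ▷ (f ≫ g ≫ cf) := by
      simp [bicategoricalComp]
    _ = mA'.hom ▷ f ▷ (g ≫ cn) ⊗≫ af₂ ◁ t₁ ▷ (g ≫ cn) ⊗≫ (cA.hom ▷ (f ≫ bf₁ ≫ g ≫ cn) ≫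
      (an₁ ≫ af₂) ◁ f ◁ (bf₁ ◁ g ◁ mC.hom ⊗≫ r₁ ▷ cn₂ ⊗≫ g ◁ cC.hom)) ⊗≫
      an₁ ◁ t₂ ▷ (g ≫ cn₂ ≫ cf₁) ⊗≫
      (an₁ ≫ an₂) ◁ (f ◁ r₂ ▷ cf₁ ⊗≫ f ◁ g ◁ mC'.inv) ⊗≫
      mA.inv ▷ (f ≫ g ≫ cf) := by
      rw [← whisker_exchange]; simp [bicategoricalComp]
    _ = mA'.hom ▷ f ▷ (g ≫ cn) ⊗≫ af₂ ◁ (t₁ ▷ (g ≫ cn) ≫ (an₁ ≫ f ≫ bf₁) ◁ g ◁ mC.hom) ⊗≫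
      (af₂ ≫ an₁) ◁ f ◁ (𝟙 (bf₁ ≫ g ≫ cn₁ ≫ cn₂) ⊗≫ r₁ ▷ cn₂) ⊗≫
      ((af₂ ≫ an₁) ◁ f ◁ g ◁ cC.hom ≫ cA.hom ▷ (f ≫ g ≫ cn₂ ≫ cf₁)) ⊗≫
      an₁ ◁ t₂ ▷ (g ≫ cn₂ ≫ cf₁) ⊗≫
      (an₁ ≫ an₂) ◁ (f ◁ r₂ ▷ cf₁ ⊗≫ f ◁ g ◁ mC'.inv) ⊗≫
      mA.inv ▷ (f ≫ g ≫ cf) := by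
      rw [← whisker_exchange]
      bicategory
    _ = _ := by
      rw [← whisker_exchange t₁ (g ◁ mC.hom), whisker_exchange cA.hom (f ◁ g ◁ cC.hom)]; bicategory

/-- The equivariance cell `t` with the trivial factor `bn` of its source removed. -/
def hatL {a b : M} {af an : a ⟶ a} {bf bn : b ⟶ b} {f : a ⟶ b} (ν : bn ≅ 𝟙 b)
    (t : af ≫ f ≫ bn ≅ an ≫ f ≫ bf) : af ≫ f ≅ an ≫ f ≫ bf :=
  whiskerLeftIso af ((ρ_ f).symm ≪≫ whiskerLeftIso f ν.symm) ≪≫ t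

/-- The equivariance cell `r` with the trivial factor `bn` of its target removed. -/
def hatR {b c : M} {bf bn : b ⟶ b} {cf cn : c ⟶ c} {g : b ⟶ c} (ν : bn ≅ 𝟙 b)
    (r : bf ≫ g ≫ cn ≅ bn ≫ g ≫ cf) : bf ≫ g ≫ cn ≅ g ≫ cf :=
  r ≪≫ whiskerRightIso ν (g ≫ cf) ≪≫ λ_ (g ≫ cf)

/-- The composite of the equivariance cells `t` of `f` and `r` of `g`, when `bn` is trivial: first
`t`, then `r`. -/
def compIso {a b c : M} {af an : a ⟶ a} {bf bn : b ⟶ b} {cf cn : c ⟶ c} {f : a ⟶ b} {g : b ⟶ c}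
    (ν : bn ≅ 𝟙 b) (t : af ≫ f ≫ bn ≅ an ≫ f ≫ bf) (r : bf ≫ g ≫ cn ≅ bn ≫ g ≫ cf) :
    af ≫ (f ≫ g) ≫ cn ≅ an ≫ (f ≫ g) ≫ cf :=
  whiskerLeftIso af (α_ f g cn) ≪≫ (α_ af f (g ≫ cn)).symm ≪≫
    whiskerRightIso (hatL ν t) (g ≫ cn) ≪≫ α_ an (f ≫ bf) (g ≫ cn) ≪≫
    whiskerLeftIso an (α_ f bf (g ≫ cn) ≪≫ whiskerLeftIso f (hatR ν r) ≪≫ (α_ f g cf).symm)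

theorem hatL_tri {a b : M} {af af₁ af₂ an an₁ an₂ : a ⟶ a} {bf bf₁ bf₂ bn bn₁ bn₂ : b ⟶ b}
    {f : a ⟶ b} (ν : bn ≅ 𝟙 b) (ν₁ : bn₁ ≅ 𝟙 b) (ν₂ : bn₂ ≅ 𝟙 b)
    (mA' : af ≅ af₂ ≫ af₁) (mA : an ≅ an₁ ≫ an₂)
    (mB' : bf ≅ bf₂ ≫ bf₁) (mB : bn ≅ bn₁ ≫ bn₂)
    (cA : af₂ ≫ an₁ ≅ an₁ ≫ af₂) (cB : bf₁ ≫ bn₂ ≅ bn₂ ≫ bf₁)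
    (hmB : mB.hom = ν.hom ≫ (λ_ (𝟙 b)).inv ≫ ν₁.inv ▷ 𝟙 b ≫ bn₁ ◁ ν₂.inv)
    (hcB : cB.hom = bf₁ ◁ ν₂.hom ≫ (ρ_ bf₁).hom ≫ (λ_ bf₁).inv ≫ ν₂.inv ▷ bf₁)
    (t : af ≫ f ≫ bn ≅ an ≫ f ≫ bf) (t₁ : af₁ ≫ f ≫ bn₁ ≅ an₁ ≫ f ≫ bf₁)
    (t₂ : af₂ ≫ f ≫ bn₂ ≅ an₂ ≫ f ≫ bf₂)
    (h : t.hom = triPaste mA' mA mB' mB cA cB t₁.hom t₂.hom) :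
    (hatL ν t).hom =
      mA'.hom ▷ f ⊗≫ af₂ ◁ (hatL ν₁ t₁).hom ⊗≫ cA.hom ▷ (f ≫ bf₁) ⊗≫
      an₁ ◁ (hatL ν₂ t₂).hom ▷ bf₁ ⊗≫ (an₁ ≫ an₂) ◁ f ◁ mB'.inv ≫ mA.inv ▷ (f ≫ bf) := by
  simp only [hatL, Iso.trans_hom, whiskerLeftIso_hom, Iso.symm_hom]
  rw [h, triPaste, hmB, hcB]
  clear h hmB hcB mB cB
  calc
    _ = (𝟙 (af ≫ f) ⊗≫ (af ◁ f ◁ ν.inv ≫ mA'.hom ▷ (f ≫ bn)) ⊗≫ (af₂ ≫ af₁) ◁ f ◁ ν.hom ⊗≫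
        (af₂ ≫ af₁) ◁ f ◁ ν₁.inv ⊗≫ 𝟙 (af₂ ≫ af₁ ≫ f ≫ bn₁)) ⊗≫
        (af₂ ◁ ((af₁ ≫ f ≫ bn₁) ◁ ν₂.inv ≫ t₁.hom ▷ bn₂)) ⊗≫
        cA.hom ▷ (f ≫ bf₁ ≫ bn₂) ⊗≫ (an₁ ≫ af₂) ◁ f ◁ bf₁ ◁ ν₂.hom ⊗≫
        (an₁ ≫ af₂) ◁ f ◁ ν₂.inv ▷ bf₁ ⊗≫
        an₁ ◁ t₂.hom ▷ bf₁ ⊗≫ (an₁ ≫ an₂) ◁ f ◁ mB'.inv ≫ mA.inv ▷ (f ≫ bf) := by bicategory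
    _ = (𝟙 (af ≫ f) ⊗≫ mA'.hom ▷ f ⊗≫ (af₂ ≫ af₁) ◁ f ◁ (ν.inv ≫ ν.hom) ⊗≫
        (af₂ ≫ af₁) ◁ f ◁ ν₁.inv ⊗≫ 𝟙 (af₂ ≫ af₁ ≫ f ≫ bn₁)) ⊗≫
        af₂ ◁ t₁.hom ⊗≫ ((af₂ ≫ an₁) ◁ (f ≫ bf₁) ◁ ν₂.inv ≫
        cA.hom ▷ ((f ≫ bf₁) ≫ bn₂)) ⊗≫ (an₁ ≫ af₂) ◁ f ◁ bf₁ ◁ ν₂.hom ⊗≫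
        (an₁ ≫ af₂) ◁ f ◁ ν₂.inv ▷ bf₁ ⊗≫
        an₁ ◁ t₂.hom ▷ bf₁ ⊗≫ (an₁ ≫ an₂) ◁ f ◁ mB'.inv ≫ mA.inv ▷ (f ≫ bf) := by
      have e := whisker_exchange mA'.hom (f ◁ ν.inv)
      rw [e, whisker_exchange t₁.hom ν₂.inv]; bicategory
    _ = (𝟙 (af ≫ f) ⊗≫ mA'.hom ▷ f ⊗≫ (af₂ ≫ af₁) ◁ f ◁ (ν.inv ≫ ν.hom) ⊗≫
        (af₂ ≫ af₁) ◁ f ◁ ν₁.inv ⊗≫ 𝟙 (af₂ ≫ af₁ ≫ f ≫ bn₁)) ⊗≫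
        af₂ ◁ t₁.hom ⊗≫ cA.hom ▷ (f ≫ bf₁) ⊗≫ (an₁ ≫ af₂) ◁ f ◁ bf₁ ◁ (ν₂.inv ≫ ν₂.hom) ⊗≫
        (an₁ ≫ af₂) ◁ f ◁ ν₂.inv ▷ bf₁ ⊗≫
        an₁ ◁ t₂.hom ▷ bf₁ ⊗≫ (an₁ ≫ an₂) ◁ f ◁ mB'.inv ≫ mA.inv ▷ (f ≫ bf) := by
      rw [whisker_exchange cA.hom]; bicategory
    _ = _ := by
      rw [Iso.inv_hom_id, Iso.inv_hom_id]; bicategory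

theorem hatR_tri {b c : M} {bf bf₁ bf₂ bn bn₁ bn₂ : b ⟶ b} {cf cf₁ cf₂ cn cn₁ cn₂ : c ⟶ c}
    {g : b ⟶ c} (ν : bn ≅ 𝟙 b) (ν₁ : bn₁ ≅ 𝟙 b) (ν₂ : bn₂ ≅ 𝟙 b)
    (mB' : bf ≅ bf₂ ≫ bf₁) (mB : bn ≅ bn₁ ≫ bn₂)
    (mC' : cf ≅ cf₂ ≫ cf₁) (mC : cn ≅ cn₁ ≫ cn₂)
    (cB : bf₂ ≫ bn₁ ≅ bn₁ ≫ bf₂) (cC : cf₁ ≫ cn₂ ≅ cn₂ ≫ cf₁)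
    (hmB : mB.hom = ν.hom ≫ (λ_ (𝟙 b)).inv ≫ ν₁.inv ▷ 𝟙 b ≫ bn₁ ◁ ν₂.inv)
    (hcB : cB.hom = bf₂ ◁ ν₁.hom ≫ (ρ_ bf₂).hom ≫ (λ_ bf₂).inv ≫ ν₁.inv ▷ bf₂)
    (r : bf ≫ g ≫ cn ≅ bn ≫ g ≫ cf) (r₁ : bf₁ ≫ g ≫ cn₁ ≅ bn₁ ≫ g ≫ cf₁)
    (r₂ : bf₂ ≫ g ≫ cn₂ ≅ bn₂ ≫ g ≫ cf₂)
    (h : r.hom = triPaste mB' mB mC' mC cB cC r₁.hom r₂.hom) :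
    (hatR ν r).hom =
      mB'.hom ▷ (g ≫ cn) ≫ (bf₂ ≫ bf₁) ◁ g ◁ mC.hom ⊗≫ bf₂ ◁ (hatR ν₁ r₁).hom ▷ cn₂ ⊗≫
      bf₂ ◁ g ◁ cC.hom ⊗≫ (hatR ν₂ r₂).hom ▷ cf₁ ⊗≫ g ◁ mC'.inv := by
  have hmB' : mB.inv = bn₁ ◁ ν₂.hom ≫ ν₁.hom ▷ 𝟙 b ≫ (λ_ (𝟙 b)).hom ≫ ν.inv := by
    rw [← cancel_epi mB.hom, Iso.hom_inv_id, hmB]; simp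
  simp only [hatR, Iso.trans_hom, whiskerRightIso_hom]
  rw [h, triPaste, hmB', hcB]
  clear h hmB hmB' hcB mB cB
  calc
    _ = mB'.hom ▷ (g ≫ cn) ≫ (bf₂ ≫ bf₁) ◁ g ◁ mC.hom ⊗≫
      bf₂ ◁ r₁.hom ▷ cn₂ ⊗≫ bf₂ ◁ ν₁.hom ▷ (g ≫ cf₁ ≫ cn₂) ⊗≫ (ν₁.inv ▷ (bf₂ ≫ g ≫ cf₁ ≫ cn₂)
      ≫ bn₁ ◁ (bf₂ ◁ g ◁ cC.hom ⊗≫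
      r₂.hom ▷ cf₁ ⊗≫ bn₂ ◁ g ◁ mC'.inv ≫ ν₂.hom ▷ (g ≫ cf))) ⊗≫ ν₁.hom ▷ (g ≫ cf) ⊗≫
        (ν.inv ≫ ν.hom) ▷ (g ≫ cf) ⊗≫ 𝟙 (g ≫ cf) := by bicategory
    _ = mB'.hom ▷ (g ≫ cn) ≫ (bf₂ ≫ bf₁) ◁ g ◁ mC.hom ⊗≫
      bf₂ ◁ r₁.hom ▷ cn₂ ⊗≫ bf₂ ◁ ν₁.hom ▷ (g ≫ cf₁ ≫ cn₂) ⊗≫ (bf₂ ◁ g ◁ cC.hom ⊗≫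
      r₂.hom ▷ cf₁ ⊗≫ (bn₂ ◁ g ◁ mC'.inv ≫ ν₂.hom ▷ (g ≫ cf))) ⊗≫ (ν₁.inv ≫ ν₁.hom) ▷ (g ≫ cf) ⊗≫
        (ν.inv ≫ ν.hom) ▷ (g ≫ cf) ⊗≫ 𝟙 (g ≫ cf) := by
      rw [← whisker_exchange ν₁.inv]; bicategory
    _ = _ := by
      rw [Iso.inv_hom_id, Iso.inv_hom_id, whisker_exchange ν₂.hom]; bicategory

theorem compIso_tri {a b c : M} {af af₁ af₂ an an₁ an₂ : a ⟶ a}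
    {bf bf₁ bf₂ bn bn₁ bn₂ : b ⟶ b} {cf cf₁ cf₂ cn cn₁ cn₂ : c ⟶ c}
    {f : a ⟶ b} {g : b ⟶ c} (ν : bn ≅ 𝟙 b) (ν₁ : bn₁ ≅ 𝟙 b) (ν₂ : bn₂ ≅ 𝟙 b)
    (mA' : af ≅ af₂ ≫ af₁) (mA : an ≅ an₁ ≫ an₂)
    (mB' : bf ≅ bf₂ ≫ bf₁) (mB : bn ≅ bn₁ ≫ bn₂)
    (mC' : cf ≅ cf₂ ≫ cf₁) (mC : cn ≅ cn₁ ≫ cn₂)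
    (cA : af₂ ≫ an₁ ≅ an₁ ≫ af₂) (cB : bf₁ ≫ bn₂ ≅ bn₂ ≫ bf₁) (cB' : bf₂ ≫ bn₁ ≅ bn₁ ≫ bf₂)
    (cC : cf₁ ≫ cn₂ ≅ cn₂ ≫ cf₁)
    (hmB : mB.hom = ν.hom ≫ (λ_ (𝟙 b)).inv ≫ ν₁.inv ▷ 𝟙 b ≫ bn₁ ◁ ν₂.inv)
    (hcB : cB.hom = bf₁ ◁ ν₂.hom ≫ (ρ_ bf₁).hom ≫ (λ_ bf₁).inv ≫ ν₂.inv ▷ bf₁)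
    (hcB' : cB'.hom = bf₂ ◁ ν₁.hom ≫ (ρ_ bf₂).hom ≫ (λ_ bf₂).inv ≫ ν₁.inv ▷ bf₂)
    (t : af ≫ f ≫ bn ≅ an ≫ f ≫ bf) (t₁ : af₁ ≫ f ≫ bn₁ ≅ an₁ ≫ f ≫ bf₁)
    (t₂ : af₂ ≫ f ≫ bn₂ ≅ an₂ ≫ f ≫ bf₂)
    (r : bf ≫ g ≫ cn ≅ bn ≫ g ≫ cf) (r₁ : bf₁ ≫ g ≫ cn₁ ≅ bn₁ ≫ g ≫ cf₁)
    (r₂ : bf₂ ≫ g ≫ cn₂ ≅ bn₂ ≫ g ≫ cf₂)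
    (h : t.hom = triPaste mA' mA mB' mB cA cB t₁.hom t₂.hom)
    (k : r.hom = triPaste mB' mB mC' mC cB' cC r₁.hom r₂.hom) :
    (compIso ν t r).hom = triPaste mA' mA mC' mC cA cC
      (compIso ν₁ t₁ r₁).hom (compIso ν₂ t₂ r₂).hom := by
  have H := tri_comp mA' mA mB' mC' mC cA cC _ _ _ _ _ _
    (hatL_tri ν ν₁ ν₂ mA' mA mB' mB cA cB hmB hcB t t₁ t₂ h)
    (hatR_tri ν ν₁ ν₂ mB' mB mC' mC cB' cC hmB hcB' r r₁ r₂ k)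
  simp only [triPaste, compIso, Iso.trans_hom, whiskerLeftIso_hom, whiskerRightIso_hom,
    Iso.symm_hom]
  generalize (hatL ν t).hom = T at H ⊢
  generalize (hatL ν₁ t₁).hom = T₁ at H ⊢
  generalize (hatL ν₂ t₂).hom = T₂ at H ⊢
  generalize (hatR ν r).hom = R at H ⊢
  generalize (hatR ν₁ r₁).hom = R₁ at H ⊢
  generalize (hatR ν₂ r₂).hom = R₂ at H ⊢
  calc
    _ = 𝟙 (af ≫ (f ≫ g) ≫ cn) ⊗≫ (T ▷ (g ≫ cn) ⊗≫ an ◁ f ◁ R) ⊗≫ 𝟙 (an ≫ (f ≫ g) ≫ cf) := by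
      bicategory
    _ = _ := by
      rw [H]; bicategory

theorem compIso_nat {a b c : M} {af af' an an' : a ⟶ a}
    {bf bf' bn bn' : b ⟶ b} {cf cf' cn cn' : c ⟶ c}
    {f : a ⟶ b} {g : b ⟶ c} (ν : bn ≅ 𝟙 b) (ν' : bn' ≅ 𝟙 b)
    (haf : af ⟶ af') (han : an ⟶ an') (hbf : bf ⟶ bf') (hbn : bn ⟶ bn') (hcf : cf ⟶ cf')
    (hcn : cn ⟶ cn') (hbn' : hbn = ν.hom ≫ ν'.inv)
    (t : af ≫ f ≫ bn ≅ an ≫ f ≫ bf) (t' : af' ≫ f ≫ bn' ≅ an' ≫ f ≫ bf')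
    (r : bf ≫ g ≫ cn ≅ bn ≫ g ≫ cf) (r' : bf' ≫ g ≫ cn' ≅ bn' ≫ g ≫ cf')
    (h : haf ▷ (f ≫ bn) ≫ af' ◁ f ◁ hbn ≫ t'.hom =
      t.hom ≫ han ▷ (f ≫ bf) ≫ an' ◁ f ◁ hbf)
    (k : hbf ▷ (g ≫ cn) ≫ bf' ◁ g ◁ hcn ≫ r'.hom =
      r.hom ≫ hbn ▷ (g ≫ cf) ≫ bn' ◁ g ◁ hcf) :
    haf ▷ ((f ≫ g) ≫ cn) ≫ af' ◁ (f ≫ g) ◁ hcn ≫ (compIso ν' t' r').hom =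
      (compIso ν t r).hom ≫ han ▷ ((f ≫ g) ≫ cf) ≫ an' ◁ (f ≫ g) ◁ hcf := by
  have h' : haf ▷ f ≫ (hatL ν' t').hom = (hatL ν t).hom ≫ han ▷ (f ≫ bf) ≫ an' ◁ f ◁ hbf := by
    simp only [hatL, Iso.trans_hom, whiskerLeftIso_hom, Iso.symm_hom, Category.assoc]
    rw [← h, hbn']
    calc
      _ = haf ▷ f ⊗≫ af' ◁ f ◁ ν'.inv ≫ t'.hom := by bicategory
      _ = 𝟙 (af ≫ f) ⊗≫ haf ▷ f ⊗≫ af' ◁ f ◁ (ν.inv ≫ ν.hom) ⊗≫ af' ◁ f ◁ ν'.inv ≫ t'.hom := by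
        rw [Iso.inv_hom_id]; bicategory
      _ = 𝟙 (af ≫ f) ⊗≫ (haf ▷ (f ≫ 𝟙 b) ≫ af' ◁ f ◁ ν.inv) ⊗≫ af' ◁ f ◁ ν.hom ⊗≫
          af' ◁ f ◁ ν'.inv ≫ t'.hom := by
        bicategory
      _ = _ := by
        rw [← whisker_exchange haf]; bicategory
  have k' : hbf ▷ (g ≫ cn) ≫ bf' ◁ g ◁ hcn ≫ (hatR ν' r').hom = (hatR ν r).hom ≫ g ◁ hcf := by
    simp only [hatR, Iso.trans_hom, whiskerRightIso_hom, Category.assoc]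
    rw [reassoc_of% k, hbn', whisker_exchange_assoc]
    simp
  simp only [compIso, Iso.trans_hom, whiskerLeftIso_hom, whiskerRightIso_hom, Iso.symm_hom]
  generalize (hatL ν t).hom = T at h' ⊢
  generalize (hatL ν' t').hom = T' at h' ⊢
  generalize (hatR ν r).hom = R at k' ⊢
  generalize (hatR ν' r').hom = R' at k' ⊢
  calc
    _ = 𝟙 (af ≫ (f ≫ g) ≫ cn) ⊗≫ (haf ▷ f ≫ T') ▷ (g ≫ cn) ⊗≫ an' ◁ f ◁ (bf' ◁ g ◁ hcn ≫ R') ⊗≫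
        𝟙 (an' ≫ (f ≫ g) ≫ cf') := by
      calc
        _ = 𝟙 (af ≫ (f ≫ g) ≫ cn) ⊗≫ haf ▷ f ▷ (g ≫ cn) ⊗≫ ((af' ≫ f) ◁ g ◁ hcn ≫ T' ▷ (g ≫ cn')) ⊗≫
            an' ◁ f ◁ R' ⊗≫ 𝟙 (an' ≫ (f ≫ g) ≫ cf') := by bicategory
        _ = _ := by rw [whisker_exchange T']; bicategory
    _ = 𝟙 (af ≫ (f ≫ g) ≫ cn) ⊗≫ (T ≫ han ▷ (f ≫ bf)) ▷ (g ≫ cn) ⊗≫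
          an' ◁ f ◁ (hbf ▷ (g ≫ cn) ≫ bf' ◁ g ◁ hcn ≫ R') ⊗≫
        𝟙 (an' ≫ (f ≫ g) ≫ cf') := by
      rw [h']; bicategory
    _ = 𝟙 (af ≫ (f ≫ g) ≫ cn) ⊗≫ T ▷ (g ≫ cn) ⊗≫ (han ▷ (f ≫ bf ≫ g ≫ cn) ≫ an' ◁ f ◁ R) ⊗≫
        an' ◁ (f ≫ g) ◁ hcf := by
      rw [k']; bicategory
    _ = _ := by
      rw [← whisker_exchange]; bicategory

theorem compIso_whisker {a b c : M} {af an : a ⟶ a} {bf bn : b ⟶ b} {cf cn : c ⟶ c}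
    {f f' : a ⟶ b} {g : b ⟶ c} (ν : bn ≅ 𝟙 b) (t : af ≫ f ≫ bn ≅ an ≫ f ≫ bf)
    (t' : af ≫ f' ≫ bn ≅ an ≫ f' ≫ bf) (r : bf ≫ g ≫ cn ≅ bn ≫ g ≫ cf) (θ : f ⟶ f')
    (h : af ◁ θ ▷ bn ≫ t'.hom = t.hom ≫ an ◁ θ ▷ bf) :
    af ◁ (θ ▷ g) ▷ cn ≫ (compIso ν t' r).hom = (compIso ν t r).hom ≫ an ◁ (θ ▷ g) ▷ cf := by
  have h' : af ◁ θ ≫ (hatL ν t').hom = (hatL ν t).hom ≫ an ◁ θ ▷ bf := by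
    simp only [hatL, Iso.trans_hom, whiskerLeftIso_hom, Iso.symm_hom, Category.assoc]
    rw [← h]
    calc
      _ = 𝟙 (af ≫ f) ⊗≫ af ◁ (θ ▷ 𝟙 b ≫ f' ◁ ν.inv) ≫ t'.hom := by bicategory
      _ = _ := by rw [← whisker_exchange]; bicategory
  simp only [compIso, Iso.trans_hom, whiskerLeftIso_hom, whiskerRightIso_hom, Iso.symm_hom]
  generalize (hatL ν t).hom = T at h' ⊢
  generalize (hatL ν t').hom = T' at h' ⊢
  generalize (hatR ν r).hom = R
  calc
    _ = 𝟙 (af ≫ (f ≫ g) ≫ cn) ⊗≫ (af ◁ θ ≫ T') ▷ (g ≫ cn) ⊗≫ an ◁ f' ◁ R ⊗≫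
        𝟙 (an ≫ (f' ≫ g) ≫ cf) := by bicategory
    _ = 𝟙 (af ≫ (f ≫ g) ≫ cn) ⊗≫ T ▷ (g ≫ cn) ⊗≫ an ◁ (θ ▷ (bf ≫ g ≫ cn) ≫ f' ◁ R) ⊗≫
        𝟙 (an ≫ (f' ≫ g) ≫ cf) := by rw [h']; bicategory
    _ = _ := by rw [← whisker_exchange]; bicategory

theorem compIso_one {a b c : M} {af an : a ⟶ a} {bf bn : b ⟶ b} {cf cn : c ⟶ c}
    {f : a ⟶ b} {g : b ⟶ c} (ν : bn ≅ 𝟙 b) 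
    (af0 : af ≅ 𝟙 a) (an0 : an ≅ 𝟙 a) (bf0 : bf ≅ 𝟙 b) (cf0 : cf ≅ 𝟙 c) (cn0 : cn ≅ 𝟙 c)
    (t : af ≫ f ≫ bn ≅ an ≫ f ≫ bf) (r : bf ≫ g ≫ cn ≅ bn ≫ g ≫ cf)
    (h : t.hom = af0.hom ▷ (f ≫ bn) ≫ 𝟙 a ◁ f ◁ ν.hom ≫ 𝟙 a ◁ f ◁ bf0.inv ≫ an0.inv ▷ (f ≫ bf))
    (k : r.hom = bf0.hom ▷ (g ≫ cn) ≫ 𝟙 b ◁ g ◁ cn0.hom ≫ 𝟙 b ◁ g ◁ cf0.inv ≫ ν.inv ▷ (g ≫ cf)) :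
    (compIso ν t r).hom =
      af0.hom ▷ ((f ≫ g) ≫ cn) ≫ 𝟙 a ◁ (f ≫ g) ◁ cn0.hom ≫ 𝟙 a ◁ (f ≫ g) ◁ cf0.inv ≫
        an0.inv ▷ ((f ≫ g) ≫ cf) := by
  have h' : (hatL ν t).hom = af0.hom ▷ f ⊗≫ f ◁ bf0.inv ⊗≫ an0.inv ▷ (f ≫ bf) := by
    simp only [hatL, Iso.trans_hom, whiskerLeftIso_hom, Iso.symm_hom, h]
    calc
      _ = 𝟙 (af ≫ f) ⊗≫ (af ◁ f ◁ ν.inv ≫ af0.hom ▷ (f ≫ bn)) ⊗≫ f ◁ ν.hom ⊗≫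
          f ◁ bf0.inv ⊗≫ an0.inv ▷ (f ≫ bf) := by bicategory
      _ = 𝟙 (af ≫ f) ⊗≫ af0.hom ▷ f ⊗≫ f ◁ (ν.inv ≫ ν.hom) ⊗≫
          f ◁ bf0.inv ⊗≫ an0.inv ▷ (f ≫ bf) := by rw [whisker_exchange]; bicategory
      _ = _ := by rw [Iso.inv_hom_id]; bicategory
  have k' : (hatR ν r).hom = bf0.hom ▷ (g ≫ cn) ⊗≫ g ◁ cn0.hom ⊗≫ g ◁ cf0.inv := by
    simp only [hatR, Iso.trans_hom, whiskerRightIso_hom, k]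
    calc
      _ = bf0.hom ▷ (g ≫ cn) ⊗≫ g ◁ cn0.hom ⊗≫ g ◁ cf0.inv ⊗≫ (ν.inv ≫ ν.hom) ▷ (g ≫ cf) ⊗≫
          𝟙 (g ≫ cf) := by bicategory
      _ = _ := by rw [Iso.inv_hom_id]; bicategory
  simp only [compIso, Iso.trans_hom, whiskerLeftIso_hom, whiskerRightIso_hom, Iso.symm_hom]
  rw [h', k']
  calc
    _ = 𝟙 (af ≫ (f ≫ g) ≫ cn) ⊗≫ af0.hom ▷ (f ≫ g ≫ cn) ⊗≫ f ◁ bf0.inv ▷ (g ≫ cn) ⊗≫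
        (an0.inv ▷ (f ≫ bf ≫ g ≫ cn) ≫ an ◁ f ◁ (bf0.hom ▷ (g ≫ cn) ⊗≫ g ◁ cn0.hom ⊗≫ g ◁ cf0.inv))
        ⊗≫ 𝟙 (an ≫ (f ≫ g) ≫ cf) := by bicategory
    _ = 𝟙 (af ≫ (f ≫ g) ≫ cn) ⊗≫ af0.hom ▷ (f ≫ g ≫ cn) ⊗≫ f ◁ (bf0.inv ≫ bf0.hom) ▷ (g ≫ cn) ⊗≫
        f ◁ g ◁ cn0.hom ⊗≫ f ◁ g ◁ cf0.inv ⊗≫ an0.inv ▷ (f ≫ g ≫ cf)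
        ⊗≫ 𝟙 (an ≫ (f ≫ g) ≫ cf) := by rw [← whisker_exchange]; bicategory
    _ = _ := by rw [Iso.inv_hom_id]; bicategory

/-- The equivariance cell of an identity. -/
def idIso {a : M} {af an : a ⟶ a} (c : af ≫ an ≅ an ≫ af) :
    af ≫ 𝟙 a ≫ an ≅ an ≫ 𝟙 a ≫ af :=
  whiskerLeftIso af (λ_ an) ≪≫ c ≪≫ whiskerLeftIso an (λ_ af).symm

theorem id_nat {a : M} {af af' an an' : a ⟶ a} (ν : an ≅ 𝟙 a) (ν' : an' ≅ 𝟙 a)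
    (haf : af ⟶ af') (han : an ⟶ an') (hh : han = ν.hom ≫ ν'.inv)
    (c : af ≫ an ≅ an ≫ af) (c' : af' ≫ an' ≅ an' ≫ af')
    (hc : c.hom = af ◁ ν.hom ≫ (ρ_ af).hom ≫ (λ_ af).inv ≫ ν.inv ▷ af)
    (hc' : c'.hom = af' ◁ ν'.hom ≫ (ρ_ af').hom ≫ (λ_ af').inv ≫ ν'.inv ▷ af') :
    haf ▷ (𝟙 a ≫ an) ≫ af' ◁ 𝟙 a ◁ han ≫ (idIso c').hom =
      (idIso c).hom ≫ han ▷ (𝟙 a ≫ af) ≫ an' ◁ 𝟙 a ◁ haf := by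
  simp only [idIso, Iso.trans_hom, whiskerLeftIso_hom, Iso.symm_hom, hc, hc', hh]
  calc
    _ = (haf ▷ (𝟙 a ≫ an) ≫ af' ◁ 𝟙 a ◁ ν.hom) ⊗≫ af' ◁ (ν'.inv ≫ ν'.hom) ⊗≫
      ν'.inv ▷ af' ⊗≫ 𝟙 (an' ≫ 𝟙 a ≫ af') := by bicategory
    _ = 𝟙 (af ≫ 𝟙 a ≫ an) ⊗≫ af ◁ ν.hom ⊗≫ (𝟙 a ◁ haf ≫ ν'.inv ▷ af') ⊗≫
        𝟙 (an' ≫ 𝟙 a ≫ af') := by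
      rw [← whisker_exchange, Iso.inv_hom_id]; bicategory
    _ = 𝟙 (af ≫ 𝟙 a ≫ an) ⊗≫ af ◁ ν.hom ⊗≫ (ν.inv ≫ ν.hom) ▷ af ⊗≫ ν'.inv ▷ af ⊗≫ an' ◁ haf ⊗≫
        𝟙 (an' ≫ 𝟙 a ≫ af') := by
      rw [whisker_exchange, Iso.inv_hom_id]; bicategory
    _ = _ := by bicategory

theorem id_one {a : M} {af an : a ⟶ a} (ν : an ≅ 𝟙 a) (af0 : af ≅ 𝟙 a)
    (c : af ≫ an ≅ an ≫ af)
    (hc : c.hom = af ◁ ν.hom ≫ (ρ_ af).hom ≫ (λ_ af).inv ≫ ν.inv ▷ af) :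
    (idIso c).hom = af0.hom ▷ (𝟙 a ≫ an) ≫ 𝟙 a ◁ 𝟙 a ◁ ν.hom ≫ 𝟙 a ◁ 𝟙 a ◁ af0.inv ≫
      ν.inv ▷ (𝟙 a ≫ af) := by
  simp only [idIso, Iso.trans_hom, whiskerLeftIso_hom, Iso.symm_hom, hc]
  calc
    _ = 𝟙 (af ≫ 𝟙 a ≫ an) ⊗≫ af ◁ ν.hom ⊗≫ (af0.hom ≫ af0.inv) ⊗≫ ν.inv ▷ af ⊗≫
        𝟙 (an ≫ 𝟙 a ≫ af) := by rw [Iso.hom_inv_id]; bicategory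
    _ = (af ◁ 𝟙 a ◁ ν.hom ≫ af0.hom ▷ (𝟙 a ≫ 𝟙 a)) ⊗≫ af0.inv ⊗≫ ν.inv ▷ af ⊗≫
        𝟙 (an ≫ 𝟙 a ≫ af) := by bicategory
    _ = _ := by rw [whisker_exchange]; bicategory

theorem id_tri {a : M} {af af₁ af₂ an an₁ an₂ : a ⟶ a}
    (ν : an ≅ 𝟙 a) (ν₁ : an₁ ≅ 𝟙 a) (ν₂ : an₂ ≅ 𝟙 a)
    (mA' : af ≅ af₂ ≫ af₁) (mA : an ≅ an₁ ≫ an₂)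
    (cA : af₂ ≫ an₁ ≅ an₁ ≫ af₂) (cB : af₁ ≫ an₂ ≅ an₂ ≫ af₁)
    (c : af ≫ an ≅ an ≫ af) (c₁ : af₁ ≫ an₁ ≅ an₁ ≫ af₁) (c₂ : af₂ ≫ an₂ ≅ an₂ ≫ af₂)
    (hmA : mA.hom = ν.hom ≫ (λ_ (𝟙 a)).inv ≫ ν₁.inv ▷ 𝟙 a ≫ an₁ ◁ ν₂.inv)
    (hcA : cA.hom = af₂ ◁ ν₁.hom ≫ (ρ_ af₂).hom ≫ (λ_ af₂).inv ≫ ν₁.inv ▷ af₂)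
    (hcB : cB.hom = af₁ ◁ ν₂.hom ≫ (ρ_ af₁).hom ≫ (λ_ af₁).inv ≫ ν₂.inv ▷ af₁)
    (hc : c.hom = af ◁ ν.hom ≫ (ρ_ af).hom ≫ (λ_ af).inv ≫ ν.inv ▷ af)
    (hc₁ : c₁.hom = af₁ ◁ ν₁.hom ≫ (ρ_ af₁).hom ≫ (λ_ af₁).inv ≫ ν₁.inv ▷ af₁)
    (hc₂ : c₂.hom = af₂ ◁ ν₂.hom ≫ (ρ_ af₂).hom ≫ (λ_ af₂).inv ≫ ν₂.inv ▷ af₂) :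
    (idIso c).hom = triPaste mA' mA mA' mA cA cB (idIso c₁).hom (idIso c₂).hom := by
  have hmA' : mA.inv = an₁ ◁ ν₂.hom ≫ ν₁.hom ▷ 𝟙 a ≫ (λ_ (𝟙 a)).hom ≫ ν.inv := by
    rw [← cancel_epi mA.hom, Iso.hom_inv_id, hmA]; simp
  simp only [triPaste, idIso, Iso.trans_hom, whiskerLeftIso_hom, Iso.symm_hom, hmA, hmA', hcA, hcB, hc, hc₁,
    hc₂]
  symm
  calc
    _ = mA'.hom ▷ (𝟙 a ≫ an) ⊗≫ (af₂ ≫ af₁) ◁ ν.hom ⊗≫ (af₂ ≫ af₁) ◁ ν₁.inv ⊗≫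
        (af₂ ≫ af₁) ◁ (an₁ ◁ ν₂.inv ≫ ν₁.hom ▷ an₂) ⊗≫
        af₂ ◁ (ν₁.inv ≫ ν₁.hom) ▷ (af₁ ≫ an₂) ⊗≫
        (ν₁.inv ▷ (af₂ ≫ af₁ ≫ an₂) ≫ an₁ ◁ (af₂ ◁ af₁ ◁ ν₂.hom ⊗≫
        af₂ ◁ (ν₂.inv ≫ ν₂.hom) ▷ af₁ ⊗≫ ν₂.inv ▷ (af₂ ≫ af₁) ⊗≫ an₂ ◁ mA'.inv ⊗≫ ν₂.hom ▷ af))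
        ⊗≫ ν₁.hom ▷ af ⊗≫ ν.inv ▷ af ⊗≫ 𝟙 (an ≫ 𝟙 a ≫ af) := by
      bicategory
    _ = mA'.hom ▷ (𝟙 a ≫ an) ⊗≫ (af₂ ≫ af₁) ◁ ν.hom ⊗≫ (af₂ ≫ af₁) ◁ ν₁.inv ⊗≫
        (af₂ ≫ af₁) ◁ ν₁.hom ⊗≫ (af₂ ≫ af₁) ◁ ν₂.inv ⊗≫ (af₂ ≫ af₁) ◁ ν₂.hom ⊗≫
        ν₂.inv ▷ (af₂ ≫ af₁) ⊗≫ an₂ ◁ mA'.inv ⊗≫ ν₂.hom ▷ af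
        ⊗≫ ν₁.inv ▷ af ⊗≫ ν₁.hom ▷ af ⊗≫ ν.inv ▷ af ⊗≫ 𝟙 (an ≫ 𝟙 a ≫ af) := by
      rw [ν₁.inv_hom_id, ν₂.inv_hom_id, ← whisker_exchange ν₁.inv, whisker_exchange ν₁.hom ν₂.inv]
      bicategory
    _ = mA'.hom ▷ (𝟙 a ≫ an) ⊗≫ (af₂ ≫ af₁) ◁ ν.hom ⊗≫ (af₂ ≫ af₁) ◁ (ν₁.inv ≫ ν₁.hom) ⊗≫
        (af₂ ≫ af₁) ◁ (ν₂.inv ≫ ν₂.hom) ⊗≫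
        (ν₂.inv ▷ (af₂ ≫ af₁) ≫ an₂ ◁ mA'.inv) ⊗≫ ν₂.hom ▷ af
        ⊗≫ (ν₁.inv ≫ ν₁.hom) ▷ af ⊗≫ ν.inv ▷ af ⊗≫ 𝟙 (an ≫ 𝟙 a ≫ af) := by
      bicategory
    _ = mA'.hom ▷ (𝟙 a ≫ an) ⊗≫ (af₂ ≫ af₁) ◁ ν.hom ⊗≫ mA'.inv ⊗≫ ν₂.inv ▷ af ⊗≫ ν₂.hom ▷ af
        ⊗≫ ν.inv ▷ af ⊗≫ 𝟙 (an ≫ 𝟙 a ≫ af) := by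
      rw [ν₁.inv_hom_id, ν₂.inv_hom_id, ← whisker_exchange ν₂.inv]
      bicategory
    _ = mA'.hom ▷ (𝟙 a ≫ an) ⊗≫ (af₂ ≫ af₁) ◁ ν.hom ⊗≫ mA'.inv ⊗≫ (ν₂.inv ≫ ν₂.hom) ▷ af
        ⊗≫ ν.inv ▷ af ⊗≫ 𝟙 (an ≫ 𝟙 a ≫ af) := by
      bicategory
    _ = mA'.hom ▷ (𝟙 a ≫ an) ⊗≫ ((af₂ ≫ af₁) ◁ ν.hom ≫ mA'.inv ▷ 𝟙 a) ⊗≫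
        ν.inv ▷ af ⊗≫ 𝟙 (an ≫ 𝟙 a ≫ af) := by
      rw [Iso.inv_hom_id]; bicategory
    _ = (mA'.hom ≫ mA'.inv) ▷ (𝟙 a ≫ an) ⊗≫ af ◁ ν.hom ⊗≫
        ν.inv ▷ af ⊗≫ 𝟙 (an ≫ 𝟙 a ≫ af) := by
      rw [whisker_exchange]
      bicategory
    _ = _ := by rw [Iso.hom_inv_id]; bicategory

end Coherence

/-! ### Calculus of the evaluation at the unit -/

section Coherence

open Bicategory

variable {M : Type u₂} [Bicategory.{w₂, v₂} M]

/-- The equivariance cell of the evaluation at the unit: the wedge cell `σ`, followed by the inverse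
of the compatibility `k` of the evaluation with the actions. -/
def epsIso {a b : M} {ef en : b ⟶ b} {f n : a ⟶ a} {p q : b ⟶ a} (ν : ef ≅ 𝟙 b)
    (σ : p ≫ n ≅ q ≫ f) (k : en ≫ p ≅ q) : ef ≫ p ≫ n ≅ en ≫ p ≫ f :=
  whiskerRightIso ν (p ≫ n) ≪≫ λ_ (p ≫ n) ≪≫ σ ≪≫ whiskerRightIso k.symm f ≪≫ α_ en p f

theorem eps_nat {a b : M} {ef ef' en en' : b ⟶ b} {f f' n n' : a ⟶ a} {p q q' : b ⟶ a}
    (ν : ef ≅ 𝟙 b) (ν' : ef' ≅ 𝟙 b)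
    (hef : ef ⟶ ef') (hen : en ⟶ en') (hf : f ⟶ f') (hn : n ⟶ n') (hq : q ⟶ q')
    (σ : p ≫ n ≅ q ≫ f) (σ' : p ≫ n' ≅ q' ≫ f') (k : en ≫ p ≅ q) (k' : en' ≫ p ≅ q')
    (hh : hef = ν.hom ≫ ν'.inv)
    (hσ : p ◁ hn ≫ σ'.hom = σ.hom ≫ hq ▷ f ≫ q' ◁ hf)
    (hk : hen ▷ p ≫ k'.hom = k.hom ≫ hq) :
    hef ▷ (p ≫ n) ≫ ef' ◁ p ◁ hn ≫ (epsIso ν' σ' k').hom =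
      (epsIso ν σ k).hom ≫ hen ▷ (p ≫ f) ≫ en' ◁ p ◁ hf := by
  have hk' : k.inv ≫ hen ▷ p = hq ≫ k'.inv := by
    rw [Iso.inv_comp_eq, ← Category.assoc, ← hk]; simp
  simp only [epsIso, Iso.trans_hom, whiskerRightIso_hom, Iso.symm_hom, hh]
  calc
    _ = (ν.hom ≫ ν'.inv) ▷ (p ≫ n) ≫ (ef' ◁ p ◁ hn ≫ ν'.hom ▷ (p ≫ n')) ⊗≫ σ'.hom ⊗≫
        k'.inv ▷ f' ⊗≫ 𝟙 (en' ≫ p ≫ f') := by bicategory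
    _ = ν.hom ▷ (p ≫ n) ⊗≫ (ν'.inv ≫ ν'.hom) ▷ (p ≫ n) ⊗≫ (p ◁ hn ≫ σ'.hom) ⊗≫
        k'.inv ▷ f' ⊗≫ 𝟙 (en' ≫ p ≫ f') := by rw [whisker_exchange]; bicategory
    _ = ν.hom ▷ (p ≫ n) ⊗≫ σ.hom ⊗≫ hq ▷ f ⊗≫ (q' ◁ hf ≫
        k'.inv ▷ f') ⊗≫ 𝟙 (en' ≫ p ≫ f') := by rw [hσ, Iso.inv_hom_id]; bicategory
    _ = ν.hom ▷ (p ≫ n) ⊗≫ σ.hom ⊗≫ (hq ≫ k'.inv) ▷ f ⊗≫ (en' ≫ p) ◁ hf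
        ⊗≫ 𝟙 (en' ≫ p ≫ f') := by rw [whisker_exchange]; bicategory
    _ = _ := by rw [← hk']; bicategory

theorem eps_one {a b : M} {ef en : b ⟶ b} {f n : a ⟶ a} {p q : b ⟶ a} (ν : ef ≅ 𝟙 b)
    (σ : p ≫ n ≅ q ≫ f) (k : en ≫ p ≅ q) (x : p ≅ q)
    (n0 : n ≅ 𝟙 a) (f0 : f ≅ 𝟙 a) (en0 : en ≅ 𝟙 b)
    (hσ : σ.hom = p ◁ n0.hom ≫ x.hom ▷ 𝟙 a ≫ q ◁ f0.inv)
    (hk : k.hom = en0.hom ▷ p ≫ (λ_ p).hom ≫ x.hom) :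
    (epsIso ν σ k).hom = ν.hom ▷ (p ≫ n) ≫ 𝟙 b ◁ p ◁ n0.hom ≫ 𝟙 b ◁ p ◁ f0.inv ≫
      en0.inv ▷ (p ≫ f) := by
  have hk' : k.inv = x.inv ≫ (λ_ p).inv ≫ en0.inv ▷ p := by
    rw [← cancel_epi k.hom, Iso.hom_inv_id, hk]; simp
  simp only [epsIso, Iso.trans_hom, whiskerRightIso_hom, Iso.symm_hom, hk', hσ]
  calc
    _ = ν.hom ▷ (p ≫ n) ⊗≫ p ◁ n0.hom ⊗≫ x.hom ⊗≫ (q ◁ f0.inv ≫ x.inv ▷ f) ⊗≫ en0.inv ▷ (p ≫ f) := by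
      bicategory
    _ = ν.hom ▷ (p ≫ n) ⊗≫ p ◁ n0.hom ⊗≫ (x.hom ≫ x.inv) ⊗≫ p ◁ f0.inv ⊗≫ en0.inv ▷ (p ≫ f) := by
      rw [whisker_exchange]; bicategory
    _ = _ := by rw [Iso.hom_inv_id]; bicategory

theorem eps_tri_aux {a b : M} {ef ef₁ ef₂ en en₁ en₂ : b ⟶ b} {f f₁ f₂ n n₁ n₂ : a ⟶ a}
    {p : b ⟶ a} (ν : ef ≅ 𝟙 b) (ν₁ : ef₁ ≅ 𝟙 b) (ν₂ : ef₂ ≅ 𝟙 b)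
    (mE' : ef ≅ ef₂ ≫ ef₁) (mE : en ≅ en₁ ≫ en₂) (mA' : f ≅ f₂ ≫ f₁) (mA : n ≅ n₁ ≫ n₂)
    (cE : ef₂ ≫ en₁ ≅ en₁ ≫ ef₂) (cA : f₁ ≫ n₂ ≅ n₂ ≫ f₁)
    (hmE' : mE'.hom = ν.hom ≫ (λ_ (𝟙 b)).inv ≫ ν₂.inv ▷ 𝟙 b ≫ ef₂ ◁ ν₁.inv)
    (hcE : cE.hom = ν₂.hom ▷ en₁ ≫ (λ_ en₁).hom ≫ (ρ_ en₁).inv ≫ en₁ ◁ ν₂.inv)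
    (S : p ≫ n ⟶ en ≫ p ≫ f) (S₁ : p ≫ n₁ ⟶ en₁ ≫ p ≫ f₁) (S₂ : p ≫ n₂ ⟶ en₂ ≫ p ≫ f₂)
    (hS : S = p ◁ mA.hom ⊗≫ S₁ ▷ n₂ ⊗≫ en₁ ◁ p ◁ cA.hom ⊗≫ en₁ ◁ S₂ ▷ f₁ ⊗≫
      (en₁ ≫ en₂) ◁ p ◁ mA'.inv ≫ mE.inv ▷ (p ≫ f)) :
    ν.hom ▷ (p ≫ n) ⊗≫ S =
      mE'.hom ▷ (p ≫ n) ≫ (ef₂ ≫ ef₁) ◁ p ◁ mA.hom ⊗≫ ef₂ ◁ (ν₁.hom ▷ (p ≫ n₁) ⊗≫ S₁) ▷ n₂ ⊗≫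
      cE.hom ▷ (p ≫ f₁ ≫ n₂) ≫ (en₁ ≫ ef₂) ◁ p ◁ cA.hom ⊗≫
      en₁ ◁ (ν₂.hom ▷ (p ≫ n₂) ⊗≫ S₂) ▷ f₁ ⊗≫ (en₁ ≫ en₂) ◁ p ◁ mA'.inv ≫ mE.inv ▷ (p ≫ f) := by
  rw [hS, hmE', hcE]
  symm
  calc
    _ = ν.hom ▷ (p ≫ n) ⊗≫ ν₂.inv ▷ (p ≫ n) ⊗≫
        ef₂ ◁ (ν₁.inv ▷ (p ≫ n) ≫ ef₁ ◁ p ◁ mA.hom) ⊗≫ ef₂ ◁ ν₁.hom ▷ (p ≫ n₁ ≫ n₂) ⊗≫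
        ef₂ ◁ S₁ ▷ n₂ ⊗≫ ν₂.hom ▷ (en₁ ≫ p ≫ f₁ ≫ n₂) ⊗≫
        en₁ ◁ (ν₂.inv ▷ (p ≫ f₁ ≫ n₂) ≫ ef₂ ◁ p ◁ cA.hom) ⊗≫ en₁ ◁ ν₂.hom ▷ (p ≫ n₂ ≫ f₁) ⊗≫
        en₁ ◁ S₂ ▷ f₁ ⊗≫ (en₁ ≫ en₂) ◁ p ◁ mA'.inv ≫ mE.inv ▷ (p ≫ f) := by bicategory
    _ = ν.hom ▷ (p ≫ n) ⊗≫ ν₂.inv ▷ (p ≫ n) ⊗≫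
        (ef₂ ≫ p) ◁ mA.hom ⊗≫ ef₂ ◁ (ν₁.inv ≫ ν₁.hom) ▷ (p ≫ n₁ ≫ n₂) ⊗≫
        ef₂ ◁ S₁ ▷ n₂ ⊗≫ ν₂.hom ▷ (en₁ ≫ p ≫ f₁ ≫ n₂) ⊗≫
        en₁ ◁ p ◁ cA.hom ⊗≫ en₁ ◁ (ν₂.inv ≫ ν₂.hom) ▷ (p ≫ n₂ ≫ f₁) ⊗≫
        en₁ ◁ S₂ ▷ f₁ ⊗≫ (en₁ ≫ en₂) ◁ p ◁ mA'.inv ≫ mE.inv ▷ (p ≫ f) := by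
      rw [← whisker_exchange ν₁.inv, ← whisker_exchange ν₂.inv]; bicategory
    _ = ν.hom ▷ (p ≫ n) ⊗≫ (ν₂.inv ▷ (p ≫ n) ≫ ef₂ ◁ (p ◁ mA.hom ⊗≫ S₁ ▷ n₂)) ⊗≫
        ν₂.hom ▷ (en₁ ≫ p ≫ f₁ ≫ n₂) ⊗≫ en₁ ◁ p ◁ cA.hom ⊗≫
        en₁ ◁ S₂ ▷ f₁ ⊗≫ (en₁ ≫ en₂) ◁ p ◁ mA'.inv ≫ mE.inv ▷ (p ≫ f) := by
      rw [ν₁.inv_hom_id, ν₂.inv_hom_id]; bicategory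
    _ = ν.hom ▷ (p ≫ n) ⊗≫ p ◁ mA.hom ⊗≫ S₁ ▷ n₂ ⊗≫
        (ν₂.inv ≫ ν₂.hom) ▷ (en₁ ≫ p ≫ f₁ ≫ n₂) ⊗≫ en₁ ◁ p ◁ cA.hom ⊗≫
        en₁ ◁ S₂ ▷ f₁ ⊗≫ (en₁ ≫ en₂) ◁ p ◁ mA'.inv ≫ mE.inv ▷ (p ≫ f) := by
      rw [← whisker_exchange ν₂.inv]; bicategory
    _ = _ := by rw [ν₂.inv_hom_id]; bicategory

/-- The pasting of wedge cells `σ₁`, `σ₁₂` along the multiplicativity of the actions on `a` and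
the commutation of the actions of the two sides. -/
def wedgePaste {a b : M} {f f₁ f₂ n n₁ n₂ : a ⟶ a} {p q q₁ q₁₂ : b ⟶ a}
    (mA' : f ≅ f₂ ≫ f₁) (mA : n ≅ n₁ ≫ n₂) (cA : f₁ ≫ n₂ ≅ n₂ ≫ f₁)
    (σ₁ : p ≫ n₁ ⟶ q₁ ≫ f₁) (σ₁₂ : q₁ ≫ n₂ ⟶ q₁₂ ≫ f₂) (x : q₁₂ ⟶ q) : p ≫ n ⟶ q ≫ f :=
  p ◁ mA.hom ⊗≫ σ₁ ▷ n₂ ⊗≫ q₁ ◁ cA.hom ⊗≫ σ₁₂ ▷ f₁ ⊗≫ x ▷ (f₂ ≫ f₁) ≫ q ◁ mA'.inv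

theorem eps_tri {a b : M} {ef ef₁ ef₂ en en₁ en₂ : b ⟶ b} {f f₁ f₂ n n₁ n₂ : a ⟶ a}
    {p q q₁ q₂ q₁₂ : b ⟶ a} (ν : ef ≅ 𝟙 b) (ν₁ : ef₁ ≅ 𝟙 b) (ν₂ : ef₂ ≅ 𝟙 b)
    (mE' : ef ≅ ef₂ ≫ ef₁) (mE : en ≅ en₁ ≫ en₂) (mA' : f ≅ f₂ ≫ f₁) (mA : n ≅ n₁ ≫ n₂)
    (cE : ef₂ ≫ en₁ ≅ en₁ ≫ ef₂) (cA : f₁ ≫ n₂ ≅ n₂ ≫ f₁)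
    (hmE' : mE'.hom = ν.hom ≫ (λ_ (𝟙 b)).inv ≫ ν₂.inv ▷ 𝟙 b ≫ ef₂ ◁ ν₁.inv)
    (hcE : cE.hom = ν₂.hom ▷ en₁ ≫ (λ_ en₁).hom ≫ (ρ_ en₁).inv ≫ en₁ ◁ ν₂.inv)
    (σ : p ≫ n ≅ q ≫ f) (σ₁ : p ≫ n₁ ≅ q₁ ≫ f₁) (σ₂ : p ≫ n₂ ≅ q₂ ≫ f₂)
    (σ₁₂ : q₁ ≫ n₂ ≅ q₁₂ ≫ f₂) (x : q₁₂ ≅ q)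
    (k : en ≫ p ≅ q) (k₁ : en₁ ≫ p ≅ q₁) (k₂ : en₂ ≫ p ≅ q₂) (k₁₂ : en₁ ≫ q₂ ≅ q₁₂)
    (hσ : σ.hom = wedgePaste mA' mA cA σ₁.hom σ₁₂.hom x.hom)
    (hkσ : en₁ ◁ σ₂.hom ≫ (α_ _ _ _).inv ≫ k₁₂.hom ▷ f₂ = (α_ en₁ p n₂).inv ≫ k₁.hom ▷ n₂ ≫ σ₁₂.hom)
    (hk : k.hom = mE.hom ▷ p ≫ (α_ _ _ _).hom ≫ en₁ ◁ k₂.hom ≫ k₁₂.hom ≫ x.hom) :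
    (epsIso ν σ k).hom =
      triPaste mE' mE mA' mA cE cA (epsIso ν₁ σ₁ k₁).hom (epsIso ν₂ σ₂ k₂).hom := by
  have hk' : k.inv = x.inv ≫ k₁₂.inv ≫ en₁ ◁ k₂.inv ⊗≫ mE.inv ▷ p := by
    rw [← cancel_epi k.hom, Iso.hom_inv_id, hk]; simp [bicategoricalComp]
  have hσ' : σ₁₂.hom ≫ k₁₂.inv ▷ f₂ = k₁.inv ▷ n₂ ⊗≫ en₁ ◁ σ₂.hom ⊗≫ 𝟙 ((en₁ ≫ q₂) ≫ f₂) := by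
    have := congrArg (fun y => k₁.inv ▷ n₂ ≫ (α_ en₁ p n₂).hom ≫ y ≫ k₁₂.inv ▷ f₂) hkσ
    simp at this
    simp [bicategoricalComp, this]
  have H := eps_tri_aux ν ν₁ ν₂ mE' mE mA' mA cE cA hmE' hcE
    (σ.hom ≫ k.inv ▷ f ≫ (α_ en p f).hom) (σ₁.hom ≫ k₁.inv ▷ f₁ ≫ (α_ en₁ p f₁).hom)
    (σ₂.hom ≫ k₂.inv ▷ f₂ ≫ (α_ en₂ p f₂).hom) (by
      rw [hσ, wedgePaste, hk']
      calc
        _ = p ◁ mA.hom ⊗≫ σ₁.hom ▷ n₂ ⊗≫ q₁ ◁ cA.hom ⊗≫ σ₁₂.hom ▷ f₁ ⊗≫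
            x.hom ▷ (f₂ ≫ f₁) ≫ (q ◁ mA'.inv ≫
              (x.inv ≫ k₁₂.inv ≫ en₁ ◁ k₂.inv ⊗≫ mE.inv ▷ p) ▷ f) ⊗≫ 𝟙 (en ≫ p ≫ f) := by
          bicategory
        _ = p ◁ mA.hom ⊗≫ σ₁.hom ▷ n₂ ⊗≫ q₁ ◁ cA.hom ⊗≫ σ₁₂.hom ▷ f₁ ⊗≫
            (x.hom ≫ x.inv) ▷ (f₂ ≫ f₁) ⊗≫ k₁₂.inv ▷ (f₂ ≫ f₁) ⊗≫
            en₁ ◁ k₂.inv ▷ (f₂ ≫ f₁) ⊗≫ (mE.inv ▷ p ▷ (f₂ ≫ f₁) ≫ (en ≫ p) ◁ mA'.inv) ⊗≫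
              𝟙 (en ≫ p ≫ f) := by
          rw [whisker_exchange]; bicategory
        _ = p ◁ mA.hom ⊗≫ σ₁.hom ▷ n₂ ⊗≫ q₁ ◁ cA.hom ⊗≫ (σ₁₂.hom ≫ k₁₂.inv ▷ f₂) ▷ f₁ ⊗≫
            en₁ ◁ k₂.inv ▷ (f₂ ≫ f₁) ⊗≫ (mE.inv ▷ p ▷ (f₂ ≫ f₁) ≫ (en ≫ p) ◁ mA'.inv) ⊗≫
              𝟙 (en ≫ p ≫ f) := by
          rw [Iso.hom_inv_id]; bicategory
        _ = p ◁ mA.hom ⊗≫ σ₁.hom ▷ n₂ ⊗≫ (q₁ ◁ cA.hom ≫ k₁.inv ▷ (n₂ ≫ f₁)) ⊗≫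
            en₁ ◁ σ₂.hom ▷ f₁ ⊗≫
            en₁ ◁ k₂.inv ▷ (f₂ ≫ f₁) ⊗≫ (mE.inv ▷ p ▷ (f₂ ≫ f₁) ≫ (en ≫ p) ◁ mA'.inv) ⊗≫
              𝟙 (en ≫ p ≫ f) := by
          rw [hσ']; bicategory
        _ = _ := by
          rw [whisker_exchange k₁.inv, ← whisker_exchange (mE.inv ▷ p)]; bicategory)
  simp only [triPaste, epsIso, Iso.trans_hom, whiskerRightIso_hom, Iso.symm_hom]
  refine Eq.trans ?_ (H.trans ?_) <;> bicategory

/-- The composition of a wedge cell with `g`. -/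
def pullIso {a b b' : M} {f n : a ⟶ a} {p q : b ⟶ a} (g : b' ⟶ b) (σ : p ≫ n ≅ q ≫ f) :
    (g ≫ p) ≫ n ≅ (g ≫ q) ≫ f :=
  α_ g p n ≪≫ whiskerLeftIso g σ ≪≫ (α_ g q f).symm

theorem pull_nat_obj {a b b' : M} {f n : a ⟶ a} {p q p' q' : b ⟶ a} (g : b' ⟶ b)
    (σ : p ≫ n ≅ q ≫ f) (σ' : p' ≫ n ≅ q' ≫ f) (e : p ⟶ p') (x : q ⟶ q')
    (h : e ▷ n ≫ σ'.hom = σ.hom ≫ x ▷ f) :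
    (g ◁ e) ▷ n ≫ (pullIso g σ').hom = (pullIso g σ).hom ≫ (g ◁ x) ▷ f := by
  simp only [pullIso, Iso.trans_hom, whiskerLeftIso_hom, Iso.symm_hom]
  calc
    _ = 𝟙 ((g ≫ p) ≫ n) ⊗≫ g ◁ (e ▷ n ≫ σ'.hom) ⊗≫ 𝟙 ((g ≫ q') ≫ f) := by bicategory
    _ = _ := by rw [h]; bicategory

theorem pull_nat {a b b' : M} {f f' n n' : a ⟶ a} {p q q' : b ⟶ a} (g : b' ⟶ b)
    (σ : p ≫ n ≅ q ≫ f) (σ' : p ≫ n' ≅ q' ≫ f') (hn : n ⟶ n') (hf : f ⟶ f') (x : q ⟶ q')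
    (h : p ◁ hn ≫ σ'.hom = σ.hom ≫ x ▷ f ≫ q' ◁ hf) :
    (g ≫ p) ◁ hn ≫ (pullIso g σ').hom =
      (pullIso g σ).hom ≫ (g ◁ x) ▷ f ≫ (g ≫ q') ◁ hf := by
  simp only [pullIso, Iso.trans_hom, whiskerLeftIso_hom, Iso.symm_hom]
  calc
    _ = 𝟙 ((g ≫ p) ≫ n) ⊗≫ g ◁ (p ◁ hn ≫ σ'.hom) ⊗≫ 𝟙 ((g ≫ q') ≫ f') := by bicategory
    _ = _ := by rw [h]; bicategory

theorem pull_one {a b b' : M} {f n : a ⟶ a} {p q : b ⟶ a} (g : b' ⟶ b)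
    (σ : p ≫ n ≅ q ≫ f) (n0 : n ⟶ 𝟙 a) (f0 : 𝟙 a ⟶ f) (x : p ⟶ q)
    (h : σ.hom = p ◁ n0 ≫ x ▷ 𝟙 a ≫ q ◁ f0) :
    (pullIso g σ).hom = (g ≫ p) ◁ n0 ≫ (g ◁ x) ▷ 𝟙 a ≫ (g ≫ q) ◁ f0 := by
  simp only [pullIso, Iso.trans_hom, whiskerLeftIso_hom, Iso.symm_hom, h]
  bicategory

theorem pull_whisker {a b b' : M} {f n : a ⟶ a} {p q : b ⟶ a} {g g' : b' ⟶ b} (θ : g ⟶ g')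
    (σ : p ≫ n ≅ q ≫ f) :
    (θ ▷ p) ▷ n ≫ (pullIso g' σ).hom = (pullIso g σ).hom ≫ (θ ▷ q) ▷ f := by
  simp only [pullIso, Iso.trans_hom, whiskerLeftIso_hom, Iso.symm_hom]
  calc
    _ = 𝟙 ((g ≫ p) ≫ n) ⊗≫ (θ ▷ (p ≫ n) ≫ g' ◁ σ.hom) ⊗≫ 𝟙 ((g' ≫ q) ≫ f) := by bicategory
    _ = _ := by rw [← whisker_exchange]; bicategory

theorem pull_tri {a b b' : M} {f f₁ f₂ n n₁ n₂ : a ⟶ a} {p q q₁ q₁₂ : b ⟶ a} (g : b' ⟶ b)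
    (mA' : f ≅ f₂ ≫ f₁) (mA : n ≅ n₁ ≫ n₂) (cA : f₁ ≫ n₂ ≅ n₂ ≫ f₁)
    (σ : p ≫ n ≅ q ≫ f) (σ₁ : p ≫ n₁ ≅ q₁ ≫ f₁) (σ₁₂ : q₁ ≫ n₂ ≅ q₁₂ ≫ f₂) (x : q₁₂ ⟶ q)
    (hσ : σ.hom = wedgePaste mA' mA cA σ₁.hom σ₁₂.hom x) :
    (pullIso g σ).hom =
      wedgePaste mA' mA cA (pullIso g σ₁).hom (pullIso g σ₁₂).hom (g ◁ x) := by
  simp only [pullIso, Iso.trans_hom, whiskerLeftIso_hom, Iso.symm_hom, hσ, wedgePaste]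
  bicategory

end Coherence

/-! ### `VCat`-categories, one-sided actions -/

section Bicat

open Bicategory

variable (V : Type u') [Category.{v'} V] [MonoidalCategory V]

/-- A category enriched in `V`-categories whose underlying `2`-category is `M` : the
hom-categories are `V`-categories and the composition is a `V`-functor in each variable. -/
class VCatCategory (M : Type u₂) [Bicategory.{w₂, v₂} M] where
  enr (A B : M) : EnrichedOrdinaryCategory V (A ⟶ B)
  precomp {A B : M} (C : M) (f : A ⟶ B) : IsVFunctor V (precomp C f)
  postcomp (A : M) {B C : M} (g : B ⟶ C) : IsVFunctor V (postcomp A g)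

attribute [reducible, instance] VCatCategory.enr

variable (I : Type w) [Category.{w} I] [MonoidalCategory I] [EnrichedOrdinaryCategory V I]
variable (M : Type u₂) [Bicategory.{w₂, v₂} M] [VCatCategory V M]

variable {M} in
/-- A strict action of `I` on the object `A` on the side `s`: a strict `VCat`-functor from the
delooping of `I` (for `s = l`), or from its `1`-cell dual (for `s = r`), with value `A`. -/
structure SAct (s : Side) (A : M) where
  F : I ⥤ (A ⟶ A)
  isVFunctor : IsVFunctor V F
  one : F.obj (tunit I) = 𝟙 A
  mul (u v : I) : F.obj (s.mul u v) = F.obj u ≫ F.obj v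
  mul_map {u u' v v' : I} (f : u ⟶ u') (g : v ⟶ v') :
    F.map (s.mulMap f g) =
      eqToHom (mul u v) ≫ (F.map f ▷ F.obj v ≫ F.obj u' ◁ F.map g) ≫ eqToHom (mul u' v').symm

/-- An `I`-object: an object of `M` with an action of `I` that is mute on the side other than
`side`. -/
structure IObj where
  pt : M
  side : Side
  act : SAct V I side pt

variable {V I M}

namespace IObj

/-- The action of `I` on the side `s`: for `α` the two-sided action, `X.actOn .l` is
`u ↦ α(u, 𝟙)` and `X.actOn .r` is `u ↦ α(𝟙, u)`. It is trivial on the mute side. -/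
@[reducible]
def actOn : (X : IObj V I M) → (s : Side) → (I ⥤ (X.pt ⟶ X.pt))
  | ⟨_, .l, S⟩, .l => S.F
  | ⟨_, .r, S⟩, .r => S.F
  | ⟨A, .l, _⟩, .r => (Functor.const I).obj (𝟙 A)
  | ⟨A, .r, _⟩, .l => (Functor.const I).obj (𝟙 A)

/-- `α(𝟙) = id`, as an isomorphism. -/
@[reducible]
def oneIso : (X : IObj V I M) → (s : Side) → ((X.actOn s).obj (tunit I) ≅ 𝟙 X.pt)
  | ⟨_, .l, S⟩, .l => eqToIso S.one
  | ⟨_, .r, S⟩, .r => eqToIso S.one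
  | ⟨_, .l, _⟩, .r => Iso.refl _
  | ⟨_, .r, _⟩, .l => Iso.refl _

/-- The multiplicativity of the action on the side `s`, as an isomorphism. -/
@[reducible]
def mulIso : (X : IObj V I M) → (s : Side) → (u v : I) →
    ((X.actOn s).obj (s.mul u v) ≅ (X.actOn s).obj u ≫ (X.actOn s).obj v)
  | ⟨_, .l, S⟩, .l, u, v => eqToIso (S.mul u v)
  | ⟨_, .r, S⟩, .r, u, v => eqToIso (S.mul u v)
  | ⟨_, .l, _⟩, .r, _, _ => (λ_ _).symm
  | ⟨_, .r, _⟩, .l, _, _ => (λ_ _).symm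

/-- The multiplicativity of the action on the side opposite to `s`, as an isomorphism. -/
@[reducible]
def mulIso' : (X : IObj V I M) → (s : Side) → (u v : I) →
    ((X.actOn s.op).obj (s.mul u v) ≅ (X.actOn s.op).obj v ≫ (X.actOn s.op).obj u)
  | X, .l, u, v => X.mulIso .r v u
  | X, .r, u, v => X.mulIso .l v u

/-- The actions on the two sides commute. -/
@[reducible]
def commIso : (X : IObj V I M) → (s : Side) → (u v : I) →
    ((X.actOn s.op).obj u ≫ (X.actOn s).obj v ≅ (X.actOn s).obj v ≫ (X.actOn s.op).obj u)
  | ⟨_, .l, _⟩, .l, _, _ => λ_ _ ≪≫ (ρ_ _).symm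
  | ⟨_, .r, _⟩, .l, _, _ => ρ_ _ ≪≫ (λ_ _).symm
  | ⟨_, .l, _⟩, .r, _, _ => ρ_ _ ≪≫ (λ_ _).symm
  | ⟨_, .r, _⟩, .r, _, _ => λ_ _ ≪≫ (ρ_ _).symm

end IObj

/-! ### Equivariant morphisms -/

/-- The conditions on an equivariance structure `τ` on `f`, seen from the side `s`. For `s = r`
and `α`, `β` the two-sided actions on `A`, `B`, the component `τ u` goes from
`β(𝟙, u) ∘ f ∘ α(u, 𝟙)` to `β(u, 𝟙) ∘ f ∘ α(𝟙, u)`. -/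
structure IsEquivariant {A B : IObj V I M} (s : Side) (f : A.pt ⟶ B.pt)
    (τ : ∀ u : I, (A.actOn s.op).obj u ≫ f ≫ (B.actOn s).obj u ≅
      (A.actOn s).obj u ≫ f ≫ (B.actOn s.op).obj u) : Prop where
  nat : ∀ {u v : I} (h : u ⟶ v),
    (A.actOn s.op).map h ▷ (f ≫ (B.actOn s).obj u) ≫
        (A.actOn s.op).obj v ◁ f ◁ (B.actOn s).map h ≫ (τ v).hom =
      (τ u).hom ≫ (A.actOn s).map h ▷ (f ≫ (B.actOn s.op).obj u) ≫
        (A.actOn s).obj v ◁ f ◁ (B.actOn s.op).map h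
  tri : ∀ u v : I, (τ (s.mul u v)).hom =
    triPaste (A.mulIso' s u v) (A.mulIso s u v) (B.mulIso' s u v) (B.mulIso s u v)
      (A.commIso s v u) (B.commIso s u v) (τ u).hom (τ v).hom
  one : (τ (tunit I)).hom =
    (A.oneIso s.op).hom ▷ (f ≫ (B.actOn s).obj (tunit I)) ≫ 𝟙 A.pt ◁ f ◁ (B.oneIso s).hom ≫
    𝟙 A.pt ◁ f ◁ (B.oneIso s.op).inv ≫ (A.oneIso s).inv ▷ (f ≫ (B.actOn s.op).obj (tunit I))


namespace IObj

/-- The action on the mute side is trivial. -/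
@[reducible]
def muteIso : (X : IObj V I M) → (u : I) → ((X.actOn X.side.op).obj u ≅ 𝟙 X.pt)
  | ⟨_, .l, _⟩, _ => Iso.refl _
  | ⟨_, .r, _⟩, _ => Iso.refl _

variable (X : IObj V I M)

theorem mute_map {u v : I} (h : u ⟶ v) :
    (X.actOn X.side.op).map h = (X.muteIso u).hom ≫ (X.muteIso v).inv := by
  rcases X with ⟨_, _ | _, _⟩ <;> exact (Category.comp_id _).symm

theorem mute_mul (u v : I) :
    (X.mulIso X.side.op u v).hom = (X.muteIso _).hom ≫ (λ_ (𝟙 X.pt)).inv ≫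
      (X.muteIso u).inv ▷ 𝟙 X.pt ≫ (X.actOn X.side.op).obj u ◁ (X.muteIso v).inv := by
  rcases X with ⟨_, _ | _, _⟩ <;> simp

theorem mute_mul' (u v : I) :
    (X.mulIso' X.side u v).hom = (X.muteIso _).hom ≫ (λ_ (𝟙 X.pt)).inv ≫
      (X.muteIso v).inv ▷ 𝟙 X.pt ≫ (X.actOn X.side.op).obj v ◁ (X.muteIso u).inv := by
  rcases X with ⟨_, _ | _, _⟩ <;> simp

theorem mute_comm (u v : I) :
    (X.commIso X.side.op u v).hom = (X.actOn X.side.op.op).obj u ◁ (X.muteIso v).hom ≫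
      (ρ_ _).hom ≫ (λ_ _).inv ≫ (X.muteIso v).inv ▷ (X.actOn X.side.op.op).obj u := by
  rcases X with ⟨_, _ | _, _⟩ <;> simp

theorem mute_comm' (u v : I) :
    (X.commIso X.side u v).hom = (X.muteIso u).hom ▷ (X.actOn X.side).obj v ≫
      (λ_ _).hom ≫ (ρ_ _).inv ≫ (X.actOn X.side).obj v ◁ (X.muteIso u).inv := by
  rcases X with ⟨_, _ | _, _⟩ <;> simp

theorem mute_one : (X.oneIso X.side.op).hom = (X.muteIso _).hom := by
  rcases X with ⟨_, _ | _, _⟩ <;> rfl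

theorem mute_one_inv : (X.oneIso X.side.op).inv = (X.muteIso _).inv := by
  rcases X with ⟨_, _ | _, _⟩ <;> rfl

theorem commIso_op (s : Side) (u v : I) :
    HEq (X.commIso s.op u v) (X.commIso s v u).symm := by
  rcases X with ⟨_, _ | _, _⟩ <;> cases s <;> exact heq_of_eq (Iso.ext rfl)

end IObj

theorem IsEquivariant.flip_l {A B : IObj V I M} {f : A.pt ⟶ B.pt}
    {τ : ∀ u : I, (A.actOn .r).obj u ≫ f ≫ (B.actOn .l).obj u ≅
      (A.actOn .l).obj u ≫ f ≫ (B.actOn .r).obj u} (h : IsEquivariant .l f τ) :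
    IsEquivariant .r f (fun u => (τ u).symm) where
  nat {u v} g := by
    have := h.nat g
    dsimp at this ⊢
    rw [← cancel_epi (τ u).hom, Iso.hom_inv_id_assoc]
    simp only [← Category.assoc]
    rw [← cancel_mono (τ v).hom]
    simpa using this.symm
  tri u v := by
    have := tri_flip _ _ _ _ _ _ _ _ _ (h.tri v u)
    refine Eq.trans this ?_
    rw [← eq_of_heq (A.commIso_op .l v u), ← eq_of_heq (B.commIso_op .l u v)]
    rfl
  one := by
    have := h.one
    change (τ _).inv = _
    rw [← cancel_epi (τ _).hom, Iso.hom_inv_id, this]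
    simp

theorem IsEquivariant.flip_r {A B : IObj V I M} {f : A.pt ⟶ B.pt}
    {τ : ∀ u : I, (A.actOn .l).obj u ≫ f ≫ (B.actOn .r).obj u ≅
      (A.actOn .r).obj u ≫ f ≫ (B.actOn .l).obj u} (h : IsEquivariant .r f τ) :
    IsEquivariant .l f (fun u => (τ u).symm) where
  nat {u v} g := by
    have := h.nat g
    dsimp at this ⊢
    rw [← cancel_epi (τ u).hom, Iso.hom_inv_id_assoc]
    simp only [← Category.assoc]
    rw [← cancel_mono (τ v).hom]
    simpa using this.symm
  tri u v := by
    have := tri_flip _ _ _ _ _ _ _ _ _ (h.tri v u)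
    refine Eq.trans this ?_
    rw [← eq_of_heq (A.commIso_op .r v u), ← eq_of_heq (B.commIso_op .r u v)]
    rfl
  one := by
    have := h.one
    change (τ _).inv = _
    rw [← cancel_epi (τ _).hom, Iso.hom_inv_id, this]
    simp

theorem comm_flip {C : Type u₁} [Category.{v₁} C] {a b c d : C} {x : a ⟶ c} {y : b ⟶ d} {t : a ≅ b}
    {t' : c ≅ d} (h : x ≫ t'.hom = t.hom ≫ y) : y ≫ t'.inv = t.inv ≫ x := by
  rw [Iso.comp_inv_eq, Category.assoc, Iso.eq_inv_comp]
  exact h.symm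

/-- An `I`-equivariant morphism. -/
structure EquivMor (A B : IObj V I M) where
  f : A.pt ⟶ B.pt
  τ : ∀ u : I, (A.actOn .l).obj u ≫ f ≫ (B.actOn .r).obj u ≅
    (A.actOn .r).obj u ≫ f ≫ (B.actOn .l).obj u
  equivariant : IsEquivariant .r f τ

namespace EquivMor

/-- The equivariance structure seen from the side `s`. -/
def τs {A B : IObj V I M} (F : EquivMor A B) : (s : Side) → (u : I) →
    ((A.actOn s.op).obj u ≫ F.f ≫ (B.actOn s).obj u ≅
      (A.actOn s).obj u ≫ F.f ≫ (B.actOn s.op).obj u)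
  | .r, u => F.τ u
  | .l, u => (F.τ u).symm

theorem equivariant_s {A B : IObj V I M} (F : EquivMor A B) (s : Side) :
    IsEquivariant s F.f (F.τs s) :=
  match s with
  | .r => F.equivariant
  | .l => F.equivariant.flip_r

/-- The equivariant morphism given by an equivariance structure seen from the side `s`. -/
def ofSide {A B : IObj V I M} : (s : Side) → (f : A.pt ⟶ B.pt) →
    (τ : ∀ u : I, (A.actOn s.op).obj u ≫ f ≫ (B.actOn s).obj u ≅
      (A.actOn s).obj u ≫ f ≫ (B.actOn s.op).obj u) → IsEquivariant s f τ → EquivMor A B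
  | .r, f, τ, h => ⟨f, τ, h⟩
  | .l, f, τ, h => ⟨f, fun u => (τ u).symm, h.flip_l⟩

/-- The composition of equivariant morphisms: on the side `s` on which `B` is mute, the
equivariance structure of the composite is that of `F` followed by that of `G`. -/
def comp {A B C : IObj V I M} (F : EquivMor A B) (G : EquivMor B C) : EquivMor A C :=
  ofSide B.side.op (F.f ≫ G.f)
    (fun u => compIso (B.muteIso u) (F.τs B.side.op u) (G.τs B.side.op u))
    { nat := fun {u v} h => compIso_nat _ _ _ _ _ _ _ _ (B.mute_map h) _ _ _ _
        ((F.equivariant_s _).nat h) ((G.equivariant_s _).nat h)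
      tri := fun u v => compIso_tri _ _ _ _ _ _ _ _ _ _ _ _ _ (B.mute_mul u v) (B.mute_comm u v)
        (B.mute_comm v u) _ _ _ _ _ _ ((F.equivariant_s _).tri u v) ((G.equivariant_s _).tri u v)
      one := compIso_one _ _ _ (B.oneIso _) _ _ _ _
        (by have := (F.equivariant_s B.side.op).one; rwa [B.mute_one] at this)
        (by have := (G.equivariant_s B.side.op).one; rwa [B.mute_one_inv] at this) }

theorem ofSide_f {A B : IObj V I M} (s : Side) (f : A.pt ⟶ B.pt)
    (τ : ∀ u : I, (A.actOn s.op).obj u ≫ f ≫ (B.actOn s).obj u ≅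
      (A.actOn s).obj u ≫ f ≫ (B.actOn s.op).obj u) (h : IsEquivariant s f τ) :
    (ofSide s f τ h).f = f := by
  cases s <;> rfl

/-- The underlying morphism of the composite is the composite (an identity). -/
def compForgetIso {A B C : IObj V I M} (F : EquivMor A B) (G : EquivMor B C) :
    F.f ≫ G.f ≅ (F.comp G).f :=
  eqToIso (ofSide_f _ _ _ _).symm

/-- The identity equivariant morphism. -/
def id (A : IObj V I M) : EquivMor A A :=
  ofSide A.side.op (𝟙 A.pt) (fun u => idIso (A.commIso A.side.op u u))
    { nat := fun {u v} h => id_nat (A.muteIso u) (A.muteIso v) _ _ (A.mute_map h) _ _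
        (A.mute_comm u u) (A.mute_comm v v)
      tri := fun u v => id_tri (A.muteIso _) (A.muteIso u) (A.muteIso v) _ _ _ _ _ _ _
        (A.mute_mul u v) (A.mute_comm v u) (A.mute_comm u v) (A.mute_comm _ _) (A.mute_comm u u)
        (A.mute_comm v v)
      one := by
        have := id_one (A.muteIso (tunit I)) (A.oneIso A.side.op.op) _ (A.mute_comm _ _)
        rw [← A.mute_one, ← A.mute_one_inv] at this
        exact this }

/-- A `2`-cell between equivariant morphisms. -/
@[ext]
structure Hom {A B : IObj V I M} (F G : EquivMor A B) where
  θ : F.f ⟶ G.f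
  comm : ∀ u : I, (A.actOn .l).obj u ◁ θ ▷ (B.actOn .r).obj u ≫ (G.τ u).hom =
    (F.τ u).hom ≫ (A.actOn .r).obj u ◁ θ ▷ (B.actOn .l).obj u

/-- The category `Fun_I(A, B)`. -/
instance {A B : IObj V I M} : Category (EquivMor A B) where
  Hom F G := Hom F G
  id F := ⟨𝟙 F.f, fun u => by simp⟩
  comp a b := ⟨a.θ ≫ b.θ, fun u => by
    have h1 := a.comm u
    have h2 := b.comm u
    simp only [comp_whiskerRight, Bicategory.whiskerLeft_comp, Category.assoc]
    rw [h2, reassoc_of% h1]⟩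
  id_comp a := Hom.ext (Category.id_comp a.θ)
  comp_id a := Hom.ext (Category.comp_id a.θ)
  assoc a b c := Hom.ext (Category.assoc a.θ b.θ c.θ)

theorem Hom.comm_s {A B : IObj V I M} {F G : EquivMor A B} (a : F ⟶ G) (s : Side) (u : I) :
    (A.actOn s.op).obj u ◁ a.θ ▷ (B.actOn s).obj u ≫ (G.τs s u).hom =
      (F.τs s u).hom ≫ (A.actOn s).obj u ◁ a.θ ▷ (B.actOn s.op).obj u := by
  cases s
  · exact comm_flip (a.comm u)
  · exact a.comm u

/-- The `2`-cell between equivariant morphisms given on the side `s`. -/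
def homOfSide {A B : IObj V I M} {f g : A.pt ⟶ B.pt} (θ : f ⟶ g) : (s : Side) →
    {τ : ∀ u : I, (A.actOn s.op).obj u ≫ f ≫ (B.actOn s).obj u ≅
      (A.actOn s).obj u ≫ f ≫ (B.actOn s.op).obj u} →
    {τ' : ∀ u : I, (A.actOn s.op).obj u ≫ g ≫ (B.actOn s).obj u ≅
      (A.actOn s).obj u ≫ g ≫ (B.actOn s.op).obj u} →
    {hτ : IsEquivariant s f τ} → {hτ' : IsEquivariant s g τ'} →
    (∀ u, (A.actOn s.op).obj u ◁ θ ▷ (B.actOn s).obj u ≫ (τ' u).hom =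
      (τ u).hom ≫ (A.actOn s).obj u ◁ θ ▷ (B.actOn s.op).obj u) →
    (ofSide s f τ hτ ⟶ ofSide s g τ' hτ')
  | .r, _, _, _, _, h => ⟨θ, h⟩
  | .l, _, _, _, _, h => ⟨θ, fun u => comm_flip (h u)⟩

/-- Composition with an equivariant morphism `G`, as a functor
`Fun_I(A, B) ⥤ Fun_I(A, C)`. -/
def postcompFunctor (A : IObj V I M) {B C : IObj V I M} (G : EquivMor B C) :
    EquivMor A B ⥤ EquivMor A C where
  obj F := F.comp G
  map a := homOfSide (a.θ ▷ G.f) B.side.op fun u =>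
    compIso_whisker _ _ _ _ _ (Hom.comm_s a _ u)
  map_id F := by
    obtain ⟨_, _ | _, _⟩ := B <;> exact Hom.ext (id_whiskerRight F.f G.f)
  map_comp a b := by
    obtain ⟨_, _ | _, _⟩ := B <;> exact Hom.ext (comp_whiskerRight a.θ b.θ G.f)

end EquivMor

/-! ### The `V`-categories of equivariant morphisms -/

section Whisker

variable (V)

/-- The left whiskering `[B, C](g, h) ⟶ [A, C](g ∘ f, h ∘ f)` on hom-objects. -/
def eWhiskerL {A B C : M} (f : A ⟶ B) (g h : B ⟶ C) : (g ⟶[V] h) ⟶ ((f ≫ g) ⟶[V] (f ≫ h)) :=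
  (VCatCategory.precomp (V := V) C f).some.map g h

/-- The right whiskering `[A, B](g, h) ⟶ [A, C](f ∘ g, f ∘ h)` on hom-objects. -/
def eWhiskerR {A B C : M} (g h : A ⟶ B) (f : B ⟶ C) : (g ⟶[V] h) ⟶ ((g ≫ f) ⟶[V] (h ≫ f)) :=
  (VCatCategory.postcomp (V := V) A f).some.map g h

theorem eHomEquiv_eWhiskerL {A B C : M} (f : A ⟶ B) {g h : B ⟶ C} (θ : g ⟶ h) :
    eHomEquiv V θ ≫ eWhiskerL V f g h = eHomEquiv V (f ◁ θ) :=
  (VCatCategory.precomp (V := V) C f).some.eHomEquiv_map θ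

theorem eHomEquiv_eWhiskerR {A B C : M} {g h : A ⟶ B} (f : B ⟶ C) (θ : g ⟶ h) :
    eHomEquiv V θ ≫ eWhiskerR V g h f = eHomEquiv V (θ ▷ f) :=
  (VCatCategory.postcomp (V := V) A f).some.eHomEquiv_map θ

variable {C : Type u₁} [Category.{v₁} C] [EnrichedOrdinaryCategory V C]

theorem eHomEquiv_whiskerLeft {X Y Y' : C} (f : X ⟶ Y) (g : Y ⟶ Y') :
    eHomEquiv V f ≫ eHomWhiskerLeft V X g = eHomEquiv V (f ≫ g) := by
  rw [eHomEquiv_comp, eHomWhiskerLeft, MonoidalCategory.tensorHom_def, Category.assoc,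
    MonoidalCategory.unitors_inv_equal,
    ← MonoidalCategory.rightUnitor_inv_naturality_assoc]

theorem eHomEquiv_whiskerRight {X X' Y : C} (f : X ⟶ X') (g : X' ⟶ Y) :
    eHomEquiv V g ≫ eHomWhiskerRight V f Y = eHomEquiv V (f ≫ g) := by
  rw [eHomEquiv_comp, eHomWhiskerRight, MonoidalCategory.tensorHom_def', Category.assoc,
    ← MonoidalCategory.leftUnitor_inv_naturality_assoc]

theorem eHom_left {A B C D : M} {g h : B ⟶ C} (θ : g ⟶ h) (l : A ⟶ B) (r : C ⟶ D) {k : A ⟶ D}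
    (t : l ≫ h ≫ r ⟶ k) :
    eHomEquiv V θ ≫ eWhiskerR V g h r ≫ eWhiskerL V l _ _ ≫ eHomWhiskerLeft V _ t =
      eHomEquiv V (l ◁ θ ▷ r ≫ t) := by
  rw [reassoc_of% eHomEquiv_eWhiskerR V, reassoc_of% eHomEquiv_eWhiskerL V, eHomEquiv_whiskerLeft]

theorem eHom_right {A B C D : M} {g h : B ⟶ C} (θ : g ⟶ h) (l : A ⟶ B) (r : C ⟶ D) {k : A ⟶ D}
    (t : k ⟶ l ≫ g ≫ r) :
    eHomEquiv V θ ≫ eWhiskerR V g h r ≫ eWhiskerL V l _ _ ≫ eHomWhiskerRight V t _ =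
      eHomEquiv V (t ≫ l ◁ θ ▷ r) := by
  rw [reassoc_of% eHomEquiv_eWhiskerR V, reassoc_of% eHomEquiv_eWhiskerL V, eHomEquiv_whiskerRight]

theorem eHom_left' {B C D : M} {g h : B ⟶ C} (θ : g ⟶ h) (r : C ⟶ D) {k : B ⟶ D}
    (t : h ≫ r ⟶ k) :
    eHomEquiv V θ ≫ eWhiskerR V g h r ≫ eHomWhiskerLeft V _ t = eHomEquiv V (θ ▷ r ≫ t) := by
  rw [reassoc_of% eHomEquiv_eWhiskerR V, eHomEquiv_whiskerLeft]

theorem eHom_right' {B C D : M} {g h : B ⟶ C} (θ : g ⟶ h) (r : C ⟶ D) {k : B ⟶ D}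
    (t : k ⟶ g ≫ r) :
    eHomEquiv V θ ≫ eWhiskerR V g h r ≫ eHomWhiskerRight V t _ = eHomEquiv V (t ≫ θ ▷ r) := by
  rw [reassoc_of% eHomEquiv_eWhiskerR V, eHomEquiv_whiskerRight]

theorem isVFunctor_comp {Z Z' A : M} (g : Z' ⟶ Z) (F : C ⥤ (Z ⟶ A)) (h : IsVFunctor V F) :
    IsVFunctor V (F ⋙ precomp A g) := by
  obtain ⟨L⟩ := h
  obtain ⟨P⟩ := VCatCategory.precomp (V := V) A g
  refine ⟨⟨fun X Y => L.map X Y ≫ P.map _ _, fun X => ?_, fun X Y T => ?_, fun {X Y} f => ?_⟩⟩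
  · rw [← Category.assoc, L.map_id, P.map_id]; rfl
  · rw [← Category.assoc, L.map_comp, Category.assoc, P.map_comp, ← Category.assoc,
      MonoidalCategory.tensorHom_comp_tensorHom]; rfl
  · rw [← Category.assoc, L.eHomEquiv_map, P.eHomEquiv_map]; rfl

end Whisker

variable [MonoidalClosed V] [HasLimitsOfSize.{w, w} V] [IsBase V]

namespace EquivMor

/-- The functor forgetting the equivariance structure. -/
def forget (A B : IObj V I M) : EquivMor A B ⥤ (A.pt ⟶ B.pt) where
  obj F := F.f
  map a := a.θ

/-- The hom-object of `Fun_I(A, B)` from `F` to `G` is the subobject of `[A, B](F.f, G.f)` of the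
`2`-cells which are compatible with the equivariance structures. -/
def presentation (A B : IObj V I M) : HomPresentation.{w} V (EquivMor A B) where
  Sh := { L := PUnit, R := I, fst := fun _ => ⟨⟩, snd := fun _ => ⟨⟩ }
  K _ := A.pt ⟶ B.pt
  cat _ := inferInstance
  enr _ := inferInstance
  U _ := forget A B
  W F G u := ((A.actOn .l).obj u ≫ F.f ≫ (B.actOn .r).obj u) ⟶[V]
    ((A.actOn .r).obj u ≫ G.f ≫ (B.actOn .l).obj u)
  a F G u := eWhiskerR V F.f G.f ((B.actOn .r).obj u) ≫ eWhiskerL V ((A.actOn .l).obj u) _ _ ≫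
    eHomWhiskerLeft V _ (G.τ u).hom
  b F G u := eWhiskerR V F.f G.f ((B.actOn .l).obj u) ≫ eWhiskerL V ((A.actOn .r).obj u) _ _ ≫
    eHomWhiskerRight V (F.τ u).hom _
  rel a u := (eHom_left V a.θ _ _ _).trans
    ((congrArg (eHomEquiv V) (a.comm u)).trans (eHom_right V a.θ _ _ _).symm)
  faithful _ _ h := Hom.ext (h ⟨⟩)
  full {F G} θ h := ⟨⟨θ ⟨⟩, fun u => (eHomEquiv V).injective
    ((eHom_left V (g := F.f) (h := G.f) (θ ⟨⟩) _ _ _).symm.trans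
      ((h u).trans (eHom_right V (g := F.f) (h := G.f) (θ ⟨⟩) _ _ _)))⟩, fun _ => rfl⟩

/-- The `V`-category `Fun_I(A, B)`. -/
instance (A B : IObj V I M) : EnrichedOrdinaryCategory V (EquivMor A B) :=
  (presentation A B).enriched

end EquivMor

/-! ### Stable objects and stabilizations -/

/-- `A` and `B` are `1`-equivalent as `I`-objects. -/
def IObj.Equivalent (A B : IObj V I M) : Prop :=
  ∃ (F : EquivMor A B) (G : EquivMor B A),
    Nonempty (F.comp G ≅ EquivMor.id A) ∧ Nonempty (G.comp F ≅ EquivMor.id B)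

/-- `A` is stable: it is `1`-equivalent to an `I`-object whose action is mute on the side opposite
to the one on which the action of `A` is mute. -/
def IObj.IsStable (A : IObj V I M) : Prop :=
  ∃ B : IObj V I M, B.side = A.side.op ∧ A.Equivalent B

/-- `S` together with `eps : S ⟶ A` is a stabilization of `A`. -/
structure IsStabilization (A S : IObj V I M) (eps : EquivMor S A) : Prop where
  isStable : S.IsStable
  isVEquivalence : ∀ B : IObj V I M, B.IsStable →
    IsVEquivalence V (EquivMor.postcompFunctor B eps)

/-! ### Wedges and the objects `Inv_l`, `Inv_r` -/

variable (V) in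
/-- For `s = r`, a wedge with vertex `Z` from the power `⋔(I, A)`: a `V`-functor
`e : I ⥤ [Z, A]` and isomorphisms `σ u : α(𝟙, u) ∘ e(-) ≅ α(u, 𝟙) ∘ e(- ⊗ u)`, natural in `u` and
compatible with the product and the unit of `I`. For `s = l` the two sides of the action and the
order of the product of `I` are exchanged and `σ` is inverted. -/
structure Wedge (s : Side) (A : IObj V I M) (Z : M) where
  e : I ⥤ (Z ⟶ A.pt)
  isVFunctor : IsVFunctor V e
  σ (u v : I) : e.obj v ≫ (A.actOn s).obj u ≅ e.obj (s.mul v u) ≫ (A.actOn s.op).obj u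
  nat_obj (u : I) {v v' : I} (g : v ⟶ v') : e.map g ▷ (A.actOn s).obj u ≫ (σ u v').hom =
    (σ u v).hom ≫ e.map (s.mulMap g (𝟙 u)) ▷ (A.actOn s.op).obj u
  nat {u u' : I} (h : u ⟶ u') (v : I) : e.obj v ◁ (A.actOn s).map h ≫ (σ u' v).hom =
    (σ u v).hom ≫ e.map (s.mulMap (𝟙 v) h) ▷ (A.actOn s.op).obj u ≫
      e.obj (s.mul v u') ◁ (A.actOn s.op).map h
  tri (u v w : I) : (σ (s.mul u v) w).hom =
    wedgePaste (A.mulIso' s u v) (A.mulIso s u v) (A.commIso s u v) (σ u w).hom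
      (σ v (s.mul w u)).hom (e.map (s.assoc w u v).hom)
  one (v : I) : (σ (tunit I) v).hom =
    e.obj v ◁ (A.oneIso s).hom ≫ e.map (s.mul_one v).inv ▷ 𝟙 A.pt ≫
      e.obj (s.mul v (tunit I)) ◁ (A.oneIso s.op).inv

namespace Wedge

/-- A morphism of wedges. -/
@[ext]
structure Hom {s : Side} {A : IObj V I M} {Z : M} (F G : Wedge V s A Z) where
  θ : F.e ⟶ G.e
  comm : ∀ u v : I, θ.app v ▷ (A.actOn s).obj u ≫ (G.σ u v).hom =
    (F.σ u v).hom ≫ θ.app (s.mul v u) ▷ (A.actOn s.op).obj u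

/-- The category of wedges. -/
instance {s : Side} {A : IObj V I M} {Z : M} : Category (Wedge V s A Z) where
  Hom F G := Hom F G
  id F := ⟨𝟙 F.e, fun u v => by simp⟩
  comp a b := ⟨a.θ ≫ b.θ, fun u v => by
    have h1 := a.comm u v
    have h2 := b.comm u v
    simp only [NatTrans.comp_app, comp_whiskerRight, Category.assoc]
    rw [h2, reassoc_of% h1]⟩
  id_comp a := Hom.ext (Category.id_comp a.θ)
  comp_id a := Hom.ext (Category.comp_id a.θ)
  assoc a b c := Hom.ext (Category.assoc a.θ b.θ c.θ)

/-- The components of morphisms of wedges. -/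
def evalFunctor (s : Side) (A : IObj V I M) (Z : M) (v : I) : Wedge V s A Z ⥤ (Z ⟶ A.pt) where
  obj F := F.e.obj v
  map a := a.θ.app v

/-- The hom-object of wedges from `F` to `G` is the subobject of `∏ v, [Z, A](F.e v, G.e v)` of the
families which are natural and compatible with the structure isomorphisms. -/
def presentation (s : Side) (A : IObj V I M) (Z : M) : HomPresentation.{w} V (Wedge V s A Z) where
  Sh :=
    { L := I
      R := (Σ v v' : I, (v ⟶ v')) ⊕ I × I
      fst := Sum.elim (fun t => t.2.1) (fun t => t.2)
      snd := Sum.elim (fun t => t.1) (fun t => s.mul t.2 t.1) }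
  K _ := Z ⟶ A.pt
  cat _ := inferInstance
  enr _ := inferInstance
  U v := evalFunctor s A Z v
  W F G t := Sum.elim
    (fun (t : Σ v v' : I, (v ⟶ v')) => F.e.obj t.1 ⟶[V] G.e.obj t.2.1)
    (fun t => (F.e.obj t.2 ≫ (A.actOn s).obj t.1) ⟶[V]
      (G.e.obj (s.mul t.2 t.1) ≫ (A.actOn s.op).obj t.1)) t
  a F G := fun
    | .inl t => eHomWhiskerRight V (F.e.map t.2.2) (G.e.obj t.2.1)
    | .inr t => eWhiskerR V (F.e.obj t.2) (G.e.obj t.2) ((A.actOn s).obj t.1) ≫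
        eHomWhiskerLeft V _ (G.σ t.1 t.2).hom
  b F G := fun
    | .inl t => eHomWhiskerLeft V (F.e.obj t.1) (G.e.map t.2.2)
    | .inr t => eWhiskerR V (F.e.obj (s.mul t.2 t.1)) (G.e.obj (s.mul t.2 t.1))
        ((A.actOn s.op).obj t.1) ≫ eHomWhiskerRight V (F.σ t.1 t.2).hom _
  rel := fun a t => match t with
    | .inl t => (eHomEquiv_whiskerRight V _ _).trans
        ((congrArg (eHomEquiv V) (a.θ.naturality t.2.2)).trans (eHomEquiv_whiskerLeft V _ _).symm)
    | .inr t => (eHom_left' V (a.θ.app t.2) _ _).trans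
        ((congrArg (eHomEquiv V) (a.comm t.1 t.2)).trans
          (eHom_right' V (a.θ.app (s.mul t.2 t.1)) _ _).symm)
  faithful _ _ h := Hom.ext (NatTrans.ext (funext h))
  full {F G} θ h :=
    ⟨⟨{ app := θ
        naturality := fun v v' g => (eHomEquiv V).injective
          ((eHomEquiv_whiskerRight V (F.e.map g) (θ v')).symm.trans
            ((h (.inl ⟨v, v', g⟩)).trans (eHomEquiv_whiskerLeft V (θ v) (G.e.map g)))) },
      fun u v => (eHomEquiv V).injective
        ((eHom_left' V (g := F.e.obj v) (h := G.e.obj v) (θ v) _ _).symm.trans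
          ((h (.inr (u, v))).trans (eHom_right' V (g := F.e.obj (s.mul v u))
            (h := G.e.obj (s.mul v u)) (θ (s.mul v u)) _ _)))⟩, fun _ => rfl⟩

/-- The `V`-category of wedges. -/
instance (s : Side) (A : IObj V I M) (Z : M) : EnrichedOrdinaryCategory V (Wedge V s A Z) :=
  (presentation s A Z).enriched

end Wedge

namespace Wedge

/-- The composition of a wedge with a morphism `g : Z' ⟶ Z`. -/
def pull {s : Side} {A : IObj V I M} {Z Z' : M} (W : Wedge V s A Z) (g : Z' ⟶ Z) :
    Wedge V s A Z' where
  e := W.e ⋙ precomp A.pt g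
  isVFunctor := isVFunctor_comp V g W.e W.isVFunctor
  σ u v := pullIso g (W.σ u v)
  nat_obj u _ _ h := pull_nat_obj g _ _ _ _ (W.nat_obj u h)
  nat h v := pull_nat g _ _ _ _ _ (W.nat h v)
  tri u v w := pull_tri g _ _ _ _ _ _ _ (W.tri u v w)
  one v := pull_one g _ _ _ _ (W.one v)

/-- The composition of a wedge with morphisms `Z' ⟶ Z`, as a functor. -/
def pullFunctor {s : Side} {A : IObj V I M} {Z : M} (W : Wedge V s A Z) (Z' : M) :
    (Z' ⟶ Z) ⥤ Wedge V s A Z' where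
  obj g := W.pull g
  map θ :=
    { θ :=
        { app := fun v => θ ▷ W.e.obj v
          naturality := fun _ _ h => whisker_exchange θ (W.e.map h) }
      comm := fun u v => pull_whisker θ (W.σ u v) }
  map_id g := Hom.ext (NatTrans.ext (funext fun v => id_whiskerRight g (W.e.obj v)))
  map_comp a b := Hom.ext (NatTrans.ext (funext fun v => comp_whiskerRight a b (W.e.obj v)))

end Wedge

variable (V) in
/-- `Inv_s(A)`: an object with a universal wedge `(e, σ)`, i.e. composition with the wedge is an
equivalence of `V`-categories from `[Z, Inv_s(A)]` to the wedges with vertex `Z`, together with the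
strict action of `I` on the side `s` which is induced by `e ↦ e(y ⊗ -)` for `s = r` and by
`e ↦ e(- ⊗ y)` for `s = l`: `κ` identifies the wedge composed with the action of `y` with the wedge
`e(y ⊗ -)`, resp. `e(- ⊗ y)`, compatibly with the product and the unit of `I`. -/
structure InvData (s : Side) (A : IObj V I M) where
  pt : M
  act : SAct V I s pt
  wedge : Wedge V s A pt
  universal (Z : M) : IsVEquivalence V (wedge.pullFunctor Z)
  κ (y v : I) : act.F.obj y ≫ wedge.e.obj v ≅ wedge.e.obj (s.mul y v)
  κ_nat_obj (y : I) {v v' : I} (g : v ⟶ v') :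
    act.F.obj y ◁ wedge.e.map g ≫ (κ y v').hom = (κ y v).hom ≫ wedge.e.map (s.mulMap (𝟙 y) g)
  κ_nat {y y' : I} (h : y ⟶ y') (v : I) :
    act.F.map h ▷ wedge.e.obj v ≫ (κ y' v).hom = (κ y v).hom ≫ wedge.e.map (s.mulMap h (𝟙 v))
  κ_σ (y u v : I) :
    act.F.obj y ◁ (wedge.σ u v).hom ≫ (α_ _ _ _).inv ≫
        ((κ y (s.mul v u)).hom ≫ wedge.e.map (s.assoc y v u).inv) ▷ (A.actOn s.op).obj u =
      (α_ _ _ _).inv ≫ (κ y v).hom ▷ (A.actOn s).obj u ≫ (wedge.σ u (s.mul y v)).hom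
  κ_mul (y y' v : I) : (κ (s.mul y y') v).hom =
    eqToHom (act.mul y y') ▷ wedge.e.obj v ≫ (α_ _ _ _).hom ≫ act.F.obj y ◁ (κ y' v).hom ≫
      (κ y (s.mul y' v)).hom ≫ wedge.e.map (s.assoc y y' v).inv
  κ_one (v : I) : (κ (tunit I) v).hom =
    eqToHom act.one ▷ wedge.e.obj v ≫ (λ_ _).hom ≫ wedge.e.map (s.one_mul v).inv

namespace InvData

/-- `Inv_s(A)` as an `I`-object. -/
@[reducible]
def obj {s : Side} {A : IObj V I M} (D : InvData V s A) : IObj V I M := ⟨D.pt, s, D.act⟩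

/-- The action of `y` on `e(𝟙)`, as an isomorphism with `e(𝟙 ⊗ y)`. -/
def κ₁ {s : Side} {A : IObj V I M} (D : InvData V s A) (y : I) :
    D.act.F.obj y ≫ D.wedge.e.obj (tunit I) ≅ D.wedge.e.obj (s.mul (tunit I) y) :=
  D.κ y (tunit I) ≪≫ D.wedge.e.mapIso (s.mul_one y ≪≫ (s.one_mul y).symm)

/-- The equivariance structure of the evaluation at the unit. -/
def epsτ : (s : Side) → {A : IObj V I M} → (D : InvData V s A) → (u : I) →
    ((D.obj.actOn s.op).obj u ≫ D.wedge.e.obj (tunit I) ≫ (A.actOn s).obj u ≅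
      (D.obj.actOn s).obj u ≫ D.wedge.e.obj (tunit I) ≫ (A.actOn s.op).obj u)
  | .l, _, D, u => epsIso (D.obj.muteIso u) (D.wedge.σ u (tunit I)) (D.κ₁ u)
  | .r, _, D, u => epsIso (D.obj.muteIso u) (D.wedge.σ u (tunit I)) (D.κ₁ u)

theorem κ₁_nat {s : Side} {A : IObj V I M} (D : InvData V s A) {u v : I} (h : u ⟶ v) :
    D.act.F.map h ▷ D.wedge.e.obj (tunit I) ≫ (D.κ₁ v).hom =
      (D.κ₁ u).hom ≫ D.wedge.e.map (s.mulMap (𝟙 (tunit I)) h) := by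
  have := D.κ_nat h (tunit I)
  simp only [κ₁, Iso.trans_hom, Functor.mapIso_hom, Category.assoc]
  rw [reassoc_of% this, ← Functor.map_comp, ← Functor.map_comp]
  exact congrArg (fun x => _ ≫ D.wedge.e.map x) (s.unit_nat h)

/-- The action of `u` on `e(𝟙 ⊗ v)`, as an isomorphism with `e((𝟙 ⊗ u) ⊗ v)`. -/
def κ₂ {s : Side} {A : IObj V I M} (D : InvData V s A) (u v : I) :
    D.act.F.obj u ≫ D.wedge.e.obj (s.mul (tunit I) v) ≅
      D.wedge.e.obj (s.mul (s.mul (tunit I) u) v) :=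
  D.κ u (s.mul (tunit I) v) ≪≫ D.wedge.e.mapIso ((s.assoc u (tunit I) v).symm ≪≫
    s.mulIsoRight (s.mul_one u ≪≫ (s.one_mul u).symm) v)

theorem κ₂_σ {s : Side} {A : IObj V I M} (D : InvData V s A) (u v : I) :
    D.act.F.obj u ◁ (D.wedge.σ v (tunit I)).hom ≫ (α_ _ _ _).inv ≫
        (D.κ₂ u v).hom ▷ (A.actOn s.op).obj v =
      (α_ _ _ _).inv ≫ (D.κ₁ u).hom ▷ (A.actOn s).obj v ≫
        (D.wedge.σ v (s.mul (tunit I) u)).hom := by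
  have h1 := D.κ_σ u v (tunit I)
  have h2 := D.wedge.nat_obj v (s.mul_one u ≪≫ (s.one_mul u).symm).hom
  simp only [κ₁, κ₂, Iso.trans_hom, Functor.mapIso_hom, comp_whiskerRight, Category.assoc,
    Functor.map_comp, Iso.symm_hom] at h1 h2 ⊢
  rw [h2, ← reassoc_of% h1]

theorem κ₁_mul {s : Side} {A : IObj V I M} (D : InvData V s A) (u v : I) :
    (D.κ₁ (s.mul u v)).hom = eqToHom (D.act.mul u v) ▷ D.wedge.e.obj (tunit I) ≫ (α_ _ _ _).hom ≫
      D.act.F.obj u ◁ (D.κ₁ v).hom ≫ (D.κ₂ u v).hom ≫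
        D.wedge.e.map (s.assoc (tunit I) u v).hom := by
  have h1 := D.κ_mul u v (tunit I)
  have h2 := D.κ_nat_obj u (s.mul_one v ≪≫ (s.one_mul v).symm).hom
  simp only [κ₁, κ₂, Iso.trans_hom, Functor.mapIso_hom, Bicategory.whiskerLeft_comp,
    Category.assoc, Iso.symm_hom] at h1 h2 ⊢
  rw [h1, reassoc_of% h2]
  simp only [← Functor.map_comp, Category.assoc]
  exact congrArg (fun x => _ ≫ _ ≫ _ ≫ _ ≫ D.wedge.e.map x) (s.unit_coh u v)

theorem κ₁_one {s : Side} {A : IObj V I M} (D : InvData V s A) :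
    (D.κ₁ (tunit I)).hom = eqToHom D.act.one ▷ D.wedge.e.obj (tunit I) ≫ (λ_ _).hom ≫
      D.wedge.e.map (s.mul_one (tunit I)).inv := by
  have h1 := D.κ_one (tunit I)
  simp only [κ₁, Iso.trans_hom, Functor.mapIso_hom, Iso.symm_hom] at h1 ⊢
  rw [h1]
  simp only [← Functor.map_comp, Category.assoc]
  exact congrArg (fun x => _ ≫ _ ≫ D.wedge.e.map x) s.unit_unit

theorem isEquivariant_epsτ (s : Side) {A : IObj V I M} (D : InvData V s A) :
    IsEquivariant (A := D.obj) (B := A) s (D.wedge.e.obj (tunit I)) (epsτ s D) := by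
  cases s
  all_goals exact
    { nat := fun {u v} h => eps_nat (D.obj.muteIso u) (D.obj.muteIso v) _ _ _ _ _ _ _ _ _
        (D.obj.mute_map h) (D.wedge.nat h _) (D.κ₁_nat h)
      tri := fun u v => eps_tri (D.obj.muteIso _) (D.obj.muteIso u) (D.obj.muteIso v)
        _ _ _ _ _ _ (D.obj.mute_mul' u v) (D.obj.mute_comm' v u) _ _ _ _
        (D.wedge.e.mapIso (Side.assoc _ (tunit I) u v)) _ _ _ (D.κ₂ u v)
        (D.wedge.tri u v _) (D.κ₂_σ u v) (D.κ₁_mul u v)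
      one := eps_one (D.obj.muteIso _) _ _ (D.wedge.e.mapIso (Side.mul_one _ (tunit I)).symm) _ _ _
        (D.wedge.one _) D.κ₁_one }

/-- The evaluation at the unit `Inv_s(A) ⟶ A`. -/
def eps {s : Side} {A : IObj V I M} (D : InvData V s A) : EquivMor D.obj A :=
  EquivMor.ofSide s (D.wedge.e.obj (tunit I)) (epsτ s D) (isEquivariant_epsτ s D)

end InvData

/-! ### The tower and its weak limit -/

variable (inv : ∀ (s : Side) (X : IObj V I M), InvData V s X)

/-- `tower inv A n` is `Inv_I^(n + 1)(A)`. -/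
def tower (A : IObj V I M) : ℕ → IObj V I M
  | 0 => (inv .l A).obj
  | n + 1 => (inv .l (inv .r (tower A n)).obj).obj

/-- The map `Inv_I(X) ⟶ X`, for `X = Inv_I^(n + 1)(A)`. -/
def towerMap (A : IObj V I M) (n : ℕ) : EquivMor (tower inv A (n + 1)) (tower inv A n) :=
  (inv .l (inv .r (tower inv A n)).obj).eps.comp (inv .r (tower inv A n)).eps

section Cone

/-- A weak cone with vertex `Z` on a tower of objects of `M`. -/
structure TowerCone (X : ℕ → M) (t : ∀ n, X (n + 1) ⟶ X n) (Z : M) where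
  g (n : ℕ) : Z ⟶ X n
  φ (n : ℕ) : g (n + 1) ≫ t n ≅ g n

namespace TowerCone

variable {X : ℕ → M} {t : ∀ n, X (n + 1) ⟶ X n}

/-- A morphism of weak cones. -/
@[ext]
structure Hom {Z : M} (F G : TowerCone X t Z) where
  θ (n : ℕ) : F.g n ⟶ G.g n
  comm : ∀ n, θ (n + 1) ▷ t n ≫ (G.φ n).hom = (F.φ n).hom ≫ θ n

/-- The category of weak cones. -/
instance {Z : M} : Category (TowerCone X t Z) where
  Hom F G := Hom F G
  id F := ⟨fun n => 𝟙 (F.g n), fun n => by simp⟩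
  comp a b := ⟨fun n => a.θ n ≫ b.θ n, fun n => by
    have h1 := a.comm n
    have h2 := b.comm n
    simp only [comp_whiskerRight, Category.assoc]
    rw [h2, reassoc_of% h1]⟩
  id_comp a := Hom.ext (funext fun n => Category.id_comp (a.θ n))
  comp_id a := Hom.ext (funext fun n => Category.comp_id (a.θ n))
  assoc a b c := Hom.ext (funext fun n => Category.assoc (a.θ n) (b.θ n) (c.θ n))

/-- The components of morphisms of weak cones. -/
def evalFunctor (Z : M) (n : ℕ) : TowerCone X t Z ⥤ (Z ⟶ X n) where
  obj F := F.g n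
  map a := a.θ n

/-- The hom-object of weak cones from `F` to `G` is the subobject of `∏ n, [Z, X n](F.g n, G.g n)`
of the families which are compatible with the structure isomorphisms. -/
def presentation (Z : M) : HomPresentation.{w} V (TowerCone X t Z) where
  Sh := { L := ULift ℕ, R := ULift ℕ, fst := fun n => ⟨n.down + 1⟩, snd := fun n => n }
  K n := Z ⟶ X n.down
  cat _ := inferInstance
  enr _ := inferInstance
  U n := evalFunctor Z n.down
  W F G n := (F.g (n.down + 1) ≫ t n.down) ⟶[V] G.g n.down
  a F G n := eWhiskerR V (F.g (n.down + 1)) (G.g (n.down + 1)) (t n.down) ≫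
    eHomWhiskerLeft V _ (G.φ n.down).hom
  b F _ n := eHomWhiskerRight V (F.φ n.down).hom _
  rel a n := (eHom_left' V (a.θ (n.down + 1)) _ _).trans
    ((congrArg (eHomEquiv V) (a.comm n.down)).trans
      (eHomEquiv_whiskerRight V _ (a.θ n.down)).symm)
  faithful _ _ h := Hom.ext (funext fun n => h ⟨n⟩)
  full {F G} θ h := ⟨⟨fun n => θ ⟨n⟩, fun n => (eHomEquiv V).injective
    ((eHom_left' V (g := F.g (n + 1)) (h := G.g (n + 1)) (θ ⟨n + 1⟩) _ _).symm.trans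
      ((h ⟨n⟩).trans (eHomEquiv_whiskerRight V (F.φ n).hom (θ ⟨n⟩))))⟩, fun _ => rfl⟩

/-- The `V`-category of weak cones. -/
instance (Z : M) : EnrichedOrdinaryCategory V (TowerCone X t Z) :=
  (presentation.{w} Z).enriched

/-- The composition of a weak cone with morphisms `Z' ⟶ Z`, as a functor. -/
def pullFunctor {Z : M} (F : TowerCone X t Z) (Z' : M) : (Z' ⟶ Z) ⥤ TowerCone X t Z' where
  obj h := ⟨fun n => h ≫ F.g n, fun n => α_ h (F.g (n + 1)) (t n) ≪≫ whiskerLeftIso h (F.φ n)⟩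
  map θ := ⟨fun n => θ ▷ F.g n, fun n => by
    have := whisker_exchange θ (F.φ n).hom
    simp [this]⟩
  map_id h := Hom.ext (funext fun n => id_whiskerRight h (F.g n))
  map_comp a b := Hom.ext (funext fun n => comp_whiskerRight a b (F.g n))

end TowerCone

end Cone

/-- `Inv_I^∞(A)`: a weak limit of the tower in the category of left `I`-objects, given by a weak
limit of the underlying tower in `M` with the induced action. -/
structure TowerLimit (A : IObj V I M) where
  pt : M
  act : SAct V I .l pt
  p (n : ℕ) : EquivMor ⟨pt, .l, act⟩ (tower inv A n)
  φ (n : ℕ) : (p (n + 1)).comp (towerMap inv A n) ≅ p n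
  universal (Z : M) : IsVEquivalence V (TowerCone.pullFunctor
    (t := fun n => (towerMap inv A n).f)
    ⟨fun n => (p n).f, fun n => EquivMor.compForgetIso _ _ ≪≫ (EquivMor.forget _ _).mapIso (φ n)⟩ Z)

namespace TowerLimit

variable {inv}

/-- `Inv_I^∞(A)` as an `I`-object. -/
@[reducible]
def obj {A : IObj V I M} (L : TowerLimit inv A) : IObj V I M := ⟨L.pt, .l, L.act⟩

/-- `ε^∞ : Inv_I^∞(A) ⟶ A`, the composite of the projection `Inv_I^∞(A) ⟶ Inv_I^1(A) = Inv_l(A)`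
and of the evaluation at the unit. -/
def epsInf {A : IObj V I M} (L : TowerLimit inv A) : EquivMor L.obj A :=
  (L.p 0).comp (inv .l A).eps

end TowerLimit

end Bicat

end

end StabAct

/-! Composites are written in diagrammatic order. The proof has two halves.

Mapping property. Let `B` act on the side `s` through β. An equivariant morphism `f : B ⟶ A` yields
the wedge v ↦ β(v) ≫ f with vertex `B`, and the universal wedge of Inv_s(A) is the wedge of the
evaluation `ev` at the unit (`InvData.evWedgeIso`). Hence the wedge of `f` is induced by some g : B
⟶ Inv_s(A) in `M`. Shifting the index of the wedge of `f` by u amounts to precomposing with β(u),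
and shifting the index of the universal wedge is the action on Inv_s(A); universality therefore
gives `g` an equivariance structure, whose axioms follow from uniqueness. So composition with `ev`
is an equivalence on morphisms out of `B` (`EquivMor.isVEquivalence_postcomp_of_wedge`). A stable
`B` is equivalent to objects acting on either side, so for stable `B` this holds for both Inv_l and
Inv_r (`InvData.isVEquivalence_postcomp_ev_of_isStable`), and every map of the tower becomes an
equivalence under Fun(B, -). A weak limit in `M` of objects acting on one side is also a weak limit
for equivariant morphisms (`TowerCone.isVEquivalence_pullFunctor`), and a weak limit of a tower of
equivalences projects to its bottom term by an equivalence (`TowerCone.isVEquivalence_evalFunctor`).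
Composing with ε_l gives the mapping property of ε^∞.

Stability. Let L be the weak limit, X_n the terms of the tower and R_n = Inv_r(X_n), so that the
tower factors as X_{n+1} ⟶ R_n ⟶ X_n. Wedges of type `r` on L are weak cones of wedges on the X_n
(`TowerCone.isEquivalence_wedgeFunctor`), so Inv_r(L) is a weak limit of the R_n
(`isEquivalence_pullFunctor_of_wedge`). But L also carries a cone on the R_n, because the two towers
interleave. This cone induces an equivariant G : L ⟶ Inv_r(L) with G ≫ ev ≅ 𝟙
(`InvData.exists_section`). As Inv_r(L) acts on the right, the mapping property of `ev` applies to
Inv_r(L) itself and gives ev ≫ G ≅ 𝟙 (`nonempty_iso_id_of_section`). Thus L, which acts on the left,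
is equivalent to an object acting on the right.

Enrichment. Because V(𝟙, -) is faithful, being a `V`-functor is a condition on each function between
hom-sets separately, recorded by `VRep`. A `V`-equivalence is then an essentially surjective
`V`-functor whose hom-set bijections have inverses induced by morphisms of hom-objects (`VFF`). -/

namespace StabAct

open CategoryTheory Limits

noncomputable section

/-! ### Functions between hom-sets induced by morphisms of hom-objects -/

section VRep

open MonoidalCategory

variable (V : Type u') [Category.{v'} V] [MonoidalCategory V]
variable {C : Type u₁} [Category.{v₁} C] [EnrichedOrdinaryCategory V C]
  {D : Type u₂} [Category.{v₂} D] [EnrichedOrdinaryCategory V D]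
  {E : Type u₃} [Category.{v₃} E] [EnrichedOrdinaryCategory V E]

/-- The function `φ` between hom-sets is induced by a morphism of hom-objects. -/
def VRep {X Y : C} {X' Y' : D} (φ : (X ⟶ Y) → (X' ⟶ Y')) : Prop :=
  ∃ m : (X ⟶[V] Y) ⟶ (X' ⟶[V] Y'), ∀ f, eHomEquiv V f ≫ m = eHomEquiv V (φ f)

variable {V}

theorem VRep.comp {X Y : C} {X' Y' : D} {X'' Y'' : E} {φ : (X ⟶ Y) → (X' ⟶ Y')}
    {ψ : (X' ⟶ Y') → (X'' ⟶ Y'')} (hψ : VRep V ψ) (hφ : VRep V φ) :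
    VRep V (fun f => ψ (φ f)) := by
  obtain ⟨m, hm⟩ := hφ
  obtain ⟨k, hk⟩ := hψ
  exact ⟨m ≫ k, fun f => by rw [← Category.assoc, hm, hk]⟩

theorem VRep.id {X Y : C} : VRep V (fun f : X ⟶ Y => f) := ⟨𝟙 _, fun f => by simp⟩

theorem VRep.postcomp {X Y : C} {X' Y' Y'' : D} {φ : (X ⟶ Y) → (X' ⟶ Y')} (h : VRep V φ)
    (g : Y' ⟶ Y'') : VRep V (fun f => φ f ≫ g) := by
  obtain ⟨m, hm⟩ := h
  exact ⟨m ≫ eHomWhiskerLeft V X' g, fun f => by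
    rw [← Category.assoc, hm, eHomEquiv_whiskerLeft]⟩

theorem VRep.precomp {X Y : C} {X' Y' X'' : D} {φ : (X ⟶ Y) → (X' ⟶ Y')} (h : VRep V φ)
    (g : X'' ⟶ X') : VRep V (fun f => g ≫ φ f) := by
  obtain ⟨m, hm⟩ := h
  exact ⟨m ≫ eHomWhiskerRight V g Y', fun f => by
    rw [← Category.assoc, hm, eHomEquiv_whiskerRight]⟩

theorem VRep.congr {X Y : C} {X' Y' : D} {φ ψ : (X ⟶ Y) → (X' ⟶ Y')} (h : VRep V φ)
    (e : ∀ f, φ f = ψ f) : VRep V ψ := by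
  obtain rfl : φ = ψ := funext e
  exact h

theorem IsVFunctor.vrep {F : C ⥤ D} (h : IsVFunctor V F) (X Y : C) :
    VRep V (fun f : X ⟶ Y => F.map f) :=
  ⟨h.some.map X Y, fun f => h.some.eHomEquiv_map f⟩

/-- The axioms of a `V`-functor are equations between morphisms of `V`, which can be tested on
elements 𝟙 ⟶ Hom; for the tensor product this is `tensor_ext`, which uses closedness. On elements
they are the functoriality of `F`. So the chosen maps of hom-objects need no compatibility. -/
theorem isVFunctor_of_vrep [IsBase V] [MonoidalClosed V] {F : C ⥤ D}
    (h : ∀ X Y, VRep V (fun f : X ⟶ Y => F.map f)) : IsVFunctor V F := by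
  choose m hm using h
  dsimp only at hm
  refine ⟨⟨m, fun X => ?_, fun X Y Z => ?_, fun f => hm _ _ f⟩⟩
  · rw [← eHomEquiv_id, hm, F.map_id, eHomEquiv_id]
  · apply tensor_ext
    intro x y
    obtain ⟨f, rfl⟩ := (eHomEquiv V).surjective x
    obtain ⟨g, rfl⟩ := (eHomEquiv V).surjective y
    have h1 := hm _ _ (f ≫ g)
    rw [F.map_comp, eHomEquiv_comp, eHomEquiv_comp, ← hm, ← hm] at h1
    simpa using h1

theorem IsVFunctor.comp [IsBase V] [MonoidalClosed V] {F : C ⥤ D} {G : D ⥤ E}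
    (hF : IsVFunctor V F) (hG : IsVFunctor V G) : IsVFunctor V (F ⋙ G) :=
  isVFunctor_of_vrep fun X Y => (hG.vrep _ _).comp (hF.vrep X Y)

/-- The functor `F` is bijective on hom-sets, and the inverse bijections are induced by morphisms of
hom-objects. -/
def VFF (V : Type u') [Category.{v'} V] [MonoidalCategory V]
    {C : Type u₁} [Category.{v₁} C] [EnrichedOrdinaryCategory V C]
    {D : Type u₂} [Category.{v₂} D] [EnrichedOrdinaryCategory V D] (F : C ⥤ D) : Prop :=
  ∀ X Y, ∃ ψ : (F.obj X ⟶ F.obj Y) → (X ⟶ Y), VRep V ψ ∧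
    (∀ g, F.map (ψ g) = g) ∧ ∀ f, ψ (F.map f) = f

theorem VFF.full {F : C ⥤ D} (h : VFF V F) : F.Full where
  map_surjective {X Y} g := by
    obtain ⟨ψ, -, h1, -⟩ := h X Y
    exact ⟨ψ g, h1 g⟩

theorem VFF.faithful {F : C ⥤ D} (h : VFF V F) : F.Faithful where
  map_injective {X Y} f g e := by
    obtain ⟨ψ, -, -, h2⟩ := h X Y
    rw [← h2 f, e, h2]

theorem isVEquivalence_of_vff [IsBase V] [MonoidalClosed V] {F : C ⥤ D} (hF : IsVFunctor V F)
    (h : VFF V F) (he : F.EssSurj) : IsVEquivalence V F := by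
  have := h.full
  have := h.faithful
  have : F.IsEquivalence := { }
  refine ⟨hF, F.inv, isVFunctor_of_vrep fun X Y => ?_, ⟨F.asEquivalence.unitIso.symm⟩,
    ⟨F.asEquivalence.counitIso⟩⟩
  obtain ⟨ψ, h0, h1, h2⟩ := h (F.inv.obj X) (F.inv.obj Y)
  -- On hom-sets the inverse functor is f ↦ ψ(ε ≫ f ≫ ε⁻¹) with ε the counit, a composite of
  -- functions induced by morphisms of hom-objects.
  refine (h0.comp ((VRep.id.precomp (F.asEquivalence.counitIso.hom.app X)).postcomp
    (F.asEquivalence.counitIso.inv.app Y))).congr fun f => ?_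
  apply F.map_injective
  refine (h1 _).trans ?_
  have := F.asEquivalence.counitIso.hom.naturality f
  dsimp at this ⊢
  rw [← this, Category.assoc, Iso.hom_inv_id_app]
  exact Category.comp_id _

theorem IsVEquivalence.isEquivalence {F : C ⥤ D} (h : IsVEquivalence V F) : F.IsEquivalence := by
  obtain ⟨-, G, -, ⟨a⟩, ⟨b⟩⟩ := h
  exact (CategoryTheory.Equivalence.mk F G a.symm b).isEquivalence_functor

theorem IsVEquivalence.vff {F : C ⥤ D} (h : IsVEquivalence V F) : VFF V F := by
  have := h.isEquivalence
  obtain ⟨-, G, hG, ⟨a⟩, ⟨b⟩⟩ := h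
  intro X Y
  -- Conjugating `G.map` by the unit gives a left inverse of `F.map`; as `F` is full it is also a
  -- right inverse.
  have key : ∀ f : X ⟶ Y, a.inv.app X ≫ G.map (F.map f) ≫ a.hom.app Y = f := fun f => by
    have := a.hom.naturality f
    dsimp at this
    rw [this]
    simp
  refine ⟨fun g => a.inv.app X ≫ G.map g ≫ a.hom.app Y,
    ((hG.vrep _ _).postcomp _).precomp _, fun g => ?_, key⟩
  obtain ⟨f, rfl⟩ := F.map_surjective g
  exact congrArg _ (key f)

theorem VFF.comp {F : C ⥤ D} {G : D ⥤ E} (hF : VFF V F) (hG : VFF V G) : VFF V (F ⋙ G) := by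
  intro X Y
  obtain ⟨ψ, h0, h1, h2⟩ := hF X Y
  obtain ⟨χ, k0, k1, k2⟩ := hG (F.obj X) (F.obj Y)
  exact ⟨fun g => ψ (χ g), h0.comp k0, fun g => by simp [h1, k1], fun f => by simp [h2, k2]⟩

theorem IsVEquivalence.comp [IsBase V] [MonoidalClosed V] {F : C ⥤ D} {G : D ⥤ E}
    (hF : IsVEquivalence V F) (hG : IsVEquivalence V G) : IsVEquivalence V (F ⋙ G) := by
  have := hF.isEquivalence
  have := hG.isEquivalence
  exact isVEquivalence_of_vff (hF.1.comp hG.1) (hF.vff.comp hG.vff) inferInstance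

theorem IsVEquivalence.of_iso [IsBase V] [MonoidalClosed V] {F G : C ⥤ D}
    (hF : IsVEquivalence V F) (e : F ≅ G) : IsVEquivalence V G := by
  obtain ⟨h, H, hH, ⟨a⟩, ⟨b⟩⟩ := hF
  refine ⟨isVFunctor_of_vrep fun X Y => (((h.vrep X Y).postcomp (e.hom.app Y)).precomp
    (e.inv.app X)).congr fun f => ?_, H, hH, ⟨Functor.isoWhiskerRight e.symm H ≪≫ a⟩,
    ⟨Functor.isoWhiskerLeft H e.symm ≪≫ b⟩⟩
  simp

/-- Cancellation of a `V`-equivalence on the right. -/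
theorem IsVEquivalence.of_comp [IsBase V] [MonoidalClosed V] {F : C ⥤ D} {G : D ⥤ E}
    (hF : IsVFunctor V F) (hG : IsVEquivalence V G) (h : IsVEquivalence V (F ⋙ G)) :
    IsVEquivalence V F := by
  have := hG.isEquivalence
  have := h.isEquivalence
  have := Functor.isEquivalence_of_comp_right F G
  refine isVEquivalence_of_vff hF (fun X Y => ?_) inferInstance
  obtain ⟨ψ, h0, h1, h2⟩ := h.vff X Y
  -- The inverse of `F` on hom-sets: apply `G`, then invert the composite `F ⋙ G`.
  refine ⟨fun g => ψ (G.map g), h0.comp (hG.1.vrep _ _), fun g => G.map_injective (h1 _),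
    fun f => h2 f⟩

end VRep

/-! ### Functions into and out of hom-objects defined as limits. -/

section Presentation

open MonoidalCategory

variable {V : Type u'} [Category.{v'} V] [MonoidalCategory V]
variable {C : Type u₁} [Category.{v₁} C] [EnrichedOrdinaryCategory V C]
variable {D : Type u₂} [Category.{v₂} D] (P : HomPresentation.{w, v', u', v₂, u₂, v₃, u₃} V D)
variable [HasLimitsOfSize.{w, w} V] [IsBase V] [MonoidalClosed V]

theorem HomPresentation.vrep_map (j : P.Sh.L) (d d' : D) :
    letI := P.enriched
    VRep V (fun f : d ⟶ d' => (P.U j).map f) :=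
  letI := P.enriched
  ⟨Multiequalizer.ι (P.index d d') j, fun f => P.toHom_ι f j⟩

/-- The hom-object is a limit, so a morphism into it is a compatible family of morphisms, and the
compatibility can be tested on elements, where it is `P.rel`. Hence enrichment of functors into
equivariant morphisms, wedges or weak cones is checked one component at a time. -/
theorem HomPresentation.vrep_of {X Y : C} {d d' : D} (φ : (X ⟶ Y) → (d ⟶ d'))
    (h : ∀ j, VRep V (fun f => (P.U j).map (φ f))) :
    letI := P.enriched
    VRep V φ := by
  let := P.enriched
  choose m hm using h
  refine ⟨Multiequalizer.lift _ _ m fun t => ?_, fun f => ?_⟩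
  · apply unit_ext
    intro x
    obtain ⟨f, rfl⟩ := (eHomEquiv V).surjective x
    have := P.rel (φ f) t
    rw [← hm, ← hm] at this
    simpa using this
  · refine Multiequalizer.hom_ext _ _ _ fun j => ?_
    change _ = P.toHom (φ f) ≫ _
    rw [P.toHom_ι, ← hm, Category.assoc]
    exact congrArg _ (Multiequalizer.lift_ι _ _ _ _ _)

end Presentation

/-! ### The bicategory of `I`-objects -/

section Coherence

open Bicategory

variable {M : Type u₂} [Bicategory.{w₂, v₂} M]

/-- The case of two middle objects acting on the same side: both composites paste the three cells in
the same order, and only coherence is left. -/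
theorem compIso_assoc {a b c d : M} {af an : a ⟶ a} {bf : b ⟶ b} {cf : c ⟶ c}
    {df dn : d ⟶ d} {f : a ⟶ b} {g : b ⟶ c} {h : c ⟶ d}
    (t : af ≫ f ≫ 𝟙 b ≅ an ≫ f ≫ bf) (r : bf ≫ g ≫ 𝟙 c ≅ 𝟙 b ≫ g ≫ cf)
    (q : cf ≫ h ≫ dn ≅ 𝟙 c ≫ h ≫ df) :
    af ◁ (α_ f g h).hom ▷ dn ≫ (compIso (Iso.refl _) t (compIso (Iso.refl _) r q)).hom =
      (compIso (Iso.refl _) (compIso (Iso.refl _) t r) q).hom ≫ an ◁ (α_ f g h).hom ▷ df := by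
  simp only [compIso, hatL, hatR, Iso.trans_hom, whiskerLeftIso_hom, whiskerRightIso_hom,
    Iso.symm_hom, Iso.refl_hom, Iso.refl_inv]
  bicategory

/-- The case of two middle objects acting on opposite sides. One bracketing applies `t`, `q`, `r` in
this order, the other `q`, `t`, `r`; the cells `t` and `q` sit at the two ends of the composite and
commute by the interchange law. -/
theorem compIso_assoc_op {a b c d : M} {af an : a ⟶ a} {bf : b ⟶ b} {cn : c ⟶ c}
    {df dn : d ⟶ d} {f : a ⟶ b} {g : b ⟶ c} {h : c ⟶ d}
    (t : af ≫ f ≫ 𝟙 b ≅ an ≫ f ≫ bf) (r : bf ≫ g ≫ cn ≅ 𝟙 b ≫ g ≫ 𝟙 c)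
    (q : 𝟙 c ≫ h ≫ dn ≅ cn ≫ h ≫ df) :
    af ◁ (α_ f g h).hom ▷ dn ≫
        (compIso (Iso.refl _) t (compIso (Iso.refl _) r.symm q.symm).symm).hom =
      (compIso (Iso.refl _) (compIso (Iso.refl _) t r).symm q.symm).inv ≫
        an ◁ (α_ f g h).hom ▷ df := by
  simp only [compIso, hatL, hatR, Iso.trans_hom, whiskerLeftIso_hom, whiskerRightIso_hom,
    Iso.symm_hom, Iso.refl_hom, Iso.refl_inv, Iso.trans_inv, whiskerLeftIso_inv,
    whiskerRightIso_inv, Iso.symm_inv]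
  calc
    _ = 𝟙 (af ≫ ((f ≫ g) ≫ h) ≫ dn) ⊗≫ (t.hom ▷ (g ≫ 𝟙 c ≫ h ≫ dn) ≫
        (an ≫ f ≫ bf) ◁ g ◁ q.hom) ⊗≫ an ◁ f ◁ r.hom ▷ (h ≫ df) ⊗≫
          𝟙 (an ≫ (f ≫ g ≫ h) ≫ df) := by bicategory
    _ = _ := by rw [← whisker_exchange]; bicategory

theorem compIso_id {a c : M} {af : a ⟶ a} {cf cn : c ⟶ c} {f : a ⟶ c}
    (t : af ≫ f ≫ cn ≅ 𝟙 a ≫ f ≫ cf) :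
    af ◁ (λ_ f).hom ▷ cn ≫ t.hom =
      (compIso (Iso.refl _) (idIso (ρ_ af ≪≫ (λ_ af).symm)) t).hom ≫ 𝟙 a ◁ (λ_ f).hom ▷ cf := by
  simp only [compIso, hatL, hatR, idIso, Iso.trans_hom, whiskerLeftIso_hom, whiskerRightIso_hom,
    Iso.symm_hom, Iso.refl_hom, Iso.refl_inv]
  bicategory

theorem id_compIso {a c : M} {af an : a ⟶ a} {cf : c ⟶ c} {f : a ⟶ c}
    (t : af ≫ f ≫ 𝟙 c ≅ an ≫ f ≫ cf) :
    af ◁ (ρ_ f).hom ▷ 𝟙 c ≫ t.hom =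
      (compIso (Iso.refl _) t (idIso (ρ_ cf ≪≫ (λ_ cf).symm))).hom ≫ an ◁ (ρ_ f).hom ▷ cf := by
  simp only [compIso, hatL, hatR, idIso, Iso.trans_hom, whiskerLeftIso_hom, whiskerRightIso_hom,
    Iso.symm_hom, Iso.refl_hom, Iso.refl_inv]
  bicategory

theorem compIso_whiskerLeft {a b c : M} {af an : a ⟶ a} {bf : b ⟶ b} {cf cn : c ⟶ c}
    {f : a ⟶ b} {g g' : b ⟶ c} (t : af ≫ f ≫ 𝟙 b ≅ an ≫ f ≫ bf)
    (r : bf ≫ g ≫ cn ≅ 𝟙 b ≫ g ≫ cf) (r' : bf ≫ g' ≫ cn ≅ 𝟙 b ≫ g' ≫ cf) (θ : g ⟶ g')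
    (h : bf ◁ θ ▷ cn ≫ r'.hom = r.hom ≫ 𝟙 b ◁ θ ▷ cf) :
    af ◁ (f ◁ θ) ▷ cn ≫ (compIso (Iso.refl _) t r').hom =
      (compIso (Iso.refl _) t r).hom ≫ an ◁ (f ◁ θ) ▷ cf := by
  simp only [compIso, hatL, hatR, Iso.trans_hom, whiskerLeftIso_hom, whiskerRightIso_hom,
    Iso.symm_hom, Iso.refl_hom, Iso.refl_inv]
  calc
    _ = 𝟙 (af ≫ (f ≫ g) ≫ cn) ⊗≫ ((af ≫ f ≫ 𝟙 b) ◁ θ ▷ cn ≫ t.hom ▷ (g' ≫ cn)) ⊗≫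
        an ◁ f ◁ r'.hom ⊗≫ 𝟙 (an ≫ (f ≫ g') ≫ cf) := by bicategory
    _ = 𝟙 (af ≫ (f ≫ g) ≫ cn) ⊗≫ t.hom ▷ (g ≫ cn) ⊗≫
        an ◁ f ◁ (bf ◁ θ ▷ cn ≫ r'.hom) ⊗≫ 𝟙 (an ≫ (f ≫ g') ≫ cf) := by
      rw [whisker_exchange]; bicategory
    _ = _ := by rw [h]; bicategory

end Coherence

section Bicat

open Bicategory

variable {V : Type u'} [Category.{v'} V] [MonoidalCategory V]
variable {I : Type w} [Category.{w} I] [MonoidalCategory I] [EnrichedOrdinaryCategory V I]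
variable {M : Type u₂} [Bicategory.{w₂, v₂} M] [VCatCategory V M]

namespace EquivMor

variable {A B C D : IObj V I M}

@[ext]
theorem hom_ext {F G : EquivMor A B} {a b : F ⟶ G} (h : a.θ = b.θ) : a = b := Hom.ext h

/-- An equivariance structure seen from the side `s`, seen from the right side. -/
def flipτ {f : A.pt ⟶ B.pt} : (s : Side) →
    (∀ u : I, (A.actOn s.op).obj u ≫ f ≫ (B.actOn s).obj u ≅
      (A.actOn s).obj u ≫ f ≫ (B.actOn s.op).obj u) →
    ∀ u : I, (A.actOn .l).obj u ≫ f ≫ (B.actOn .r).obj u ≅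
      (A.actOn .r).obj u ≫ f ≫ (B.actOn .l).obj u
  | .r, τ => τ
  | .l, τ => fun u => (τ u).symm

/-- The equivariant morphism with underlying morphism `f` given by an equivariance structure seen
from the side `s`. -/
def mkSide (s : Side) (f : A.pt ⟶ B.pt)
    (τ : ∀ u : I, (A.actOn s.op).obj u ≫ f ≫ (B.actOn s).obj u ≅
      (A.actOn s).obj u ≫ f ≫ (B.actOn s.op).obj u) (h : IsEquivariant s f τ) : EquivMor A B where
  f := f
  τ := flipτ s τ
  equivariant := by
    cases s
    · exact h.flip_l
    · exact h

/-- In `mkSide` the underlying morphism is `f` by definition, whereas `ofSide` must first be split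
on the side. The bicategory is therefore built with `mkSide`, and this equality translates back to
the composition used in the statement. -/
theorem ofSide_eq_mkSide (s : Side) (f : A.pt ⟶ B.pt)
    (τ : ∀ u : I, (A.actOn s.op).obj u ≫ f ≫ (B.actOn s).obj u ≅
      (A.actOn s).obj u ≫ f ≫ (B.actOn s.op).obj u) (h : IsEquivariant s f τ) :
    ofSide s f τ h = mkSide s f τ h := by
  cases s <;> rfl

theorem mkSide_τs (s : Side) (f : A.pt ⟶ B.pt)
    (τ : ∀ u : I, (A.actOn s.op).obj u ≫ f ≫ (B.actOn s).obj u ≅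
      (A.actOn s).obj u ≫ f ≫ (B.actOn s.op).obj u) (h : IsEquivariant s f τ) (u : I) :
    (mkSide s f τ h).τs s u = τ u := by
  cases s <;> rfl

/-- The `2`-cell with underlying `2`-cell `θ`, whose equivariance is checked on the side `s`. -/
def homMk {F G : EquivMor A B} (s : Side) (θ : F.f ⟶ G.f)
    (h : ∀ u, (A.actOn s.op).obj u ◁ θ ▷ (B.actOn s).obj u ≫ (G.τs s u).hom =
      (F.τs s u).hom ≫ (A.actOn s).obj u ◁ θ ▷ (B.actOn s.op).obj u) : F ⟶ G where
  θ := θ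
  comm u := by
    cases s
    · exact comm_flip (h u)
    · exact h u

/-- The invertible `2`-cell with underlying `2`-cell `θ`, whose equivariance is checked on the side
`s`. -/
def isoMk {F G : EquivMor A B} (s : Side) (θ : F.f ≅ G.f)
    (h : ∀ u, (A.actOn s.op).obj u ◁ θ.hom ▷ (B.actOn s).obj u ≫ (G.τs s u).hom =
      (F.τs s u).hom ≫ (A.actOn s).obj u ◁ θ.hom ▷ (B.actOn s.op).obj u) : F ≅ G where
  hom := homMk s θ.hom h
  inv := homMk s θ.inv fun u => by
    have := h u
    rw [← cancel_epi ((A.actOn s.op).obj u ◁ θ.hom ▷ (B.actOn s).obj u), reassoc_of% this]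
    simp [← Bicategory.whiskerLeft_comp, ← comp_whiskerRight,
      ← Bicategory.whiskerLeft_comp_assoc]
  hom_inv_id := hom_ext θ.hom_inv_id
  inv_hom_id := hom_ext θ.inv_hom_id

/-- The composition of equivariant morphisms. -/
def cmp (F : EquivMor A B) (G : EquivMor B C) : EquivMor A C :=
  mkSide B.side.op (F.f ≫ G.f)
    (fun u => compIso (B.muteIso u) (F.τs B.side.op u) (G.τs B.side.op u))
    { nat := fun {u v} h => compIso_nat _ _ _ _ _ _ _ _ (B.mute_map h) _ _ _ _
        ((F.equivariant_s _).nat h) ((G.equivariant_s _).nat h)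
      tri := fun u v => compIso_tri _ _ _ _ _ _ _ _ _ _ _ _ _ (B.mute_mul u v) (B.mute_comm u v)
        (B.mute_comm v u) _ _ _ _ _ _ ((F.equivariant_s _).tri u v) ((G.equivariant_s _).tri u v)
      one := compIso_one _ _ _ (B.oneIso _) _ _ _ _
        (by have := (F.equivariant_s B.side.op).one; rwa [B.mute_one] at this)
        (by have := (G.equivariant_s B.side.op).one; rwa [B.mute_one_inv] at this) }

theorem comp_eq_cmp (F : EquivMor A B) (G : EquivMor B C) : F.comp G = F.cmp G :=
  ofSide_eq_mkSide _ _ _ _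

/-- The identity equivariant morphism. -/
def idm (A : IObj V I M) : EquivMor A A :=
  mkSide A.side.op (𝟙 A.pt) (fun u => idIso (A.commIso A.side.op u u))
    { nat := fun {u v} h => id_nat (A.muteIso u) (A.muteIso v) _ _ (A.mute_map h) _ _
        (A.mute_comm u u) (A.mute_comm v v)
      tri := fun u v => id_tri (A.muteIso _) (A.muteIso u) (A.muteIso v) _ _ _ _ _ _ _
        (A.mute_mul u v) (A.mute_comm v u) (A.mute_comm u v) (A.mute_comm _ _) (A.mute_comm u u)
        (A.mute_comm v v)
      one := by
        have := id_one (A.muteIso (tunit I)) (A.oneIso A.side.op.op) _ (A.mute_comm _ _)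
        rw [← A.mute_one, ← A.mute_one_inv] at this
        exact this }

theorem id_eq_idm (A : IObj V I M) : EquivMor.id A = idm A := ofSide_eq_mkSide _ _ _ _

/-- The associativity of the composition of equivariant morphisms. -/
def assocIso (F : EquivMor A B) (G : EquivMor B C) (H : EquivMor C D) :
    (F.cmp G).cmp H ≅ F.cmp (G.cmp H) := by
  refine isoMk B.side.op (α_ F.f G.f H.f) fun u => ?_
  -- The four combinations of sides of the two middle objects: equal sides in the first and last
  -- case, opposite sides in the other two.
  rcases B with ⟨_, _ | _, _⟩ <;> rcases C with ⟨_, _ | _, _⟩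
  · exact compIso_assoc (F.τs .r u) (G.τs .r u) (H.τs .r u)
  · exact compIso_assoc_op (F.τs .r u) (G.τs .r u) (H.τs .r u)
  · exact compIso_assoc_op (F.τs .l u) (G.τs .l u) (H.τs .l u)
  · exact compIso_assoc (F.τs .l u) (G.τs .l u) (H.τs .l u)

/-- The left unit law of the composition of equivariant morphisms. -/
def leftUnitIso (F : EquivMor A B) : (idm A).cmp F ≅ F := by
  refine isoMk A.side.op (λ_ F.f) fun u => ?_
  rcases A with ⟨_, _ | _, _⟩ <;> exact compIso_id _

/-- The right unit law of the composition of equivariant morphisms. -/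
def rightUnitIso (F : EquivMor A B) : F.cmp (idm B) ≅ F := by
  refine isoMk B.side.op (ρ_ F.f) fun u => ?_
  rcases B with ⟨_, _ | _, _⟩ <;> exact id_compIso _

/-- The left whiskering of a `2`-cell. -/
def whiskL (F : EquivMor A B) {G G' : EquivMor B C} (a : G ⟶ G') : F.cmp G ⟶ F.cmp G' :=
  homMk B.side.op (F.f ◁ a.θ) fun u => by
    have := Hom.comm_s a B.side.op u
    rcases B with ⟨_, _ | _, _⟩ <;> exact compIso_whiskerLeft _ _ _ _ this

/-- The right whiskering of a `2`-cell. -/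
def whiskR {F F' : EquivMor A B} (a : F ⟶ F') (G : EquivMor B C) : F.cmp G ⟶ F'.cmp G :=
  homMk B.side.op (a.θ ▷ G.f) fun u => by
    have := Hom.comm_s a B.side.op u
    rcases B with ⟨_, _ | _, _⟩ <;> exact compIso_whisker _ _ _ _ _ this

end EquivMor

/-- The bicategory of `I`-objects and equivariant morphisms. -/
instance : Bicategory (IObj V I M) where
  Hom := EquivMor
  id := EquivMor.idm
  comp := EquivMor.cmp
  homCategory _ _ := inferInstance
  whiskerLeft F _ _ a := EquivMor.whiskL F a
  whiskerRight a G := EquivMor.whiskR a G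
  associator := EquivMor.assocIso
  leftUnitor := EquivMor.leftUnitIso
  rightUnitor := EquivMor.rightUnitIso
  -- A 2-cell is determined by its underlying 2-cell, and composition, whiskering and structure
  -- isomorphisms lie over those of `M`; so each axiom is the same axiom in `M`.
  whiskerLeft_id _ _ := EquivMor.hom_ext (Bicategory.whiskerLeft_id _ _)
  whiskerLeft_comp _ _ _ _ _ _ := EquivMor.hom_ext (Bicategory.whiskerLeft_comp _ _ _)
  id_whiskerLeft _ := EquivMor.hom_ext (Bicategory.id_whiskerLeft _)
  comp_whiskerLeft _ _ _ _ _ := EquivMor.hom_ext (Bicategory.comp_whiskerLeft _ _ _)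
  id_whiskerRight _ _ := EquivMor.hom_ext (Bicategory.id_whiskerRight _ _)
  comp_whiskerRight _ _ _ := EquivMor.hom_ext (Bicategory.comp_whiskerRight _ _ _)
  whiskerRight_id _ := EquivMor.hom_ext (Bicategory.whiskerRight_id _)
  whiskerRight_comp _ _ _ := EquivMor.hom_ext (Bicategory.whiskerRight_comp _ _ _)
  whisker_assoc _ _ _ _ _ := EquivMor.hom_ext (Bicategory.whisker_assoc _ _ _)
  whisker_exchange _ _ := EquivMor.hom_ext (Bicategory.whisker_exchange _ _)
  pentagon _ _ _ _ := EquivMor.hom_ext (Bicategory.pentagon _ _ _ _)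
  triangle _ _ := EquivMor.hom_ext (Bicategory.triangle _ _)

end Bicat

/-! ### The enrichment of the bicategory of `I`-objects, and transport along equivalences. -/

section Bicat

open Bicategory

variable {V : Type u'} [Category.{v'} V] [MonoidalCategory V]
variable {I : Type w} [Category.{w} I] [MonoidalCategory I] [EnrichedOrdinaryCategory V I]
variable {M : Type u₂} [Bicategory.{w₂, v₂} M] [VCatCategory V M]

/-- Links the functor in the definition of a stabilization to postcomposition in the bicategory of
`I`-objects, where the general lemmas on equivalences apply. -/
theorem EquivMor.postcompFunctor_eq (A : IObj V I M) {B C : IObj V I M} (G : B ⟶ C) :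
    EquivMor.postcompFunctor A G = (postcomp A G : (A ⟶ B) ⥤ (A ⟶ C)) := by
  rcases B with ⟨_, _ | _, _⟩ <;> rfl

section

variable {C : Type u₁} [Category.{v₁} C] [EnrichedOrdinaryCategory V C] {X Y : C}

theorem VRep.whiskerLeft {a b c : M} {g h : b ⟶ c} {φ : (X ⟶ Y) → (g ⟶ h)} (hφ : VRep V φ)
    (f : a ⟶ b) : VRep V (fun x => f ◁ φ x) := by
  obtain ⟨m, hm⟩ := hφ
  exact ⟨m ≫ eWhiskerL V f g h, fun x => by rw [← Category.assoc, hm, eHomEquiv_eWhiskerL]⟩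

theorem VRep.whiskerRight {a b c : M} {g h : a ⟶ b} {φ : (X ⟶ Y) → (g ⟶ h)} (hφ : VRep V φ)
    (f : b ⟶ c) : VRep V (fun x => φ x ▷ f) := by
  obtain ⟨m, hm⟩ := hφ
  exact ⟨m ≫ eWhiskerR V g h f, fun x => by rw [← Category.assoc, hm, eHomEquiv_eWhiskerR]⟩

end

section Transport

variable {K : Type u₁} [Bicategory.{v₃, v₁} K] [VCatCategory V K]

variable {A B C D : K}

theorem isVEquivalence_precomp {P : A ⟶ B} {Q : B ⟶ A} (e : P ≫ Q ≅ 𝟙 A) (e' : Q ≫ P ≅ 𝟙 B)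
    (C : K) : IsVEquivalence V (precomp C P : (B ⟶ C) ⥤ (A ⟶ C)) :=
  ⟨VCatCategory.precomp C P, precomp C Q, VCatCategory.precomp C Q,
    ⟨NatIso.ofComponents (fun (H : B ⟶ C) => (α_ Q P H).symm ≪≫ whiskerRightIso e' H ≪≫ λ_ H)
      (fun {H H'} (a : H ⟶ H') => by
        change Q ◁ P ◁ a ≫ (α_ Q P H').inv ≫ e'.hom ▷ H' ≫ (λ_ H').hom =
          ((α_ Q P H).inv ≫ e'.hom ▷ H ≫ (λ_ H).hom) ≫ a
        have := whisker_exchange e'.hom a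
        simp only [Category.assoc, ← leftUnitor_naturality, ← reassoc_of% this]
        simp)⟩,
    ⟨NatIso.ofComponents (fun (H : A ⟶ C) => (α_ P Q H).symm ≪≫ whiskerRightIso e H ≪≫ λ_ H)
      (fun {H H'} (a : H ⟶ H') => by
        change P ◁ Q ◁ a ≫ (α_ P Q H').inv ≫ e.hom ▷ H' ≫ (λ_ H').hom =
          ((α_ P Q H).inv ≫ e.hom ▷ H ≫ (λ_ H).hom) ≫ a
        have := whisker_exchange e.hom a
        simp only [Category.assoc, ← leftUnitor_naturality, ← reassoc_of% this]
        simp)⟩⟩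

/-- The postcomposition with `R` commutes with the precomposition with an equivalence `P`. -/
theorem isVEquivalence_postcomp_of_equiv [MonoidalClosed V] [IsBase V] {P : A ⟶ B} {Q : B ⟶ A}
    (e : P ≫ Q ≅ 𝟙 A)
    (e' : Q ≫ P ≅ 𝟙 B) (R : C ⟶ D)
    (h : IsVEquivalence V (postcomp B R : (B ⟶ C) ⥤ (B ⟶ D))) :
    IsVEquivalence V (postcomp A R : (A ⟶ C) ⥤ (A ⟶ D)) := by
  -- Precomposition with `Q` is an equivalence and commutes with postcomposition with `R` up to the
  -- associator, so it can be cancelled.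
  refine IsVEquivalence.of_comp (VCatCategory.postcomp A R)
    (isVEquivalence_precomp (P := Q) (Q := P) e' e D) ?_
  refine ((isVEquivalence_precomp (P := Q) (Q := P) e' e C).comp h).of_iso
    (NatIso.ofComponents (fun (H : A ⟶ C) => α_ Q H R) (fun {H H'} (a : H ⟶ H') => ?_))
  change (Q ◁ a) ▷ R ≫ (α_ Q H' R).hom = (α_ Q H R).hom ≫ Q ◁ a ▷ R
  simp

end Transport

variable [MonoidalClosed V] [HasLimitsOfSize.{w, w} V] [IsBase V]
variable {C : Type u₁} [Category.{v₁} C] [EnrichedOrdinaryCategory V C] {X Y : C}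

namespace EquivMor

variable {A B : IObj V I M}

theorem vrep_θ (F G : EquivMor A B) : VRep V (fun a : F ⟶ G => a.θ) :=
  (presentation A B).vrep_map ⟨⟩ F G

theorem vrep_of {F G : EquivMor A B} {φ : (X ⟶ Y) → (F ⟶ G)} (h : VRep V (fun x => (φ x).θ)) :
    VRep V φ :=
  (presentation A B).vrep_of φ fun _ => h

end EquivMor

namespace Wedge

variable {s : Side} {A : IObj V I M} {Z : M}

theorem vrep_of {F G : Wedge V s A Z} {φ : (X ⟶ Y) → (F ⟶ G)}
    (h : ∀ v, VRep V (fun x => (φ x).θ.app v)) : VRep V φ :=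
  (presentation s A Z).vrep_of φ h

end Wedge

namespace TowerCone

variable {S : ℕ → M} {t : ∀ n, S (n + 1) ⟶ S n} {Z : M}

theorem vrep_θ (F G : TowerCone S t Z) (n : ℕ) :
    VRep V (fun a : F ⟶ G => TowerCone.Hom.θ a n) :=
  (presentation.{w} Z).vrep_map ⟨n⟩ F G

theorem vrep_of {F G : TowerCone S t Z} {φ : (X ⟶ Y) → (F ⟶ G)}
    (h : ∀ n, VRep V (fun x => TowerCone.Hom.θ (φ x) n)) : VRep V φ :=
  (presentation.{w} Z).vrep_of φ fun n => h n.down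

end TowerCone

instance (A B : IObj V I M) : EnrichedOrdinaryCategory V (A ⟶ B) :=
  inferInstanceAs (EnrichedOrdinaryCategory V (EquivMor A B))

/-- The category of `I`-objects is enriched in `V`-categories. -/
instance : VCatCategory V (IObj V I M) where
  enr _ _ := inferInstance
  precomp _ P := isVFunctor_of_vrep fun F G =>
    EquivMor.vrep_of ((EquivMor.vrep_θ F G).whiskerLeft (EquivMor.f P))
  postcomp _ _ _ P := isVFunctor_of_vrep fun F G =>
    EquivMor.vrep_of ((EquivMor.vrep_θ F G).whiskerRight (EquivMor.f P))

end Bicat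

/-! ### Equivariant morphisms seen from the side of the action of the source -/

section Coherence

open Bicategory

variable {M : Type u₂} [Bicategory.{w₂, v₂} M]

/-- The equivariance cell `τ` with the trivial factor `bn` of its source removed. -/
def srcIso {a b : M} {bf bn : b ⟶ b} {f n : a ⟶ a} {p : b ⟶ a} (ν : bn ≅ 𝟙 b)
    (τ : bn ≫ p ≫ n ≅ bf ≫ p ≫ f) : p ≫ n ≅ bf ≫ p ≫ f :=
  (λ_ (p ≫ n)).symm ≪≫ whiskerRightIso ν.symm (p ≫ n) ≪≫ τ

/-- The pasting of the cells `srcIso`. -/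
def srcPaste {a b : M} {bf bf₁ bf₂ : b ⟶ b} {f f₁ f₂ n n₁ n₂ : a ⟶ a} {p : b ⟶ a}
    (mB : bf ≅ bf₁ ≫ bf₂) (mA' : f ≅ f₂ ≫ f₁) (mA : n ≅ n₁ ≫ n₂)
    (cA : f₁ ≫ n₂ ≅ n₂ ≫ f₁) (t₁ : p ≫ n₁ ⟶ bf₁ ≫ p ≫ f₁) (t₂ : p ≫ n₂ ⟶ bf₂ ≫ p ≫ f₂) :
    p ≫ n ⟶ bf ≫ p ≫ f :=
  p ◁ mA.hom ⊗≫ t₁ ▷ n₂ ⊗≫ (bf₁ ≫ p) ◁ cA.hom ⊗≫ bf₁ ◁ t₂ ▷ f₁ ⊗≫ (bf₁ ≫ bf₂) ◁ p ◁ mA'.inv ≫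
    mB.inv ▷ (p ≫ f)

/-- With the trivial action of the source erased, `triPaste` and `srcPaste` differ only by unitors.
This and the next three lemmas translate the axioms of an equivariance cell and of a 2-cell into the
form without the mute factor, in both directions because unitors are invertible. -/
theorem srcIso_tri {a b : M} {bf bf₁ bf₂ : b ⟶ b} {f f₁ f₂ n n₁ n₂ : a ⟶ a} {p : b ⟶ a}
    (mB : bf ≅ bf₁ ≫ bf₂) (mA' : f ≅ f₂ ≫ f₁) (mA : n ≅ n₁ ≫ n₂)
    (cA : f₁ ≫ n₂ ≅ n₂ ≫ f₁) (τ : 𝟙 b ≫ p ≫ n ≅ bf ≫ p ≫ f)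
    (τ₁ : 𝟙 b ≫ p ≫ n₁ ≅ bf₁ ≫ p ≫ f₁) (τ₂ : 𝟙 b ≫ p ≫ n₂ ≅ bf₂ ≫ p ≫ f₂) :
    τ.hom = triPaste (λ_ _).symm mB mA' mA (λ_ _ ≪≫ (ρ_ _).symm) cA τ₁.hom τ₂.hom ↔
      (srcIso (Iso.refl _) τ).hom = srcPaste mB mA' mA cA (srcIso (Iso.refl _) τ₁).hom
        (srcIso (Iso.refl _) τ₂).hom := by
  rw [← cancel_epi (λ_ (p ≫ n)).inv]
  simp only [srcIso, srcPaste, triPaste, Iso.trans_hom, Iso.symm_hom, whiskerRightIso_hom,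
    Iso.refl_inv, id_whiskerRight, Category.id_comp]
  refine Eq.congr_right ?_
  bicategory

theorem srcIso_nat {a b : M} {bf bf' : b ⟶ b} {f f' n n' : a ⟶ a} {p : b ⟶ a}
    (hb : bf ⟶ bf') (hf : f ⟶ f') (hn : n ⟶ n')
    (τ : 𝟙 b ≫ p ≫ n ≅ bf ≫ p ≫ f) (τ' : 𝟙 b ≫ p ≫ n' ≅ bf' ≫ p ≫ f') :
    𝟙 (𝟙 b) ▷ (p ≫ n) ≫ 𝟙 b ◁ p ◁ hn ≫ τ'.hom = τ.hom ≫ hb ▷ (p ≫ f) ≫ bf' ◁ p ◁ hf ↔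
      p ◁ hn ≫ (srcIso (Iso.refl _) τ').hom =
        (srcIso (Iso.refl _) τ).hom ≫ hb ▷ (p ≫ f) ≫ bf' ◁ p ◁ hf := by
  rw [← cancel_epi (λ_ (p ≫ n)).inv]
  simp only [srcIso, Iso.trans_hom, Iso.symm_hom, whiskerRightIso_hom, Iso.refl_inv,
    id_whiskerRight, Category.id_comp]
  simp

theorem srcIso_one {a b : M} {bf : b ⟶ b} {f n : a ⟶ a} {p : b ⟶ a}
    (b0 : bf ≅ 𝟙 b) (f0 : f ≅ 𝟙 a) (n0 : n ≅ 𝟙 a) (τ : 𝟙 b ≫ p ≫ n ≅ bf ≫ p ≫ f) :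
    τ.hom = 𝟙 (𝟙 b) ▷ (p ≫ n) ≫ 𝟙 b ◁ p ◁ n0.hom ≫ 𝟙 b ◁ p ◁ f0.inv ≫ b0.inv ▷ (p ≫ f) ↔
      (srcIso (Iso.refl _) τ).hom = p ◁ n0.hom ≫ p ◁ f0.inv ≫ (λ_ (p ≫ f)).inv ≫
        b0.inv ▷ (p ≫ f) := by
  rw [← cancel_epi (λ_ (p ≫ n)).inv]
  simp only [srcIso, Iso.trans_hom, Iso.symm_hom, whiskerRightIso_hom, Iso.refl_inv,
    id_whiskerRight, Category.id_comp]
  simp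

theorem srcIso_comm {a b : M} {bf : b ⟶ b} {f n : a ⟶ a} {p p' : b ⟶ a} (θ : p ⟶ p')
    (τ : 𝟙 b ≫ p ≫ n ≅ bf ≫ p ≫ f) (τ' : 𝟙 b ≫ p' ≫ n ≅ bf ≫ p' ≫ f) :
    𝟙 b ◁ θ ▷ n ≫ τ'.hom = τ.hom ≫ bf ◁ θ ▷ f ↔
      θ ▷ n ≫ (srcIso (Iso.refl _) τ').hom = (srcIso (Iso.refl _) τ).hom ≫ bf ◁ θ ▷ f := by
  rw [← cancel_epi (λ_ (p ≫ n)).inv]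
  simp only [srcIso, Iso.trans_hom, Iso.symm_hom, whiskerRightIso_hom, Iso.refl_inv,
    id_whiskerRight, Category.id_comp]
  simp

end Coherence

section Bicat

open Bicategory

variable {V : Type u'} [Category.{v'} V] [MonoidalCategory V]
variable {I : Type w} [Category.{w} I] [MonoidalCategory I] [EnrichedOrdinaryCategory V I]
variable {M : Type u₂} [Bicategory.{w₂, v₂} M] [VCatCategory V M]

namespace IObj

variable (X : IObj V I M)

/-- The action of `X` on its side. -/
abbrev act' : I ⥤ (X.pt ⟶ X.pt) := X.actOn X.side

/-- The multiplicativity of the action. -/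
abbrev μ (u v : I) : X.act'.obj (X.side.mul u v) ≅ X.act'.obj u ≫ X.act'.obj v :=
  X.mulIso X.side u v

/-- The unitality of the action. -/
abbrev η : X.act'.obj (tunit I) ≅ 𝟙 X.pt := X.oneIso X.side

theorem isVFunctor_act' : IsVFunctor V X.act' := by
  rcases X with ⟨_, _ | _, S⟩ <;> exact S.isVFunctor

theorem μ_nat {u u' v v' : I} (f : u ⟶ u') (g : v ⟶ v') :
    X.act'.map (X.side.mulMap f g) ≫ (X.μ u' v').hom =
      (X.μ u v).hom ≫ X.act'.map f ▷ X.act'.obj v ≫ X.act'.obj u' ◁ X.act'.map g := by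
  rcases X with ⟨_, _ | _, S⟩ <;>
  · change S.F.map _ ≫ eqToHom (S.mul u' v') =
      eqToHom (S.mul u v) ≫ S.F.map f ▷ S.F.obj v ≫ S.F.obj u' ◁ S.F.map g
    rw [S.mul_map]
    simp

section Strict

variable [Bicategory.Strict M] [IsStrictMonoidal I]

/-- Since `I` and `M` are strict, all cells involved here and in the two unit laws below are
`eqToHom`s, and parallel `eqToHom`s agree. -/
theorem μ_assoc (u v w : I) :
    X.act'.map (X.side.assoc u v w).hom ≫ (X.μ u (X.side.mul v w)).hom ≫
        X.act'.obj u ◁ (X.μ v w).hom =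
      (X.μ (X.side.mul u v) w).hom ≫ (X.μ u v).hom ▷ X.act'.obj w ≫ (α_ _ _ _).hom := by
  rcases X with ⟨_, _ | _, S⟩
  · simp [μ, act', IObj.mulIso, IsStrictMonoidal.associator_eq, eqToHom_map,
      Bicategory.Strict.associator_eqToIso]
  · simp [μ, act', IObj.mulIso, IsStrictMonoidal.associator_eq, eqToHom_map,
      Bicategory.Strict.associator_eqToIso]

theorem μ_one_mul (u : I) :
    X.act'.map (X.side.one_mul u).hom = (X.μ (tunit I) u).hom ≫ X.η.hom ▷ X.act'.obj u ≫
      (λ_ _).hom := by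
  rcases X with ⟨_, _ | _, S⟩
  · simp [μ, act', η, IObj.mulIso, IsStrictMonoidal.rightUnitor_eq, eqToHom_map,
      Bicategory.Strict.leftUnitor_eqToIso]
  · simp [μ, act', η, IObj.mulIso, IsStrictMonoidal.leftUnitor_eq, eqToHom_map,
      Bicategory.Strict.leftUnitor_eqToIso]

theorem μ_mul_one (u : I) :
    X.act'.map (X.side.mul_one u).hom = (X.μ u (tunit I)).hom ≫ X.act'.obj u ◁ X.η.hom ≫
      (ρ_ _).hom := by
  rcases X with ⟨_, _ | _, S⟩
  · simp [μ, act', η, IObj.mulIso, IsStrictMonoidal.leftUnitor_eq, eqToHom_map,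
      Bicategory.Strict.rightUnitor_eqToIso]
  · simp [μ, act', η, IObj.mulIso, IsStrictMonoidal.rightUnitor_eq, eqToHom_map,
      Bicategory.Strict.rightUnitor_eqToIso]

end Strict

end IObj

namespace EquivMor

variable {A B : IObj V I M}

/-- The equivariance structure, seen from the side of the action of the source. -/
def t (F : EquivMor B A) (u : I) :
    F.f ≫ (A.actOn B.side).obj u ≅ B.act'.obj u ≫ F.f ≫ (A.actOn B.side.op).obj u :=
  srcIso (B.muteIso u) (F.τs B.side u)

theorem t_nat (F : EquivMor B A) {u v : I} (h : u ⟶ v) :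
    F.f ◁ (A.actOn B.side).map h ≫ (F.t v).hom = (F.t u).hom ≫
      B.act'.map h ▷ (F.f ≫ (A.actOn B.side.op).obj u) ≫
        B.act'.obj v ◁ F.f ◁ (A.actOn B.side.op).map h := by
  have := (F.equivariant_s B.side).nat h
  rcases B with ⟨_, _ | _, _⟩ <;> exact (srcIso_nat _ _ _ _ _).1 this

theorem t_tri (F : EquivMor B A) (u v : I) :
    (F.t (B.side.mul u v)).hom = srcPaste (B.μ u v) (A.mulIso' B.side u v) (A.mulIso B.side u v)
      (A.commIso B.side u v) (F.t u).hom (F.t v).hom := by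
  have := (F.equivariant_s B.side).tri u v
  rcases B with ⟨_, _ | _, _⟩ <;> exact (srcIso_tri _ _ _ _ _ _ _).1 this

theorem t_one (F : EquivMor B A) :
    (F.t (tunit I)).hom = F.f ◁ (A.oneIso B.side).hom ≫ F.f ◁ (A.oneIso B.side.op).inv ≫
      (λ_ _).inv ≫ B.η.inv ▷ (F.f ≫ (A.actOn B.side.op).obj (tunit I)) := by
  have := (F.equivariant_s B.side).one
  rcases B with ⟨_, _ | _, _⟩ <;> exact (srcIso_one _ _ _ _).1 this

theorem Hom.comm_t {F G : EquivMor B A} (a : F ⟶ G) (u : I) :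
    a.θ ▷ (A.actOn B.side).obj u ≫ (G.t u).hom =
      (F.t u).hom ≫ B.act'.obj u ◁ a.θ ▷ (A.actOn B.side.op).obj u := by
  have := a.comm_s B.side u
  rcases B with ⟨_, _ | _, _⟩ <;> exact (srcIso_comm _ _ _).1 this

/-- The converse of `Hom.comm_t`: a 2-cell compatible with the reduced cells `t` satisfies the
condition required by `homMk` and `isoMk` on the side of the source. -/
theorem comm_of_t {F G : EquivMor B A} (θ : F.f ⟶ G.f)
    (h : ∀ u, θ ▷ (A.actOn B.side).obj u ≫ (G.t u).hom =
      (F.t u).hom ≫ B.act'.obj u ◁ θ ▷ (A.actOn B.side.op).obj u) (u : I) :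
    (B.actOn B.side.op).obj u ◁ θ ▷ (A.actOn B.side).obj u ≫ (G.τs B.side u).hom =
      (F.τs B.side u).hom ≫ (B.actOn B.side).obj u ◁ θ ▷ (A.actOn B.side.op).obj u := by
  have := h u
  rcases B with ⟨_, _ | _, _⟩ <;> exact (srcIso_comm _ _ _).2 this

/-- The equivariance structure with the trivial factor added back. -/
def τOfT {f : B.pt ⟶ A.pt}
    (t : ∀ u, f ≫ (A.actOn B.side).obj u ≅ B.act'.obj u ≫ f ≫ (A.actOn B.side.op).obj u) (u : I) :
    (B.actOn B.side.op).obj u ≫ f ≫ (A.actOn B.side).obj u ≅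
      (B.actOn B.side).obj u ≫ f ≫ (A.actOn B.side.op).obj u :=
  whiskerRightIso (B.muteIso u) _ ≪≫ λ_ _ ≪≫ t u

theorem srcIso_τOfT {f : B.pt ⟶ A.pt}
    (t : ∀ u, f ≫ (A.actOn B.side).obj u ≅ B.act'.obj u ≫ f ≫ (A.actOn B.side.op).obj u) (u : I) :
    srcIso (B.muteIso u) (τOfT t u) = t u := by
  ext
  simp [srcIso, τOfT]

/-- The equivariant morphism given by an equivariance structure seen from the side of the action of
the source. -/
def ofT (f : B.pt ⟶ A.pt)
    (t : ∀ u, f ≫ (A.actOn B.side).obj u ≅ B.act'.obj u ≫ f ≫ (A.actOn B.side.op).obj u)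
    (nat : ∀ {u v : I} (h : u ⟶ v), f ◁ (A.actOn B.side).map h ≫ (t v).hom = (t u).hom ≫
      B.act'.map h ▷ (f ≫ (A.actOn B.side.op).obj u) ≫
        B.act'.obj v ◁ f ◁ (A.actOn B.side.op).map h)
    (tri : ∀ u v : I, (t (B.side.mul u v)).hom =
      srcPaste (B.μ u v) (A.mulIso' B.side u v) (A.mulIso B.side u v)
        (A.commIso B.side u v) (t u).hom (t v).hom)
    (one : (t (tunit I)).hom = f ◁ (A.oneIso B.side).hom ≫ f ◁ (A.oneIso B.side.op).inv ≫
      (λ_ _).inv ≫ B.η.inv ▷ (f ≫ (A.actOn B.side.op).obj (tunit I))) : EquivMor B A :=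
  mkSide B.side f (τOfT t)
    { nat := fun {u v} h => by
        have := nat h
        rw [← srcIso_τOfT t, ← srcIso_τOfT t] at this
        rcases B with ⟨_, _ | _, _⟩ <;> exact (srcIso_nat _ _ _ _ _).2 this
      tri := fun u v => by
        have := tri u v
        rw [← srcIso_τOfT t, ← srcIso_τOfT t, ← srcIso_τOfT t] at this
        rcases B with ⟨_, _ | _, _⟩ <;> exact (srcIso_tri _ _ _ _ _ _ _).2 this
      one := by
        have := one
        rw [← srcIso_τOfT t] at this
        rcases B with ⟨_, _ | _, _⟩ <;> exact (srcIso_one _ _ _ _).2 this }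

theorem ofT_t (f : B.pt ⟶ A.pt)
    (t : ∀ u, f ≫ (A.actOn B.side).obj u ≅ B.act'.obj u ≫ f ≫ (A.actOn B.side.op).obj u) (nat)
    (tri) (one) (u : I) : (ofT f t nat tri one).t u = t u :=
  (congrArg (srcIso (B.muteIso u)) (mkSide_τs _ _ _ _ u)).trans (srcIso_τOfT t u)

end EquivMor

end Bicat

/-! ### The wedge of an equivariant morphism -/

section Coherence

open Bicategory

variable {M : Type u₂} [Bicategory.{w₂, v₂} M]

/-- The wedge cell given by an equivariance cell. -/
def phiIso {a b : M} {bu bv bvu : b ⟶ b} {m n : a ⟶ a} {f : b ⟶ a}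
    (t : f ≫ n ≅ bu ≫ f ≫ m) (μ : bvu ≅ bv ≫ bu) : (bv ≫ f) ≫ n ≅ (bvu ≫ f) ≫ m :=
  α_ bv f n ≪≫ whiskerLeftIso bv t ≪≫ (α_ bv bu (f ≫ m)).symm ≪≫
    whiskerRightIso μ.symm (f ≫ m) ≪≫ (α_ bvu f m).symm

theorem phi_nat_obj {a b : M} {bu bv bvu bv' bvu' : b ⟶ b} {m n : a ⟶ a} {f : b ⟶ a}
    (t : f ≫ n ≅ bu ≫ f ≫ m) (μ : bvu ≅ bv ≫ bu) (μ' : bvu' ≅ bv' ≫ bu) (x : bv ⟶ bv')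
    (y : bvu ⟶ bvu') (h : y ≫ μ'.hom = μ.hom ≫ x ▷ bu) :
    (x ▷ f) ▷ n ≫ (phiIso t μ').hom = (phiIso t μ).hom ≫ (y ▷ f) ▷ m := by
  have h' : x ▷ bu ≫ μ'.inv = μ.inv ≫ y := by
    rw [Iso.comp_inv_eq, Category.assoc, h, Iso.inv_hom_id_assoc]
  simp only [phiIso, Iso.trans_hom, whiskerLeftIso_hom, Iso.symm_hom, whiskerRightIso_hom]
  calc
    _ = 𝟙 ((bv ≫ f) ≫ n) ⊗≫ (x ▷ (f ≫ n) ≫ bv' ◁ t.hom) ⊗≫ μ'.inv ▷ (f ≫ m) ⊗≫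
        𝟙 ((bvu' ≫ f) ≫ m) := by bicategory
    _ = 𝟙 ((bv ≫ f) ≫ n) ⊗≫ bv ◁ t.hom ⊗≫ (x ▷ bu ≫ μ'.inv) ▷ (f ≫ m) ⊗≫
        𝟙 ((bvu' ≫ f) ≫ m) := by rw [← whisker_exchange]; bicategory
    _ = _ := by rw [h']; bicategory

/-- Naturality in the index that acts on the target: `ht` moves the 2-cell through `t`, and
naturality of `μ` then carries it through the regrouping of the product. -/
theorem phi_nat {a b : M} {bu bu' bv bvu bvu' : b ⟶ b} {m n m' n' : a ⟶ a} {f : b ⟶ a}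
    (t : f ≫ n ≅ bu ≫ f ≫ m) (t' : f ≫ n' ≅ bu' ≫ f ≫ m') (μ : bvu ≅ bv ≫ bu)
    (μ' : bvu' ≅ bv ≫ bu') (hn : n ⟶ n') (hm : m ⟶ m') (hb : bu ⟶ bu')
    (y : bvu ⟶ bvu') (h : y ≫ μ'.hom = μ.hom ≫ bv ◁ hb)
    (ht : f ◁ hn ≫ t'.hom = t.hom ≫ hb ▷ (f ≫ m) ≫ bu' ◁ f ◁ hm) :
    (bv ≫ f) ◁ hn ≫ (phiIso t' μ').hom =
      (phiIso t μ).hom ≫ (y ▷ f) ▷ m ≫ (bvu' ≫ f) ◁ hm := by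
  have h' : bv ◁ hb ≫ μ'.inv = μ.inv ≫ y := by
    rw [Iso.comp_inv_eq, Category.assoc, h, Iso.inv_hom_id_assoc]
  simp only [phiIso, Iso.trans_hom, whiskerLeftIso_hom, Iso.symm_hom, whiskerRightIso_hom]
  calc
    _ = 𝟙 ((bv ≫ f) ≫ n) ⊗≫ bv ◁ (f ◁ hn ≫ t'.hom) ⊗≫ μ'.inv ▷ (f ≫ m') ⊗≫
        𝟙 ((bvu' ≫ f) ≫ m') := by bicategory
    _ = 𝟙 ((bv ≫ f) ≫ n) ⊗≫ bv ◁ t.hom ⊗≫ bv ◁ hb ▷ (f ≫ m) ⊗≫ ((bv ≫ bu') ◁ f ◁ hm ≫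
        μ'.inv ▷ (f ≫ m')) ⊗≫ 𝟙 ((bvu' ≫ f) ≫ m') := by rw [ht]; bicategory
    _ = 𝟙 ((bv ≫ f) ≫ n) ⊗≫ bv ◁ t.hom ⊗≫ (bv ◁ hb ≫ μ'.inv) ▷ (f ≫ m) ⊗≫ bvu' ◁ f ◁ hm ⊗≫
        𝟙 ((bvu' ≫ f) ≫ m') := by rw [whisker_exchange]; bicategory
    _ = _ := by rw [h']; bicategory

theorem phi_map {a b : M} {bu bv bvu : b ⟶ b} {m n : a ⟶ a} {f f' : b ⟶ a}
    (t : f ≫ n ≅ bu ≫ f ≫ m) (t' : f' ≫ n ≅ bu ≫ f' ≫ m) (μ : bvu ≅ bv ≫ bu) (θ : f ⟶ f')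
    (h : θ ▷ n ≫ t'.hom = t.hom ≫ bu ◁ θ ▷ m) :
    (bv ◁ θ) ▷ n ≫ (phiIso t' μ).hom = (phiIso t μ).hom ≫ (bvu ◁ θ) ▷ m := by
  simp only [phiIso, Iso.trans_hom, whiskerLeftIso_hom, Iso.symm_hom, whiskerRightIso_hom]
  calc
    _ = 𝟙 ((bv ≫ f) ≫ n) ⊗≫ bv ◁ (θ ▷ n ≫ t'.hom) ⊗≫ μ.inv ▷ (f' ≫ m) ⊗≫
        𝟙 ((bvu ≫ f') ≫ m) := by bicategory
    _ = 𝟙 ((bv ≫ f) ≫ n) ⊗≫ bv ◁ t.hom ⊗≫ ((bv ≫ bu) ◁ θ ▷ m ≫ μ.inv ▷ (f' ≫ m)) ⊗≫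
        𝟙 ((bvu ≫ f') ≫ m) := by rw [h]; bicategory
    _ = _ := by rw [whisker_exchange]; bicategory

theorem phi_one {a b : M} {bu bv bvu : b ⟶ b} {m n : a ⟶ a} {f : b ⟶ a}
    (t : f ≫ n ≅ bu ≫ f ≫ m) (μ : bvu ≅ bv ≫ bu) (n0 : n ≅ 𝟙 a) (m0 : m ≅ 𝟙 a) (η : bu ≅ 𝟙 b)
    (x : bvu ≅ bv) (hx : x.hom = μ.hom ≫ bv ◁ η.hom ≫ (ρ_ bv).hom)
    (ht : t.hom = f ◁ n0.hom ≫ f ◁ m0.inv ≫ (λ_ _).inv ≫ η.inv ▷ (f ≫ m)) :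
    (phiIso t μ).hom = (bv ≫ f) ◁ n0.hom ≫ (x.inv ▷ f) ▷ 𝟙 a ≫ (bvu ≫ f) ◁ m0.inv := by
  have hx' : x.inv = (ρ_ bv).inv ≫ bv ◁ η.inv ≫ μ.inv := by
    rw [← cancel_epi x.hom, Iso.hom_inv_id, hx]; simp
  simp only [phiIso, Iso.trans_hom, whiskerLeftIso_hom, Iso.symm_hom, whiskerRightIso_hom, ht, hx']
  calc
    _ = (bv ≫ f) ◁ n0.hom ⊗≫ (bv ◁ f ◁ m0.inv ⊗≫ (bv ◁ η.inv ≫ μ.inv) ▷ (f ≫ m)) ⊗≫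
      𝟙 ((bvu ≫ f) ≫ m) := by bicategory
    _ = (bv ≫ f) ◁ n0.hom ⊗≫ ((bv ≫ 𝟙 b) ◁ f ◁ m0.inv ≫ (bv ◁ η.inv ≫ μ.inv) ▷ (f ≫ m)) ⊗≫
      𝟙 ((bvu ≫ f) ≫ m) := by bicategory
    _ = _ := by rw [whisker_exchange]; bicategory

/-- The product law of the wedge. By `ht` the cell at the product uv is the cell at u followed by
the one at v; `hx`, the associativity of the action, identifies the two ways of splitting the action
of wuv, once as w with uv and once as wu with v. -/
theorem phi_tri {a b : M} {bu bv bw buv bwu bwuv bwuv' : b ⟶ b} {m m₁ m₂ n n₁ n₂ : a ⟶ a}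
    {f : b ⟶ a} (mA' : m ≅ m₂ ≫ m₁) (mA : n ≅ n₁ ≫ n₂) (cA : m₁ ≫ n₂ ≅ n₂ ≫ m₁)
    (t : f ≫ n ≅ buv ≫ f ≫ m) (t₁ : f ≫ n₁ ≅ bu ≫ f ≫ m₁) (t₂ : f ≫ n₂ ≅ bv ≫ f ≫ m₂)
    (μ : buv ≅ bu ≫ bv) (μ₁ : bwu ≅ bw ≫ bu) (μ₂ : bwuv ≅ bw ≫ buv) (μ₃ : bwuv' ≅ bwu ≫ bv)
    (x : bwuv' ≅ bwuv)
    (hx : x.hom ≫ μ₂.hom ≫ bw ◁ μ.hom = μ₃.hom ≫ μ₁.hom ▷ bv ≫ (α_ _ _ _).hom)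
    (ht : t.hom = srcPaste μ mA' mA cA t₁.hom t₂.hom) :
    (phiIso t μ₂).hom = wedgePaste mA' mA cA (phiIso t₁ μ₁).hom (phiIso t₂ μ₃).hom
      (x.hom ▷ f) := by
  have hx' : μ₁.inv ▷ bv ≫ μ₃.inv ≫ x.hom = (α_ _ _ _).hom ≫ bw ◁ μ.inv ≫ μ₂.inv := by
    rw [← cancel_mono (μ₂.hom ≫ bw ◁ μ.hom)]
    simp only [Category.assoc, hx]
    simp
  simp only [phiIso, Iso.trans_hom, whiskerLeftIso_hom, Iso.symm_hom, whiskerRightIso_hom, ht,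
    wedgePaste, srcPaste]
  symm
  calc
    _ = (bw ≫ f) ◁ mA.hom ⊗≫ bw ◁ t₁.hom ▷ n₂ ⊗≫ (μ₁.inv ▷ (f ≫ m₁ ≫ n₂) ≫
        bwu ◁ (f ◁ cA.hom ⊗≫ t₂.hom ▷ m₁)) ⊗≫ (μ₃.inv ≫ x.hom) ▷ (f ≫ m₂ ≫ m₁) ⊗≫
        bwuv ◁ f ◁ mA'.inv ⊗≫ 𝟙 ((bwuv ≫ f) ≫ m) := by bicategory
    _ = (bw ≫ f) ◁ mA.hom ⊗≫ bw ◁ t₁.hom ▷ n₂ ⊗≫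
        (bw ≫ bu) ◁ (f ◁ cA.hom ⊗≫ t₂.hom ▷ m₁) ⊗≫
        (μ₁.inv ▷ bv ≫ μ₃.inv ≫ x.hom) ▷ (f ≫ m₂ ≫ m₁) ⊗≫
        bwuv ◁ f ◁ mA'.inv ⊗≫ 𝟙 ((bwuv ≫ f) ≫ m) := by
      rw [← whisker_exchange]; bicategory
    _ = (bw ≫ f) ◁ mA.hom ⊗≫ bw ◁ t₁.hom ▷ n₂ ⊗≫
        (bw ≫ bu) ◁ (f ◁ cA.hom ⊗≫ t₂.hom ▷ m₁) ⊗≫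
        ((bw ◁ μ.inv ≫ μ₂.inv) ▷ (f ≫ m₂ ≫ m₁) ≫
        bwuv ◁ f ◁ mA'.inv) ⊗≫ 𝟙 ((bwuv ≫ f) ≫ m) := by
      rw [hx']; bicategory
    _ = _ := by rw [← whisker_exchange]; bicategory

end Coherence

section Bicat

open Bicategory

variable {V : Type u'} [Category.{v'} V] [MonoidalCategory V]
variable {I : Type w} [Category.{w} I] [MonoidalCategory I] [EnrichedOrdinaryCategory V I]
variable {M : Type u₂} [Bicategory.{w₂, v₂} M] [VCatCategory V M]

namespace Wedge

variable {s : Side} {A : IObj V I M} {Z : M}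

theorem hom_ext {F G : Wedge V s A Z} {a b : F ⟶ G} (h : ∀ v, a.θ.app v = b.θ.app v) : a = b :=
  Hom.ext (NatTrans.ext (funext h))

/-- An isomorphism of wedges. -/
def isoMk {F G : Wedge V s A Z} (i : ∀ v, F.e.obj v ≅ G.e.obj v)
    (nat : ∀ {v v' : I} (h : v ⟶ v'), F.e.map h ≫ (i v').hom = (i v).hom ≫ G.e.map h)
    (comm : ∀ u v : I, (i v).hom ▷ (A.actOn s).obj u ≫ (G.σ u v).hom =
      (F.σ u v).hom ≫ (i (s.mul v u)).hom ▷ (A.actOn s.op).obj u) : F ≅ G where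
  hom := ⟨{ app := fun v => (i v).hom, naturality := fun _ _ h => nat h }, comm⟩
  inv := ⟨(NatIso.ofComponents i nat).inv, fun u v => by
    have := comm u v
    rw [← cancel_epi ((i v).hom ▷ (A.actOn s).obj u), reassoc_of% this]
    simp [← comp_whiskerRight, ← comp_whiskerRight_assoc]⟩
  hom_inv_id := hom_ext fun v => (i v).hom_inv_id
  inv_hom_id := hom_ext fun v => (i v).inv_hom_id

/-- The components of an isomorphism of wedges. -/
def isoApp {F G : Wedge V s A Z} (i : F ≅ G) (v : I) : F.e.obj v ≅ G.e.obj v :=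
  (evalFunctor s A Z v).mapIso i

end Wedge

variable [MonoidalClosed V] [IsBase V]

namespace EquivMor

variable {A B : IObj V I M} [Bicategory.Strict M] [IsStrictMonoidal I]

/-- The wedge of an equivariant morphism. -/
def wedge (F : EquivMor B A) : Wedge V B.side A B.pt where
  e := B.act' ⋙ postcomp B.pt F.f
  isVFunctor := B.isVFunctor_act'.comp (VCatCategory.postcomp B.pt F.f)
  σ u v := phiIso (F.t u) (B.μ v u)
  nat_obj u v v' g := phi_nat_obj (F.t u) (B.μ v u) (B.μ v' u) (B.act'.map g)
    (B.act'.map (B.side.mulMap g (𝟙 u))) (by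
      have := B.μ_nat g (𝟙 u)
      simpa using this)
  nat {u u'} h v := phi_nat (F.t u) (F.t u') (B.μ v u) (B.μ v u') _ _ (B.act'.map h)
    (B.act'.map (B.side.mulMap (𝟙 v) h)) (by
      have := B.μ_nat (𝟙 v) h
      simpa using this) (F.t_nat h)
  tri u v w := phi_tri _ _ _ (F.t _) (F.t u) (F.t v) (B.μ u v) (B.μ w u) (B.μ w _) (B.μ _ v)
    (B.act'.mapIso (B.side.assoc w u v)) (B.μ_assoc w u v) (F.t_tri u v)
  one v := phi_one (F.t (tunit I)) (B.μ v (tunit I)) (A.oneIso B.side) (A.oneIso B.side.op) B.η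
    (B.act'.mapIso (B.side.mul_one v)) (B.μ_mul_one v) F.t_one

/-- The functoriality of the wedge of an equivariant morphism. -/
def wedgeMap {F G : EquivMor B A} (a : F ⟶ G) : F.wedge ⟶ G.wedge where
  θ :=
    { app := fun v => B.act'.obj v ◁ a.θ
      naturality := fun _ _ h => (whisker_exchange (B.act'.map h) a.θ).symm }
  comm u v := phi_map (F.t u) (G.t u) (B.μ v u) a.θ (a.comm_t u)

end EquivMor

end Bicat

/-! ### Equivariant morphisms between objects with actions on the same side -/

section Coherence

open Bicategory

variable {M : Type u₂} [Bicategory.{w₂, v₂} M]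

/-- The equivariance cell `t` with the trivial factor `f` of its target removed. -/
def tgtIso {a b : M} {bf : b ⟶ b} {f n : a ⟶ a} {p : b ⟶ a} (ν : f ≅ 𝟙 a)
    (t : p ≫ n ≅ bf ≫ p ≫ f) : p ≫ n ≅ bf ≫ p :=
  t ≪≫ whiskerLeftIso bf (whiskerLeftIso p ν ≪≫ ρ_ p)

/-- The pasting of the cells `tgtIso`. -/
def tgtPaste {a b : M} {bf bf₁ bf₂ : b ⟶ b} {n n₁ n₂ : a ⟶ a} {p : b ⟶ a}
    (mB : bf ≅ bf₁ ≫ bf₂) (mA : n ≅ n₁ ≫ n₂)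
    (t₁ : p ≫ n₁ ⟶ bf₁ ≫ p) (t₂ : p ≫ n₂ ⟶ bf₂ ≫ p) : p ≫ n ⟶ bf ≫ p :=
  p ◁ mA.hom ⊗≫ t₁ ▷ n₂ ⊗≫ bf₁ ◁ t₂ ⊗≫ mB.inv ▷ p

/-- This and the next three lemmas erase the remaining mute factor when the target acts on the same
side as the source: the cell becomes p ≫ n ≅ bf ≫ p, as for a pseudonatural transformation, and the
two forms of each axiom differ by right unitors. -/
theorem tgtIso_tri {a b : M} {bf bf₁ bf₂ : b ⟶ b} {n n₁ n₂ : a ⟶ a} {p : b ⟶ a}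
    (mB : bf ≅ bf₁ ≫ bf₂) (mA : n ≅ n₁ ≫ n₂) (t : p ≫ n ≅ bf ≫ p ≫ 𝟙 a)
    (t₁ : p ≫ n₁ ≅ bf₁ ≫ p ≫ 𝟙 a) (t₂ : p ≫ n₂ ≅ bf₂ ≫ p ≫ 𝟙 a) :
    t.hom = srcPaste mB (λ_ _).symm mA (λ_ _ ≪≫ (ρ_ _).symm) t₁.hom t₂.hom ↔
      (tgtIso (Iso.refl _) t).hom = tgtPaste mB mA (tgtIso (Iso.refl _) t₁).hom
        (tgtIso (Iso.refl _) t₂).hom := by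
  rw [← cancel_mono (bf ◁ (ρ_ p).hom)]
  simp only [tgtIso, srcPaste, tgtPaste, Iso.trans_hom, Iso.symm_hom, whiskerLeftIso_hom,
    Iso.refl_hom, Bicategory.whiskerLeft_id, Category.id_comp, Iso.symm_inv]
  refine Eq.congr_right ?_
  bicategory

theorem tgtIso_nat {a b : M} {bf bf' : b ⟶ b} {n n' : a ⟶ a} {p : b ⟶ a}
    (hb : bf ⟶ bf') (hn : n ⟶ n') (t : p ≫ n ≅ bf ≫ p ≫ 𝟙 a) (t' : p ≫ n' ≅ bf' ≫ p ≫ 𝟙 a) :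
    p ◁ hn ≫ t'.hom = t.hom ≫ hb ▷ (p ≫ 𝟙 a) ≫ bf' ◁ p ◁ 𝟙 (𝟙 a) ↔
      p ◁ hn ≫ (tgtIso (Iso.refl _) t').hom = (tgtIso (Iso.refl _) t).hom ≫ hb ▷ p := by
  rw [← cancel_mono (bf' ◁ (ρ_ p).hom)]
  simp only [tgtIso, Iso.trans_hom, whiskerLeftIso_hom, Iso.refl_hom, Bicategory.whiskerLeft_id,
    Category.id_comp, Category.comp_id, Category.assoc]
  rw [whisker_exchange]

theorem tgtIso_one {a b : M} {bf : b ⟶ b} {n : a ⟶ a} {p : b ⟶ a}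
    (b0 : bf ≅ 𝟙 b) (n0 : n ≅ 𝟙 a) (t : p ≫ n ≅ bf ≫ p ≫ 𝟙 a) :
    t.hom = p ◁ n0.hom ≫ p ◁ 𝟙 _ ≫ (λ_ (p ≫ 𝟙 a)).inv ≫ b0.inv ▷ (p ≫ 𝟙 a) ↔
      (tgtIso (Iso.refl _) t).hom = p ◁ n0.hom ≫ (ρ_ p).hom ≫ (λ_ p).inv ≫ b0.inv ▷ p := by
  rw [← cancel_mono (bf ◁ (ρ_ p).hom)]
  simp only [tgtIso, Iso.trans_hom, whiskerLeftIso_hom, Iso.refl_hom, Bicategory.whiskerLeft_id,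
    Category.id_comp]
  refine Eq.congr_right ?_
  bicategory

theorem tgtIso_comm {a b : M} {bf : b ⟶ b} {n : a ⟶ a} {p p' : b ⟶ a} (θ : p ⟶ p')
    (t : p ≫ n ≅ bf ≫ p ≫ 𝟙 a) (t' : p' ≫ n ≅ bf ≫ p' ≫ 𝟙 a) :
    θ ▷ n ≫ t'.hom = t.hom ≫ bf ◁ θ ▷ 𝟙 a ↔
      θ ▷ n ≫ (tgtIso (Iso.refl _) t').hom = (tgtIso (Iso.refl _) t).hom ≫ bf ◁ θ := by
  rw [← cancel_mono (bf ◁ (ρ_ p').hom)]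
  simp [tgtIso]

/-- The composite of the equivariance cells `t` and `r`. -/
def compT {a b c : M} {bf : b ⟶ b} {cf : c ⟶ c} {f n : a ⟶ a} {g : b ⟶ c} {p : c ⟶ a}
    (t : g ≫ cf ≅ bf ≫ g) (r : p ≫ n ≅ cf ≫ p ≫ f) : (g ≫ p) ≫ n ≅ bf ≫ (g ≫ p) ≫ f :=
  α_ g p n ≪≫ whiskerLeftIso g r ≪≫ (α_ g cf (p ≫ f)).symm ≪≫ whiskerRightIso t (p ≫ f) ≪≫
    α_ bf g (p ≫ f) ≪≫ whiskerLeftIso bf (α_ g p f).symm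

/-- If `b` and `c` act on the same side, the composite is defined from the side on which `c` is
mute. Seen from the acting side this means composing inverses in the reverse order, which is the
ordinary pasting `compT`. -/
theorem srcIso_compIso {a b c : M} {bf : b ⟶ b} {cf : c ⟶ c} {f n : a ⟶ a} {g : b ⟶ c} {p : c ⟶ a}
    (t : 𝟙 b ≫ g ≫ cf ≅ bf ≫ g ≫ 𝟙 c) (r : 𝟙 c ≫ p ≫ n ≅ cf ≫ p ≫ f) :
    srcIso (Iso.refl _) (compIso (Iso.refl _) t.symm r.symm).symm =
      compT (tgtIso (Iso.refl _) (srcIso (Iso.refl _) t)) (srcIso (Iso.refl _) r) := by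
  ext
  simp only [srcIso, tgtIso, compT, compIso, hatL, hatR, Iso.trans_hom, Iso.symm_hom,
    whiskerLeftIso_hom, Iso.refl_hom, whiskerRightIso_hom, Iso.trans_inv, Iso.symm_inv,
    whiskerLeftIso_inv, whiskerRightIso_inv, Iso.refl_inv]
  bicategory

/-- The compatibility of the wedge of a composite with the composition of wedges. -/
theorem pull_phi {a b c : M} {bu bv bvu : b ⟶ b} {cu cv cvu : c ⟶ c} {m n : a ⟶ a} {g : b ⟶ c}
    {p : c ⟶ a} (μb : bvu ≅ bv ≫ bu) (μc : cvu ≅ cv ≫ cu) (tu : g ≫ cu ≅ bu ≫ g)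
    (tv : g ≫ cv ≅ bv ≫ g) (tvu : g ≫ cvu ≅ bvu ≫ g) (r : p ≫ n ≅ cu ≫ p ≫ m)
    (h : tvu.hom = tgtPaste μb μc tv.hom tu.hom) :
    ((α_ g cv p).inv ≫ tv.hom ▷ p ≫ (α_ bv g p).hom) ▷ n ≫ (phiIso (compT tu r) μb).hom =
      (pullIso g (phiIso r μc)).hom ≫
        ((α_ g cvu p).inv ≫ tvu.hom ▷ p ≫ (α_ bvu g p).hom) ▷ m := by
  simp only [phiIso, pullIso, compT, Iso.trans_hom, Iso.symm_hom, whiskerLeftIso_hom,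
    whiskerRightIso_hom, h, tgtPaste]
  symm
  calc
    -- Expanding the cell at the product puts `μc.inv` next to `μc.hom`; once they cancel, `r` and
    -- `tv` act on disjoint factors and are interchanged.
    _ = 𝟙 ((g ≫ cv ≫ p) ≫ n) ⊗≫ g ◁ cv ◁ r.hom ⊗≫ g ◁ (μc.inv ≫ μc.hom) ▷ (p ≫ m) ⊗≫
        tv.hom ▷ (cu ≫ p ≫ m) ⊗≫ bv ◁ tu.hom ▷ (p ≫ m) ⊗≫ μb.inv ▷ (g ≫ p ≫ m) ⊗≫
        𝟙 ((bvu ≫ g ≫ p) ≫ m) := by bicategory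
    _ = 𝟙 ((g ≫ cv ≫ p) ≫ n) ⊗≫ ((g ≫ cv) ◁ r.hom ≫ tv.hom ▷ (cu ≫ p ≫ m)) ⊗≫
        bv ◁ tu.hom ▷ (p ≫ m) ⊗≫ μb.inv ▷ (g ≫ p ≫ m) ⊗≫
        𝟙 ((bvu ≫ g ≫ p) ≫ m) := by rw [Iso.inv_hom_id]; bicategory
    _ = _ := by rw [whisker_exchange]; bicategory

end Coherence

section Bicat

open Bicategory

variable {V : Type u'} [Category.{v'} V] [MonoidalCategory V]
variable {I : Type w} [Category.{w} I] [MonoidalCategory I] [EnrichedOrdinaryCategory V I]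
variable {M : Type u₂} [Bicategory.{w₂, v₂} M] [VCatCategory V M]

/-- The `I`-object given by an action. -/
@[reducible]
def SAct.ob {s : Side} {b : M} (β : SAct V I s b) : IObj V I M := ⟨b, s, β⟩

namespace EquivMor

variable {s : Side} {b c : M} {β : SAct V I s b} {γ : SAct V I s c}

/-- The equivariance structure of a morphism between objects with actions on the same side. -/
def ts (G : EquivMor β.ob γ.ob) (u : I) : G.f ≫ γ.ob.act'.obj u ≅ β.ob.act'.obj u ≫ G.f :=
  tgtIso (γ.ob.muteIso u) (G.t u)

theorem ts_nat (G : EquivMor β.ob γ.ob) {u v : I} (h : u ⟶ v) :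
    G.f ◁ γ.ob.act'.map h ≫ (G.ts v).hom = (G.ts u).hom ≫ β.ob.act'.map h ▷ G.f := by
  have := G.t_nat h
  cases s <;> exact (tgtIso_nat _ _ _ _).1 this

theorem ts_tri (G : EquivMor β.ob γ.ob) (u v : I) :
    (G.ts (s.mul u v)).hom = tgtPaste (β.ob.μ u v) (γ.ob.μ u v) (G.ts u).hom (G.ts v).hom := by
  have := G.t_tri u v
  cases s <;> exact (tgtIso_tri _ _ _ _ _).1 this

theorem ts_one (G : EquivMor β.ob γ.ob) :
    (G.ts (tunit I)).hom = G.f ◁ γ.ob.η.hom ≫ (ρ_ G.f).hom ≫ (λ_ G.f).inv ≫ β.ob.η.inv ▷ G.f := by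
  have := G.t_one
  cases s <;> exact (tgtIso_one _ _ _).1 this

theorem Hom.comm_ts {F G : EquivMor β.ob γ.ob} (a : F ⟶ G) (u : I) :
    a.θ ▷ γ.ob.act'.obj u ≫ (G.ts u).hom = (F.ts u).hom ≫ β.ob.act'.obj u ◁ a.θ := by
  have := a.comm_t u
  cases s <;> exact (tgtIso_comm _ _ _).1 this

theorem comm_of_ts {F G : EquivMor β.ob γ.ob} (θ : F.f ⟶ G.f)
    (h : ∀ u, θ ▷ γ.ob.act'.obj u ≫ (G.ts u).hom = (F.ts u).hom ≫ β.ob.act'.obj u ◁ θ) (u : I) :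
    (β.ob.actOn s.op).obj u ◁ θ ▷ (γ.ob.actOn s).obj u ≫ (G.τs s u).hom =
      (F.τs s u).hom ≫ (β.ob.actOn s).obj u ◁ θ ▷ (γ.ob.actOn s.op).obj u :=
  comm_of_t θ (fun u => by
    have := h u
    cases s <;> exact (tgtIso_comm _ _ _).2 this) u

/-- The equivariance structure `ts` with the trivial factor added back. -/
def tOfTs {f : b ⟶ c} (t : ∀ u, f ≫ γ.ob.act'.obj u ≅ β.ob.act'.obj u ≫ f) (u : I) :
    f ≫ (γ.ob.actOn s).obj u ≅ β.ob.act'.obj u ≫ f ≫ (γ.ob.actOn s.op).obj u :=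
  t u ≪≫ whiskerLeftIso _ ((ρ_ f).symm ≪≫ whiskerLeftIso f (γ.ob.muteIso u).symm)

theorem tgtIso_tOfTs {f : b ⟶ c} (t : ∀ u, f ≫ γ.ob.act'.obj u ≅ β.ob.act'.obj u ≫ f) (u : I) :
    tgtIso (γ.ob.muteIso u) (tOfTs t u) = t u := by
  ext
  simp only [tgtIso, tOfTs, Iso.trans_hom, whiskerLeftIso_hom, Iso.symm_hom, Category.assoc]
  simp [← Bicategory.whiskerLeft_comp, ← Bicategory.whiskerLeft_comp_assoc]

/-- The equivariant morphism between objects with actions on the same side given by an equivariance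
structure `t`. -/
def ofTs (f : b ⟶ c) (t : ∀ u, f ≫ γ.ob.act'.obj u ≅ β.ob.act'.obj u ≫ f)
    (nat : ∀ {u v : I} (h : u ⟶ v),
      f ◁ γ.ob.act'.map h ≫ (t v).hom = (t u).hom ≫ β.ob.act'.map h ▷ f)
    (tri : ∀ u v : I,
      (t (s.mul u v)).hom = tgtPaste (β.ob.μ u v) (γ.ob.μ u v) (t u).hom (t v).hom)
    (one : (t (tunit I)).hom = f ◁ γ.ob.η.hom ≫ (ρ_ f).hom ≫ (λ_ f).inv ≫ β.ob.η.inv ▷ f) :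
    EquivMor β.ob γ.ob :=
  ofT f (tOfTs t)
    (fun {u v} h => by
      have := nat h
      rw [← tgtIso_tOfTs t, ← tgtIso_tOfTs t] at this
      cases s <;> exact (tgtIso_nat _ _ _ _).2 this)
    (fun u v => by
      have := tri u v
      rw [← tgtIso_tOfTs t, ← tgtIso_tOfTs t, ← tgtIso_tOfTs t] at this
      cases s <;> exact (tgtIso_tri _ _ _ _ _).2 this)
    (by
      have := one
      rw [← tgtIso_tOfTs t] at this
      cases s <;> exact (tgtIso_one _ _ _).2 this)

theorem ofTs_ts (f : b ⟶ c) (t : ∀ u, f ≫ γ.ob.act'.obj u ≅ β.ob.act'.obj u ≫ f) (nat) (tri) (one)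
    (u : I) : (ofTs f t nat tri one).ts u = t u :=
  (congrArg (tgtIso (γ.ob.muteIso u)) (ofT_t (B := β.ob) (A := γ.ob) f (tOfTs t) _ _ _ u)).trans
    (tgtIso_tOfTs t u)

theorem cmp_t {A : IObj V I M} (G : EquivMor β.ob γ.ob) (F : EquivMor γ.ob A) (u : I) :
    (G.cmp F).t u = compT (G.ts u) (F.t u) := by
  cases s
  · exact srcIso_compIso (G.τs .l u) (F.τs .l u)
  · exact srcIso_compIso (G.τs .r u) (F.τs .r u)

end EquivMor

variable [MonoidalClosed V] [IsBase V] [Bicategory.Strict M] [IsStrictMonoidal I]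

/-- The wedge of the composite of `G` and `F` is the composite of `G` with the wedge of `F`. -/
def EquivMor.wedgeCmp {s : Side} {b c : M} {β : SAct V I s b} {γ : SAct V I s c} {A : IObj V I M}
    (G : EquivMor β.ob γ.ob) (F : EquivMor γ.ob A) : F.wedge.pull G.f ≅ (G.cmp F).wedge :=
  Wedge.isoMk (fun v => (α_ _ _ _).symm ≪≫ whiskerRightIso (G.ts v) F.f ≪≫ α_ _ _ _)
    (fun {v v'} h => by
      have := G.ts_nat h
      change G.f ◁ (γ.ob.act'.map h ▷ F.f) ≫ (α_ _ _ _).inv ≫ (G.ts v').hom ▷ F.f ≫ (α_ _ _ _).hom =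
        ((α_ _ _ _).inv ≫ (G.ts v).hom ▷ F.f ≫ (α_ _ _ _).hom) ≫ β.ob.act'.map h ▷ (G.f ≫ F.f)
      rw [associator_inv_naturality_middle_assoc, ← comp_whiskerRight_assoc, this]
      simp)
    (fun u v => by
      have := pull_phi (β.ob.μ v u) (γ.ob.μ v u) (G.ts u) (G.ts v) (G.ts _) (F.t u) (G.ts_tri v u)
      rw [← EquivMor.cmp_t] at this
      exact this)

end Bicat

/-! ### Lifting equivariant morphisms to `Inv_s` -/

section Coherence

open Bicategory

variable {M : Type u₂} [Bicategory.{w₂, v₂} M]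

/-- With its mirror image, this serves to compare two pastings written with the same invertible
outer cells, so that only the middle cells remain. -/
theorem bicategoricalComp_cancel_left {a b : M} {f g h i : a ⟶ b} [BicategoricalCoherence g h]
    (x : f ⟶ g) [IsIso x] {y y' : h ⟶ i} (e : x ⊗≫ y = x ⊗≫ y') : y = y' := by
  simpa only [bicategoricalComp, cancel_epi] using e

theorem bicategoricalComp_cancel_right {a b : M} {f g h i : a ⟶ b} [BicategoricalCoherence g h]
    (z : h ⟶ i) [IsIso z] {y y' : f ⟶ g} (e : y ⊗≫ z = y' ⊗≫ z) : y = y' := by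
  simp only [bicategoricalComp, ← Category.assoc, cancel_mono] at e
  exact e

instance {a b : M} {f g h i : a ⟶ b} [BicategoricalCoherence g h]
    (x : f ⟶ g) [IsIso x] (y : h ⟶ i) [IsIso y] : IsIso (x ⊗≫ y) := by
  unfold bicategoricalComp; infer_instance

/-- The equivariance cell of the evaluation is a wedge cell followed by the inverse of the action
isomorphism `ku`. Multiplicativity of the action isomorphisms, `h₃`, makes `ku.inv` and `μ.inv`
cancel, and their compatibility with the wedge cells, `h₂`, moves `σ₁` to the shifted index. -/
theorem phi_eps {a c : M} {n m : a ⟶ a} {p qu qv qvu q ev evu : c ⟶ a} {ru rv rvu : c ⟶ c}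
    (μ : rvu ≅ rv ≫ ru) (σ₁ : p ≫ n ≅ qu ≫ m) (σ : ev ≫ n ≅ evu ≫ m) (σ₂ : qv ≫ n ≅ q ≫ m)
    (ku : ru ≫ p ≅ qu) (kv : rv ≫ p ≅ qv) (kvu : rvu ≫ p ≅ qvu) (k : rv ≫ qu ≅ q)
    (xv : qv ≅ ev) (xvu : qvu ≅ evu) (y : q ⟶ evu) (z : q ⟶ qvu)
    (h₁ : xv.hom ▷ n ≫ σ.hom = σ₂.hom ≫ y ▷ m)
    (h₂ : rv ◁ σ₁.hom ≫ (α_ _ _ _).inv ≫ k.hom ▷ m = (α_ _ _ _).inv ≫ kv.hom ▷ n ≫ σ₂.hom)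
    (h₃ : kvu.hom = μ.hom ▷ p ≫ (α_ _ _ _).hom ≫ rv ◁ ku.hom ≫ k.hom ≫ z)
    (h₄ : z ≫ xvu.hom = y) :
    (kv ≪≫ xv).hom ▷ n ≫ σ.hom =
      (phiIso (σ₁ ≪≫ whiskerRightIso ku.symm m ≪≫ α_ _ _ _) μ).hom ≫
        (kvu ≪≫ xvu).hom ▷ m := by
  have h₅ : kv.hom ▷ n ≫ σ₂.hom = (α_ _ _ _).hom ≫ rv ◁ σ₁.hom ≫ (α_ _ _ _).inv ≫ k.hom ▷ m := by
    rw [h₂]; simp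
  simp only [phiIso, Iso.trans_hom, Iso.symm_hom, whiskerRightIso_hom, whiskerLeftIso_hom, h₃,
    comp_whiskerRight, Category.assoc, h₁, reassoc_of% h₅, ← h₄]
  calc
    _ = 𝟙 ((rv ≫ p) ≫ n) ⊗≫ rv ◁ σ₁.hom ⊗≫ rv ◁ (ku.inv ≫ ku.hom) ▷ m ⊗≫ k.hom ▷ m ≫ z ▷ m ≫
        xvu.hom ▷ m := by rw [Iso.inv_hom_id]; bicategory
    _ = 𝟙 ((rv ≫ p) ≫ n) ⊗≫ rv ◁ σ₁.hom ⊗≫ rv ◁ ku.inv ▷ m ⊗≫ (μ.inv ≫ μ.hom) ▷ p ▷ m ⊗≫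
        rv ◁ ku.hom ▷ m ⊗≫ k.hom ▷ m ≫ z ▷ m ≫
        xvu.hom ▷ m := by rw [μ.inv_hom_id]; bicategory
    _ = _ := by bicategory

/-- At the unit of `I` the equivariance cells `t`, `t'` are composites of unit isomorphisms, so `hθ`
becomes an equation between `θ ▷ p` and `h` with equal invertible cells around them. It shows that
the lift of `h` restricts to `h` along the evaluation. -/
theorem lift_hom_one {a b c : M} {c₁ : c ⟶ c} {b₁ : b ⟶ b} {g g' : b ⟶ c} {p : c ⟶ a}
    (ηc : c₁ ≅ 𝟙 c) (ηb : b₁ ≅ 𝟙 b) (t : g ≫ c₁ ⟶ b₁ ≫ g) (t' : g' ≫ c₁ ⟶ b₁ ≫ g')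
    (ht : t = g ◁ ηc.hom ≫ (ρ_ g).hom ≫ (λ_ g).inv ≫ ηb.inv ▷ g)
    (ht' : t' = g' ◁ ηc.hom ≫ (ρ_ g').hom ≫ (λ_ g').inv ≫ ηb.inv ▷ g')
    (θ : g ⟶ g') (h : g ≫ p ⟶ g' ≫ p)
    (hθ : θ ▷ (c₁ ≫ p) ≫ (α_ _ _ _).inv ≫ t' ▷ p ≫ (α_ _ _ _).hom =
      ((α_ _ _ _).inv ≫ t ▷ p ≫ (α_ _ _ _).hom) ≫ b₁ ◁ h) : θ ▷ p = h := by
  have e₁ : θ ▷ (c₁ ≫ p) ≫ (α_ _ _ _).inv ≫ t' ▷ p ≫ (α_ _ _ _).hom =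
      g ◁ ηc.hom ▷ p ⊗≫ θ ▷ p ⊗≫ ηb.inv ▷ (g' ≫ p) := by
    rw [ht']
    calc
      _ = (θ ▷ (c₁ ≫ p) ≫ g' ◁ ηc.hom ▷ p) ⊗≫ ηb.inv ▷ (g' ≫ p) := by bicategory
      _ = _ := by rw [← whisker_exchange]; bicategory
  have e₂ : ((α_ _ _ _).inv ≫ t ▷ p ≫ (α_ _ _ _).hom) ≫ b₁ ◁ h =
      g ◁ ηc.hom ▷ p ⊗≫ h ⊗≫ ηb.inv ▷ (g' ≫ p) := by
    rw [ht]
    calc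
      _ = g ◁ ηc.hom ▷ p ⊗≫ (ηb.inv ▷ (g ≫ p) ≫ b₁ ◁ h) := by bicategory
      _ = _ := by rw [← whisker_exchange]; bicategory
  rw [e₁, e₂] at hθ
  exact bicategoricalComp_cancel_right _ (bicategoricalComp_cancel_left _ hθ)

/-- A 2-cell into Inv_s(A) is known by its whiskerings with all γ(v) ≫ ε. The condition `huv` at the
product uv splits by multiplicativity into a part at u and a part at v; the condition `hv` rewrites
the latter, and the invertible cell `tv'` then cancels, leaving the equivariance of `θ` at u. -/
theorem lift_hom_comm {a b c : M} {cu cv cuv : c ⟶ c} {bu bv buv : b ⟶ b} {g g' : b ⟶ c}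
    {p : c ⟶ a} (μc : cuv ≅ cu ≫ cv) (μb : buv ≅ bu ≫ bv)
    (tu : g ≫ cu ⟶ bu ≫ g) (tu' : g' ≫ cu ⟶ bu ≫ g')
    (tv : g ≫ cv ⟶ bv ≫ g) (tv' : g' ≫ cv ≅ bv ≫ g')
    (tuv : g ≫ cuv ⟶ buv ≫ g) (tuv' : g' ≫ cuv ⟶ buv ≫ g')
    (h : tuv = tgtPaste μb μc tu tv) (h' : tuv' = tgtPaste μb μc tu' tv'.hom)
    (θ : g ⟶ g') (k : g ≫ p ⟶ g' ≫ p)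
    (hv : θ ▷ (cv ≫ p) ≫ (α_ _ _ _).inv ≫ tv'.hom ▷ p ≫ (α_ _ _ _).hom =
      ((α_ _ _ _).inv ≫ tv ▷ p ≫ (α_ _ _ _).hom) ≫ bv ◁ k)
    (huv : θ ▷ (cuv ≫ p) ≫ (α_ _ _ _).inv ≫ tuv' ▷ p ≫ (α_ _ _ _).hom =
      ((α_ _ _ _).inv ≫ tuv ▷ p ≫ (α_ _ _ _).hom) ≫ buv ◁ k) :
    (θ ▷ cu ≫ tu') ▷ (cv ≫ p) = (tu ≫ bu ◁ θ) ▷ (cv ≫ p) := by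
  have e₁ : θ ▷ (cuv ≫ p) ≫ (α_ _ _ _).inv ≫ tuv' ▷ p ≫ (α_ _ _ _).hom =
      g ◁ μc.hom ▷ p ⊗≫ (θ ▷ cu ≫ tu') ▷ (cv ≫ p) ⊗≫ bu ◁ tv'.hom ▷ p ⊗≫ μb.inv ▷ (g' ≫ p) := by
    rw [h', tgtPaste]
    calc
      _ = (θ ▷ (cuv ≫ p) ≫ g' ◁ μc.hom ▷ p) ⊗≫ tu' ▷ (cv ≫ p) ⊗≫ bu ◁ tv'.hom ▷ p ⊗≫
          μb.inv ▷ (g' ≫ p) := by bicategory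
      _ = _ := by rw [← whisker_exchange]; bicategory
  have e₂ : ((α_ _ _ _).inv ≫ tuv ▷ p ≫ (α_ _ _ _).hom) ≫ buv ◁ k =
      g ◁ μc.hom ▷ p ⊗≫ (tu ≫ bu ◁ θ) ▷ (cv ≫ p) ⊗≫ bu ◁ tv'.hom ▷ p ⊗≫
        μb.inv ▷ (g' ≫ p) := by
    rw [h, tgtPaste]
    calc
      _ = g ◁ μc.hom ▷ p ⊗≫ tu ▷ (cv ≫ p) ⊗≫ bu ◁ tv ▷ p ⊗≫ (μb.inv ▷ (g ≫ p) ≫ buv ◁ k) := by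
        bicategory
      _ = g ◁ μc.hom ▷ p ⊗≫ tu ▷ (cv ≫ p) ⊗≫
          bu ◁ (((α_ _ _ _).inv ≫ tv ▷ p ≫ (α_ _ _ _).hom) ≫ bv ◁ k) ⊗≫ μb.inv ▷ (g' ≫ p) := by
        rw [← whisker_exchange]; bicategory
      _ = _ := by rw [← hv]; bicategory
  rw [e₁, e₂] at huv
  exact bicategoricalComp_cancel_right _ (bicategoricalComp_cancel_left _ huv)


/-- The candidate for the whiskering of the equivariance cell of a lift `g` of `f`. -/
def liftCell {a b c : M} {cu cv cuv : c ⟶ c} {bu bv buv : b ⟶ b} {g : b ⟶ c} {p : c ⟶ a}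
    {f : b ⟶ a} (μc : cuv ≅ cu ≫ cv) (μb : buv ≅ bu ≫ bv) (kv : g ≫ cv ≫ p ≅ bv ≫ f)
    (kuv : g ≫ cuv ≫ p ≅ buv ≫ f) : (g ≫ cu) ≫ cv ≫ p ≅ (bu ≫ g) ≫ cv ≫ p :=
  α_ _ _ _ ≪≫ whiskerLeftIso g ((α_ _ _ _).symm ≪≫ whiskerRightIso μc.symm p) ≪≫ kuv ≪≫
    whiskerRightIso μb f ≪≫ α_ _ _ _ ≪≫ whiskerLeftIso bu kv.symm ≪≫ (α_ _ _ _).symm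

theorem liftCell_hom {a b c : M} {cu cv cuv : c ⟶ c} {bu bv buv : b ⟶ b} {g : b ⟶ c} {p : c ⟶ a}
    {f : b ⟶ a} (μc : cuv ≅ cu ≫ cv) (μb : buv ≅ bu ≫ bv) (kv : g ≫ cv ≫ p ≅ bv ≫ f)
    (kuv : g ≫ cuv ≫ p ≅ buv ≫ f) : (liftCell μc μb kv kuv).hom =
      𝟙 ((g ≫ cu) ≫ cv ≫ p) ⊗≫ g ◁ μc.inv ▷ p ⊗≫ kuv.hom ⊗≫ μb.hom ▷ f ⊗≫ bu ◁ kv.inv ⊗≫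
        𝟙 ((bu ≫ g) ≫ cv ≫ p) := by
  simp only [liftCell, Iso.trans_hom, whiskerLeftIso_hom, Iso.symm_hom, whiskerRightIso_hom]
  bicategory

theorem liftCell_nat {a b c : M} {cu cv cv' cuv cuv' : c ⟶ c} {bu bv bv' buv buv' : b ⟶ b}
    {g : b ⟶ c} {p : c ⟶ a} {f : b ⟶ a} (μc : cuv ≅ cu ≫ cv) (μc' : cuv' ≅ cu ≫ cv')
    (μb : buv ≅ bu ≫ bv) (μb' : buv' ≅ bu ≫ bv') (kv : g ≫ cv ≫ p ≅ bv ≫ f)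
    (kv' : g ≫ cv' ≫ p ≅ bv' ≫ f) (kuv : g ≫ cuv ≫ p ≅ buv ≫ f) (kuv' : g ≫ cuv' ≫ p ≅ buv' ≫ f)
    (xc : cv ⟶ cv') (xb : bv ⟶ bv') (yc : cuv ⟶ cuv') (yb : buv ⟶ buv')
    (hc : yc ≫ μc'.hom = μc.hom ≫ cu ◁ xc) (hb : yb ≫ μb'.hom = μb.hom ≫ bu ◁ xb)
    (hv : g ◁ (xc ▷ p) ≫ kv'.hom = kv.hom ≫ xb ▷ f)
    (huv : g ◁ (yc ▷ p) ≫ kuv'.hom = kuv.hom ≫ yb ▷ f) :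
    (g ≫ cu) ◁ (xc ▷ p) ≫ (liftCell μc' μb' kv' kuv').hom =
      (liftCell μc μb kv kuv).hom ≫ (bu ≫ g) ◁ (xc ▷ p) := by
  have hc' : cu ◁ xc ≫ μc'.inv = μc.inv ≫ yc := by
    rw [Iso.comp_inv_eq, Category.assoc, hc, Iso.inv_hom_id_assoc]
  have hv' : kv.inv ≫ g ◁ (xc ▷ p) = xb ▷ f ≫ kv'.inv := by
    rw [Iso.inv_comp_eq, ← Category.assoc, ← hv, Category.assoc, Iso.hom_inv_id, Category.comp_id]
  rw [liftCell_hom, liftCell_hom]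
  calc
    _ = 𝟙 ((g ≫ cu) ≫ cv ≫ p) ⊗≫ g ◁ (cu ◁ xc ≫ μc'.inv) ▷ p ⊗≫ kuv'.hom ⊗≫ μb'.hom ▷ f ⊗≫
        bu ◁ kv'.inv ⊗≫ 𝟙 ((bu ≫ g) ≫ cv' ≫ p) := by bicategory
    _ = 𝟙 ((g ≫ cu) ≫ cv ≫ p) ⊗≫ g ◁ μc.inv ▷ p ⊗≫ (g ◁ (yc ▷ p) ≫ kuv'.hom) ⊗≫ μb'.hom ▷ f ⊗≫
        bu ◁ kv'.inv ⊗≫ 𝟙 ((bu ≫ g) ≫ cv' ≫ p) := by rw [hc']; bicategory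
    _ = 𝟙 ((g ≫ cu) ≫ cv ≫ p) ⊗≫ g ◁ μc.inv ▷ p ⊗≫ kuv.hom ⊗≫ (yb ≫ μb'.hom) ▷ f ⊗≫
        bu ◁ kv'.inv ⊗≫ 𝟙 ((bu ≫ g) ≫ cv' ≫ p) := by rw [huv]; bicategory
    _ = 𝟙 ((g ≫ cu) ≫ cv ≫ p) ⊗≫ g ◁ μc.inv ▷ p ⊗≫ kuv.hom ⊗≫ μb.hom ▷ f ⊗≫
        bu ◁ (xb ▷ f ≫ kv'.inv) ⊗≫ 𝟙 ((bu ≫ g) ≫ cv' ≫ p) := by rw [hb]; bicategory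
    _ = _ := by rw [← hv']; bicategory

/-- Together with `liftCell_nat`, this says that for fixed u the cells `liftCell` form a morphism of
wedges in v, hence come from a cell g ≫ γ(u) ≅ β(u) ≫ g. The wedge condition on k is used at v and
at uv, and `hc`, `hb` reconcile the two bracketings of uvw. -/
theorem liftCell_comm {a b c : M} {n m : a ⟶ a} {cu cv cw cuv cvw cuvw cuvw' : c ⟶ c}
    {bu bv bw buv bvw buvw buvw' : b ⟶ b}
    {g : b ⟶ c} {p : c ⟶ a} {f : b ⟶ a} (μc : cuv ≅ cu ≫ cv) (μb : buv ≅ bu ≫ bv)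
    (μc₁ : cvw ≅ cv ≫ cw) (μb₁ : bvw ≅ bv ≫ bw) (μc₂ : cuvw ≅ cu ≫ cvw) (μb₂ : buvw ≅ bu ≫ bvw)
    (μc₃ : cuvw' ≅ cuv ≫ cw) (μb₃ : buvw' ≅ buv ≫ bw)
    (r : p ≫ n ≅ cw ≫ p ≫ m) (t : f ≫ n ≅ bw ≫ f ≫ m)
    (kv : g ≫ cv ≫ p ≅ bv ≫ f) (kuv : g ≫ cuv ≫ p ≅ buv ≫ f)
    (kvw : g ≫ cvw ≫ p ≅ bvw ≫ f) (kuvw : g ≫ cuvw ≫ p ≅ buvw ≫ f)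
    (kuvw' : g ≫ cuvw' ≫ p ≅ buvw' ≫ f) (xc : cuvw' ⟶ cuvw) (xb : buvw' ⟶ buvw)
    (hc : xc ≫ μc₂.hom ≫ cu ◁ μc₁.hom = μc₃.hom ≫ μc.hom ▷ cw ≫ (α_ _ _ _).hom)
    (hb : xb ≫ μb₂.hom ≫ bu ◁ μb₁.hom = μb₃.hom ≫ μb.hom ▷ bw ≫ (α_ _ _ _).hom)
    (hk : g ◁ (xc ▷ p) ≫ kuvw.hom = kuvw'.hom ≫ xb ▷ f)
    (hv : kv.hom ▷ n ≫ (phiIso t μb₁).hom = (pullIso g (phiIso r μc₁)).hom ≫ kvw.hom ▷ m)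
    (huv : kuv.hom ▷ n ≫ (phiIso t μb₃).hom = (pullIso g (phiIso r μc₃)).hom ≫ kuvw'.hom ▷ m) :
    (liftCell μc μb kv kuv).hom ▷ n ≫ (pullIso (bu ≫ g) (phiIso r μc₁)).hom =
      (pullIso (g ≫ cu) (phiIso r μc₁)).hom ≫ (liftCell μc₂ μb₂ kvw kuvw).hom ▷ m := by
  -- The wedge condition at v is needed for the inverse of the comparison, since `liftCell` ends
  -- with `kv.inv`.
  have hv' : kv.inv ▷ n ≫ (pullIso g (phiIso r μc₁)).hom =
      (phiIso t μb₁).hom ≫ kvw.inv ▷ m := by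
    rw [← cancel_epi (kv.hom ▷ n), ← cancel_mono (kvw.hom ▷ m)]
    simp only [Category.assoc, ← comp_whiskerRight, Iso.inv_hom_id, id_whiskerRight,
      Category.comp_id, hv]
    simp
  have hb' : μb.hom ▷ bw ≫ (α_ _ _ _).hom ≫ bu ◁ μb₁.inv = μb₃.inv ≫ xb ≫ μb₂.hom := by
    rw [Iso.eq_inv_comp, ← cancel_mono (bu ◁ μb₁.hom)]
    simp only [Category.assoc, hb, ← Bicategory.whiskerLeft_comp, Iso.inv_hom_id]
    simp
  have hc' : μc.inv ▷ cw ≫ μc₃.inv ≫ xc = (α_ _ _ _).hom ≫ cu ◁ μc₁.inv ≫ μc₂.inv := by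
    rw [← cancel_mono (μc₂.hom ≫ cu ◁ μc₁.hom)]
    simp only [Category.assoc, hc]
    simp
  rw [liftCell_hom, liftCell_hom]
  simp only [phiIso, pullIso, Iso.trans_hom, whiskerLeftIso_hom, Iso.symm_hom,
    whiskerRightIso_hom] at hv' huv ⊢
  calc
    _ = 𝟙 (((g ≫ cu) ≫ cv ≫ p) ≫ n) ⊗≫ g ◁ μc.inv ▷ (p ≫ n) ⊗≫ kuv.hom ▷ n ⊗≫
        μb.hom ▷ (f ≫ n) ⊗≫ bu ◁ (kv.inv ▷ n ≫ (α_ g (cv ≫ p) n).hom ≫ g ◁ ((α_ cv p n).hom ≫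
        cv ◁ r.hom ≫ (α_ cv cw (p ≫ m)).inv ≫ μc₁.inv ▷ (p ≫ m) ≫ (α_ cvw p m).inv) ≫
        (α_ g (cvw ≫ p) m).inv) ⊗≫ 𝟙 (((bu ≫ g) ≫ cvw ≫ p) ≫ m) := by bicategory
    _ = 𝟙 (((g ≫ cu) ≫ cv ≫ p) ≫ n) ⊗≫ g ◁ μc.inv ▷ (p ≫ n) ⊗≫ kuv.hom ▷ n ⊗≫
        (μb.hom ▷ (f ≫ n) ≫ (bu ≫ bv) ◁ t.hom) ⊗≫ bu ◁ μb₁.inv ▷ (f ≫ m) ⊗≫ bu ◁ kvw.inv ▷ m ⊗≫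
        𝟙 (((bu ≫ g) ≫ cvw ≫ p) ≫ m) := by rw [hv']; bicategory
    _ = 𝟙 (((g ≫ cu) ≫ cv ≫ p) ≫ n) ⊗≫ g ◁ μc.inv ▷ (p ≫ n) ⊗≫ kuv.hom ▷ n ⊗≫
        buv ◁ t.hom ⊗≫ (μb.hom ▷ bw ≫ (α_ _ _ _).hom ≫ bu ◁ μb₁.inv) ▷ (f ≫ m) ⊗≫
        bu ◁ kvw.inv ▷ m ⊗≫ 𝟙 (((bu ≫ g) ≫ cvw ≫ p) ≫ m) := by
      rw [← whisker_exchange]; bicategory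
    _ = 𝟙 (((g ≫ cu) ≫ cv ≫ p) ≫ n) ⊗≫ g ◁ μc.inv ▷ (p ≫ n) ⊗≫ (kuv.hom ▷ n ≫
        (α_ buv f n).hom ≫ buv ◁ t.hom ≫ (α_ buv bw (f ≫ m)).inv ≫ μb₃.inv ▷ (f ≫ m) ≫
        (α_ buvw' f m).inv) ⊗≫ xb ▷ (f ≫ m) ⊗≫ μb₂.hom ▷ (f ≫ m) ⊗≫
        bu ◁ kvw.inv ▷ m ⊗≫ 𝟙 (((bu ≫ g) ≫ cvw ≫ p) ≫ m) := by
      rw [hb']; bicategory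
    _ = 𝟙 (((g ≫ cu) ≫ cv ≫ p) ≫ n) ⊗≫ g ◁ (μc.inv ▷ (p ≫ n) ≫ cuv ◁ r.hom) ⊗≫
        g ◁ μc₃.inv ▷ (p ≫ m) ⊗≫ (kuvw'.hom ≫ xb ▷ f) ▷ m ⊗≫ μb₂.hom ▷ (f ≫ m) ⊗≫
        bu ◁ kvw.inv ▷ m ⊗≫ 𝟙 (((bu ≫ g) ≫ cvw ≫ p) ≫ m) := by
      rw [huv]; bicategory
    _ = 𝟙 (((g ≫ cu) ≫ cv ≫ p) ≫ n) ⊗≫ g ◁ (cu ≫ cv) ◁ r.hom ⊗≫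
        g ◁ (μc.inv ▷ cw ≫ μc₃.inv ≫ xc) ▷ (p ≫ m) ⊗≫ kuvw.hom ▷ m ⊗≫ μb₂.hom ▷ (f ≫ m) ⊗≫
        bu ◁ kvw.inv ▷ m ⊗≫ 𝟙 (((bu ≫ g) ≫ cvw ≫ p) ≫ m) := by
      rw [← whisker_exchange, ← hk]; bicategory
    _ = _ := by rw [hc']; bicategory

/-- The lifted cells are known only after whiskering with γ(v) ≫ ε. There naturality in u follows
from naturality of the wedge comparison along the product with v. -/
theorem lift_nat {a b c : M} {cu cu' cv cuv cuv' : c ⟶ c} {bu bu' bv buv buv' : b ⟶ b}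
    {g : b ⟶ c} {p : c ⟶ a} {f : b ⟶ a} (μc : cuv ≅ cu ≫ cv) (μc' : cuv' ≅ cu' ≫ cv)
    (μb : buv ≅ bu ≫ bv) (μb' : buv' ≅ bu' ≫ bv) (kv : g ≫ cv ≫ p ≅ bv ≫ f)
    (kuv : g ≫ cuv ≫ p ≅ buv ≫ f) (kuv' : g ≫ cuv' ≫ p ≅ buv' ≫ f)
    (xc : cu ⟶ cu') (xb : bu ⟶ bu') (yc : cuv ⟶ cuv') (yb : buv ⟶ buv')
    (hc : yc ≫ μc'.hom = μc.hom ≫ xc ▷ cv) (hb : yb ≫ μb'.hom = μb.hom ≫ xb ▷ bv)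
    (huv : g ◁ (yc ▷ p) ≫ kuv'.hom = kuv.hom ≫ yb ▷ f)
    (t : g ≫ cu ≅ bu ≫ g) (t' : g ≫ cu' ≅ bu' ≫ g)
    (ht : t.hom ▷ (cv ≫ p) = (liftCell μc μb kv kuv).hom)
    (ht' : t'.hom ▷ (cv ≫ p) = (liftCell μc' μb' kv kuv').hom) :
    (g ◁ xc ≫ t'.hom) ▷ (cv ≫ p) = (t.hom ≫ xb ▷ g) ▷ (cv ≫ p) := by
  have hc' : xc ▷ cv ≫ μc'.inv = μc.inv ≫ yc := by
    rw [Iso.comp_inv_eq, Category.assoc, hc, Iso.inv_hom_id_assoc]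
  rw [comp_whiskerRight, comp_whiskerRight, ht, ht', liftCell_hom, liftCell_hom]
  calc
    _ = 𝟙 ((g ≫ cu) ≫ cv ≫ p) ⊗≫ g ◁ (xc ▷ cv ≫ μc'.inv) ▷ p ⊗≫ kuv'.hom ⊗≫ μb'.hom ▷ f ⊗≫
        bu' ◁ kv.inv ⊗≫ 𝟙 ((bu' ≫ g) ≫ cv ≫ p) := by bicategory
    _ = 𝟙 ((g ≫ cu) ≫ cv ≫ p) ⊗≫ g ◁ μc.inv ▷ p ⊗≫ (g ◁ (yc ▷ p) ≫ kuv'.hom) ⊗≫ μb'.hom ▷ f ⊗≫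
        bu' ◁ kv.inv ⊗≫ 𝟙 ((bu' ≫ g) ≫ cv ≫ p) := by rw [hc']; bicategory
    _ = 𝟙 ((g ≫ cu) ≫ cv ≫ p) ⊗≫ g ◁ μc.inv ▷ p ⊗≫ kuv.hom ⊗≫ (yb ≫ μb'.hom) ▷ f ⊗≫
        bu' ◁ kv.inv ⊗≫ 𝟙 ((bu' ≫ g) ≫ cv ≫ p) := by rw [huv]; bicategory
    _ = 𝟙 ((g ≫ cu) ≫ cv ≫ p) ⊗≫ g ◁ μc.inv ▷ p ⊗≫ kuv.hom ⊗≫ μb.hom ▷ f ⊗≫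
        (xb ▷ (bv ≫ f) ≫ bu' ◁ kv.inv) ⊗≫ 𝟙 ((bu' ≫ g) ≫ cv ≫ p) := by rw [hb]; bicategory
    _ = _ := by rw [← whisker_exchange]; bicategory

/-- After whiskering at w, the cell at u is taken at index vw and the cell at v at index w. In their
pasting `kvw.inv` meets `kvw.hom` and cancels, and associativity turns the rest into the cell of the
product uv. -/
theorem lift_tri {a b c : M} {cu cv cw cuv cvw cuvw cuvw' : c ⟶ c}
    {bu bv bw buv bvw buvw buvw' : b ⟶ b}
    {g : b ⟶ c} {p : c ⟶ a} {f : b ⟶ a} (μc : cuv ≅ cu ≫ cv) (μb : buv ≅ bu ≫ bv)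
    (μc₁ : cvw ≅ cv ≫ cw) (μb₁ : bvw ≅ bv ≫ bw) (μc₂ : cuvw ≅ cu ≫ cvw) (μb₂ : buvw ≅ bu ≫ bvw)
    (μc₃ : cuvw' ≅ cuv ≫ cw) (μb₃ : buvw' ≅ buv ≫ bw) (kw : g ≫ cw ≫ p ≅ bw ≫ f)
    (kvw : g ≫ cvw ≫ p ≅ bvw ≫ f) (kuvw : g ≫ cuvw ≫ p ≅ buvw ≫ f)
    (kuvw' : g ≫ cuvw' ≫ p ≅ buvw' ≫ f) (xc : cuvw' ⟶ cuvw) (xb : buvw' ⟶ buvw)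
    (hc : xc ≫ μc₂.hom ≫ cu ◁ μc₁.hom = μc₃.hom ≫ μc.hom ▷ cw ≫ (α_ _ _ _).hom)
    (hb : xb ≫ μb₂.hom ≫ bu ◁ μb₁.hom = μb₃.hom ≫ μb.hom ▷ bw ≫ (α_ _ _ _).hom)
    (hk : g ◁ (xc ▷ p) ≫ kuvw.hom = kuvw'.hom ≫ xb ▷ f)
    (tu : g ≫ cu ≅ bu ≫ g) (tv : g ≫ cv ≅ bv ≫ g) (tuv : g ≫ cuv ≅ buv ≫ g)
    (hu : tu.hom ▷ (cvw ≫ p) = (liftCell μc₂ μb₂ kvw kuvw).hom)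
    (hv : tv.hom ▷ (cw ≫ p) = (liftCell μc₁ μb₁ kw kvw).hom)
    (huv : tuv.hom ▷ (cw ≫ p) = (liftCell μc₃ μb₃ kw kuvw').hom) :
    tuv.hom ▷ (cw ≫ p) = (tgtPaste μb μc tu.hom tv.hom) ▷ (cw ≫ p) := by
  have hb' : μb₃.hom ≫ μb.hom ▷ bw = xb ≫ μb₂.hom ≫ bu ◁ μb₁.hom ≫ (α_ _ _ _).inv := by
    rw [← cancel_mono (α_ _ _ _).hom]; simp [hb]
  have hc' : μc₃.inv ≫ xc = μc.hom ▷ cw ≫ (α_ _ _ _).hom ≫ cu ◁ μc₁.inv ≫ μc₂.inv := by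
    rw [← cancel_mono (μc₂.hom ≫ cu ◁ μc₁.hom)]
    simp only [Category.assoc, hc]
    simp
  rw [liftCell_hom] at hu hv huv
  rw [huv, tgtPaste]
  symm
  calc
    _ = 𝟙 ((g ≫ cuv) ≫ cw ≫ p) ⊗≫ g ◁ μc.hom ▷ (cw ≫ p) ⊗≫
        (tu.hom ▷ (cv ≫ cw ≫ p) ≫ (bu ≫ g) ◁ 𝟙 (cv ≫ cw ≫ p)) ⊗≫
        bu ◁ (tv.hom ▷ (cw ≫ p)) ⊗≫ μb.inv ▷ (g ≫ cw ≫ p) ⊗≫ 𝟙 ((buv ≫ g) ≫ cw ≫ p) := by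
      bicategory
    -- The trivial pair built from `μc₁` is inserted because `hu` describes `tu` only at the single
    -- index vw, not at the composite of the actions of v and w.
    _ = 𝟙 ((g ≫ cuv) ≫ cw ≫ p) ⊗≫ g ◁ μc.hom ▷ (cw ≫ p) ⊗≫ (tu.hom ▷ (cv ≫ cw ≫ p) ≫
        (bu ≫ g) ◁ ((α_ _ _ _).inv ≫ (μc₁.inv ≫ μc₁.hom) ▷ p ≫ (α_ _ _ _).hom)) ⊗≫
        bu ◁ (tv.hom ▷ (cw ≫ p)) ⊗≫ μb.inv ▷ (g ≫ cw ≫ p) ⊗≫ 𝟙 ((buv ≫ g) ≫ cw ≫ p) := by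
      rw [μc₁.inv_hom_id]; bicategory
    _ = 𝟙 ((g ≫ cuv) ≫ cw ≫ p) ⊗≫ g ◁ μc.hom ▷ (cw ≫ p) ⊗≫ (tu.hom ▷ (cv ≫ cw ≫ p) ≫
        (bu ≫ g) ◁ ((α_ _ _ _).inv ≫ μc₁.inv ▷ p)) ⊗≫ bu ◁ g ◁ μc₁.hom ▷ p ⊗≫
        bu ◁ (tv.hom ▷ (cw ≫ p)) ⊗≫ μb.inv ▷ (g ≫ cw ≫ p) ⊗≫ 𝟙 ((buv ≫ g) ≫ cw ≫ p) := by
      bicategory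
    _ = 𝟙 ((g ≫ cuv) ≫ cw ≫ p) ⊗≫ g ◁ μc.hom ▷ (cw ≫ p) ⊗≫ g ◁ cu ◁ μc₁.inv ▷ p ⊗≫
        tu.hom ▷ (cvw ≫ p) ⊗≫
        bu ◁ g ◁ μc₁.hom ▷ p ⊗≫
        bu ◁ (tv.hom ▷ (cw ≫ p)) ⊗≫ μb.inv ▷ (g ≫ cw ≫ p) ⊗≫ 𝟙 ((buv ≫ g) ≫ cw ≫ p) := by
      rw [← whisker_exchange]; bicategory
    _ = 𝟙 ((g ≫ cuv) ≫ cw ≫ p) ⊗≫ g ◁ μc.hom ▷ (cw ≫ p) ⊗≫ g ◁ cu ◁ μc₁.inv ▷ p ⊗≫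
        g ◁ μc₂.inv ▷ p ⊗≫ kuvw.hom ⊗≫
        μb₂.hom ▷ f ⊗≫ bu ◁ kvw.inv ⊗≫ bu ◁ g ◁ (μc₁.hom ≫ μc₁.inv) ▷ p ⊗≫ bu ◁ kvw.hom ⊗≫
        bu ◁ μb₁.hom ▷ f ⊗≫ bu ◁ bv ◁ kw.inv ⊗≫
        μb.inv ▷ (g ≫ cw ≫ p) ⊗≫ 𝟙 ((buv ≫ g) ≫ cw ≫ p) := by
      rw [hu, hv]; bicategory
    _ = 𝟙 ((g ≫ cuv) ≫ cw ≫ p) ⊗≫ g ◁ μc.hom ▷ (cw ≫ p) ⊗≫ g ◁ cu ◁ μc₁.inv ▷ p ⊗≫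
        g ◁ μc₂.inv ▷ p ⊗≫ kuvw.hom ⊗≫
        μb₂.hom ▷ f ⊗≫ bu ◁ (kvw.inv ≫ kvw.hom) ⊗≫
        bu ◁ μb₁.hom ▷ f ⊗≫ ((bu ≫ bv) ◁ kw.inv ≫
        μb.inv ▷ (g ≫ cw ≫ p)) ⊗≫ 𝟙 ((buv ≫ g) ≫ cw ≫ p) := by
      rw [μc₁.hom_inv_id]; bicategory
    _ = 𝟙 ((g ≫ cuv) ≫ cw ≫ p) ⊗≫
        g ◁ (μc.hom ▷ cw ≫ (α_ _ _ _).hom ≫ cu ◁ μc₁.inv ≫ μc₂.inv) ▷ p ⊗≫ kuvw.hom ⊗≫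
        μb₂.hom ▷ f ⊗≫ bu ◁ μb₁.hom ▷ f ⊗≫ μb.inv ▷ (bw ≫ f) ⊗≫ buv ◁ kw.inv ⊗≫
        𝟙 ((buv ≫ g) ≫ cw ≫ p) := by
      rw [kvw.inv_hom_id, whisker_exchange]; bicategory
    _ = 𝟙 ((g ≫ cuv) ≫ cw ≫ p) ⊗≫ g ◁ μc₃.inv ▷ p ⊗≫ (g ◁ (xc ▷ p) ≫ kuvw.hom) ⊗≫
        μb₂.hom ▷ f ⊗≫ bu ◁ μb₁.hom ▷ f ⊗≫ μb.inv ▷ (bw ≫ f) ⊗≫ buv ◁ kw.inv ⊗≫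
        𝟙 ((buv ≫ g) ≫ cw ≫ p) := by
      rw [← hc']; bicategory
    _ = 𝟙 ((g ≫ cuv) ≫ cw ≫ p) ⊗≫ g ◁ μc₃.inv ▷ p ⊗≫ kuvw'.hom ⊗≫
        (xb ≫ μb₂.hom ≫ bu ◁ μb₁.hom ≫ (α_ _ _ _).inv) ▷ f ⊗≫ μb.inv ▷ (bw ≫ f) ⊗≫
        buv ◁ kw.inv ⊗≫ 𝟙 ((buv ≫ g) ≫ cw ≫ p) := by
      rw [hk]; bicategory
    _ = 𝟙 ((g ≫ cuv) ≫ cw ≫ p) ⊗≫ g ◁ μc₃.inv ▷ p ⊗≫ kuvw'.hom ⊗≫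
        μb₃.hom ▷ f ⊗≫ (μb.hom ≫ μb.inv) ▷ (bw ≫ f) ⊗≫
        buv ◁ kw.inv ⊗≫ 𝟙 ((buv ≫ g) ≫ cw ≫ p) := by
      rw [← hb']; bicategory
    _ = _ := by rw [μb.hom_inv_id]; bicategory

/-- For u the unit of `I`, naturality of the wedge comparison along the unit isomorphism relates
`kv'` to `kv`, which then cancels against `kv.inv`. -/
theorem lift_one {a b c : M} {c₁ cv cv' : c ⟶ c} {b₁ bv bv' : b ⟶ b}
    {g : b ⟶ c} {p : c ⟶ a} {f : b ⟶ a} (μc : cv' ≅ c₁ ≫ cv) (μb : bv' ≅ b₁ ≫ bv)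
    (ηc : c₁ ≅ 𝟙 c) (ηb : b₁ ≅ 𝟙 b) (kv : g ≫ cv ≫ p ≅ bv ≫ f) (kv' : g ≫ cv' ≫ p ≅ bv' ≫ f)
    (xc : cv' ⟶ cv) (xb : bv' ⟶ bv) (hc : xc = μc.hom ≫ ηc.hom ▷ cv ≫ (λ_ _).hom)
    (hb : xb = μb.hom ≫ ηb.hom ▷ bv ≫ (λ_ _).hom)
    (hk : g ◁ (xc ▷ p) ≫ kv.hom = kv'.hom ≫ xb ▷ f)
    (t : g ≫ c₁ ≅ b₁ ≫ g) (ht : t.hom ▷ (cv ≫ p) = (liftCell μc μb kv kv').hom) :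
    t.hom ▷ (cv ≫ p) =
      (g ◁ ηc.hom ≫ (ρ_ g).hom ≫ (λ_ g).inv ≫ ηb.inv ▷ g) ▷ (cv ≫ p) := by
  have hb' : μb.hom = xb ≫ (λ_ _).inv ≫ ηb.inv ▷ bv := by rw [hb]; simp
  have hc' : μc.inv ≫ xc = ηc.hom ▷ cv ≫ (λ_ _).hom := by rw [hc]; simp
  rw [ht, liftCell_hom, hb']
  calc
    _ = 𝟙 ((g ≫ c₁) ≫ cv ≫ p) ⊗≫ g ◁ μc.inv ▷ p ⊗≫ (kv'.hom ≫ xb ▷ f) ⊗≫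
        (ηb.inv ▷ (bv ≫ f) ≫ b₁ ◁ kv.inv) ⊗≫ 𝟙 ((b₁ ≫ g) ≫ cv ≫ p) := by bicategory
    _ = 𝟙 ((g ≫ c₁) ≫ cv ≫ p) ⊗≫ g ◁ (μc.inv ≫ xc) ▷ p ⊗≫ (kv.hom ≫ kv.inv) ⊗≫
        ηb.inv ▷ (g ≫ cv ≫ p) ⊗≫ 𝟙 ((b₁ ≫ g) ≫ cv ≫ p) := by
      rw [← hk, ← whisker_exchange]; bicategory
    _ = _ := by rw [kv.hom_inv_id, hc']; bicategory

/-- The comparison of the composite of the lift with `f`. -/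
def liftUnit {a b c : M} {c₁ : c ⟶ c} {b₁ : b ⟶ b} {g : b ⟶ c} {p : c ⟶ a} {f : b ⟶ a}
    (ηc : c₁ ≅ 𝟙 c) (ηb : b₁ ≅ 𝟙 b) (k : g ≫ c₁ ≫ p ≅ b₁ ≫ f) : g ≫ p ≅ f :=
  whiskerLeftIso g ((λ_ p).symm ≪≫ whiskerRightIso ηc.symm p) ≪≫ k ≪≫ whiskerRightIso ηb f ≪≫ λ_ f

/-- The wedge isomorphism is recovered from its component at the unit and the equivariance cells of
the lift: the lifted cell at v, whiskered at the unit, contains the inverse of the unit component,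
which cancels. -/
theorem liftUnit_cell {a b c : M} {c₁ cv cv' : c ⟶ c} {b₁ bv bv' : b ⟶ b}
    {g : b ⟶ c} {p : c ⟶ a} {f : b ⟶ a} (μc : cv' ≅ cv ≫ c₁) (μb : bv' ≅ bv ≫ b₁)
    (ηc : c₁ ≅ 𝟙 c) (ηb : b₁ ≅ 𝟙 b) (k : g ≫ c₁ ≫ p ≅ b₁ ≫ f) (kv : g ≫ cv ≫ p ≅ bv ≫ f)
    (kv' : g ≫ cv' ≫ p ≅ bv' ≫ f)
    (xc : cv' ≅ cv) (xb : bv' ⟶ bv) (hc : xc.hom = μc.hom ≫ cv ◁ ηc.hom ≫ (ρ_ _).hom)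
    (hb : xb = μb.hom ≫ bv ◁ ηb.hom ≫ (ρ_ _).hom)
    (hk : g ◁ (xc.hom ▷ p) ≫ kv.hom = kv'.hom ≫ xb ▷ f)
    (t : g ≫ cv ≅ bv ≫ g) (ht : t.hom ▷ (c₁ ≫ p) = (liftCell μc μb k kv').hom) :
    (α_ _ _ _).inv ≫ t.hom ▷ p ≫ (α_ _ _ _).hom ≫ bv ◁ (liftUnit ηc ηb k).hom = kv.hom := by
  have hc' : xc.inv = (ρ_ _).inv ≫ cv ◁ ηc.inv ≫ μc.inv := by
    rw [← cancel_epi xc.hom, Iso.hom_inv_id, hc]; simp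
  have hk' : kv.hom = g ◁ (xc.inv ▷ p) ≫ kv'.hom ≫ xb ▷ f := by
    rw [← hk]; simp [← Bicategory.whiskerLeft_comp_assoc, ← comp_whiskerRight]
  rw [liftCell_hom] at ht
  rw [hk', hc', hb]
  simp only [liftUnit, Iso.trans_hom, whiskerLeftIso_hom, Iso.symm_hom, whiskerRightIso_hom]
  calc
    _ = 𝟙 (g ≫ cv ≫ p) ⊗≫ (t.hom ▷ (𝟙 c ≫ p) ≫ (bv ≫ g) ◁ (ηc.inv ▷ p)) ⊗≫ bv ◁ k.hom ⊗≫
        bv ◁ ηb.hom ▷ f ⊗≫ 𝟙 (bv ≫ f) := by bicategory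
    _ = 𝟙 (g ≫ cv ≫ p) ⊗≫ g ◁ cv ◁ ηc.inv ▷ p ⊗≫ t.hom ▷ (c₁ ≫ p) ⊗≫ bv ◁ k.hom ⊗≫
        bv ◁ ηb.hom ▷ f ⊗≫ 𝟙 (bv ≫ f) := by rw [← whisker_exchange]; bicategory
    _ = 𝟙 (g ≫ cv ≫ p) ⊗≫ g ◁ cv ◁ ηc.inv ▷ p ⊗≫ g ◁ μc.inv ▷ p ⊗≫ kv'.hom ⊗≫ μb.hom ▷ f ⊗≫
        bv ◁ (k.inv ≫ k.hom) ⊗≫ bv ◁ ηb.hom ▷ f ⊗≫ 𝟙 (bv ≫ f) := by rw [ht]; bicategory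
    _ = _ := by rw [k.inv_hom_id]; bicategory

/-- Equivariance of the comparison between the composite of the lift and `f`. By `hu` the pasting
with `tu` is the component `ku`, and what remains is the wedge condition of the comparison at the
unit. -/
theorem liftUnit_comm {a b c : M} {n m : a ⟶ a} {c₁ cu cu' : c ⟶ c} {b₁ bu bu' : b ⟶ b}
    {g : b ⟶ c} {p : c ⟶ a} {f : b ⟶ a} (μc : cu' ≅ c₁ ≫ cu) (μb : bu' ≅ b₁ ≫ bu)
    (ηc : c₁ ≅ 𝟙 c) (ηb : b₁ ≅ 𝟙 b) (k : g ≫ c₁ ≫ p ≅ b₁ ≫ f) (ku : g ≫ cu ≫ p ≅ bu ≫ f)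
    (ku' : g ≫ cu' ≫ p ≅ bu' ≫ f)
    (xc : cu' ≅ cu) (xb : bu' ⟶ bu) (hc : xc.hom = μc.hom ≫ ηc.hom ▷ cu ≫ (λ_ _).hom)
    (hb : xb = μb.hom ≫ ηb.hom ▷ bu ≫ (λ_ _).hom)
    (hk : g ◁ (xc.hom ▷ p) ≫ ku.hom = ku'.hom ≫ xb ▷ f)
    (r : p ≫ n ≅ cu ≫ p ≫ m) (t : f ≫ n ≅ bu ≫ f ≫ m)
    (h₁ : k.hom ▷ n ≫ (phiIso t μb).hom = (pullIso g (phiIso r μc)).hom ≫ ku'.hom ▷ m)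
    (tu : g ≫ cu ≅ bu ≫ g)
    (hu : (α_ _ _ _).inv ≫ tu.hom ▷ p ≫ (α_ _ _ _).hom ≫ bu ◁ (liftUnit ηc ηb k).hom = ku.hom) :
    (liftUnit ηc ηb k).hom ▷ n ≫ t.hom =
      (compT tu r).hom ≫ bu ◁ (liftUnit ηc ηb k).hom ▷ m := by
  have hc' : xc.inv = (λ_ _).inv ≫ ηc.inv ▷ cu ≫ μc.inv := by
    rw [← cancel_epi xc.hom, Iso.hom_inv_id, hc]; simp
  have hk' : ku.hom = g ◁ (xc.inv ▷ p) ≫ ku'.hom ≫ xb ▷ f := by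
    rw [← hk]; simp [← Bicategory.whiskerLeft_comp_assoc, ← comp_whiskerRight]
  have e₁ : (compT tu r).hom ≫ bu ◁ (liftUnit ηc ηb k).hom ▷ m =
      𝟙 ((g ≫ p) ≫ n) ⊗≫ g ◁ r.hom ⊗≫ ku.hom ▷ m ⊗≫ 𝟙 (bu ≫ f ≫ m) := by
    rw [← hu]
    simp only [compT, Iso.trans_hom, whiskerLeftIso_hom, Iso.symm_hom, whiskerRightIso_hom]
    bicategory
  rw [e₁, hk', hc', hb]
  simp only [phiIso, pullIso, liftUnit, Iso.trans_hom, whiskerLeftIso_hom, Iso.symm_hom,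
    whiskerRightIso_hom] at h₁ ⊢
  calc
    _ = 𝟙 ((g ≫ p) ≫ n) ⊗≫ g ◁ ηc.inv ▷ (p ≫ n) ⊗≫ k.hom ▷ n ⊗≫
        (ηb.hom ▷ (f ≫ n) ≫ 𝟙 b ◁ t.hom) ⊗≫ 𝟙 (bu ≫ f ≫ m) := by bicategory
    _ = 𝟙 ((g ≫ p) ≫ n) ⊗≫ g ◁ ηc.inv ▷ (p ≫ n) ⊗≫ k.hom ▷ n ⊗≫
        b₁ ◁ t.hom ⊗≫ 𝟙 (b₁ ≫ bu) ▷ (f ≫ m) ⊗≫ ηb.hom ▷ (bu ≫ f ≫ m) ⊗≫ 𝟙 (bu ≫ f ≫ m) := by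
      rw [← whisker_exchange]; bicategory
    _ = 𝟙 ((g ≫ p) ≫ n) ⊗≫ g ◁ ηc.inv ▷ (p ≫ n) ⊗≫ (k.hom ▷ n ≫ (α_ b₁ f n).hom ≫
        b₁ ◁ t.hom ≫ (α_ b₁ bu (f ≫ m)).inv ≫ μb.inv ▷ (f ≫ m) ≫ (α_ bu' f m).inv) ⊗≫
        μb.hom ▷ (f ≫ m) ⊗≫ ηb.hom ▷ (bu ≫ f ≫ m) ⊗≫ 𝟙 (bu ≫ f ≫ m) := by
      rw [← μb.inv_hom_id]; bicategory
    _ = 𝟙 ((g ≫ p) ≫ n) ⊗≫ g ◁ (ηc.inv ▷ (p ≫ n) ≫ c₁ ◁ r.hom) ⊗≫ g ◁ μc.inv ▷ (p ≫ m) ⊗≫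
        ku'.hom ▷ m ⊗≫
        μb.hom ▷ (f ≫ m) ⊗≫ ηb.hom ▷ (bu ≫ f ≫ m) ⊗≫ 𝟙 (bu ≫ f ≫ m) := by
      rw [h₁]; bicategory
    _ = _ := by rw [← whisker_exchange]; bicategory

end Coherence

section Coherence

open Bicategory

theorem srcIso_epsIso {M : Type u₂} [Bicategory.{w₂, v₂} M] {a b : M} {ef en : b ⟶ b} {f n : a ⟶ a}
    {p q : b ⟶ a} (ν : ef ≅ 𝟙 b) (σ : p ≫ n ≅ q ≫ f) (k : en ≫ p ≅ q) :
    srcIso ν (epsIso ν σ k) = σ ≪≫ whiskerRightIso k.symm f ≪≫ α_ _ _ _ := by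
  ext
  simp [srcIso, epsIso]

end Coherence

/-! ### The universal wedge as the wedge of the evaluation at the unit. -/

section Bicat

open Bicategory

variable {V : Type u'} [Category.{v'} V] [MonoidalCategory V]
variable {I : Type w} [Category.{w} I] [MonoidalCategory I] [EnrichedOrdinaryCategory V I]
variable {M : Type u₂} [Bicategory.{w₂, v₂} M] [VCatCategory V M]

variable [MonoidalClosed V] [HasLimitsOfSize.{w, w} V] [IsBase V]

namespace Wedge

variable {s : Side} {A : IObj V I M} {Z : M}

/-- Isomorphic wedges induce isomorphic functors. -/
def pullFunctorIso {W W' : Wedge V s A Z} (i : W ≅ W') (Z' : M) :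
    W.pullFunctor Z' ≅ W'.pullFunctor Z' :=
  NatIso.ofComponents
    (fun g => isoMk (fun v => whiskerLeftIso g (isoApp i v))
      (fun h => by
        change g ◁ W.e.map h ≫ g ◁ i.hom.θ.app _ = g ◁ i.hom.θ.app _ ≫ g ◁ W'.e.map h
        rw [← Bicategory.whiskerLeft_comp, i.hom.θ.naturality, Bicategory.whiskerLeft_comp])
      (fun u v => pull_nat_obj g _ _ _ _ (i.hom.comm u v)))
    (fun θ => hom_ext fun v => (whisker_exchange θ (i.hom.θ.app v)).symm)

end Wedge

theorem Side.assoc_one_mul (s : Side) (v u : I) :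
    (s.assoc (tunit I) v u).hom ≫ (s.one_mul (s.mul v u)).hom =
      s.mulMap (s.one_mul v).hom (𝟙 u) := by
  cases s <;> simp

theorem Side.one_mul_nat (s : Side) {u v : I} (h : u ⟶ v) :
    s.mulMap (𝟙 (tunit I)) h ≫ (s.one_mul v).hom = (s.one_mul u).hom ≫ h := by
  cases s <;> simp

namespace InvData

/-- The isomorphism `κ₁` for the action of the object `D.act.ob`. -/
def evAct : (s : Side) → {A : IObj V I M} → (D : InvData V s A) → (y : I) →
    (D.act.ob.act'.obj y ≫ D.wedge.e.obj (tunit I) ≅ D.wedge.e.obj (s.mul (tunit I) y))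
  | .l, _, D, y => D.κ₁ y
  | .r, _, D, y => D.κ₁ y

/-- The isomorphism `κ₂` for the action of the object `D.act.ob`. -/
def evAct₂ : (s : Side) → {A : IObj V I M} → (D : InvData V s A) → (u v : I) →
    (D.act.ob.act'.obj u ≫ D.wedge.e.obj (s.mul (tunit I) v) ≅
      D.wedge.e.obj (s.mul (s.mul (tunit I) u) v))
  | .l, _, D, u, v => D.κ₂ u v
  | .r, _, D, u, v => D.κ₂ u v

variable {s : Side} {A : IObj V I M} (D : InvData V s A)

/-- The evaluation at the unit, with the underlying morphism `e(𝟙)`. -/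
def ev : EquivMor D.act.ob A :=
  EquivMor.mkSide s (D.wedge.e.obj (tunit I)) (epsτ s D) (isEquivariant_epsτ s D)

theorem eps_eq_ev : D.eps = D.ev := EquivMor.ofSide_eq_mkSide _ _ _ _

theorem ev_t (u : I) : D.ev.t u =
    D.wedge.σ u (tunit I) ≪≫ whiskerRightIso (evAct s D u).symm _ ≪≫ α_ _ _ _ := by
  refine (congrArg (srcIso (D.act.ob.muteIso u))
    (EquivMor.mkSide_τs (A := D.act.ob) (B := A) s _ _ _ u)).trans ?_
  cases s <;> exact srcIso_epsIso _ _ _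

variable [Bicategory.Strict M] [IsStrictMonoidal I]

/-- The universal wedge is the wedge of the evaluation at the unit. -/
def evWedgeIso : D.ev.wedge ≅ D.wedge :=
  Wedge.isoMk (F := D.ev.wedge) (G := D.wedge)
    -- The action on Inv_s(A) shifts the argument of the universal wedge, so γ(v) ≫ e(𝟙) is e at the
    -- product of the unit with v, that is e(v).
    (fun v => evAct s D v ≪≫ D.wedge.e.mapIso (s.one_mul v))
    (fun {v v'} h => by
      have h₁ := D.κ₁_nat h
      have h₂ := s.one_mul_nat h
      have h₃ : D.act.ob.act'.map h ▷ D.wedge.e.obj (tunit I) ≫ (evAct s D v').hom =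
        (evAct s D v).hom ≫ D.wedge.e.map (s.mulMap (𝟙 (tunit I)) h) := by
        cases s <;> exact h₁
      change D.act.ob.act'.map h ▷ D.wedge.e.obj (tunit I) ≫
        (evAct s D v' ≪≫ D.wedge.e.mapIso (s.one_mul v')).hom =
        (evAct s D v ≪≫ D.wedge.e.mapIso (s.one_mul v)).hom ≫ D.wedge.e.map h
      simp only [Iso.trans_hom, Functor.mapIso_hom, Category.assoc]
      rw [reassoc_of% h₃, ← Functor.map_comp, h₂, Functor.map_comp])
    (fun u v => by
      have h := phi_eps (D.act.ob.μ v u) (D.wedge.σ u (tunit I)) (D.wedge.σ u v)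
        (D.wedge.σ u (s.mul (tunit I) v)) (evAct s D u) (evAct s D v) (evAct s D (s.mul v u))
        (evAct₂ s D v u)
        (D.wedge.e.mapIso (s.one_mul v)) (D.wedge.e.mapIso (s.one_mul (s.mul v u)))
        (D.wedge.e.map (s.mulMap (s.one_mul v).hom (𝟙 u)))
        (D.wedge.e.map (s.assoc (tunit I) v u).hom)
        (D.wedge.nat_obj u (s.one_mul v).hom)
        (by have := D.κ₂_σ v u; cases s <;> exact this)
        (by have := D.κ₁_mul v u; cases s <;> exact this)
        (by rw [Functor.mapIso_hom, ← Functor.map_comp, s.assoc_one_mul])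
      rw [← D.ev_t] at h
      exact h)

/-- From here on the universal property of Inv_s(A) involves only the equivariant morphism `D.ev`.
-/
theorem universal_ev (Z : M) : IsVEquivalence V (D.ev.wedge.pullFunctor Z) :=
  (D.universal Z).of_iso (Wedge.pullFunctorIso D.evWedgeIso.symm Z)

end InvData

end Bicat

section Coherence

open Bicategory

theorem whisker_cell_comm {M : Type u₂} [Bicategory.{w₂, v₂} M] {a b c : M} {bv : b ⟶ b}
    {cv : c ⟶ c} {g g' : b ⟶ c} (p : c ⟶ a) (θ : g ⟶ g') (t : g ≫ cv ⟶ bv ≫ g)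
    (t' : g' ≫ cv ⟶ bv ≫ g') (h : θ ▷ cv ≫ t' = t ≫ bv ◁ θ) :
    θ ▷ (cv ≫ p) ≫ (α_ _ _ _).inv ≫ t' ▷ p ≫ (α_ _ _ _).hom =
      ((α_ _ _ _).inv ≫ t ▷ p ≫ (α_ _ _ _).hom) ≫ bv ◁ (θ ▷ p) := by
  rw [whiskerRight_comp, Category.assoc, Category.assoc, Iso.hom_inv_id_assoc,
    ← comp_whiskerRight_assoc, h]
  simp

end Coherence

/-! ### Lifting 2-cells and equivariant morphisms through a universal wedge. -/

section Bicat

open Bicategory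

variable {V : Type u'} [Category.{v'} V] [MonoidalCategory V]
variable {I : Type w} [Category.{w} I] [MonoidalCategory I] [EnrichedOrdinaryCategory V I]
variable {M : Type u₂} [Bicategory.{w₂, v₂} M] [VCatCategory V M]
variable [MonoidalClosed V] [HasLimitsOfSize.{w, w} V] [IsBase V]
variable [Bicategory.Strict M] [IsStrictMonoidal I]
variable {s : Side} {b c : M} {β : SAct V I s b} {γ : SAct V I s c} {A : IObj V I M}
  (E : EquivMor γ.ob A)

namespace EquivMor

theorem wedgeCmp_naturality {F F' : EquivMor β.ob γ.ob} (a : F ⟶ F') :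
    (E.wedge.pullFunctor b).map a.θ ≫ (F'.wedgeCmp E).hom =
      (F.wedgeCmp E).hom ≫ wedgeMap (F := F.cmp E) (G := F'.cmp E) (whiskR a E) := by
  refine Wedge.hom_ext fun v => ?_
  exact whisker_cell_comm E.f a.θ _ _ (a.comm_ts v)

/-- A 2-cell between composites with `E` induces a morphism between their wedges, which are the
wedge of `E` pulled back along the two morphisms. It lifts uniquely to a 2-cell of `M`. Equivariance
of this 2-cell is tested on the components of the wedge, and the component at the unit shows that
the two constructions are inverse. -/
theorem vff_postcomp_of_wedge (hE : VFF V (E.wedge.pullFunctor b)) :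
    VFF V (postcomp β.ob E : (β.ob ⟶ γ.ob) ⥤ (β.ob ⟶ A)) := by
  intro F F'
  obtain ⟨ψ, hψ, h₁, h₂⟩ := hE (EquivMor.f F) (EquivMor.f F')
  let w (h : F.cmp E ⟶ F'.cmp E) : E.wedge.pull F.f ⟶ E.wedge.pull F'.f :=
    (F.wedgeCmp E).hom ≫ wedgeMap h ≫ (F'.wedgeCmp E).inv
  have hw (h : F.cmp E ⟶ F'.cmp E) (v : I) :
      ψ (w h) ▷ (γ.ob.act'.obj v ≫ E.f) ≫ (α_ _ _ _).inv ≫ (F'.ts v).hom ▷ E.f ≫ (α_ _ _ _).hom =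
        ((α_ _ _ _).inv ≫ (F.ts v).hom ▷ E.f ≫ (α_ _ _ _).hom) ≫ β.ob.act'.obj v ◁ h.θ := by
    -- The defining property of the lift, with the comparison `F'.wedgeCmp E` moved to the other
    -- side so that no inverse cells appear.
    have e : w h ≫ (F'.wedgeCmp E).hom = (F.wedgeCmp E).hom ≫ wedgeMap h := by simp [w]
    exact congrArg (fun x => Wedge.Hom.θ x |>.app v)
      ((congrArg (· ≫ (F'.wedgeCmp E).hom) (h₁ (w h))).trans e)
  have hc (h : F.cmp E ⟶ F'.cmp E) (u : I) :
      ψ (w h) ▷ γ.ob.act'.obj u ≫ (F'.ts u).hom = (F.ts u).hom ≫ β.ob.act'.obj u ◁ ψ (w h) := by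
    have := hE.faithful
    apply (E.wedge.pullFunctor b).map_injective
    refine Wedge.hom_ext fun v => ?_
    exact lift_hom_comm (γ.ob.μ u v) (β.ob.μ u v) _ _ _ (F'.ts v) _ _ (F.ts_tri u v)
      (F'.ts_tri u v) (ψ (w h)) h.θ (hw h v) (hw h _)
  refine ⟨fun h => homMk s (ψ (w h)) (comm_of_ts _ (hc h)), vrep_of (hψ.comp ?_),
    fun h => hom_ext ?_, fun a => hom_ext ?_⟩
  · exact (VRep.postcomp (Wedge.vrep_of fun v => (vrep_θ _ _).whiskerLeft _) _).precomp _
  · exact lift_hom_one γ.ob.η β.ob.η _ _ F.ts_one F'.ts_one (ψ (w h)) h.θ (hw h _)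
  · refine Eq.trans (congrArg ψ ?_) (h₂ (Hom.θ a))
    exact (Category.assoc _ _ _).symm.trans
      ((Iso.eq_comp_inv _).2 (wedgeCmp_naturality E a)).symm

/-- The wedge of `f` remembers the action β: it takes the value β(uv) ≫ f ≅ β(u) ≫ β(v) ≫ f at uv.
So g ≫ γ(u) and β(u) ≫ g induce isomorphic wedges from the wedge of `E`, and are isomorphic.
Faithfulness yields the axioms of an equivariance structure, and the unit component compares the
composite with `f`. -/
theorem exists_lift_of_wedge (hE : (E.wedge.pullFunctor b).IsEquivalence) (f : EquivMor β.ob A) :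
    ∃ G : EquivMor β.ob γ.ob, Nonempty (G.cmp E ≅ f) := by
  let g := (E.wedge.pullFunctor b).objPreimage f.wedge
  let k : E.wedge.pull g ≅ f.wedge := (E.wedge.pullFunctor b).objObjPreimageIso f.wedge
  let kv (v : I) : g ≫ γ.ob.act'.obj v ≫ E.f ≅ β.ob.act'.obj v ≫ f.f := Wedge.isoApp k v
  have kv_nat {v v' : I} (h : v ⟶ v') : g ◁ (γ.ob.act'.map h ▷ E.f) ≫ (kv v').hom =
    (kv v).hom ≫ β.ob.act'.map h ▷ f.f := k.hom.θ.naturality h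
  have kv_σ (u v : I) : (kv v).hom ▷ (A.actOn s).obj u ≫ (phiIso (f.t u) (β.ob.μ v u)).hom =
    (pullIso g (phiIso (E.t u) (γ.ob.μ v u))).hom ≫ (kv (s.mul v u)).hom ▷ (A.actOn s.op).obj u :=
    k.hom.comm u v
  have μ_nat_left (X : IObj V I M) (u : I) {v v' : I} (h : v ⟶ v') :
      X.act'.map (X.side.mulMap (𝟙 u) h) ≫ (X.μ u v').hom =
        (X.μ u v).hom ≫ X.act'.obj u ◁ X.act'.map h := by
    simpa using X.μ_nat (𝟙 u) h
  have μ_nat_right (X : IObj V I M) {u u' : I} (h : u ⟶ u') (v : I) :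
      X.act'.map (X.side.mulMap h (𝟙 v)) ≫ (X.μ u' v).hom =
        (X.μ u v).hom ≫ X.act'.map h ▷ X.act'.obj v := by
    simpa using X.μ_nat h (𝟙 v)
  -- The chain g ≫ γ(u) ≫ γ(v) ≫ ε ≅ g ≫ γ(uv) ≫ ε ≅ β(uv) ≫ f ≅ β(u) ≫ β(v) ≫ f ≅ β(u) ≫ g ≫ γ(v) ≫
  -- ε, where ε stands for `E.f`.
  let d (u v : I) := liftCell (γ.ob.μ u v) (β.ob.μ u v) (kv v) (kv (s.mul u v))
  let D (u : I) : E.wedge.pull (g ≫ γ.ob.act'.obj u) ≅ E.wedge.pull (β.ob.act'.obj u ≫ g) :=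
    Wedge.isoMk (d u)
      (fun {v v'} h => liftCell_nat (γ.ob.μ u v) (γ.ob.μ u v') (β.ob.μ u v) (β.ob.μ u v') _ _ _ _
        (γ.ob.act'.map h) (β.ob.act'.map h) _ _
        (μ_nat_left γ.ob u h) (μ_nat_left β.ob u h) (kv_nat h) (kv_nat _))
      (fun w v => liftCell_comm (γ.ob.μ u v) (β.ob.μ u v) (γ.ob.μ v w) (β.ob.μ v w)
        (γ.ob.μ u _) (β.ob.μ u _) (γ.ob.μ _ w) (β.ob.μ _ w) (E.t w) (f.t w) _ _ _ _ _
        _ _ (γ.ob.μ_assoc u v w) (β.ob.μ_assoc u v w)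
        (kv_nat _) (kv_σ w v) (kv_σ w _))
  let t (u : I) : g ≫ γ.ob.act'.obj u ≅ β.ob.act'.obj u ≫ g :=
    (E.wedge.pullFunctor b).preimageIso (D u)
  have ht (u v : I) : (t u).hom ▷ (γ.ob.act'.obj v ≫ E.f) = (d u v).hom := by
    have : (E.wedge.pullFunctor b).map (t u).hom = (D u).hom :=
      Functor.map_preimage _ _
    exact congrArg (fun x => x.θ.app v) this
  let G : EquivMor β.ob γ.ob := ofTs g t
    (fun {u u'} h => (E.wedge.pullFunctor b).map_injective (Wedge.hom_ext fun v =>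
      lift_nat (γ.ob.μ u v) (γ.ob.μ u' v) (β.ob.μ u v) (β.ob.μ u' v) _ _ _ _ _ _ _
        (μ_nat_right γ.ob h v) (μ_nat_right β.ob h v) (kv_nat _) (t u) (t u') (ht u v) (ht u' v)))
    (fun u v => (E.wedge.pullFunctor b).map_injective (Wedge.hom_ext fun w =>
      lift_tri (γ.ob.μ u v) (β.ob.μ u v) (γ.ob.μ v w) (β.ob.μ v w)
        (γ.ob.μ u _) (β.ob.μ u _) (γ.ob.μ _ w) (β.ob.μ _ w) _ _ _ _ _ _
        (γ.ob.μ_assoc u v w) (β.ob.μ_assoc u v w) (kv_nat _) (t u) (t v) (t _) (ht u _) (ht v w)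
        (ht _ w)))
    ((E.wedge.pullFunctor b).map_injective (Wedge.hom_ext fun v =>
      lift_one (γ.ob.μ _ v) (β.ob.μ _ v) γ.ob.η β.ob.η (kv v) _ _ _ (γ.ob.μ_one_mul v)
        (β.ob.μ_one_mul v) (kv_nat _) (t _) (ht _ v)))
  have hG (u : I) : G.ts u = t u := ofTs_ts _ _ _ _ _ u
  -- The only fact still missing for the equivariance of `liftUnit`: pasted with the new cell `t u`,
  -- it gives back `kv u`.
  have hj (u : I) := liftUnit_cell (γ.ob.μ u _) (β.ob.μ u _) γ.ob.η β.ob.η (kv (tunit I)) (kv u)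
    (kv _) (γ.ob.act'.mapIso (s.mul_one u)) _ (γ.ob.μ_mul_one u) (β.ob.μ_mul_one u) (kv_nat _)
    (t u) (ht u _)
  refine ⟨G, ⟨isoMk s (liftUnit γ.ob.η β.ob.η (kv (tunit I))) (comm_of_t _ fun u => ?_)⟩⟩
  have := liftUnit_comm (γ.ob.μ _ u) (β.ob.μ _ u) γ.ob.η β.ob.η (kv (tunit I)) (kv u) (kv _)
    (γ.ob.act'.mapIso (s.one_mul u)) _ (γ.ob.μ_one_mul u) (β.ob.μ_one_mul u) (kv_nat _) (E.t u)
    (f.t u) (kv_σ u _) (t u) (hj u)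
  refine this.trans (congrArg (fun x => Iso.hom x ≫ _) ?_)
  exact (congrArg (fun x => compT x (E.t u)) (hG u)).symm.trans (cmp_t G E u).symm

theorem isVEquivalence_postcomp_of_wedge (hE : IsVEquivalence V (E.wedge.pullFunctor b)) :
    IsVEquivalence V (postcomp β.ob E : (β.ob ⟶ γ.ob) ⥤ (β.ob ⟶ A)) :=
  isVEquivalence_of_vff (VCatCategory.postcomp _ _) (vff_postcomp_of_wedge E hE.vff)
    ⟨fun f => exists_lift_of_wedge E hE.isEquivalence f⟩

end EquivMor

end Bicat

/-! ### Equivariant morphisms seen from the side of the action of the target -/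

section Coherence

open Bicategory

variable {M : Type u₂} [Bicategory.{w₂, v₂} M]

/-- The equivariance cell `τ` with the trivial factor `yf` of its target removed. -/
def outIso {a y : M} {af an : a ⟶ a} {yf yn : y ⟶ y} {f : a ⟶ y} (ν : yf ≅ 𝟙 y)
    (τ : af ≫ f ≫ yn ≅ an ≫ f ≫ yf) : af ≫ f ≫ yn ≅ an ≫ f :=
  τ ≪≫ whiskerLeftIso an (whiskerLeftIso f ν ≪≫ ρ_ f)

/-- The pasting of the cells `outIso`. -/
def outPaste {a y : M} {af af₁ af₂ an an₁ an₂ : a ⟶ a} {yn yn₁ yn₂ : y ⟶ y} {f : a ⟶ y}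
    (mA' : af ≅ af₂ ≫ af₁) (mA : an ≅ an₁ ≫ an₂) (mY : yn ≅ yn₁ ≫ yn₂)
    (cA : af₂ ≫ an₁ ≅ an₁ ≫ af₂) (t₁ : af₁ ≫ f ≫ yn₁ ⟶ an₁ ≫ f) (t₂ : af₂ ≫ f ≫ yn₂ ⟶ an₂ ≫ f) :
    af ≫ f ≫ yn ⟶ an ≫ f :=
  mA'.hom ▷ (f ≫ yn) ≫ (af₂ ≫ af₁) ◁ f ◁ mY.hom ⊗≫ af₂ ◁ t₁ ▷ yn₂ ⊗≫ cA.hom ▷ (f ≫ yn₂) ⊗≫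
    an₁ ◁ t₂ ⊗≫ mA.inv ▷ f

/-- This and the next three lemmas erase the mute factor of the target. This form suits an arbitrary
source mapping into a tower whose objects all act on one side. -/
theorem outIso_tri {a y : M} {af af₁ af₂ an an₁ an₂ : a ⟶ a} {yn yn₁ yn₂ : y ⟶ y} {f : a ⟶ y}
    (mA' : af ≅ af₂ ≫ af₁) (mA : an ≅ an₁ ≫ an₂) (mY : yn ≅ yn₁ ≫ yn₂)
    (cA : af₂ ≫ an₁ ≅ an₁ ≫ af₂) (t : af ≫ f ≫ yn ≅ an ≫ f ≫ 𝟙 y)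
    (t₁ : af₁ ≫ f ≫ yn₁ ≅ an₁ ≫ f ≫ 𝟙 y) (t₂ : af₂ ≫ f ≫ yn₂ ≅ an₂ ≫ f ≫ 𝟙 y) :
    t.hom = triPaste mA' mA (λ_ _).symm mY cA (λ_ _ ≪≫ (ρ_ _).symm) t₁.hom t₂.hom ↔
      (outIso (Iso.refl _) t).hom = outPaste mA' mA mY cA (outIso (Iso.refl _) t₁).hom
        (outIso (Iso.refl _) t₂).hom := by
  rw [← cancel_mono (an ◁ (ρ_ f).hom)]
  simp only [outIso, outPaste, triPaste, Iso.trans_hom, Iso.symm_hom, whiskerLeftIso_hom,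
    Iso.refl_hom, Bicategory.whiskerLeft_id, Category.id_comp, Iso.symm_inv]
  refine Eq.congr_right ?_
  bicategory

theorem outIso_nat {a y : M} {af af' an an' : a ⟶ a} {yn yn' : y ⟶ y} {f : a ⟶ y}
    (hf : af ⟶ af') (hn : an ⟶ an') (hy : yn ⟶ yn') (t : af ≫ f ≫ yn ≅ an ≫ f ≫ 𝟙 y)
    (t' : af' ≫ f ≫ yn' ≅ an' ≫ f ≫ 𝟙 y) :
    hf ▷ (f ≫ yn) ≫ af' ◁ f ◁ hy ≫ t'.hom = t.hom ≫ hn ▷ (f ≫ 𝟙 y) ≫ an' ◁ f ◁ 𝟙 (𝟙 y) ↔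
      hf ▷ (f ≫ yn) ≫ af' ◁ f ◁ hy ≫ (outIso (Iso.refl _) t').hom =
        (outIso (Iso.refl _) t).hom ≫ hn ▷ f := by
  rw [← cancel_mono (an' ◁ (ρ_ f).hom)]
  simp only [outIso, Iso.trans_hom, whiskerLeftIso_hom, Iso.refl_hom, Bicategory.whiskerLeft_id,
    Category.id_comp, Category.comp_id, Category.assoc]
  rw [whisker_exchange]

theorem outIso_one {a y : M} {af an : a ⟶ a} {yn : y ⟶ y} {f : a ⟶ y}
    (f0 : af ≅ 𝟙 a) (n0 : an ≅ 𝟙 a) (y0 : yn ≅ 𝟙 y) (t : af ≫ f ≫ yn ≅ an ≫ f ≫ 𝟙 y) :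
    t.hom = f0.hom ▷ (f ≫ yn) ≫ 𝟙 a ◁ f ◁ y0.hom ≫ 𝟙 a ◁ f ◁ 𝟙 (𝟙 y) ≫ n0.inv ▷ (f ≫ 𝟙 y) ↔
      (outIso (Iso.refl _) t).hom = f0.hom ▷ (f ≫ yn) ≫ 𝟙 a ◁ f ◁ y0.hom ≫ 𝟙 a ◁ (ρ_ f).hom ≫
        n0.inv ▷ f := by
  rw [← cancel_mono (an ◁ (ρ_ f).hom)]
  simp only [outIso, Iso.trans_hom, whiskerLeftIso_hom, Iso.refl_hom, Bicategory.whiskerLeft_id,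
    Category.id_comp]
  refine Eq.congr_right ?_
  bicategory

theorem outIso_comm {a y : M} {af an : a ⟶ a} {yn : y ⟶ y} {f f' : a ⟶ y} (θ : f ⟶ f')
    (t : af ≫ f ≫ yn ≅ an ≫ f ≫ 𝟙 y) (t' : af ≫ f' ≫ yn ≅ an ≫ f' ≫ 𝟙 y) :
    af ◁ θ ▷ yn ≫ t'.hom = t.hom ≫ an ◁ θ ▷ 𝟙 y ↔
      af ◁ θ ▷ yn ≫ (outIso (Iso.refl _) t').hom = (outIso (Iso.refl _) t).hom ≫ an ◁ θ := by
  rw [← cancel_mono (an ◁ (ρ_ f').hom)]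
  simp [outIso]

/-- The composite of the equivariance cells `w` and `P`. -/
def compOut {a y x : M} {af an : a ⟶ a} {yn : y ⟶ y} {xn : x ⟶ x} {f : a ⟶ y} {p : y ⟶ x}
    (w : af ≫ f ≫ yn ≅ an ≫ f) (P : p ≫ xn ≅ yn ≫ p) : af ≫ (f ≫ p) ≫ xn ≅ an ≫ f ≫ p :=
  whiskerLeftIso af (α_ f p xn ≪≫ whiskerLeftIso f P ≪≫ (α_ f yn p).symm) ≪≫
    (α_ af (f ≫ yn) p).symm ≪≫ whiskerRightIso w p ≪≫ α_ an f p

theorem outIso_compIso {a y x : M} {af an : a ⟶ a} {yn : y ⟶ y} {xn : x ⟶ x} {f : a ⟶ y}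
    {p : y ⟶ x} (t : af ≫ f ≫ yn ≅ an ≫ f ≫ 𝟙 y) (r : 𝟙 y ≫ p ≫ xn ≅ yn ≫ p ≫ 𝟙 x) :
    outIso (Iso.refl _) (compIso (Iso.refl _) t.symm r.symm).symm =
      compOut (outIso (Iso.refl _) t) (tgtIso (Iso.refl _) (srcIso (Iso.refl _) r)) := by
  ext
  simp only [srcIso, tgtIso, outIso, compOut, compIso, hatL, hatR, Iso.trans_hom, Iso.symm_hom,
    whiskerLeftIso_hom, Iso.refl_hom, whiskerRightIso_hom, Iso.trans_inv, Iso.symm_inv,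
    whiskerLeftIso_inv, whiskerRightIso_inv, Iso.refl_inv]
  bicategory

/-- The composite of equivariance cells of morphisms between objects with actions on the same
side. -/
def compTgt {a b c : M} {bf : b ⟶ b} {cf : c ⟶ c} {n : a ⟶ a} {g : b ⟶ c} {p : c ⟶ a}
    (t : g ≫ cf ≅ bf ≫ g) (r : p ≫ n ≅ cf ≫ p) : (g ≫ p) ≫ n ≅ bf ≫ (g ≫ p) :=
  α_ g p n ≪≫ whiskerLeftIso g r ≪≫ (α_ g cf p).symm ≪≫ whiskerRightIso t p ≪≫ α_ bf g p

theorem tgtIso_compT {a b c : M} {bf : b ⟶ b} {cf : c ⟶ c} {f n : a ⟶ a} {g : b ⟶ c} {p : c ⟶ a}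
    (ν : f ≅ 𝟙 a) (t : g ≫ cf ≅ bf ≫ g) (r : p ≫ n ≅ cf ≫ p ≫ f) :
    tgtIso ν (compT t r) = compTgt t (tgtIso ν r) := by
  ext
  simp only [tgtIso, compT, compTgt, Iso.trans_hom, Iso.symm_hom, whiskerLeftIso_hom,
    whiskerRightIso_hom]
  calc
    _ = 𝟙 ((g ≫ p) ≫ n) ⊗≫ g ◁ r.hom ⊗≫ (t.hom ▷ (p ≫ f) ≫ (bf ≫ g) ◁ p ◁ ν.hom) ⊗≫
        𝟙 (bf ≫ (g ≫ p)) := by bicategory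
    _ = _ := by rw [← whisker_exchange]; bicategory

/-- The cell `w` is compatible with the cells `r` along `c : f ≫ p ≅ F`. -/
def limCell {a y x : M} {af an : a ⟶ a} {yn : y ⟶ y} {xn : x ⟶ x} {f : a ⟶ y} {p : y ⟶ x}
    {F : a ⟶ x} (P : p ≫ xn ≅ yn ≫ p) (c : f ≫ p ≅ F) (r : af ≫ F ≫ xn ≅ an ≫ F) :
    (af ≫ f ≫ yn) ≫ p ≅ (an ≫ f) ≫ p :=
  α_ _ _ _ ≪≫ whiskerLeftIso af (α_ _ _ _ ≪≫ whiskerLeftIso f P.symm ≪≫ (α_ _ _ _).symm ≪≫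
    whiskerRightIso c xn) ≪≫ r ≪≫ whiskerLeftIso an c.symm ≪≫ (α_ _ _ _).symm

theorem limCell_hom {a y x : M} {af an : a ⟶ a} {yn : y ⟶ y} {xn : x ⟶ x} {f : a ⟶ y} {p : y ⟶ x}
    {F : a ⟶ x} (P : p ≫ xn ≅ yn ≫ p) (c : f ≫ p ≅ F) (r : af ≫ F ≫ xn ≅ an ≫ F) :
    (limCell P c r).hom = 𝟙 ((af ≫ f ≫ yn) ≫ p) ⊗≫ af ◁ f ◁ P.inv ⊗≫ af ◁ c.hom ▷ xn ⊗≫ r.hom ⊗≫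
      an ◁ c.inv ⊗≫ 𝟙 ((an ≫ f) ≫ p) := by
  simp only [limCell, Iso.trans_hom, whiskerLeftIso_hom, Iso.symm_hom, whiskerRightIso_hom]
  bicategory

/-- Makes the isomorphism between a leg of the given cone and the composite of the induced morphism
with the projection into an equivariant 2-cell. -/
theorem compOut_of_limCell {a y x : M} {af an : a ⟶ a} {yn : y ⟶ y} {xn : x ⟶ x} {f : a ⟶ y}
    {p : y ⟶ x} {F : a ⟶ x} (P : p ≫ xn ≅ yn ≫ p) (c : f ≫ p ≅ F) (r : af ≫ F ≫ xn ≅ an ≫ F)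
    (w : af ≫ f ≫ yn ≅ an ≫ f) (h : w.hom ▷ p = (limCell P c r).hom) :
    af ◁ c.hom ▷ xn ≫ r.hom = (compOut w P).hom ≫ an ◁ c.hom := by
  rw [limCell_hom] at h
  simp only [compOut, Iso.trans_hom, whiskerLeftIso_hom, Iso.symm_hom, whiskerRightIso_hom, h]
  symm
  calc
    _ = 𝟙 (af ≫ (f ≫ p) ≫ xn) ⊗≫ af ◁ f ◁ (P.hom ≫ P.inv) ⊗≫ af ◁ c.hom ▷ xn ⊗≫ r.hom ⊗≫
        an ◁ (c.inv ≫ c.hom) ⊗≫ 𝟙 (an ≫ F) := by bicategory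
    _ = _ := by rw [P.hom_inv_id, c.inv_hom_id]; bicategory

/-- As `P` is invertible, equivariance of the projected 2-cell `θ ▷ p` differs from the whiskered
equivariance of `θ` only by cells that cancel. -/
theorem lim_comm {a y x : M} {af an : a ⟶ a} {yn : y ⟶ y} {xn : x ⟶ x} {f f' : a ⟶ y} {p : y ⟶ x}
    (P : p ≫ xn ≅ yn ≫ p) (w : af ≫ f ≫ yn ≅ an ≫ f) (w' : af ≫ f' ≫ yn ≅ an ≫ f') (θ : f ⟶ f')
    (h : af ◁ (θ ▷ p) ▷ xn ≫ (compOut w' P).hom = (compOut w P).hom ≫ an ◁ (θ ▷ p)) :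
    (af ◁ θ ▷ yn ≫ w'.hom) ▷ p = (w.hom ≫ an ◁ θ) ▷ p := by
  have e₁ : af ◁ (θ ▷ p) ▷ xn ≫ (compOut w' P).hom =
      af ◁ ((α_ _ _ _).hom ≫ f ◁ P.hom) ⊗≫ (af ◁ θ ▷ yn ≫ w'.hom) ▷ p ⊗≫ 𝟙 (an ≫ f' ≫ p) := by
    simp only [compOut, Iso.trans_hom, whiskerLeftIso_hom, Iso.symm_hom, whiskerRightIso_hom]
    calc
      _ = 𝟙 (af ≫ (f ≫ p) ≫ xn) ⊗≫ af ◁ (θ ▷ (p ≫ xn) ≫ f' ◁ P.hom) ⊗≫ w'.hom ▷ p ⊗≫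
          𝟙 (an ≫ f' ≫ p) := by bicategory
      _ = _ := by rw [← whisker_exchange]; bicategory
  have e₂ : (compOut w P).hom ≫ an ◁ (θ ▷ p) =
      af ◁ ((α_ _ _ _).hom ≫ f ◁ P.hom) ⊗≫ (w.hom ≫ an ◁ θ) ▷ p ⊗≫ 𝟙 (an ≫ f' ≫ p) := by
    simp only [compOut, Iso.trans_hom, whiskerLeftIso_hom, Iso.symm_hom, whiskerRightIso_hom]
    bicategory
  rw [e₁, e₂] at h
  exact bicategoricalComp_cancel_right _ (bicategoricalComp_cancel_left _ h)

/-- Here and in `lim_one` and `lim_tri`, the cell `w` into the weak limit is known through its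
projections, where it is the equivariance cell `r` of a leg conjugated by `P` and `c`. The axioms
for `w` follow from those for `r` and for the projection. -/
theorem lim_nat {a y x : M} {af an af' an' : a ⟶ a} {yn yn' : y ⟶ y} {xn xn' : x ⟶ x} {f : a ⟶ y}
    {p : y ⟶ x} {F : a ⟶ x} (P : p ≫ xn ≅ yn ≫ p) (P' : p ≫ xn' ≅ yn' ≫ p) (c : f ≫ p ≅ F)
    (r : af ≫ F ≫ xn ≅ an ≫ F) (r' : af' ≫ F ≫ xn' ≅ an' ≫ F) (w : af ≫ f ≫ yn ≅ an ≫ f)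
    (w' : af' ≫ f ≫ yn' ≅ an' ≫ f) (hf : af ⟶ af') (hn : an ⟶ an') (hy : yn ⟶ yn') (hx : xn ⟶ xn')
    (hr : hf ▷ (F ≫ xn) ≫ af' ◁ F ◁ hx ≫ r'.hom = r.hom ≫ hn ▷ F)
    (hP : p ◁ hx ≫ P'.hom = P.hom ≫ hy ▷ p)
    (hw : w.hom ▷ p = (limCell P c r).hom) (hw' : w'.hom ▷ p = (limCell P' c r').hom) :
    (hf ▷ (f ≫ yn) ≫ af' ◁ f ◁ hy ≫ w'.hom) ▷ p = (w.hom ≫ hn ▷ f) ▷ p := by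
  have hP' : hy ▷ p ≫ P'.inv = P.inv ≫ p ◁ hx := by
    rw [Iso.comp_inv_eq, Category.assoc, hP, Iso.inv_hom_id_assoc]
  simp only [comp_whiskerRight, hw, hw', limCell_hom]
  calc
    _ = 𝟙 ((af ≫ f ≫ yn) ≫ p) ⊗≫ hf ▷ (f ≫ yn ≫ p) ⊗≫ af' ◁ f ◁ (hy ▷ p ≫ P'.inv) ⊗≫
        af' ◁ c.hom ▷ xn' ⊗≫ r'.hom ⊗≫ an' ◁ c.inv ⊗≫ 𝟙 ((an' ≫ f) ≫ p) := by bicategory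
    _ = 𝟙 ((af ≫ f ≫ yn) ≫ p) ⊗≫ (hf ▷ (f ≫ yn ≫ p) ≫ af' ◁ f ◁ P.inv) ⊗≫
        af' ◁ ((f ≫ p) ◁ hx ≫ c.hom ▷ xn') ⊗≫ r'.hom ⊗≫ an' ◁ c.inv ⊗≫ 𝟙 ((an' ≫ f) ≫ p) := by
      rw [hP']; bicategory
    _ = 𝟙 ((af ≫ f ≫ yn) ≫ p) ⊗≫ af ◁ f ◁ P.inv ⊗≫ (hf ▷ ((f ≫ p) ≫ xn) ≫
        af' ◁ (c.hom ▷ xn)) ⊗≫ (af' ◁ F ◁ hx ≫ r'.hom) ⊗≫ an' ◁ c.inv ⊗≫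
        𝟙 ((an' ≫ f) ≫ p) := by
      rw [← whisker_exchange, whisker_exchange c.hom]; bicategory
    _ = 𝟙 ((af ≫ f ≫ yn) ≫ p) ⊗≫ af ◁ f ◁ P.inv ⊗≫ af ◁ (c.hom ▷ xn) ⊗≫
        (hf ▷ (F ≫ xn) ≫ af' ◁ F ◁ hx ≫ r'.hom) ⊗≫ an' ◁ c.inv ⊗≫
        𝟙 ((an' ≫ f) ≫ p) := by
      rw [← whisker_exchange]; bicategory
    _ = 𝟙 ((af ≫ f ≫ yn) ≫ p) ⊗≫ af ◁ f ◁ P.inv ⊗≫ af ◁ (c.hom ▷ xn) ⊗≫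
        r.hom ⊗≫ (hn ▷ F ≫ an' ◁ c.inv) ⊗≫ 𝟙 ((an' ≫ f) ≫ p) := by
      rw [hr]; bicategory
    _ = _ := by rw [← whisker_exchange]; bicategory

theorem lim_one {a y x : M} {af an : a ⟶ a} {yn : y ⟶ y} {xn : x ⟶ x} {f : a ⟶ y}
    {p : y ⟶ x} {F : a ⟶ x} (P : p ≫ xn ≅ yn ≫ p) (c : f ≫ p ≅ F)
    (r : af ≫ F ≫ xn ≅ an ≫ F) (w : af ≫ f ≫ yn ≅ an ≫ f) (f0 : af ≅ 𝟙 a) (n0 : an ≅ 𝟙 a)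
    (y0 : yn ≅ 𝟙 y) (x0 : xn ≅ 𝟙 x)
    (hr : r.hom = f0.hom ▷ (F ≫ xn) ≫ 𝟙 a ◁ F ◁ x0.hom ≫ 𝟙 a ◁ (ρ_ F).hom ≫ n0.inv ▷ F)
    (hP : P.hom = p ◁ x0.hom ≫ (ρ_ p).hom ≫ (λ_ p).inv ≫ y0.inv ▷ p)
    (hw : w.hom ▷ p = (limCell P c r).hom) :
    w.hom ▷ p = (f0.hom ▷ (f ≫ yn) ≫ 𝟙 a ◁ f ◁ y0.hom ≫ 𝟙 a ◁ (ρ_ f).hom ≫ n0.inv ▷ f) ▷ p := by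
  have hP' : P.inv = y0.hom ▷ p ≫ (λ_ p).hom ≫ (ρ_ p).inv ≫ p ◁ x0.inv := by
    rw [← cancel_epi P.hom, Iso.hom_inv_id, hP]; simp
  rw [hw, limCell_hom, hP', hr]
  calc
    _ = 𝟙 ((af ≫ f ≫ yn) ≫ p) ⊗≫ af ◁ f ◁ y0.hom ▷ p ⊗≫ af ◁ ((f ≫ p) ◁ x0.inv ≫
        c.hom ▷ xn) ⊗≫ (f0.hom ▷ (F ≫ xn) ≫ 𝟙 a ◁ F ◁ x0.hom) ⊗≫ (n0.inv ▷ F ≫ an ◁ c.inv) ⊗≫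
        𝟙 ((an ≫ f) ≫ p) := by bicategory
    _ = 𝟙 ((af ≫ f ≫ yn) ≫ p) ⊗≫ (af ◁ f ◁ y0.hom ▷ p) ⊗≫ af ◁ c.hom ⊗≫ af ◁ F ◁ (x0.inv ≫
        x0.hom) ⊗≫ (f0.hom ▷ F ≫ 𝟙 a ◁ c.inv) ⊗≫ n0.inv ▷ (f ≫ p) ⊗≫
        𝟙 ((an ≫ f) ≫ p) := by
      rw [whisker_exchange c.hom, ← whisker_exchange f0.hom, ← whisker_exchange n0.inv]; bicategory
    _ = 𝟙 ((af ≫ f ≫ yn) ≫ p) ⊗≫ (af ◁ f ◁ y0.hom ▷ p) ⊗≫ af ◁ (c.hom ≫ c.inv) ⊗≫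
        f0.hom ▷ (f ≫ p) ⊗≫ n0.inv ▷ (f ≫ p) ⊗≫
        𝟙 ((an ≫ f) ≫ p) := by
      rw [x0.inv_hom_id, ← whisker_exchange f0.hom]; bicategory
    _ = 𝟙 ((af ≫ f ≫ yn) ≫ p) ⊗≫ (af ◁ (f ◁ y0.hom ▷ p) ≫ f0.hom ▷ (f ≫ 𝟙 y ≫ p)) ⊗≫
        n0.inv ▷ (f ≫ p) ⊗≫ 𝟙 ((an ≫ f) ≫ p) := by
      rw [c.hom_inv_id]; bicategory
    _ = _ := by rw [whisker_exchange]; bicategory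

theorem lim_tri {a y x : M} {af af₁ af₂ an an₁ an₂ : a ⟶ a} {yn yn₁ yn₂ : y ⟶ y}
    {xn xn₁ xn₂ : x ⟶ x} {f : a ⟶ y} {p : y ⟶ x} {F : a ⟶ x} (mA' : af ≅ af₂ ≫ af₁)
    (mA : an ≅ an₁ ≫ an₂) (mY : yn ≅ yn₁ ≫ yn₂) (mX : xn ≅ xn₁ ≫ xn₂)
    (cA : af₂ ≫ an₁ ≅ an₁ ≫ af₂) (P : p ≫ xn ≅ yn ≫ p) (P₁ : p ≫ xn₁ ≅ yn₁ ≫ p)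
    (P₂ : p ≫ xn₂ ≅ yn₂ ≫ p) (c : f ≫ p ≅ F) (r : af ≫ F ≫ xn ≅ an ≫ F)
    (r₁ : af₁ ≫ F ≫ xn₁ ≅ an₁ ≫ F) (r₂ : af₂ ≫ F ≫ xn₂ ≅ an₂ ≫ F) (w : af ≫ f ≫ yn ≅ an ≫ f)
    (w₁ : af₁ ≫ f ≫ yn₁ ≅ an₁ ≫ f) (w₂ : af₂ ≫ f ≫ yn₂ ≅ an₂ ≫ f)
    (hr : r.hom = outPaste mA' mA mX cA r₁.hom r₂.hom)
    (hP : P.hom = tgtPaste mY mX P₁.hom P₂.hom)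
    (hw : w.hom ▷ p = (limCell P c r).hom) (hw₁ : w₁.hom ▷ p = (limCell P₁ c r₁).hom)
    (hw₂ : w₂.hom ▷ p = (limCell P₂ c r₂).hom) :
    w.hom ▷ p = (outPaste mA' mA mY cA w₁.hom w₂.hom) ▷ p := by
  have hP' : P.inv = mY.hom ▷ p ⊗≫ yn₁ ◁ P₂.inv ⊗≫ P₁.inv ▷ xn₂ ⊗≫ p ◁ mX.inv := by
    rw [← cancel_epi P.hom, Iso.hom_inv_id, hP]
    simp [tgtPaste, bicategoricalComp]
  rw [limCell_hom] at hw₁ hw₂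
  rw [hw, limCell_hom, hP', hr, outPaste, outPaste]
  -- A common normal form: the cells `r₁` and `r₂` of the leg, with `P₂`, `P₁` and `c` undone at the
  -- beginning and `c` restored at the end.
  trans 𝟙 ((af ≫ f ≫ yn) ≫ p) ⊗≫ mA'.hom ▷ (f ≫ yn ≫ p) ⊗≫ af₂ ◁ af₁ ◁ f ◁ mY.hom ▷ p ⊗≫
    af₂ ◁ af₁ ◁ f ◁ yn₁ ◁ P₂.inv ⊗≫ af₂ ◁ af₁ ◁ f ◁ P₁.inv ▷ xn₂ ⊗≫
    af₂ ◁ af₁ ◁ c.hom ▷ (xn₁ ≫ xn₂) ⊗≫ af₂ ◁ r₁.hom ▷ xn₂ ⊗≫ cA.hom ▷ (F ≫ xn₂) ⊗≫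
    an₁ ◁ r₂.hom ⊗≫ an₁ ◁ an₂ ◁ c.inv ⊗≫ mA.inv ▷ (f ≫ p) ⊗≫ 𝟙 ((an ≫ f) ≫ p)
  · calc
      _ = 𝟙 ((af ≫ f ≫ yn) ≫ p) ⊗≫ (af ◁ (f ◁ (mY.hom ▷ p ⊗≫ yn₁ ◁ P₂.inv ⊗≫ P₁.inv ▷ xn₂ ⊗≫
          p ◁ mX.inv) ⊗≫ c.hom ▷ xn) ≫ mA'.hom ▷ (F ≫ xn)) ⊗≫ af₂ ◁ af₁ ◁ F ◁ mX.hom ⊗≫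
          af₂ ◁ r₁.hom ▷ xn₂ ⊗≫ cA.hom ▷ (F ≫ xn₂) ⊗≫ an₁ ◁ r₂.hom ⊗≫
          (mA.inv ▷ F ≫ an ◁ c.inv) ⊗≫ 𝟙 ((an ≫ f) ≫ p) := by bicategory
      _ = 𝟙 ((af ≫ f ≫ yn) ≫ p) ⊗≫ mA'.hom ▷ (f ≫ yn ≫ p) ⊗≫ af₂ ◁ af₁ ◁ f ◁ mY.hom ▷ p ⊗≫
          af₂ ◁ af₁ ◁ f ◁ yn₁ ◁ P₂.inv ⊗≫ af₂ ◁ af₁ ◁ f ◁ P₁.inv ▷ xn₂ ⊗≫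
          af₂ ◁ af₁ ◁ ((f ≫ p) ◁ mX.inv ≫ c.hom ▷ xn) ⊗≫ af₂ ◁ af₁ ◁ F ◁ mX.hom ⊗≫
          af₂ ◁ r₁.hom ▷ xn₂ ⊗≫ cA.hom ▷ (F ≫ xn₂) ⊗≫ an₁ ◁ r₂.hom ⊗≫
          an₁ ◁ an₂ ◁ c.inv ⊗≫ mA.inv ▷ (f ≫ p) ⊗≫ 𝟙 ((an ≫ f) ≫ p) := by
        rw [whisker_exchange mA'.hom, ← whisker_exchange mA.inv]; bicategory
      _ = 𝟙 ((af ≫ f ≫ yn) ≫ p) ⊗≫ mA'.hom ▷ (f ≫ yn ≫ p) ⊗≫ af₂ ◁ af₁ ◁ f ◁ mY.hom ▷ p ⊗≫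
          af₂ ◁ af₁ ◁ f ◁ yn₁ ◁ P₂.inv ⊗≫ af₂ ◁ af₁ ◁ f ◁ P₁.inv ▷ xn₂ ⊗≫
          af₂ ◁ af₁ ◁ c.hom ▷ (xn₁ ≫ xn₂) ⊗≫ af₂ ◁ af₁ ◁ F ◁ (mX.inv ≫ mX.hom) ⊗≫
          af₂ ◁ r₁.hom ▷ xn₂ ⊗≫ cA.hom ▷ (F ≫ xn₂) ⊗≫ an₁ ◁ r₂.hom ⊗≫
          an₁ ◁ an₂ ◁ c.inv ⊗≫ mA.inv ▷ (f ≫ p) ⊗≫ 𝟙 ((an ≫ f) ≫ p) := by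
        rw [whisker_exchange c.hom]; bicategory
      _ = _ := by rw [mX.inv_hom_id]; bicategory
  · symm
    calc
      _ = 𝟙 ((af ≫ f ≫ yn) ≫ p) ⊗≫ mA'.hom ▷ (f ≫ yn ≫ p) ⊗≫ af₂ ◁ af₁ ◁ f ◁ mY.hom ▷ p ⊗≫
          af₂ ◁ (w₁.hom ▷ (yn₂ ≫ p) ≫ (an₁ ≫ f) ◁ 𝟙 (yn₂ ≫ p)) ⊗≫ cA.hom ▷ (f ≫ yn₂ ≫ p) ⊗≫
          an₁ ◁ (w₂.hom ▷ p) ⊗≫ mA.inv ▷ (f ≫ p) ⊗≫ 𝟙 ((an ≫ f) ≫ p) := by bicategory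
      -- The first cell `w₁` is followed by the action of `y` rather than by `p`; inserting the pair
      -- `P₂.inv`, `P₂.hom` brings `p` next to it so that `hw₁` applies.
      _ = 𝟙 ((af ≫ f ≫ yn) ≫ p) ⊗≫ mA'.hom ▷ (f ≫ yn ≫ p) ⊗≫ af₂ ◁ af₁ ◁ f ◁ mY.hom ▷ p ⊗≫
          af₂ ◁ (w₁.hom ▷ (yn₂ ≫ p) ≫ (an₁ ≫ f) ◁ P₂.inv) ⊗≫ (af₂ ≫ an₁) ◁ f ◁ P₂.hom ⊗≫
          cA.hom ▷ (f ≫ yn₂ ≫ p) ⊗≫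
          an₁ ◁ (w₂.hom ▷ p) ⊗≫ mA.inv ▷ (f ≫ p) ⊗≫ 𝟙 ((an ≫ f) ≫ p) := by
        rw [← P₂.inv_hom_id]; bicategory
      _ = 𝟙 ((af ≫ f ≫ yn) ≫ p) ⊗≫ mA'.hom ▷ (f ≫ yn ≫ p) ⊗≫ af₂ ◁ af₁ ◁ f ◁ mY.hom ▷ p ⊗≫
          af₂ ◁ af₁ ◁ f ◁ yn₁ ◁ P₂.inv ⊗≫ af₂ ◁ ((w₁.hom ▷ p) ▷ xn₂) ⊗≫
          (af₂ ≫ an₁) ◁ f ◁ P₂.hom ⊗≫ cA.hom ▷ (f ≫ yn₂ ≫ p) ⊗≫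
          an₁ ◁ (w₂.hom ▷ p) ⊗≫ mA.inv ▷ (f ≫ p) ⊗≫ 𝟙 ((an ≫ f) ≫ p) := by
        rw [← whisker_exchange]; bicategory
      _ = 𝟙 ((af ≫ f ≫ yn) ≫ p) ⊗≫ mA'.hom ▷ (f ≫ yn ≫ p) ⊗≫ af₂ ◁ af₁ ◁ f ◁ mY.hom ▷ p ⊗≫
          af₂ ◁ af₁ ◁ f ◁ yn₁ ◁ P₂.inv ⊗≫ af₂ ◁ af₁ ◁ f ◁ P₁.inv ▷ xn₂ ⊗≫
          af₂ ◁ af₁ ◁ c.hom ▷ (xn₁ ≫ xn₂) ⊗≫ af₂ ◁ r₁.hom ▷ xn₂ ⊗≫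
          ((af₂ ≫ an₁) ◁ (c.inv ▷ xn₂ ⊗≫ f ◁ P₂.hom) ≫ cA.hom ▷ (f ≫ yn₂ ≫ p)) ⊗≫
          an₁ ◁ af₂ ◁ f ◁ P₂.inv ⊗≫ an₁ ◁ af₂ ◁ c.hom ▷ xn₂ ⊗≫ an₁ ◁ r₂.hom ⊗≫
          an₁ ◁ an₂ ◁ c.inv ⊗≫ mA.inv ▷ (f ≫ p) ⊗≫ 𝟙 ((an ≫ f) ≫ p) := by
        rw [hw₁, hw₂]; bicategory
      _ = 𝟙 ((af ≫ f ≫ yn) ≫ p) ⊗≫ mA'.hom ▷ (f ≫ yn ≫ p) ⊗≫ af₂ ◁ af₁ ◁ f ◁ mY.hom ▷ p ⊗≫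
          af₂ ◁ af₁ ◁ f ◁ yn₁ ◁ P₂.inv ⊗≫ af₂ ◁ af₁ ◁ f ◁ P₁.inv ▷ xn₂ ⊗≫
          af₂ ◁ af₁ ◁ c.hom ▷ (xn₁ ≫ xn₂) ⊗≫ af₂ ◁ r₁.hom ▷ xn₂ ⊗≫ cA.hom ▷ (F ≫ xn₂) ⊗≫
          an₁ ◁ af₂ ◁ c.inv ▷ xn₂ ⊗≫ an₁ ◁ af₂ ◁ f ◁ (P₂.hom ≫ P₂.inv) ⊗≫
          an₁ ◁ af₂ ◁ c.hom ▷ xn₂ ⊗≫ an₁ ◁ r₂.hom ⊗≫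
          an₁ ◁ an₂ ◁ c.inv ⊗≫ mA.inv ▷ (f ≫ p) ⊗≫ 𝟙 ((an ≫ f) ≫ p) := by
        rw [whisker_exchange]; bicategory
      _ = 𝟙 ((af ≫ f ≫ yn) ≫ p) ⊗≫ mA'.hom ▷ (f ≫ yn ≫ p) ⊗≫ af₂ ◁ af₁ ◁ f ◁ mY.hom ▷ p ⊗≫
          af₂ ◁ af₁ ◁ f ◁ yn₁ ◁ P₂.inv ⊗≫ af₂ ◁ af₁ ◁ f ◁ P₁.inv ▷ xn₂ ⊗≫
          af₂ ◁ af₁ ◁ c.hom ▷ (xn₁ ≫ xn₂) ⊗≫ af₂ ◁ r₁.hom ▷ xn₂ ⊗≫ cA.hom ▷ (F ≫ xn₂) ⊗≫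
          an₁ ◁ af₂ ◁ (c.inv ≫ c.hom) ▷ xn₂ ⊗≫ an₁ ◁ r₂.hom ⊗≫
          an₁ ◁ an₂ ◁ c.inv ⊗≫ mA.inv ▷ (f ≫ p) ⊗≫ 𝟙 ((an ≫ f) ≫ p) := by
        rw [P₂.hom_inv_id]; bicategory
      _ = _ := by rw [c.inv_hom_id]; bicategory

/-- The projected cells at levels n + 1 and n agree along the transition map because the comparison
cells `φ` and `ψ` of the two cones are equivariant. Hence they form an isomorphism of weak cones in
`M`, which can be lifted to the limit. -/
theorem lim_cone {a y x x' : M} {af an : a ⟶ a} {yn : y ⟶ y} {xn : x ⟶ x} {xn' : x' ⟶ x'}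
    {f : a ⟶ y} {p : y ⟶ x} {p' : y ⟶ x'} {t : x' ⟶ x} {F : a ⟶ x} {F' : a ⟶ x'}
    (P : p ≫ xn ≅ yn ≫ p) (P' : p' ≫ xn' ≅ yn ≫ p') (T : t ≫ xn ≅ xn' ≫ t) (c : f ≫ p ≅ F)
    (c' : f ≫ p' ≅ F') (r : af ≫ F ≫ xn ≅ an ≫ F) (r' : af ≫ F' ≫ xn' ≅ an ≫ F')
    (φ : p' ≫ t ≅ p) (ψ : F' ≫ t ≅ F)
    (hφ : φ.hom ▷ xn ≫ P.hom = (compTgt P' T).hom ≫ yn ◁ φ.hom)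
    (hψ : af ◁ ψ.hom ▷ xn ≫ r.hom = (compOut r' T).hom ≫ an ◁ ψ.hom)
    (hc : c'.hom ▷ t ≫ ψ.hom = ((α_ f p' t).hom ≫ f ◁ φ.hom) ≫ c.hom) :
    (limCell P' c' r').hom ▷ t ≫ (α_ (an ≫ f) p' t).hom ≫ (an ≫ f) ◁ φ.hom =
      ((α_ (af ≫ f ≫ yn) p' t).hom ≫ (af ≫ f ≫ yn) ◁ φ.hom) ≫ (limCell P c r).hom := by
  have hφ' : yn ◁ φ.hom ≫ P.inv = (compTgt P' T).inv ≫ φ.hom ▷ xn := by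
    rw [Iso.comp_inv_eq, Category.assoc, hφ, Iso.inv_hom_id_assoc]
  have hc₁ : f ◁ φ.hom ≫ c.hom = (α_ f p' t).inv ≫ c'.hom ▷ t ≫ ψ.hom := by rw [hc]; simp
  have hc₂ : ψ.hom ≫ c.inv = c'.inv ▷ t ≫ (α_ f p' t).hom ≫ f ◁ φ.hom := by
    rw [Iso.comp_inv_eq, Category.assoc, Category.assoc, hc₁]
    simp
  rw [limCell_hom, limCell_hom]
  simp only [compTgt, compOut, Iso.trans_hom, Iso.trans_inv, Iso.symm_hom, Iso.symm_inv,
    whiskerLeftIso_hom, whiskerRightIso_hom, whiskerLeftIso_inv, whiskerRightIso_inv] at hφ' hψ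
  symm
  calc
    _ = 𝟙 (((af ≫ f ≫ yn) ≫ p') ≫ t) ⊗≫ af ◁ f ◁ (yn ◁ φ.hom ≫ P.inv) ⊗≫ af ◁ c.hom ▷ xn ⊗≫
        r.hom ⊗≫ an ◁ c.inv ⊗≫ 𝟙 ((an ≫ f) ≫ p) := by bicategory
    _ = 𝟙 (((af ≫ f ≫ yn) ≫ p') ≫ t) ⊗≫ af ◁ f ◁ P'.inv ▷ t ⊗≫ af ◁ f ◁ p' ◁ T.inv ⊗≫
        af ◁ (f ◁ φ.hom ≫ c.hom) ▷ xn ⊗≫ r.hom ⊗≫ an ◁ c.inv ⊗≫ 𝟙 ((an ≫ f) ≫ p) := by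
      rw [hφ']; bicategory
    _ = 𝟙 (((af ≫ f ≫ yn) ≫ p') ≫ t) ⊗≫ af ◁ f ◁ P'.inv ▷ t ⊗≫ af ◁ f ◁ p' ◁ T.inv ⊗≫
        af ◁ c'.hom ▷ t ▷ xn ⊗≫ (af ◁ ψ.hom ▷ xn ≫ r.hom) ⊗≫ an ◁ c.inv ⊗≫
        𝟙 ((an ≫ f) ≫ p) := by
      rw [hc₁]; bicategory
    _ = 𝟙 (((af ≫ f ≫ yn) ≫ p') ≫ t) ⊗≫ af ◁ f ◁ P'.inv ▷ t ⊗≫ af ◁ ((f ≫ p') ◁ T.inv ≫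
        c'.hom ▷ (t ≫ xn)) ⊗≫ af ◁ F' ◁ T.hom ⊗≫ r'.hom ▷ t ⊗≫ an ◁ (ψ.hom ≫ c.inv) ⊗≫
        𝟙 ((an ≫ f) ≫ p) := by
      rw [hψ]; bicategory
    _ = 𝟙 (((af ≫ f ≫ yn) ≫ p') ≫ t) ⊗≫ af ◁ f ◁ P'.inv ▷ t ⊗≫ af ◁ c'.hom ▷ (xn' ≫ t) ⊗≫
        af ◁ F' ◁ (T.inv ≫ T.hom) ⊗≫ r'.hom ▷ t ⊗≫ an ◁ c'.inv ▷ t ⊗≫ an ◁ f ◁ φ.hom ⊗≫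
        𝟙 ((an ≫ f) ≫ p) := by
      rw [whisker_exchange, hc₂]; bicategory
    _ = _ := by rw [T.inv_hom_id]; bicategory

end Coherence

section Bicat

open Bicategory

variable {V : Type u'} [Category.{v'} V] [MonoidalCategory V]
variable {I : Type w} [Category.{w} I] [MonoidalCategory I] [EnrichedOrdinaryCategory V I]
variable {M : Type u₂} [Bicategory.{w₂, v₂} M] [VCatCategory V M]

namespace EquivMor

variable {B : IObj V I M} {s : Side} {y : M} {υ : SAct V I s y}

/-- The equivariance structure, seen from the side of the action of the target. -/
def tg (F : EquivMor B υ.ob) (u : I) :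
    (B.actOn s.op).obj u ≫ F.f ≫ υ.ob.act'.obj u ≅ (B.actOn s).obj u ≫ F.f :=
  outIso (υ.ob.muteIso u) (F.τs s u)

theorem tg_nat (F : EquivMor B υ.ob) {u v : I} (h : u ⟶ v) :
    (B.actOn s.op).map h ▷ (F.f ≫ υ.ob.act'.obj u) ≫
        (B.actOn s.op).obj v ◁ F.f ◁ υ.ob.act'.map h ≫ (F.tg v).hom =
      (F.tg u).hom ≫ (B.actOn s).map h ▷ F.f := by
  have := (F.equivariant_s s).nat h
  cases s <;> exact (outIso_nat _ _ _ _ _).1 this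

theorem tg_tri (F : EquivMor B υ.ob) (u v : I) :
    (F.tg (s.mul u v)).hom = outPaste (B.mulIso' s u v) (B.mulIso s u v) (υ.ob.μ u v)
      (B.commIso s v u) (F.tg u).hom (F.tg v).hom := by
  have := (F.equivariant_s s).tri u v
  cases s <;> exact (outIso_tri _ _ _ _ _ _ _).1 this

theorem tg_one (F : EquivMor B υ.ob) :
    (F.tg (tunit I)).hom = (B.oneIso s.op).hom ▷ (F.f ≫ υ.ob.act'.obj (tunit I)) ≫
      𝟙 B.pt ◁ F.f ◁ υ.ob.η.hom ≫ 𝟙 B.pt ◁ (ρ_ F.f).hom ≫ (B.oneIso s).inv ▷ F.f := by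
  have := (F.equivariant_s s).one
  cases s <;> exact (outIso_one _ _ _ _).1 this

theorem Hom.comm_tg {F G : EquivMor B υ.ob} (a : F ⟶ G) (u : I) :
    (B.actOn s.op).obj u ◁ a.θ ▷ υ.ob.act'.obj u ≫ (G.tg u).hom =
      (F.tg u).hom ≫ (B.actOn s).obj u ◁ a.θ := by
  have := a.comm_s s u
  cases s <;> exact (outIso_comm _ _ _).1 this

theorem comm_of_tg {F G : EquivMor B υ.ob} (θ : F.f ⟶ G.f)
    (h : ∀ u, (B.actOn s.op).obj u ◁ θ ▷ υ.ob.act'.obj u ≫ (G.tg u).hom =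
      (F.tg u).hom ≫ (B.actOn s).obj u ◁ θ) (u : I) :
    (B.actOn s.op).obj u ◁ θ ▷ (υ.ob.actOn s).obj u ≫ (G.τs s u).hom =
      (F.τs s u).hom ≫ (B.actOn s).obj u ◁ θ ▷ (υ.ob.actOn s.op).obj u := by
  have := h u
  cases s <;> exact (outIso_comm _ _ _).2 this

/-- The equivariance structure `tg` with the trivial factor added back. -/
def τOfTg {f : B.pt ⟶ y}
    (t : ∀ u, (B.actOn s.op).obj u ≫ f ≫ υ.ob.act'.obj u ≅ (B.actOn s).obj u ≫ f) (u : I) :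
    (B.actOn s.op).obj u ≫ f ≫ (υ.ob.actOn s).obj u ≅
      (B.actOn s).obj u ≫ f ≫ (υ.ob.actOn s.op).obj u :=
  t u ≪≫ whiskerLeftIso _ ((ρ_ f).symm ≪≫ whiskerLeftIso f (υ.ob.muteIso u).symm)

theorem outIso_τOfTg {f : B.pt ⟶ y}
    (t : ∀ u, (B.actOn s.op).obj u ≫ f ≫ υ.ob.act'.obj u ≅ (B.actOn s).obj u ≫ f) (u : I) :
    outIso (υ.ob.muteIso u) (τOfTg t u) = t u := by
  ext
  simp only [outIso, τOfTg, Iso.trans_hom, whiskerLeftIso_hom, Iso.symm_hom, Category.assoc]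
  simp [← Bicategory.whiskerLeft_comp, ← Bicategory.whiskerLeft_comp_assoc]

/-- The equivariant morphism given by an equivariance structure seen from the side of the action of
the target. -/
def ofTg (f : B.pt ⟶ y)
    (t : ∀ u, (B.actOn s.op).obj u ≫ f ≫ υ.ob.act'.obj u ≅ (B.actOn s).obj u ≫ f)
    (nat : ∀ {u v : I} (h : u ⟶ v), (B.actOn s.op).map h ▷ (f ≫ υ.ob.act'.obj u) ≫
        (B.actOn s.op).obj v ◁ f ◁ υ.ob.act'.map h ≫ (t v).hom =
      (t u).hom ≫ (B.actOn s).map h ▷ f)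
    (tri : ∀ u v : I, (t (s.mul u v)).hom = outPaste (B.mulIso' s u v) (B.mulIso s u v)
      (υ.ob.μ u v) (B.commIso s v u) (t u).hom (t v).hom)
    (one : (t (tunit I)).hom = (B.oneIso s.op).hom ▷ (f ≫ υ.ob.act'.obj (tunit I)) ≫
      𝟙 B.pt ◁ f ◁ υ.ob.η.hom ≫ 𝟙 B.pt ◁ (ρ_ f).hom ≫ (B.oneIso s).inv ▷ f) : EquivMor B υ.ob :=
  mkSide s f (τOfTg t)
    { nat := fun {u v} h => by
        have := nat h
        rw [← outIso_τOfTg t, ← outIso_τOfTg t] at this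
        cases s <;> exact (outIso_nat _ _ _ _ _).2 this
      tri := fun u v => by
        have := tri u v
        rw [← outIso_τOfTg t, ← outIso_τOfTg t, ← outIso_τOfTg t] at this
        cases s <;> exact (outIso_tri _ _ _ _ _ _ _).2 this
      one := by
        have := one
        rw [← outIso_τOfTg t] at this
        cases s <;> exact (outIso_one _ _ _ _).2 this }

theorem ofTg_tg (f : B.pt ⟶ y)
    (t : ∀ u, (B.actOn s.op).obj u ≫ f ≫ υ.ob.act'.obj u ≅ (B.actOn s).obj u ≫ f) (nat) (tri) (one)
    (u : I) : (ofTg f t nat tri one).tg u = t u :=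
  (congrArg (outIso (υ.ob.muteIso u))
    (mkSide_τs (A := B) (B := υ.ob) s f (τOfTg t) _ u)).trans (outIso_τOfTg t u)

theorem cmp_tg {x : M} {ξ : SAct V I s x} (F : EquivMor B υ.ob) (P : EquivMor υ.ob ξ.ob) (u : I) :
    (F.cmp P).tg u = compOut (F.tg u) (P.ts u) := by
  cases s
  · exact outIso_compIso (F.τs .l u) (P.τs .l u)
  · exact outIso_compIso (F.τs .r u) (P.τs .r u)

theorem cmp_ts {x z : M} {ξ : SAct V I s x} {ζ : SAct V I s z} (F : EquivMor ζ.ob υ.ob)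
    (P : EquivMor υ.ob ξ.ob) (u : I) : (F.cmp P).ts u = compTgt (F.ts u) (P.ts u) :=
  (congrArg (tgtIso (ξ.ob.muteIso u)) (cmp_t F P u)).trans (tgtIso_compT _ _ _)

end EquivMor

variable [MonoidalClosed V] [HasLimitsOfSize.{w, w} V] [IsBase V]

namespace TowerCone

/-- An isomorphism of weak cones. -/
def isoMk {K : Type u₂} [Bicategory.{w₂, v₂} K] {X : ℕ → K} {t : ∀ n, X (n + 1) ⟶ X n} {Z : K}
    {F G : TowerCone X t Z} (i : ∀ n, F.g n ≅ G.g n)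
    (h : ∀ n, (i (n + 1)).hom ▷ t n ≫ (G.φ n).hom = (F.φ n).hom ≫ (i n).hom) : F ≅ G where
  hom := ⟨fun n => (i n).hom, h⟩
  inv := ⟨fun n => (i n).inv, fun n => by
    rw [← cancel_epi ((i (n + 1)).hom ▷ t n), reassoc_of% h n]
    simp⟩
  hom_inv_id := Hom.ext (funext fun n => (i n).hom_inv_id)
  inv_hom_id := Hom.ext (funext fun n => (i n).inv_hom_id)

variable {Y : ℕ → IObj V I M} {t : ∀ n, Y (n + 1) ⟶ Y n}

/-- The weak cone in `M` underlying a weak cone of `I`-objects. -/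
def forget {B : IObj V I M} (C : TowerCone Y t B) :
    TowerCone (fun n => (Y n).pt) (fun n => EquivMor.f (t n)) B.pt where
  g n := EquivMor.f (C.g n)
  φ n := (EquivMor.forget _ _).mapIso (C.φ n)

/-- The morphism of weak cones in `M` underlying a morphism of weak cones of `I`-objects. -/
def forgetMap {B : IObj V I M} {C C' : TowerCone Y t B} (a : C ⟶ C') : C.forget ⟶ C'.forget where
  θ n := EquivMor.Hom.θ (Hom.θ a n)
  comm n := congrArg EquivMor.Hom.θ (Hom.comm a n)

end TowerCone

/-! ### Weak limits in `M` of one-sided actions are weak limits for equivariant morphisms. -/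

section Limit

variable {s : Side} {pt : ℕ → M} {υ : ∀ n, SAct V I s (pt n)}
  {t : ∀ n, (υ (n + 1)).ob ⟶ (υ n).ob} {l : M} {ℓ : SAct V I s l}
  (C : TowerCone (fun n => (υ n).ob) t ℓ.ob) (B : IObj V I M)

/-- A 2-cell into the limit is lifted in `M`; its equivariance can be tested after each projection,
where it is that of the given component. The source `B` may act on either side. -/
theorem TowerCone.vff_pullFunctor (h : VFF V (C.forget.pullFunctor B.pt)) :
    VFF V (C.pullFunctor B) := by
  intro F G
  obtain ⟨ψ, hψ, h₁, h₂⟩ := h (EquivMor.f F) (EquivMor.f G)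
  have hp (a : (C.pullFunctor B).obj F ⟶ (C.pullFunctor B).obj G) (n : ℕ) :
      ψ (forgetMap a) ▷ EquivMor.f (C.g n) = EquivMor.Hom.θ (TowerCone.Hom.θ a n) :=
    congrArg (fun x => TowerCone.Hom.θ x n) (h₁ (forgetMap a))
  have hc (a : (C.pullFunctor B).obj F ⟶ (C.pullFunctor B).obj G) (u : I) :
      (B.actOn s.op).obj u ◁ ψ (forgetMap a) ▷ ℓ.ob.act'.obj u ≫ (EquivMor.tg G u).hom =
      (EquivMor.tg F u).hom ≫ (B.actOn s).obj u ◁ ψ (forgetMap a) := by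
    have := h.faithful
    apply (C.forget.pullFunctor B.pt).map_injective
    refine TowerCone.Hom.ext (funext fun n => ?_)
    refine lim_comm (EquivMor.ts (C.g n) u) (EquivMor.tg F u) (EquivMor.tg G u) _ ?_
    have := EquivMor.Hom.comm_tg (TowerCone.Hom.θ a n) u
    rw [← hp] at this
    erw [EquivMor.cmp_tg, EquivMor.cmp_tg] at this
    exact this
  refine ⟨fun a => EquivMor.homMk s (ψ (forgetMap a)) (EquivMor.comm_of_tg _ (hc a)),
    EquivMor.vrep_of (hψ.comp (TowerCone.vrep_of.{w} fun n => ?_)),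
    fun a => TowerCone.Hom.ext (funext fun n => EquivMor.hom_ext (hp a n)),
    fun a => EquivMor.hom_ext (h₂ (EquivMor.Hom.θ a))⟩
  exact (EquivMor.vrep_θ _ _).comp (TowerCone.vrep_θ _ _ n)

/-- The underlying cone induces a morphism `f` in `M`. For each u the equivariance cells of the legs
form an isomorphism of cones between the two composites to be identified, so full faithfulness
provides the cell of `f`, and faithfulness its axioms. -/
theorem TowerCone.essSurj_pullFunctor (h : (C.forget.pullFunctor B.pt).IsEquivalence) :
    (C.pullFunctor B).EssSurj := by
  refine ⟨fun D => ?_⟩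
  let f := (C.forget.pullFunctor B.pt).objPreimage D.forget
  let k := (C.forget.pullFunctor B.pt).objObjPreimageIso D.forget
  let c (n : ℕ) : f ≫ EquivMor.f (C.g n) ≅ EquivMor.f (D.g n) :=
    (TowerCone.evalFunctor B.pt n).mapIso k
  have hc (n : ℕ) : (c (n + 1)).hom ▷ EquivMor.f (t n) ≫ EquivMor.Hom.θ (D.φ n).hom =
      ((α_ _ _ _).hom ≫ f ◁ EquivMor.Hom.θ (C.φ n).hom) ≫ (c n).hom := TowerCone.Hom.comm k.hom n
  -- The equivariance cell of the n-th leg, transported to the composite of `f` with the n-th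
  -- projection.
  let d (u : I) (n : ℕ) := limCell (EquivMor.ts (C.g n) u) (c n) (EquivMor.tg (D.g n) u)
  let w (u : I) : (B.actOn s.op).obj u ≫ f ≫ ℓ.ob.act'.obj u ≅ (B.actOn s).obj u ≫ f :=
    (C.forget.pullFunctor B.pt).preimageIso (TowerCone.isoMk (d u) fun n =>
      lim_cone (EquivMor.ts (C.g n) u) (EquivMor.ts (C.g (n + 1)) u) (EquivMor.ts (t n) u) _ _ _ _
        ((EquivMor.forget _ _).mapIso (C.φ n)) ((EquivMor.forget _ _).mapIso (D.φ n))
        ((EquivMor.Hom.comm_ts (C.φ n).hom u).trans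
          (congrArg (fun x => Iso.hom x ≫ _) (EquivMor.cmp_ts _ _ u)))
        ((EquivMor.Hom.comm_tg (D.φ n).hom u).trans
          (congrArg (fun x => Iso.hom x ≫ _) (EquivMor.cmp_tg _ _ u))) (hc n))
  have hw (u : I) (n : ℕ) : (w u).hom ▷ EquivMor.f (C.g n) = (d u n).hom := by
    have : (C.forget.pullFunctor B.pt).map (w u).hom = _ := Functor.map_preimage _ _
    exact congrArg (fun x => TowerCone.Hom.θ x n) this
  let F : EquivMor B ℓ.ob := EquivMor.ofTg f w
    (fun {u v} h => (C.forget.pullFunctor B.pt).map_injective (TowerCone.Hom.ext (funext fun n =>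
      lim_nat _ _ (c n) _ _ (w u) (w v) _ _ _ _ (EquivMor.tg_nat (D.g n) h)
        (EquivMor.ts_nat (C.g n) h) (hw u n) (hw v n))))
    (fun u v => (C.forget.pullFunctor B.pt).map_injective (TowerCone.Hom.ext (funext fun n =>
      lim_tri _ _ _ _ _ _ _ _ (c n) _ _ _ (w _) (w u) (w v) (EquivMor.tg_tri (D.g n) u v)
        (EquivMor.ts_tri (C.g n) u v) (hw _ n) (hw u n) (hw v n))))
    ((C.forget.pullFunctor B.pt).map_injective (TowerCone.Hom.ext (funext fun n =>
      lim_one _ (c n) _ (w _) _ _ _ _ (EquivMor.tg_one (D.g n)) (EquivMor.ts_one (C.g n))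
        (hw _ n))))
  have hF (u : I) : F.tg u = w u := EquivMor.ofTg_tg _ _ _ _ _ u
  refine ⟨F, ⟨TowerCone.isoMk (fun n => EquivMor.isoMk s (c n) (EquivMor.comm_of_tg _ fun u => ?_))
    fun n => EquivMor.hom_ext (hc n)⟩⟩
  refine (compOut_of_limCell _ (c n) _ (w u) (hw u n)).trans
    (congrArg (fun x => Iso.hom x ≫ _) ?_)
  exact (congrArg (fun x => compOut x (EquivMor.ts (C.g n) u)) (hF u)).symm.trans
    (EquivMor.cmp_tg F (C.g n) u).symm

theorem TowerCone.isVEquivalence_pullFunctor (h : IsVEquivalence V (C.forget.pullFunctor B.pt)) :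
    IsVEquivalence V (C.pullFunctor B) :=
  isVEquivalence_of_vff (isVFunctor_of_vrep fun _ _ => TowerCone.vrep_of.{w} fun n =>
    (VRep.id (V := V)).whiskerRight (C.g n)) (C.vff_pullFunctor B h.vff)
    (C.essSurj_pullFunctor B h.isEquivalence)

end Limit

end Bicat

/-! ### Weak limits of towers of equivalences -/

section Tower

open Bicategory

variable {V : Type u'} [Category.{v'} V] [MonoidalCategory V] [MonoidalClosed V] [IsBase V]
variable {K : Type u₂} [Bicategory.{w₂, v₂} K] [VCatCategory V K]

theorem isVEquivalence_postcomp_comp {A B C D : K} {P : B ⟶ C} {Q : C ⟶ D}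
    (hP : IsVEquivalence V (postcomp A P)) (hQ : IsVEquivalence V (postcomp A Q)) :
    IsVEquivalence V (postcomp A (P ≫ Q)) :=
  (hP.comp hQ).of_iso (NatIso.ofComponents (fun F => α_ F P Q) (fun a => by simp [postcomp]))

variable [HasLimitsOfSize.{w, w} V]

namespace TowerCone

variable {X : ℕ → K} {t : ∀ n, X (n + 1) ⟶ X n} {Z : K}

/-- When all transition maps induce equivalences, a weak cone and its morphisms are determined by
their bottom component and can be built upwards from it by recursion. -/
theorem isVEquivalence_evalFunctor (h : ∀ n, IsVEquivalence V (postcomp Z (t n))) :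
    letI : EnrichedOrdinaryCategory V (TowerCone X t Z) := (presentation.{w} Z).enriched
    IsVEquivalence V (evalFunctor (X := X) (t := t) Z 0) := by
  let : EnrichedOrdinaryCategory V (TowerCone X t Z) := (presentation.{w} Z).enriched
  have := fun n => (h n).isEquivalence
  refine isVEquivalence_of_vff (isVFunctor_of_vrep fun F G => vrep_θ.{w} F G 0) (fun F G => ?_)
    ⟨fun g => ?_⟩
  · choose ψ hψ h₁ h₂ using fun n => (h n).vff (F.g (n + 1)) (G.g (n + 1))
    -- The component at n + 1 is the unique preimage of the component at n, conjugated by the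
    -- comparison isomorphisms of the two cones.
    let θ (a : F.g 0 ⟶ G.g 0) (n : ℕ) : F.g n ⟶ G.g n :=
      Nat.rec a (fun n b => ψ n ((F.φ n).hom ≫ b ≫ (G.φ n).inv)) n
    have hθ (a : F.g 0 ⟶ G.g 0) (n : ℕ) : θ a (n + 1) ▷ t n ≫ (G.φ n).hom =
        (F.φ n).hom ≫ θ a n := by
      have : θ a (n + 1) ▷ t n = (F.φ n).hom ≫ θ a n ≫ (G.φ n).inv := h₁ n _
      rw [this]
      simp
    refine ⟨fun a => ⟨θ a, hθ a⟩, vrep_of.{w} fun n => ?_, fun a => rfl,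
      fun a => Hom.ext (funext fun n => ?_)⟩
    · change VRep V (fun a => θ a n)
      induction n with
      | zero => exact VRep.id
      | succ n ih => exact (hψ n).comp ((ih.postcomp _).precomp _)
    · change θ (Hom.θ a 0) n = Hom.θ a n
      induction n with
      | zero => rfl
      | succ n ih =>
        change ψ n ((F.φ n).hom ≫ θ (Hom.θ a 0) n ≫ (G.φ n).inv) = _
        rw [ih]
        have e : (F.φ n).hom ≫ Hom.θ a n ≫ (G.φ n).inv = Hom.θ a (n + 1) ▷ t n := by
          rw [← Category.assoc, Iso.comp_inv_eq]
          exact (Hom.comm a n).symm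
        exact (congrArg (ψ n) e).trans (h₂ n _)
  · let G : ∀ n, Z ⟶ X n := fun n =>
      Nat.rec g (fun n k => (postcomp Z (t n)).objPreimage k) n
    exact ⟨⟨G, fun n => (postcomp Z (t n)).objObjPreimageIso (G n)⟩, ⟨Iso.refl _⟩⟩

theorem isVEquivalence_postcomp {W : K} (C : TowerCone X t W)
    (hC : letI : EnrichedOrdinaryCategory V (TowerCone X t Z) := (presentation.{w} Z).enriched
      IsVEquivalence V (C.pullFunctor Z))
    (h : ∀ n, IsVEquivalence V (postcomp Z (t n))) : IsVEquivalence V (postcomp Z (C.g 0)) :=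
  letI : EnrichedOrdinaryCategory V (TowerCone X t Z) := (presentation.{w} Z).enriched
  hC.comp (isVEquivalence_evalFunctor.{w} h)

end TowerCone

end Tower

/-! ### The mapping property of the weak limit of the tower for stable objects. -/

section Bicat

open Bicategory

variable {V : Type u'} [Category.{v'} V] [MonoidalCategory V]
variable {I : Type w} [Category.{w} I] [MonoidalCategory I] [EnrichedOrdinaryCategory V I]
variable {M : Type u₂} [Bicategory.{w₂, v₂} M] [VCatCategory V M]

theorem IObj.eq_ob {s : Side} {X : IObj V I M} (h : X.side = s) :
    X = (h ▸ X.act : SAct V I s X.pt).ob := by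
  subst h
  rfl

/-- The results on one-sided actions are stated for `SAct.ob`, where the side is a fixed index; this
puts a tower whose sides are only known by an equation into that form. -/
theorem IObj.exists_eq_ob {s : Side} {Y : ℕ → IObj V I M} (hs : ∀ n, (Y n).side = s) :
    ∃ (pt : ℕ → M) (υ : ∀ n, SAct V I s (pt n)), Y = fun n => (υ n).ob :=
  ⟨_, _, funext fun n => IObj.eq_ob (hs n)⟩

variable [MonoidalClosed V] [HasLimitsOfSize.{w, w} V] [IsBase V]

/-- The equivalences in the bicategory of `I`-objects. -/
theorem IObj.Equivalent.exists_equiv {A B : IObj V I M} (h : A.Equivalent B) :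
    ∃ (P : A ⟶ B) (Q : B ⟶ A), Nonempty (P ≫ Q ≅ 𝟙 A) ∧ Nonempty (Q ≫ P ≅ 𝟙 B) := by
  obtain ⟨F, G, ⟨e⟩, ⟨e'⟩⟩ := h
  rw [EquivMor.comp_eq_cmp, EquivMor.id_eq_idm] at e e'
  exact ⟨F, G, ⟨e⟩, ⟨e'⟩⟩

theorem IObj.equivalent_of_equiv {A B : IObj V I M} {P : A ⟶ B} {Q : B ⟶ A} (e : P ≫ Q ≅ 𝟙 A)
    (e' : Q ≫ P ≅ 𝟙 B) : A.Equivalent B := by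
  refine ⟨P, Q, ?_, ?_⟩
  · rw [EquivMor.comp_eq_cmp, EquivMor.id_eq_idm]
    exact ⟨e⟩
  · rw [EquivMor.comp_eq_cmp, EquivMor.id_eq_idm]
    exact ⟨e'⟩

variable [Bicategory.Strict M] [IsStrictMonoidal I]

namespace InvData

variable {s : Side} {A : IObj V I M} (D : InvData V s A)

theorem isVEquivalence_postcomp_ev {B : IObj V I M} (hB : B.side = s) :
    IsVEquivalence V (postcomp B D.ev : (B ⟶ D.act.ob) ⥤ (B ⟶ A)) := by
  obtain ⟨b, s', β⟩ := B
  obtain rfl : s' = s := hB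
  exact EquivMor.isVEquivalence_postcomp_of_wedge D.ev (D.universal_ev b)

/-- A stable `B` has an equivalent `B'` acting on the opposite side, so one of the two acts on the
side `s`. The mapping property for that one is carried over along the equivalence if necessary. -/
theorem isVEquivalence_postcomp_ev_of_isStable {B : IObj V I M} (hB : B.IsStable) :
    IsVEquivalence V (postcomp B D.ev : (B ⟶ D.act.ob) ⥤ (B ⟶ A)) := by
  obtain ⟨B', h, hB'⟩ := hB
  obtain ⟨P, Q, ⟨e⟩, ⟨e'⟩⟩ := hB'.exists_equiv
  by_cases hs : B.side = s
  · exact D.isVEquivalence_postcomp_ev hs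
  · refine isVEquivalence_postcomp_of_equiv e e' D.ev (D.isVEquivalence_postcomp_ev ?_)
    rw [h]
    cases s <;> cases hB : B.side <;> simp_all [Side.op]

end InvData

section

variable {inv : ∀ (s : Side) (X : IObj V I M), InvData V s X} {A : IObj V I M}

variable (inv A) in
/-- The map `Inv_I^(n + 2)(A) ⟶ Inv_I^(n + 1)(A)` of the tower, in the bicategory of
`I`-objects. -/
def towerHom (n : ℕ) : tower inv A (n + 1) ⟶ tower inv A n := towerMap inv A n

variable (inv A) in
/-- The evaluation `Inv_I^(n + 2)(A) ⟶ Inv_r(Inv_I^(n + 1)(A))`. -/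
def towerEv (n : ℕ) : tower inv A (n + 1) ⟶ (inv .r (tower inv A n)).act.ob :=
  (inv .l (inv .r (tower inv A n)).act.ob).ev

theorem towerHom_eq (n : ℕ) :
    towerHom inv A n = towerEv inv A n ≫ (inv .r (tower inv A n)).ev := by
  change (inv .l (inv .r (tower inv A n)).obj).eps.comp (inv .r (tower inv A n)).eps = _
  rw [EquivMor.comp_eq_cmp, InvData.eps_eq_ev, InvData.eps_eq_ev]
  rfl

theorem tower_side (n : ℕ) : (tower inv A n).side = .l := by
  cases n <;> rfl

namespace TowerLimit

variable (L : TowerLimit inv A)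

/-- The weak cone of `I`-objects on the tower. -/
def cone : TowerCone (tower inv A) (towerHom inv A) L.act.ob where
  g n := L.p n
  φ n := eqToIso (EquivMor.comp_eq_cmp _ _).symm ≪≫ L.φ n

/-- The cone of `L.universal` is the one underlying `L.cone`: the comparison isomorphisms are built
with `comp` in one and `cmp` in the other, and differ by identities. -/
theorem isVEquivalence_pullFunctor_forget (Z : M) :
    IsVEquivalence V (L.cone.forget.pullFunctor Z) := by
  have h : L.cone.forget = ⟨fun n => (L.p n).f, fun n => EquivMor.compForgetIso _ _ ≪≫
      (EquivMor.forget _ _).mapIso (L.φ n)⟩ := by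
    refine congrArg (TowerCone.mk _) (funext fun n => Iso.ext ?_)
    change (EquivMor.forget _ _).map (eqToHom (EquivMor.comp_eq_cmp _ _).symm ≫ (L.φ n).hom) =
      eqToHom (EquivMor.ofSide_f _ _ _ _).symm ≫ (EquivMor.forget _ _).map (L.φ n).hom
    rw [Functor.map_comp, eqToHom_map]
    rfl
  rw [h]
  exact L.universal Z

theorem isVEquivalence_pullFunctor (B : IObj V I M) : IsVEquivalence V (L.cone.pullFunctor B) := by
  have h := L.isVEquivalence_pullFunctor_forget B.pt
  -- The terms of the tower are defined by recursion; abstracting cone, maps and terms allows the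
  -- tower to be replaced by a family in the form `SAct.ob`.
  generalize L.cone = C at h ⊢
  generalize towerHom inv A = t at C h ⊢
  obtain ⟨pt, υ, e⟩ := IObj.exists_eq_ob (tower_side (inv := inv) (A := A))
  generalize tower inv A = Y at e t C h ⊢
  subst e
  exact C.isVEquivalence_pullFunctor B h

/-- For stable `B` each tower map is a composite of two evaluations and induces an equivalence,
hence so does the projection of the weak limit to the bottom term; the last factor ε_l is again an
evaluation. -/
theorem isVEquivalence_postcompFunctor {B : IObj V I M} (hB : B.IsStable) :
    IsVEquivalence V (EquivMor.postcompFunctor B L.epsInf) := by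
  have h₀ : L.epsInf = L.cone.g 0 ≫ (inv .l A).ev :=
    (EquivMor.comp_eq_cmp _ _).trans (by rw [InvData.eps_eq_ev]; rfl)
  rw [EquivMor.postcompFunctor_eq, h₀]
  refine isVEquivalence_postcomp_comp
    (L.cone.isVEquivalence_postcomp.{w} (L.isVEquivalence_pullFunctor B) fun n => ?_)
    ((inv .l A).isVEquivalence_postcomp_ev_of_isStable hB)
  rw [towerHom_eq]
  exact isVEquivalence_postcomp_comp (InvData.isVEquivalence_postcomp_ev_of_isStable _ hB)
    (InvData.isVEquivalence_postcomp_ev_of_isStable _ hB)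

end TowerLimit

end

end Bicat

/-! ### The composition of wedges with equivariant morphisms -/

section Coherence

open Bicategory

variable {M : Type u₂} [Bicategory.{w₂, v₂} M]

/-- The composition of a wedge cell `σ` on an object with a left action with an equivariance cell
`P`. -/
def pushCell {z x y : M} {e e' : z ⟶ x} {xu : x ⟶ x} {yu : y ⟶ y} {p : x ⟶ y}
    (P : p ≫ yu ≅ xu ≫ p) (σ : e ≫ 𝟙 x ⟶ e' ≫ xu) : (e ≫ p) ≫ 𝟙 y ⟶ (e' ≫ p) ≫ yu :=
  𝟙 ((e ≫ p) ≫ 𝟙 y) ⊗≫ σ ▷ p ⊗≫ e' ◁ P.inv ⊗≫ 𝟙 ((e' ≫ p) ≫ yu)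

/-- Since `P` is invertible, `pushCell P σ` and `σ ▷ p` carry the same information. Equations
between wedge cells on a weak limit are thereby tested on their images at each level. -/
theorem pushCell_cancel {z x y : M} {e e' : z ⟶ x} {xu : x ⟶ x} {yu : y ⟶ y} {p : x ⟶ y}
    (P : p ≫ yu ≅ xu ≫ p) {σ σ' : e ≫ 𝟙 x ⟶ e' ≫ xu} (h : pushCell P σ = pushCell P σ') :
    σ ▷ p = σ' ▷ p :=
  bicategoricalComp_cancel_right _ (bicategoricalComp_cancel_left _ h)

theorem pushCell_precomp {z x y : M} {e e' e'' : z ⟶ x} {xu : x ⟶ x} {yu : y ⟶ y} {p : x ⟶ y}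
    (P : p ≫ yu ≅ xu ≫ p) (a : e ⟶ e') (σ : e' ≫ 𝟙 x ⟶ e'' ≫ xu) :
    pushCell P (a ▷ 𝟙 x ≫ σ) = (a ▷ p) ▷ 𝟙 y ≫ pushCell P σ := by
  unfold pushCell
  bicategory

theorem pushCell_comp {z x y : M} {e e' e'' : z ⟶ x} {xu : x ⟶ x} {yu : y ⟶ y} {p : x ⟶ y}
    (P : p ≫ yu ≅ xu ≫ p) (σ : e ≫ 𝟙 x ⟶ e' ≫ xu) (b : e' ⟶ e'') :
    pushCell P (σ ≫ b ▷ xu) = pushCell P σ ≫ (b ▷ p) ▷ yu := by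
  unfold pushCell
  calc
    _ = 𝟙 ((e ≫ p) ≫ 𝟙 y) ⊗≫ σ ▷ p ⊗≫ (b ▷ (xu ≫ p) ≫ e'' ◁ P.inv) ⊗≫
        𝟙 ((e'' ≫ p) ≫ yu) := by bicategory
    _ = _ := by rw [← whisker_exchange]; bicategory

theorem pushCell_whiskerLeft {z x y : M} {e e' : z ⟶ x} {xu xu' : x ⟶ x} {yu yu' : y ⟶ y}
    {p : x ⟶ y} (P : p ≫ yu ≅ xu ≫ p) (P' : p ≫ yu' ≅ xu' ≫ p) (hx : xu ⟶ xu') (hy : yu ⟶ yu')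
    (hP : p ◁ hy ≫ P'.hom = P.hom ≫ hx ▷ p) (σ : e ≫ 𝟙 x ⟶ e' ≫ xu) :
    pushCell P' (σ ≫ e' ◁ hx) = pushCell P σ ≫ (e' ≫ p) ◁ hy := by
  have hP' : hx ▷ p ≫ P'.inv = P.inv ≫ p ◁ hy := by
    rw [Iso.comp_inv_eq, Category.assoc, hP, Iso.inv_hom_id_assoc]
  unfold pushCell
  calc
    _ = 𝟙 ((e ≫ p) ≫ 𝟙 y) ⊗≫ σ ▷ p ⊗≫ e' ◁ (hx ▷ p ≫ P'.inv) ⊗≫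
        𝟙 ((e' ≫ p) ≫ yu') := by bicategory
    _ = _ := by rw [hP']; bicategory

theorem pushCell_one {z x y : M} {e e' : z ⟶ x} {xu : x ⟶ x} {yu : y ⟶ y} {p : x ⟶ y}
    (P : p ≫ yu ≅ xu ≫ p) (x0 : xu ≅ 𝟙 x) (y0 : yu ≅ 𝟙 y)
    (hP : P.hom = p ◁ y0.hom ≫ (ρ_ p).hom ≫ (λ_ p).inv ≫ x0.inv ▷ p) (a : e ⟶ e') :
    pushCell P (e ◁ 𝟙 (𝟙 x) ≫ a ▷ 𝟙 x ≫ e' ◁ x0.inv) =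
      (e ≫ p) ◁ 𝟙 (𝟙 y) ≫ (a ▷ p) ▷ 𝟙 y ≫ (e' ≫ p) ◁ y0.inv := by
  have hP' : P.inv = x0.hom ▷ p ≫ (λ_ p).hom ≫ (ρ_ p).inv ≫ p ◁ y0.inv := by
    rw [← cancel_epi P.hom, Iso.hom_inv_id, hP]; simp
  rw [pushCell, hP']
  calc
    _ = 𝟙 ((e ≫ p) ≫ 𝟙 y) ⊗≫ a ▷ p ⊗≫ e' ◁ (x0.inv ≫ x0.hom) ▷ p ⊗≫ e' ◁ p ◁ y0.inv ⊗≫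
        𝟙 ((e' ≫ p) ≫ yu) := by bicategory
    _ = _ := by rw [x0.inv_hom_id]; bicategory

/-- The product law survives composition with an equivariant morphism: by multiplicativity the cell
`P` splits into `P₁` and `P₂`, the pair `mX.inv`, `mX.hom` cancels, and `P₁` is interchanged with
`σ₁₂`. -/
theorem pushCell_wedgePaste {z x y : M} {e q q₁ q₁₂ : z ⟶ x} {f f₁ f₂ : x ⟶ x} {k k₁ k₂ : y ⟶ y}
    {p : x ⟶ y} (mX : f ≅ f₂ ≫ f₁) (mY : k ≅ k₂ ≫ k₁) (P : p ≫ k ≅ f ≫ p)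
    (P₁ : p ≫ k₁ ≅ f₁ ≫ p) (P₂ : p ≫ k₂ ≅ f₂ ≫ p) (hP : P.hom = tgtPaste mX mY P₂.hom P₁.hom)
    (σ₁ : e ≫ 𝟙 x ⟶ q₁ ≫ f₁) (σ₁₂ : q₁ ≫ 𝟙 x ⟶ q₁₂ ≫ f₂) (a : q₁₂ ⟶ q) :
    pushCell P (wedgePaste mX (λ_ _).symm (ρ_ _ ≪≫ (λ_ _).symm) σ₁ σ₁₂ a) =
      wedgePaste mY (λ_ _).symm (ρ_ _ ≪≫ (λ_ _).symm) (pushCell P₁ σ₁) (pushCell P₂ σ₁₂)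
        (a ▷ p) := by
  have hP' : P.inv = mX.hom ▷ p ⊗≫ f₂ ◁ P₁.inv ⊗≫ P₂.inv ▷ k₁ ⊗≫ p ◁ mY.inv := by
    rw [← cancel_epi P.hom, Iso.hom_inv_id, hP]
    simp [tgtPaste, bicategoricalComp]
  simp only [pushCell, wedgePaste, hP', Iso.trans_hom, Iso.symm_hom]
  calc
    _ = 𝟙 ((e ≫ p) ≫ 𝟙 y) ⊗≫ σ₁ ▷ p ⊗≫ σ₁₂ ▷ (f₁ ≫ p) ⊗≫ a ▷ (f₂ ≫ f₁ ≫ p) ⊗≫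
        q ◁ (mX.inv ≫ mX.hom) ▷ p ⊗≫ q ◁ f₂ ◁ P₁.inv ⊗≫ q ◁ P₂.inv ▷ k₁ ⊗≫ q ◁ p ◁ mY.inv ⊗≫
        𝟙 ((q ≫ p) ≫ k) := by bicategory
    _ = 𝟙 ((e ≫ p) ≫ 𝟙 y) ⊗≫ σ₁ ▷ p ⊗≫ σ₁₂ ▷ (f₁ ≫ p) ⊗≫ (a ▷ (f₂ ≫ f₁ ≫ p) ≫
        q ◁ (f₂ ◁ P₁.inv ⊗≫ P₂.inv ▷ k₁)) ⊗≫ q ◁ p ◁ mY.inv ⊗≫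
        𝟙 ((q ≫ p) ≫ k) := by rw [mX.inv_hom_id]; bicategory
    _ = 𝟙 ((e ≫ p) ≫ 𝟙 y) ⊗≫ σ₁ ▷ p ⊗≫ (σ₁₂ ▷ (f₁ ≫ p) ≫ (q₁₂ ≫ f₂) ◁ P₁.inv) ⊗≫
        q₁₂ ◁ P₂.inv ▷ k₁ ⊗≫ a ▷ (p ≫ k₂ ≫ k₁) ⊗≫ q ◁ p ◁ mY.inv ⊗≫
        𝟙 ((q ≫ p) ≫ k) := by rw [← whisker_exchange]; bicategory
    _ = _ := by rw [← whisker_exchange]; bicategory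

/-- `pushCell` on invertible cells. -/
def pushIso {z x y : M} {e e' : z ⟶ x} {xu : x ⟶ x} {yu : y ⟶ y} {p : x ⟶ y}
    (P : p ≫ yu ≅ xu ≫ p) (σ : e ≫ 𝟙 x ≅ e' ≫ xu) : (e ≫ p) ≫ 𝟙 y ≅ (e' ≫ p) ≫ yu :=
  ρ_ _ ≪≫ whiskerRightIso ((ρ_ e).symm ≪≫ σ) p ≪≫ α_ _ _ _ ≪≫ whiskerLeftIso e' P.symm ≪≫
    (α_ _ _ _).symm

theorem pushIso_hom {z x y : M} {e e' : z ⟶ x} {xu : x ⟶ x} {yu : y ⟶ y} {p : x ⟶ y}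
    (P : p ≫ yu ≅ xu ≫ p) (σ : e ≫ 𝟙 x ≅ e' ≫ xu) : (pushIso P σ).hom = pushCell P σ.hom := by
  simp only [pushIso, pushCell, Iso.trans_hom, Iso.symm_hom, whiskerLeftIso_hom,
    whiskerRightIso_hom]
  bicategory

end Coherence

section Bicat

open Bicategory

variable {V : Type u'} [Category.{v'} V] [MonoidalCategory V]
variable {I : Type w} [Category.{w} I] [MonoidalCategory I] [EnrichedOrdinaryCategory V I]
variable {M : Type u₂} [Bicategory.{w₂, v₂} M] [VCatCategory V M]
variable [MonoidalClosed V] [IsBase V]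

namespace Wedge

variable {x y Z : M} {ξ : SAct V I .l x} {υ : SAct V I .l y}

theorem pushCell_nat_obj (W : Wedge V .r ξ.ob Z) (P : EquivMor ξ.ob υ.ob) (u : I) {v v' : I}
    (g : v ⟶ v') :
    (W.e.map g ▷ P.f) ▷ 𝟙 y ≫ pushCell (P.ts u) (W.σ u v').hom =
      pushCell (P.ts u) (W.σ u v).hom ≫ (W.e.map (Side.r.mulMap g (𝟙 u)) ▷ P.f) ▷ υ.F.obj u :=
  (pushCell_precomp _ _ _).symm.trans
    ((congrArg (pushCell (P.ts u)) (W.nat_obj u g)).trans (pushCell_comp _ _ _))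

/-- The composition of a wedge with an equivariant morphism. -/
def push (W : Wedge V .r ξ.ob Z) (P : EquivMor ξ.ob υ.ob) : Wedge V .r υ.ob Z where
  e := W.e ⋙ postcomp Z P.f
  isVFunctor := W.isVFunctor.comp (VCatCategory.postcomp Z P.f)
  σ u v := pushIso (P.ts u) (W.σ u v)
  nat_obj u v v' g := by
    change _ ≫ (pushIso (P.ts u) (W.σ u v')).hom = (pushIso (P.ts u) (W.σ u v)).hom ≫ _
    rw [pushIso_hom, pushIso_hom]
    exact W.pushCell_nat_obj P u g
  nat {u u'} h v := by
    change _ ≫ (pushIso (P.ts u') (W.σ u' v)).hom = (pushIso (P.ts u) (W.σ u v)).hom ≫ _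
    rw [pushIso_hom, pushIso_hom]
    -- The right action of a left object is constant, so the left-hand side of the naturality axiom
    -- reduces to the single cell `W.σ u' v`.
    have e : (W.σ u' v).hom = ((W.σ u v).hom ≫ W.e.map (Side.r.mulMap (𝟙 v) h) ▷ ξ.F.obj u) ≫
        W.e.obj _ ◁ ξ.F.map h := by
      have := W.nat h v
      rw [Category.assoc]
      refine Eq.trans ?_ this
      exact ((congrArg (· ≫ (W.σ u' v).hom) (Bicategory.whiskerLeft_id _ _)).trans
        (Category.id_comp _)).symm
    have := (congrArg (pushCell (P.ts u')) e).trans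
      ((pushCell_whiskerLeft _ _ _ _ (P.ts_nat h) _).trans
        (congrArg (· ≫ _) (pushCell_comp _ _ _)))
    rw [Category.assoc] at this
    exact ((congrArg (· ≫ _) (Bicategory.whiskerLeft_id _ _)).trans
        (Category.id_comp _)).trans this
  tri u v t := by
    refine (pushIso_hom _ _).trans ?_
    have := pushCell_wedgePaste (ξ.ob.μ v u) (υ.ob.μ v u) (P.ts (Side.r.mul u v)) (P.ts u) (P.ts v)
      (P.ts_tri v u) (W.σ u t).hom (W.σ v (Side.r.mul t u)).hom (W.e.map (Side.r.assoc t u v).hom)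
    rw [← pushIso_hom, ← pushIso_hom] at this
    exact (congrArg (pushCell _) (W.tri u v t)).trans this
  one v := by
    refine (pushIso_hom _ _).trans ((congrArg (pushCell _) (W.one v)).trans ?_)
    exact pushCell_one _ _ _ P.ts_one _

theorem pushCell_hom_comm {W W' : Wedge V .r ξ.ob Z} (P : EquivMor ξ.ob υ.ob) (a : W ⟶ W')
    (u v : I) :
    (a.θ.app v ▷ P.f) ▷ 𝟙 y ≫ (pushIso (P.ts u) (W'.σ u v)).hom =
      (pushIso (P.ts u) (W.σ u v)).hom ≫ (a.θ.app (Side.r.mul v u) ▷ P.f) ▷ υ.F.obj u := by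
  rw [pushIso_hom, pushIso_hom]
  exact (pushCell_precomp _ _ _).symm.trans
    ((congrArg (pushCell (P.ts u)) (a.comm u v)).trans (pushCell_comp _ _ _))

variable (Z) in
/-- The composition of wedges with an equivariant morphism, as a functor. -/
def pushFunctor (P : EquivMor ξ.ob υ.ob) : Wedge V .r ξ.ob Z ⥤ Wedge V .r υ.ob Z where
  obj W := W.push P
  map a := ⟨Functor.whiskerRight a.θ _, pushCell_hom_comm P a⟩
  map_id W := hom_ext fun v => id_whiskerRight (W.e.obj v) P.f
  map_comp a b := hom_ext fun v => comp_whiskerRight (a.θ.app v) (b.θ.app v) P.f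

end Wedge

end Bicat

/-! ### Wedge cells along the maps of a weak cone. -/

section Coherence

open Bicategory

variable {M : Type u₂} [Bicategory.{w₂, v₂} M]

/-- Conjugating both cells by isomorphisms makes the inner pairs for `q₁` and `q₁₂` cancel, so the
product law transports along an isomorphism of functors. -/
theorem wedgePaste_conj {a b : M} {f f₁ f₂ n n₁ n₂ : a ⟶ a} {p q q₁ q₁₂ p' q' q₁' q₁₂' : b ⟶ a}
    (mA' : f ≅ f₂ ≫ f₁) (mA : n ≅ n₁ ≫ n₂) (cA : f₁ ≫ n₂ ≅ n₂ ≫ f₁)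
    (σ₁ : p ≫ n₁ ⟶ q₁ ≫ f₁) (σ₁₂ : q₁ ≫ n₂ ⟶ q₁₂ ≫ f₂) (x : q₁₂ ⟶ q) (x' : q₁₂' ⟶ q')
    (c : p' ≅ p) (d : q' ≅ q) (d₁ : q₁' ≅ q₁) (d₁₂ : q₁₂' ≅ q₁₂)
    (h : x' ≫ d.hom = d₁₂.hom ≫ x) :
    wedgePaste mA' mA cA (c.hom ▷ n₁ ≫ σ₁ ≫ d₁.inv ▷ f₁) (d₁.hom ▷ n₂ ≫ σ₁₂ ≫ d₁₂.inv ▷ f₂) x' =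
      c.hom ▷ n ≫ wedgePaste mA' mA cA σ₁ σ₁₂ x ≫ d.inv ▷ f := by
  obtain rfl : x' = d₁₂.hom ≫ x ≫ d.inv := by rw [← reassoc_of% h]; simp
  unfold wedgePaste
  calc
    _ = (p' ◁ mA.hom ≫ c.hom ▷ (n₁ ≫ n₂)) ⊗≫ σ₁ ▷ n₂ ⊗≫ (d₁.inv ▷ (f₁ ≫ n₂) ≫ q₁' ◁ cA.hom) ⊗≫
        d₁.hom ▷ (n₂ ≫ f₁) ⊗≫ σ₁₂ ▷ f₁ ⊗≫
        (d₁₂.inv ≫ d₁₂.hom) ▷ (f₂ ≫ f₁) ⊗≫ x ▷ (f₂ ≫ f₁) ⊗≫ (d.inv ▷ (f₂ ≫ f₁) ≫ q' ◁ mA'.inv) := by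
      bicategory
    _ = c.hom ▷ n ⊗≫ p ◁ mA.hom ⊗≫ σ₁ ▷ n₂ ⊗≫ q₁ ◁ cA.hom ⊗≫ (d₁.inv ≫ d₁.hom) ▷ (n₂ ≫ f₁) ⊗≫
        σ₁₂ ▷ f₁ ⊗≫ x ▷ (f₂ ≫ f₁) ⊗≫ q ◁ mA'.inv ⊗≫ d.inv ▷ f := by
      rw [whisker_exchange, ← whisker_exchange d₁.inv, ← whisker_exchange d.inv, d₁₂.inv_hom_id]
      bicategory
    _ = _ := by rw [d₁.inv_hom_id]; bicategory

/-- Pushing a wedge cell to level n + 1 and then along the transition map gives the same as pushing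
it to level n, because the comparison `φ` of the cone is equivariant. -/
theorem push_cone {z l x x' : M} {e e' : z ⟶ l} {ln : l ⟶ l} {xn : x ⟶ x} {xn' : x' ⟶ x'}
    {p : l ⟶ x} {p' : l ⟶ x'} {t : x' ⟶ x} (P : p ≫ xn ≅ ln ≫ p) (P' : p' ≫ xn' ≅ ln ≫ p')
    (T : t ≫ xn ≅ xn' ≫ t) (φ : p' ≫ t ≅ p)
    (hφ : φ.hom ▷ xn ≫ P.hom = (compTgt P' T).hom ≫ ln ◁ φ.hom) (σ : e ≫ 𝟙 l ⟶ e' ≫ ln) :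
    ((α_ e p' t).hom ≫ e ◁ φ.hom) ▷ 𝟙 x ≫ pushCell P σ =
      pushCell T (pushCell P' σ) ≫ ((α_ e' p' t).hom ≫ e' ◁ φ.hom) ▷ xn := by
  have hφ' : ln ◁ φ.hom ≫ P.inv = (compTgt P' T).inv ≫ φ.hom ▷ xn := by
    rw [Iso.comp_inv_eq, Category.assoc, hφ, Iso.inv_hom_id_assoc]
  simp only [compTgt, Iso.trans_inv, Iso.symm_inv, whiskerLeftIso_inv, whiskerRightIso_inv] at hφ'
  unfold pushCell
  calc
    _ = 𝟙 _ ⊗≫ ((e ≫ 𝟙 l) ◁ φ.hom ≫ σ ▷ p) ⊗≫ e' ◁ P.inv ⊗≫ 𝟙 ((e' ≫ p) ≫ xn) := by bicategory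
    _ = 𝟙 _ ⊗≫ σ ▷ (p' ≫ t) ⊗≫ e' ◁ (ln ◁ φ.hom ≫ P.inv) ⊗≫ 𝟙 ((e' ≫ p) ≫ xn) := by
      rw [whisker_exchange]; bicategory
    _ = _ := by rw [hφ']; bicategory

/-- The candidate for the whiskering with `p` of a wedge cell which lifts `r`. -/
def pushLift {z x y : M} {e e' : z ⟶ x} {F F' : z ⟶ y} {xu : x ⟶ x} {yu : y ⟶ y} {p : x ⟶ y}
    (P : p ≫ yu ≅ xu ≫ p) (c : e ≫ p ≅ F) (c' : e' ≫ p ≅ F') (r : F ≫ 𝟙 y ≅ F' ≫ yu) :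
    (e ≫ 𝟙 x) ≫ p ≅ (e' ≫ xu) ≫ p :=
  whiskerRightIso (ρ_ e) p ≪≫ (ρ_ _).symm ≪≫ whiskerRightIso c (𝟙 y) ≪≫ r ≪≫
    whiskerRightIso c'.symm yu ≪≫ α_ _ _ _ ≪≫ whiskerLeftIso e' P ≪≫ (α_ _ _ _).symm

theorem pushLift_hom {z x y : M} {e e' : z ⟶ x} {F F' : z ⟶ y} {xu : x ⟶ x} {yu : y ⟶ y}
    {p : x ⟶ y} (P : p ≫ yu ≅ xu ≫ p) (c : e ≫ p ≅ F) (c' : e' ≫ p ≅ F')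
    (r : F ≫ 𝟙 y ≅ F' ≫ yu) : (pushLift P c c' r).hom =
      𝟙 ((e ≫ 𝟙 x) ≫ p) ⊗≫ c.hom ▷ 𝟙 y ≫ r.hom ≫ c'.inv ▷ yu ⊗≫ e' ◁ P.hom ⊗≫
        𝟙 ((e' ≫ xu) ≫ p) := by
  simp only [pushLift, Iso.trans_hom, Iso.symm_hom, whiskerLeftIso_hom, whiskerRightIso_hom]
  bicategory

/-- The formula of `pushLift` is chosen so that, after lifting, the cell pushed to each level is the
given cell `r` conjugated by the comparisons `c` and `c'`. -/
theorem pushCell_of_pushLift {z x y : M} {e e' : z ⟶ x} {F F' : z ⟶ y} {xu : x ⟶ x} {yu : y ⟶ y}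
    {p : x ⟶ y} (P : p ≫ yu ≅ xu ≫ p) (c : e ≫ p ≅ F) (c' : e' ≫ p ≅ F')
    (r : F ≫ 𝟙 y ≅ F' ≫ yu) (σ : e ≫ 𝟙 x ⟶ e' ≫ xu) (h : σ ▷ p = (pushLift P c c' r).hom) :
    pushCell P σ = c.hom ▷ 𝟙 y ≫ r.hom ≫ c'.inv ▷ yu := by
  rw [pushCell, h, pushLift_hom]
  calc
    _ = 𝟙 _ ⊗≫ c.hom ▷ 𝟙 y ≫ r.hom ≫ c'.inv ▷ yu ⊗≫ e' ◁ (P.hom ≫ P.inv) ⊗≫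
        𝟙 ((e' ≫ p) ≫ yu) := by bicategory
    _ = _ := by rw [P.hom_inv_id]; bicategory

/-- Compatibility of the given wedge cells with the transition maps, `hr`, makes the candidates at
all levels an isomorphism of weak cones in `M`, so that they lift to a cell on the limit. -/
theorem pushLift_cone {z l x x' : M} {e e' : z ⟶ l} {ln : l ⟶ l} {xn : x ⟶ x} {xn' : x' ⟶ x'}
    {F G : z ⟶ x} {F' G' : z ⟶ x'} {p : l ⟶ x} {p' : l ⟶ x'} {t : x' ⟶ x}
    (P : p ≫ xn ≅ ln ≫ p) (P' : p' ≫ xn' ≅ ln ≫ p') (T : t ≫ xn ≅ xn' ≫ t) (c : e ≫ p ≅ F)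
    (d : e' ≫ p ≅ G) (c' : e ≫ p' ≅ F') (d' : e' ≫ p' ≅ G') (r : F ≫ 𝟙 x ≅ G ≫ xn)
    (r' : F' ≫ 𝟙 x' ≅ G' ≫ xn') (φ : p' ≫ t ≅ p) (ψ : F' ≫ t ≅ F) (χ : G' ≫ t ≅ G)
    (hφ : φ.hom ▷ xn ≫ P.hom = (compTgt P' T).hom ≫ ln ◁ φ.hom)
    (hr : ψ.hom ▷ 𝟙 x ≫ r.hom = pushCell T r'.hom ≫ χ.hom ▷ xn)
    (hc : c'.hom ▷ t ≫ ψ.hom = ((α_ e p' t).hom ≫ e ◁ φ.hom) ≫ c.hom)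
    (hd : d'.hom ▷ t ≫ χ.hom = ((α_ e' p' t).hom ≫ e' ◁ φ.hom) ≫ d.hom) :
    (pushLift P' c' d' r').hom ▷ t ≫ (α_ (e' ≫ ln) p' t).hom ≫ (e' ≫ ln) ◁ φ.hom =
      ((α_ (e ≫ 𝟙 l) p' t).hom ≫ (e ≫ 𝟙 l) ◁ φ.hom) ≫ (pushLift P c d r).hom := by
  have hc₁ : e ◁ φ.hom ≫ c.hom = (α_ e p' t).inv ≫ c'.hom ▷ t ≫ ψ.hom := by rw [hc]; simp
  have hd₁ : χ.hom ≫ d.inv = d'.inv ▷ t ≫ (α_ e' p' t).hom ≫ e' ◁ φ.hom := by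
    rw [Iso.comp_inv_eq]
    rw [← cancel_epi (d'.hom ▷ t), hd]
    simp
  simp only [compTgt, Iso.trans_hom, Iso.symm_hom, whiskerLeftIso_hom, whiskerRightIso_hom] at hφ
  rw [pushLift_hom, pushLift_hom]
  symm
  calc
    _ = 𝟙 _ ⊗≫ (e ◁ φ.hom ≫ c.hom) ⊗≫ r.hom ⊗≫ d.inv ▷ xn ⊗≫ e' ◁ P.hom ⊗≫
        𝟙 ((e' ≫ ln) ≫ p) := by bicategory
    _ = 𝟙 _ ⊗≫ c'.hom ▷ t ⊗≫ (ψ.hom ▷ 𝟙 x ≫ r.hom) ⊗≫ d.inv ▷ xn ⊗≫ e' ◁ P.hom ⊗≫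
        𝟙 ((e' ≫ ln) ≫ p) := by rw [hc₁]; bicategory
    _ = 𝟙 _ ⊗≫ c'.hom ▷ t ⊗≫ r'.hom ▷ t ⊗≫ G' ◁ T.inv ⊗≫ (χ.hom ≫ d.inv) ▷ xn ⊗≫ e' ◁ P.hom ⊗≫
        𝟙 ((e' ≫ ln) ≫ p) := by rw [hr, pushCell]; bicategory
    _ = 𝟙 _ ⊗≫ c'.hom ▷ t ⊗≫ r'.hom ▷ t ⊗≫ (G' ◁ T.inv ≫ d'.inv ▷ (t ≫ xn)) ⊗≫
        e' ◁ (φ.hom ▷ xn ≫ P.hom) ⊗≫ 𝟙 ((e' ≫ ln) ≫ p) := by rw [hd₁]; bicategory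
    _ = 𝟙 _ ⊗≫ c'.hom ▷ t ⊗≫ r'.hom ▷ t ⊗≫ d'.inv ▷ (xn' ≫ t) ⊗≫ e' ◁ p' ◁ (T.inv ≫ T.hom) ⊗≫
        e' ◁ P'.hom ▷ t ⊗≫ e' ◁ ln ◁ φ.hom ⊗≫ 𝟙 ((e' ≫ ln) ≫ p) := by
      rw [whisker_exchange, hφ]; bicategory
    _ = _ := by rw [T.inv_hom_id]; bicategory

end Coherence

/-! ### Weak limits of towers of categories -/

section PCone

/-- An object of the weak limit of a tower of categories. -/
structure PCone (W : ℕ → Type u₁) [∀ n, Category.{v₁} (W n)] (T : ∀ n, W (n + 1) ⥤ W n) where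
  g (n : ℕ) : W n
  φ (n : ℕ) : (T n).obj (g (n + 1)) ≅ g n

namespace PCone

variable {W : ℕ → Type u₁} [∀ n, Category.{v₁} (W n)] {T : ∀ n, W (n + 1) ⥤ W n}

/-- A morphism of the weak limit of a tower of categories. -/
@[ext]
structure Hom (F G : PCone W T) where
  θ (n : ℕ) : F.g n ⟶ G.g n
  comm : ∀ n, (T n).map (θ (n + 1)) ≫ (G.φ n).hom = (F.φ n).hom ≫ θ n

/-- The weak limit of a tower of categories. -/
instance : Category (PCone W T) where
  Hom F G := Hom F G
  id F := ⟨fun n => 𝟙 (F.g n), fun n => by simp⟩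
  comp a b := ⟨fun n => a.θ n ≫ b.θ n, fun n => by
    rw [Functor.map_comp, Category.assoc, b.comm, reassoc_of% a.comm n]⟩
  id_comp a := Hom.ext (funext fun n => Category.id_comp (a.θ n))
  comp_id a := Hom.ext (funext fun n => Category.comp_id (a.θ n))
  assoc a b c := Hom.ext (funext fun n => Category.assoc (a.θ n) (b.θ n) (c.θ n))

/-- An isomorphism of the weak limit of a tower of categories. -/
def isoMk {F G : PCone W T} (i : ∀ n, F.g n ≅ G.g n)
    (h : ∀ n, (T n).map (i (n + 1)).hom ≫ (G.φ n).hom = (F.φ n).hom ≫ (i n).hom) : F ≅ G where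
  hom := ⟨fun n => (i n).hom, h⟩
  inv := ⟨fun n => (i n).inv, fun n => by
    rw [← cancel_epi ((T n).map (i (n + 1)).hom), reassoc_of% h n, ← Functor.map_comp_assoc]
    simp⟩
  hom_inv_id := Hom.ext (funext fun n => (i n).hom_inv_id)
  inv_hom_id := Hom.ext (funext fun n => (i n).inv_hom_id)

end PCone

end PCone

/-! ### Wedges on a weak limit as weak cones of wedges. -/

section Bicat

open Bicategory

variable {V : Type u'} [Category.{v'} V] [MonoidalCategory V]
variable {I : Type w} [Category.{w} I] [MonoidalCategory I] [EnrichedOrdinaryCategory V I]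
variable {M : Type u₂} [Bicategory.{w₂, v₂} M] [VCatCategory V M]

/-- The wedge structure on a functor isomorphic to the functor of a wedge. -/
def Wedge.ofIso {s : Side} {A : IObj V I M} {Z : M} (W : Wedge V s A Z) (e : I ⥤ (Z ⟶ A.pt))
    (he : IsVFunctor V e) (c : ∀ v, e.obj v ≅ W.e.obj v)
    (hc : ∀ {v v' : I} (h : v ⟶ v'), e.map h ≫ (c v').hom = (c v).hom ≫ W.e.map h) :
    Wedge V s A Z where
  e := e
  isVFunctor := he
  σ u v := whiskerRightIso (c v) _ ≪≫ W.σ u v ≪≫ whiskerRightIso (c _).symm _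
  nat_obj u v v' g := by
    have hc' : W.e.map (s.mulMap g (𝟙 u)) ≫ (c _).inv = (c _).inv ≫ e.map (s.mulMap g (𝟙 u)) := by
      rw [Iso.comp_inv_eq, Category.assoc, hc, Iso.inv_hom_id_assoc]
    simp only [Iso.trans_hom, whiskerRightIso_hom, Iso.symm_hom, Category.assoc]
    rw [← comp_whiskerRight_assoc, hc, comp_whiskerRight_assoc, reassoc_of% W.nat_obj u g,
      ← comp_whiskerRight, hc', comp_whiskerRight]
  nat {u u'} h v := by
    have hc' : W.e.map (s.mulMap (𝟙 v) h) ≫ (c _).inv = (c _).inv ≫ e.map (s.mulMap (𝟙 v) h) := by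
      rw [Iso.comp_inv_eq, Category.assoc, hc, Iso.inv_hom_id_assoc]
    simp only [Iso.trans_hom, whiskerRightIso_hom, Iso.symm_hom, Category.assoc]
    rw [whisker_exchange_assoc, reassoc_of% W.nat h v, whisker_exchange, ← comp_whiskerRight_assoc,
      hc', comp_whiskerRight_assoc]
  tri u v t := by
    simp only [Iso.trans_hom, whiskerRightIso_hom, Iso.symm_hom]
    rw [W.tri u v t]
    exact (wedgePaste_conj _ _ _ _ _ _ _ (c t) (c _) (c _) (c _) (hc _)).symm
  one v := by
    have hc' : W.e.map (s.mul_one v).inv ≫ (c _).inv = (c _).inv ≫ e.map (s.mul_one v).inv := by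
      rw [Iso.comp_inv_eq, Category.assoc, hc, Iso.inv_hom_id_assoc]
    simp only [Iso.trans_hom, whiskerRightIso_hom, Iso.symm_hom]
    rw [W.one v]
    simp only [Category.assoc]
    rw [← whisker_exchange_assoc, whisker_exchange, ← comp_whiskerRight_assoc (W.e.map _), hc',
      comp_whiskerRight_assoc, ← comp_whiskerRight_assoc, Iso.hom_inv_id, id_whiskerRight,
      Category.id_comp]

variable [MonoidalClosed V] [HasLimitsOfSize.{w, w} V] [IsBase V]

variable {pt : ℕ → M} {υ : ∀ n, SAct V I .l (pt n)} {t : ∀ n, (υ (n + 1)).ob ⟶ (υ n).ob} {l : M}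
  {ℓ : SAct V I .l l} (C : TowerCone (fun n => (υ n).ob) t ℓ.ob) (Z : M)

namespace TowerCone

/-- The compositions of a wedge on the vertex of a weak cone with the morphisms of the cone. -/
def wedgeFunctor : Wedge V .r ℓ.ob Z ⥤
    PCone (fun n => Wedge V .r (υ n).ob Z) (fun n => Wedge.pushFunctor Z (t n)) where
  obj W :=
    { g := fun n => W.push (C.g n)
      φ := fun n => Wedge.isoMk (F := (W.push (C.g (n + 1))).push (t n)) (G := W.push (C.g n))
        (fun v => α_ _ _ _ ≪≫ whiskerLeftIso (W.e.obj v) (C.forget.φ n))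
        (fun {v v'} h => by
          have := whisker_exchange (W.e.map h) (C.forget.φ n).hom
          change (W.e.map h ▷ _) ▷ _ ≫ (α_ _ _ _).hom ≫ _ ◁ (C.forget.φ n).hom =
            ((α_ _ _ _).hom ≫ _ ◁ (C.forget.φ n).hom) ≫ W.e.map h ▷ _
          rw [Category.assoc, this]
          simp)
        (fun u v => by
          have := push_cone (EquivMor.ts (C.g n) u) (EquivMor.ts (C.g (n + 1)) u)
            (EquivMor.ts (t n) u) (C.forget.φ n) ((EquivMor.Hom.comm_ts (C.φ n).hom u).trans
              (congrArg (fun x => Iso.hom x ≫ _) (EquivMor.cmp_ts _ _ u))) (W.σ u v).hom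
          rw [← pushIso_hom, ← pushIso_hom, ← pushIso_hom] at this
          exact this) }
  map {W W'} a :=
    { θ := fun n => (Wedge.pushFunctor Z (C.g n)).map a
      comm := fun n => Wedge.hom_ext fun v => by
        have := whisker_exchange (a.θ.app v) (C.forget.φ n).hom
        change (a.θ.app v ▷ _) ▷ _ ≫ (α_ _ _ _).hom ≫ _ ◁ (C.forget.φ n).hom =
          ((α_ _ _ _).hom ≫ _ ◁ (C.forget.φ n).hom) ≫ a.θ.app v ▷ _
        rw [Category.assoc, this]
        simp }
  map_id W := PCone.Hom.ext (funext fun n => (Wedge.pushFunctor Z (C.g n)).map_id W)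
  map_comp a b := PCone.Hom.ext (funext fun n => (Wedge.pushFunctor Z (C.g n)).map_comp a b)

theorem faithful_wedgeFunctor (h : (C.forget.pullFunctor Z).Faithful) :
    (C.wedgeFunctor Z).Faithful where
  map_injective e := Wedge.hom_ext fun v =>
    (C.forget.pullFunctor Z).map_injective (TowerCone.Hom.ext (funext fun n =>
      congrArg (fun x => Wedge.Hom.θ (PCone.Hom.θ x n) |>.app v) e))

/-- For each index v the components at the various levels form a morphism of weak cones and lift to
the limit. Naturality in v and the wedge condition hold because they hold after every projection. -/
theorem full_wedgeFunctor (h : (C.forget.pullFunctor Z).Faithful)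
    (h' : (C.forget.pullFunctor Z).Full) : (C.wedgeFunctor Z).Full where
  map_surjective {W W'} b := by
    let k (v : I) : (C.forget.pullFunctor Z).obj (W.e.obj v) ⟶
        (C.forget.pullFunctor Z).obj (W'.e.obj v) :=
      ⟨fun n => (PCone.Hom.θ b n).θ.app v,
        fun n => congrArg (fun x => Wedge.Hom.θ x |>.app v) (PCone.Hom.comm b n)⟩
    let a (v : I) : W.e.obj v ⟶ W'.e.obj v := (C.forget.pullFunctor Z).preimage (k v)
    have ha (v : I) (n : ℕ) : a v ▷ EquivMor.f (C.g n) = (PCone.Hom.θ b n).θ.app v := by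
      have : (C.forget.pullFunctor Z).map (a v) = k v := Functor.map_preimage _ _
      exact congrArg (fun x => TowerCone.Hom.θ x n) this
    refine ⟨⟨{ app := a, naturality := fun v v' f => ?_ }, fun u v => ?_⟩, ?_⟩
    · refine (C.forget.pullFunctor Z).map_injective (TowerCone.Hom.ext (funext fun n => ?_))
      change (W.e.map f ≫ a v') ▷ EquivMor.f (C.g n) = (a v ≫ W'.e.map f) ▷ EquivMor.f (C.g n)
      rw [comp_whiskerRight, comp_whiskerRight, ha, ha]
      exact (PCone.Hom.θ b n).θ.naturality f
    · refine (C.forget.pullFunctor Z).map_injective (TowerCone.Hom.ext (funext fun n => ?_))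
      refine pushCell_cancel (EquivMor.ts (C.g n) u) ?_
      refine (pushCell_precomp _ _ _).trans (Eq.trans ?_ (pushCell_comp _ _ _).symm)
      have := (PCone.Hom.θ b n).comm u v
      rw [← ha, ← ha] at this
      rw [← pushIso_hom, ← pushIso_hom]
      exact this
    · exact PCone.Hom.ext (funext fun n => Wedge.hom_ext fun v => ha v n)

variable {Z} in
/-- The weak cones given by a weak cone of wedges. -/
def ofWedges (D : PCone (fun n => Wedge V .r (υ n).ob Z) (fun n => Wedge.pushFunctor Z (t n))) :
    I ⥤ TowerCone (fun n => (υ n).ob.pt) (fun n => EquivMor.f (t n)) Z where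
  obj v := ⟨fun n => (D.g n).e.obj v, fun n => Wedge.isoApp (D.φ n) v⟩
  map h := ⟨fun n => (D.g n).e.map h, fun n => (D.φ n).hom.θ.naturality h⟩
  map_id v := TowerCone.Hom.ext (funext fun n => (D.g n).e.map_id v)
  map_comp a b := TowerCone.Hom.ext (funext fun n => (D.g n).e.map_comp a b)

/-- A weak cone of wedges is a functor from `I` to weak cones together with cells; both are lifted
to the limit. The hypothesis is a `V`-equivalence because the functor underlying the lifted wedge
must be a `V`-functor. -/
theorem essSurj_wedgeFunctor (h : IsVEquivalence V (C.forget.pullFunctor Z)) :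
    (C.wedgeFunctor Z).EssSurj := by
  have := h.isEquivalence
  refine ⟨fun D => ?_⟩
  obtain ⟨_, G, hG, _, ⟨k⟩⟩ := h
  have hD : IsVFunctor V (ofWedges D) :=
    isVFunctor_of_vrep fun v v' => vrep_of.{w} fun n => (D.g n).isVFunctor.vrep v v'
  -- An enriched inverse `G` of the comparison functor is used, so that `e` is a `V`-functor.
  let e : I ⥤ (Z ⟶ l) := ofWedges D ⋙ G
  have he : IsVFunctor V e := hD.comp hG
  let c (n : ℕ) (v : I) : e.obj v ≫ EquivMor.f (C.g n) ≅ (D.g n).e.obj v :=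
    (evalFunctor Z n).mapIso (k.app ((ofWedges D).obj v))
  have c_nat (n : ℕ) {v v' : I} (f : v ⟶ v') :
      e.map f ▷ EquivMor.f (C.g n) ≫ (c n v').hom = (c n v).hom ≫ (D.g n).e.map f :=
    congrArg (fun x => Hom.θ x n) (k.hom.naturality ((ofWedges D).map f))
  have c_cone (n : ℕ) (v : I) : (c (n + 1) v).hom ▷ EquivMor.f (t n) ≫ (D.φ n).hom.θ.app v =
      ((α_ _ _ _).hom ≫ e.obj v ◁ (C.forget.φ n).hom) ≫ (c n v).hom :=
    Hom.comm (k.hom.app ((ofWedges D).obj v)) n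
  let d (u v : I) (n : ℕ) := pushLift (EquivMor.ts (C.g n) u) (c n v) (c n (Side.r.mul v u))
    ((D.g n).σ u v)
  let σ (u v : I) : e.obj v ≫ 𝟙 l ≅ e.obj (Side.r.mul v u) ≫ ℓ.F.obj u :=
    (C.forget.pullFunctor Z).preimageIso (isoMk (d u v) fun n =>
      pushLift_cone (EquivMor.ts (C.g n) u) (EquivMor.ts (C.g (n + 1)) u) (EquivMor.ts (t n) u)
        _ _ _ _ _ _ (C.forget.φ n) (Wedge.isoApp (D.φ n) v) (Wedge.isoApp (D.φ n) _)
        ((EquivMor.Hom.comm_ts (C.φ n).hom u).trans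
          (congrArg (fun x => Iso.hom x ≫ _) (EquivMor.cmp_ts _ _ u)))
        (((D.φ n).hom.comm u v).trans
          (congrArg (· ≫ _) (pushIso_hom (EquivMor.ts (t n) u) ((D.g (n + 1)).σ u v))))
        (c_cone n v) (c_cone n _))
  have hσ (n : ℕ) (u v : I) : (σ u v).hom ▷ EquivMor.f (C.g n) = (d u v n).hom := by
    have : (C.forget.pullFunctor Z).map (σ u v).hom = _ := Functor.map_preimage _ _
    exact congrArg (fun x => Hom.θ x n) this
  -- The wedge `D.g n` transported to the functor obtained by projecting `e`. By `hp` its cells are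
  -- exactly the projected cells `σ`, so each axiom for `σ` is read off from the same axiom of `W
  -- n`.
  let W (n : ℕ) : Wedge V .r (υ n).ob Z := (D.g n).ofIso (e ⋙ postcomp Z (EquivMor.f (C.g n)))
    (he.comp (VCatCategory.postcomp Z (EquivMor.f (C.g n)))) (c n) (c_nat n)
  have hp (n : ℕ) (u v : I) : pushCell (EquivMor.ts (C.g n) u) (σ u v).hom = ((W n).σ u v).hom :=
    pushCell_of_pushLift _ _ _ _ _ (hσ n u v)
  have ext {f f' : Z ⟶ l} {a b : f ⟶ f'}
      (H : ∀ n, a ▷ EquivMor.f (C.g n) = b ▷ EquivMor.f (C.g n)) : a = b :=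
    (C.forget.pullFunctor Z).map_injective (Hom.ext (funext H))
  let X : Wedge V .r ℓ.ob Z :=
    { e := e
      isVFunctor := he
      σ := σ
      nat_obj := fun u {v v'} f => ext fun n => pushCell_cancel (EquivMor.ts (C.g n) u) (by
        refine (pushCell_precomp _ _ _).trans (Eq.trans ?_ (pushCell_comp _ _ _).symm)
        rw [hp, hp]
        exact (W n).nat_obj u f)
      nat := fun {u u'} f v => ext fun n => pushCell_cancel (EquivMor.ts (C.g n) u') (by
        refine (congrArg (pushCell _) ((congrArg (· ≫ (σ u' v).hom)
          (Bicategory.whiskerLeft_id _ _)).trans (Category.id_comp _))).trans ?_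
        refine Eq.trans ?_ (congrArg (pushCell _) (Category.assoc _ _ _))
        refine Eq.trans ?_ ((pushCell_whiskerLeft _ _ _ _ (EquivMor.ts_nat (C.g n) f) _).trans
          (congrArg (· ≫ _) (pushCell_comp _ _ _))).symm
        rw [hp, hp]
        refine Eq.trans ?_ (((W n).nat f v).trans (Category.assoc _ _ _).symm)
        exact ((congrArg (· ≫ ((W n).σ u' v).hom) (Bicategory.whiskerLeft_id _ _)).trans
          (Category.id_comp _)).symm)
      tri := fun u v w => ext fun n => pushCell_cancel (EquivMor.ts (C.g n) (Side.r.mul u v)) (by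
        refine Eq.trans ?_ (pushCell_wedgePaste (ℓ.ob.μ v u) ((υ n).ob.μ v u) _
          (EquivMor.ts (C.g n) u) (EquivMor.ts (C.g n) v) (EquivMor.ts_tri (C.g n) v u) _ _ _).symm
        rw [hp, hp, hp]
        exact (W n).tri u v w)
      one := fun v => ext fun n => pushCell_cancel (EquivMor.ts (C.g n) (tunit I)) (by
        refine Eq.trans ?_ (pushCell_one _ _ _ (EquivMor.ts_one (C.g n)) _).symm
        rw [hp]
        exact (W n).one v) }
  refine ⟨X, ⟨PCone.isoMk (fun n => Wedge.isoMk (F := X.push (C.g n)) (G := D.g n) (c n) (c_nat n)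
    fun u v => ?_) fun n => Wedge.hom_ext fun v => c_cone n v⟩⟩
  have e₁ : ((X.push (C.g n)).σ u v).hom = (c n v).hom ▷ 𝟙 (pt n) ≫ ((D.g n).σ u v).hom ≫
      (c n (Side.r.mul v u)).inv ▷ (υ n).F.obj u := (pushIso_hom _ _).trans (hp n u v)
  refine Eq.trans ?_ (congrArg (· ≫ _) e₁).symm
  have e₂ : (c n (Side.r.mul v u)).inv ▷ (υ n).F.obj u ≫
      (c n (Side.r.mul v u)).hom ▷ (υ n).F.obj u = 𝟙 _ := by
    rw [← comp_whiskerRight, Iso.inv_hom_id, id_whiskerRight]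
  exact ((Category.assoc _ _ _).trans (congrArg (_ ≫ ·) ((Category.assoc _ _ _).trans
    ((congrArg (_ ≫ ·) e₂).trans (Category.comp_id _))))).symm

theorem isEquivalence_wedgeFunctor (h : IsVEquivalence V (C.forget.pullFunctor Z)) :
    (C.wedgeFunctor Z).IsEquivalence :=
  have := h.isEquivalence
  { faithful := C.faithful_wedgeFunctor Z inferInstance
    full := C.full_wedgeFunctor Z inferInstance inferInstance
    essSurj := C.essSurj_wedgeFunctor Z h }

end TowerCone

end Bicat

/-! ### Comparison of wedges along squares of equivariant morphisms. -/

section Coherence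

open Bicategory

variable {M : Type u₂} [Bicategory.{w₂, v₂} M]

/-- The composite of an equivariance cell `t` from an object with a right action to an object with
a left action and an equivariance cell `P` between objects with left actions. -/
def compSrc {b x y : M} {bu : b ⟶ b} {xu : x ⟶ x} {yu : y ⟶ y} {f : b ⟶ x} {p : x ⟶ y}
    (t : f ≫ 𝟙 x ≅ bu ≫ f ≫ xu) (P : p ≫ yu ≅ xu ≫ p) : (f ≫ p) ≫ 𝟙 y ≅ bu ≫ (f ≫ p) ≫ yu :=
  ρ_ _ ≪≫ whiskerRightIso ((ρ_ f).symm ≪≫ t) p ≪≫ α_ _ _ _ ≪≫ whiskerLeftIso bu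
    (α_ _ _ _ ≪≫ whiskerLeftIso f P.symm ≪≫ (α_ _ _ _).symm)

/-- For a middle object acting on the left and a source acting on the right, the side on which the
middle object is mute is the acting side of the source. The first cell is thus used as it stands,
while the second enters through the inverse of its reduced form. -/
theorem srcIso_compIso_left {b x y : M} {bu : b ⟶ b} {xu : x ⟶ x} {yu : y ⟶ y} {f : b ⟶ x}
    {p : x ⟶ y} (t : 𝟙 b ≫ f ≫ 𝟙 x ≅ bu ≫ f ≫ xu) (r : xu ≫ p ≫ 𝟙 y ≅ 𝟙 x ≫ p ≫ yu) :
    srcIso (Iso.refl _) (compIso (Iso.refl _) t r) =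
      compSrc (srcIso (Iso.refl _) t) (tgtIso (Iso.refl _) (srcIso (Iso.refl _) r.symm)) := by
  ext
  simp only [srcIso, tgtIso, compIso, compSrc, hatL, hatR, Iso.trans_hom, Iso.symm_hom,
    whiskerLeftIso_hom, Iso.refl_hom, whiskerRightIso_hom, Iso.trans_inv, Iso.symm_inv,
    whiskerLeftIso_inv, whiskerRightIso_inv, Iso.refl_inv]
  bicategory

theorem push_phi {b x y : M} {bu bv bvu : b ⟶ b} {xu : x ⟶ x} {yu : y ⟶ y} {f : b ⟶ x} {p : x ⟶ y}
    (t : f ≫ 𝟙 x ≅ bu ≫ f ≫ xu) (P : p ≫ yu ≅ xu ≫ p) (μ : bvu ≅ bv ≫ bu) :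
    (α_ bv f p).hom ▷ 𝟙 y ≫ (phiIso (compSrc t P) μ).hom =
      (pushIso P (phiIso t μ)).hom ≫ (α_ bvu f p).hom ▷ yu := by
  rw [pushIso_hom]
  simp only [phiIso, compSrc, pushCell, Iso.trans_hom, Iso.symm_hom, whiskerLeftIso_hom,
    whiskerRightIso_hom]
  calc
    _ = 𝟙 _ ⊗≫ bv ◁ t.hom ▷ p ⊗≫ ((bv ≫ bu) ◁ f ◁ P.inv ≫ μ.inv ▷ (f ≫ p ≫ yu)) ⊗≫ 𝟙 _ := by
      bicategory
    _ = _ := by rw [whisker_exchange]; bicategory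

theorem pull_push {z b x y : M} {e e' : b ⟶ x} {xu : x ⟶ x} {yu : y ⟶ y} {p : x ⟶ y} (g : z ⟶ b)
    (P : p ≫ yu ≅ xu ≫ p) (σ : e ≫ 𝟙 x ≅ e' ≫ xu) :
    (α_ g e p).hom ▷ 𝟙 y ≫ (pullIso g (pushIso P σ)).hom =
      (pushIso P (pullIso g σ)).hom ≫ (α_ g e' p).hom ▷ yu := by
  simp only [pushIso, pullIso, Iso.trans_hom, Iso.symm_hom, whiskerLeftIso_hom,
    whiskerRightIso_hom]
  bicategory

theorem pull_pull {z b c x : M} {e e' : c ⟶ x} {n f : x ⟶ x} (g : z ⟶ b) (h : b ⟶ c)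
    (σ : e ≫ n ≅ e' ≫ f) :
    (α_ g h e).inv ▷ n ≫ (pullIso (g ≫ h) σ).hom =
      (pullIso g (pullIso h σ)).hom ≫ (α_ g h e').inv ▷ f := by
  simp only [pullIso, Iso.trans_hom, Iso.symm_hom, whiskerLeftIso_hom]
  bicategory

/-- The comparison of the evaluations along a square `κ`. -/
def sqIso {z b c x y : M} (g : z ⟶ b) {bv : b ⟶ b} {cv : c ⟶ c} {f : b ⟶ x} {t : x ⟶ y}
    {h : b ⟶ c} {k : c ⟶ y} (κ : f ≫ t ≅ h ≫ k) (H : h ≫ cv ≅ bv ≫ h) :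
    (g ≫ bv ≫ f) ≫ t ≅ (g ≫ h) ≫ cv ≫ k :=
  α_ g (bv ≫ f) t ≪≫ whiskerLeftIso g (α_ bv f t ≪≫ whiskerLeftIso bv κ ≪≫ (α_ _ _ _).symm ≪≫
    whiskerRightIso H.symm k ≪≫ α_ _ _ _) ≪≫ (α_ _ _ _).symm

theorem sqIso_hom {z b c x y : M} (g : z ⟶ b) {bv : b ⟶ b} {cv : c ⟶ c} {f : b ⟶ x} {t : x ⟶ y}
    {h : b ⟶ c} {k : c ⟶ y} (κ : f ≫ t ≅ h ≫ k) (H : h ≫ cv ≅ bv ≫ h) : (sqIso g κ H).hom =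
      𝟙 ((g ≫ bv ≫ f) ≫ t) ⊗≫ g ◁ bv ◁ κ.hom ⊗≫ g ◁ H.inv ▷ k ⊗≫ 𝟙 ((g ≫ h) ≫ cv ≫ k) := by
  simp only [sqIso, Iso.trans_hom, Iso.symm_hom, whiskerLeftIso_hom, whiskerRightIso_hom]
  bicategory

theorem sqIso_hom_eq {z b c x y : M} (g : z ⟶ b) {bv : b ⟶ b} {cv : c ⟶ c} {f : b ⟶ x}
    {t : x ⟶ y} {h : b ⟶ c} {k : c ⟶ y} (κ : f ≫ t ≅ h ≫ k) (H : h ≫ cv ≅ bv ≫ h) :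
    (sqIso g κ H).hom = (α_ _ _ _).hom ≫ g ◁ ((α_ _ _ _).hom ≫ bv ◁ κ.hom ≫
      ((α_ h cv k).symm ≪≫ whiskerRightIso H k ≪≫ α_ _ _ _).inv) ≫ (α_ _ _ _).inv := by
  simp [sqIso]

theorem sqIso_whisker {z b c x y : M} {g g' : z ⟶ b} (θ : g ⟶ g') {bv : b ⟶ b} {cv : c ⟶ c}
    {f : b ⟶ x} {t : x ⟶ y} {h : b ⟶ c} {k : c ⟶ y} (κ : f ≫ t ≅ h ≫ k) (H : h ≫ cv ≅ bv ≫ h) :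
    (θ ▷ (bv ≫ f)) ▷ t ≫ (sqIso g' κ H).hom = (sqIso g κ H).hom ≫ (θ ▷ h) ▷ (cv ≫ k) := by
  rw [sqIso_hom, sqIso_hom]
  calc
    _ = 𝟙 _ ⊗≫ (θ ▷ (bv ≫ f ≫ t) ≫ g' ◁ (bv ◁ κ.hom ⊗≫ H.inv ▷ k)) ⊗≫ 𝟙 _ := by bicategory
    _ = _ := by rw [← whisker_exchange]; bicategory

/-- The comparisons along the squares at levels n + 1 and n are compatible: `hκ` says so for the
underlying squares, and equivariance of `ψ` lets the action of v pass through. -/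
theorem sqIso_cone {z b c c' l x x' : M} (g : z ⟶ b) {bv : b ⟶ b} {cv : c ⟶ c} {cv' : c' ⟶ c'}
    {f : b ⟶ l} {p : l ⟶ x} {p' : l ⟶ x'} {t : x' ⟶ x} {r : b ⟶ c} {r' : b ⟶ c'} {h : c' ⟶ c}
    {k : c ⟶ x} {k' : c' ⟶ x'} (φ : p' ≫ t ≅ p) (ψ : r' ≫ h ≅ r) (κ : f ≫ p ≅ r ≫ k)
    (κ' : f ≫ p' ≅ r' ≫ k') (χ : k' ≫ t ≅ h ≫ k) (R : r ≫ cv ≅ bv ≫ r) (R' : r' ≫ cv' ≅ bv ≫ r')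
    (H : h ≫ cv ≅ cv' ≫ h)
    (hψ : ψ.hom ▷ cv ≫ R.hom = (compTgt R' H).hom ≫ bv ◁ ψ.hom)
    (hκ : κ'.hom ▷ t ≫ (α_ _ _ _).hom ≫ r' ◁ χ.hom ≫ (α_ _ _ _).inv ≫ ψ.hom ▷ k =
      (α_ _ _ _).hom ≫ f ◁ φ.hom ≫ κ.hom)
    {S : (g ≫ bv ≫ f) ≫ p ⟶ (g ≫ r) ≫ cv ≫ k} {S' : (g ≫ bv ≫ f) ≫ p' ⟶ (g ≫ r') ≫ cv' ≫ k'}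
    {U : ((g ≫ r') ≫ cv' ≫ k') ≫ t ⟶ ((g ≫ r') ≫ h) ≫ cv ≫ k} (hS : S = (sqIso g κ R).hom)
    (hS' : S' = (sqIso g κ' R').hom) (hU : U = (sqIso (g ≫ r') χ H).hom) :
    S' ▷ t ≫ U ≫ ((α_ g r' h).hom ≫ g ◁ ψ.hom) ▷ (cv ≫ k) =
      ((α_ (g ≫ bv ≫ f) p' t).hom ≫ (g ≫ bv ≫ f) ◁ φ.hom) ≫ S := by
  have hψ' : bv ◁ ψ.hom ≫ R.inv = (compTgt R' H).inv ≫ ψ.hom ▷ cv := by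
    rw [Iso.comp_inv_eq, Category.assoc, hψ, Iso.inv_hom_id_assoc]
  simp only [compTgt, Iso.trans_inv, Iso.symm_inv, whiskerLeftIso_inv, whiskerRightIso_inv] at hψ'
  rw [hS, hS', hU, sqIso_hom, sqIso_hom, sqIso_hom]
  symm
  calc
    _ = 𝟙 _ ⊗≫ g ◁ bv ◁ ((α_ _ _ _).hom ≫ f ◁ φ.hom ≫ κ.hom) ⊗≫ g ◁ R.inv ▷ k ⊗≫ 𝟙 _ := by
      bicategory
    _ = 𝟙 _ ⊗≫ g ◁ bv ◁ κ'.hom ▷ t ⊗≫ g ◁ bv ◁ r' ◁ χ.hom ⊗≫ g ◁ (bv ◁ ψ.hom ≫ R.inv) ▷ k ⊗≫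
        𝟙 _ := by rw [← hκ]; bicategory
    _ = 𝟙 _ ⊗≫ g ◁ bv ◁ κ'.hom ▷ t ⊗≫ g ◁ ((bv ≫ r') ◁ χ.hom ≫ R'.inv ▷ (h ≫ k)) ⊗≫
        g ◁ r' ◁ H.inv ▷ k ⊗≫ g ◁ ψ.hom ▷ (cv ≫ k) ⊗≫ 𝟙 _ := by rw [hψ']; bicategory
    _ = _ := by rw [whisker_exchange]; bicategory

end Coherence

section Bicat

open Bicategory

variable {V : Type u'} [Category.{v'} V] [MonoidalCategory V]
variable {I : Type w} [Category.{w} I] [MonoidalCategory I] [EnrichedOrdinaryCategory V I]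
variable {M : Type u₂} [Bicategory.{w₂, v₂} M] [VCatCategory V M]

section

variable {b x y : M} {β : SAct V I .r b} {ξ : SAct V I .l x} {υ : SAct V I .l y}

theorem EquivMor.cmp_t_left (F : EquivMor β.ob ξ.ob) (P : EquivMor ξ.ob υ.ob) (u : I) :
    (F.cmp P).t u = compSrc (F.t u) (P.ts u) :=
  srcIso_compIso_left (F.τ u) (P.τ u)

variable [MonoidalClosed V] [IsBase V] [Bicategory.Strict M] [IsStrictMonoidal I]

/-- The wedges of isomorphic equivariant morphisms are isomorphic. -/
def EquivMor.wedgeMapIso {A B : IObj V I M} {F G : EquivMor B A} (i : F ≅ G) :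
    F.wedge ≅ G.wedge where
  hom := wedgeMap i.hom
  inv := wedgeMap i.inv
  hom_inv_id := Wedge.hom_ext fun v => by
    have := whiskerLeft_hom_inv (B.act'.obj v) ((EquivMor.forget _ _).mapIso i)
    exact this
  inv_hom_id := Wedge.hom_ext fun v => by
    have := whiskerLeft_inv_hom (B.act'.obj v) ((EquivMor.forget _ _).mapIso i)
    exact this

/-- The wedge of the composite of `F` and `P` is the composite of the wedge of `F` with `P`. -/
def EquivMor.wedgePush (F : EquivMor β.ob ξ.ob) (P : EquivMor ξ.ob υ.ob) :
    F.wedge.push P ≅ (F.cmp P).wedge :=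
  Wedge.isoMk (F := F.wedge.push P) (G := (F.cmp P).wedge) (fun _ => α_ _ _ _)
    (fun {v v'} h => by
      change (β.F.map h ▷ F.f) ▷ P.f ≫ (α_ _ _ _).hom = (α_ _ _ _).hom ≫ β.F.map h ▷ (F.f ≫ P.f)
      simp)
    (fun u v => by
      have := push_phi (F.t u) (P.ts u) (β.ob.μ v u)
      rw [← EquivMor.cmp_t_left] at this
      exact this)

/-- The compositions of a wedge with morphisms of the vertex and with equivariant morphisms
commute. -/
def Wedge.pullPush {Z Z' : M} (W : Wedge V .r ξ.ob Z) (g : Z' ⟶ Z) (P : EquivMor ξ.ob υ.ob) :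
    (W.pull g).push P ≅ (W.push P).pull g :=
  Wedge.isoMk (F := (W.pull g).push P) (G := (W.push P).pull g) (fun _ => α_ _ _ _)
    (fun {v v'} h => by
      change (g ◁ W.e.map h) ▷ P.f ≫ (α_ _ _ _).hom = (α_ _ _ _).hom ≫ g ◁ (W.e.map h ▷ P.f)
      simp)
    (fun u v => pull_push g (P.ts u) (W.σ u v))

/-- The associativity of the composition of a wedge with morphisms of the vertex. -/
def Wedge.pullPull {s : Side} {A : IObj V I M} {Z Z' Z'' : M} (W : Wedge V s A Z) (g : Z'' ⟶ Z')
    (h : Z' ⟶ Z) : (W.pull h).pull g ≅ W.pull (g ≫ h) :=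
  Wedge.isoMk (F := (W.pull h).pull g) (G := W.pull (g ≫ h)) (fun _ => (α_ _ _ _).symm)
    (fun {v v'} k => by
      change g ◁ h ◁ W.e.map k ≫ (α_ _ _ _).inv = (α_ _ _ _).inv ≫ (g ≫ h) ◁ W.e.map k
      simp)
    (fun u v => pull_pull g h (W.σ u v))

variable {c : M} {γ : SAct V I .r c}

/-- The comparison of the wedges along a square of equivariant morphisms. -/
def EquivMor.wedgeSq {F : EquivMor β.ob ξ.ob} {P : EquivMor ξ.ob υ.ob} {H : EquivMor β.ob γ.ob}
    {G : EquivMor γ.ob υ.ob} (κ : F.cmp P ≅ H.cmp G) {Z : M} (g : Z ⟶ b) :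
    (F.wedge.pull g).push P ≅ G.wedge.pull (g ≫ H.f) :=
  F.wedge.pullPush g P ≪≫ (Wedge.pullFunctorIso
    (F.wedgePush P ≪≫ wedgeMapIso κ ≪≫ (H.wedgeCmp G).symm) Z).app g ≪≫ G.wedge.pullPull g H.f

theorem EquivMor.wedgeSq_app {F : EquivMor β.ob ξ.ob} {P : EquivMor ξ.ob υ.ob}
    {H : EquivMor β.ob γ.ob} {G : EquivMor γ.ob υ.ob} (κ : F.cmp P ≅ H.cmp G) {Z : M} (g : Z ⟶ b)
    (v : I) : (wedgeSq κ g).hom.θ.app v =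
      (sqIso g ((EquivMor.forget _ _).mapIso κ) (H.ts v)).hom :=
  (sqIso_hom_eq g ((EquivMor.forget _ _).mapIso κ) (H.ts v)).symm

variable [HasLimitsOfSize.{w, w} V]

theorem EquivMor.wedgeSq_naturality {F : EquivMor β.ob ξ.ob} {P : EquivMor ξ.ob υ.ob}
    {H : EquivMor β.ob γ.ob} {G : EquivMor γ.ob υ.ob} (κ : F.cmp P ≅ H.cmp G) {Z : M}
    {g g' : Z ⟶ b} (θ : g ⟶ g') :
    (Wedge.pushFunctor Z P).map ((F.wedge.pullFunctor Z).map θ) ≫ (wedgeSq κ g').hom =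
      (wedgeSq κ g).hom ≫ (G.wedge.pullFunctor Z).map (θ ▷ H.f) :=
  Wedge.hom_ext fun v => by
    have := sqIso_whisker θ (bv := β.F.obj v) (cv := γ.F.obj v) ((EquivMor.forget _ _).mapIso κ)
      (H.ts v)
    exact (congrArg (_ ≫ ·) (wedgeSq_app κ g' v)).trans (this.trans
      (congrArg (· ≫ _) (wedgeSq_app κ g v)).symm)

end

variable [MonoidalClosed V] [HasLimitsOfSize.{w, w} V] [IsBase V]
variable [Bicategory.Strict M] [IsStrictMonoidal I]

/-! ### The passage from `L` to Inv_r(L) preserves weak limits of towers. -/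

section Tower

variable {pt : ℕ → M} {υ : ∀ n, SAct V I .l (pt n)} {t : ∀ n, (υ (n + 1)).ob ⟶ (υ n).ob}
  {rpt : ℕ → M} {ρ : ∀ n, SAct V I .r (rpt n)} {h : ∀ n, (ρ (n + 1)).ob ⟶ (ρ n).ob}
  {E : ∀ n, (ρ n).ob ⟶ (υ n).ob} (κ : ∀ n, E (n + 1) ≫ t n ≅ h n ≫ E n) (Z : M)

/-- The functor from the weak cones on a tower of objects with right actions to weak cones of
wedges given by morphisms `E n` to a tower of objects with left actions. -/
def evFunctor : TowerCone (fun n => (ρ n).ob.pt) (fun n => EquivMor.f (h n)) Z ⥤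
    PCone (fun n => Wedge V .r (υ n).ob Z) (fun n => Wedge.pushFunctor Z (t n)) where
  obj c := ⟨fun n => (EquivMor.wedge (E n)).pull (c.g n), fun n =>
    EquivMor.wedgeSq (κ n) (c.g (n + 1)) ≪≫
      ((EquivMor.wedge (E n)).pullFunctor Z).mapIso (c.φ n)⟩
  map {c d} a := ⟨fun n => ((EquivMor.wedge (E n)).pullFunctor Z).map (a.θ n), fun n => by
    have h₁ := EquivMor.wedgeSq_naturality (κ n) (a.θ (n + 1))
    have h₂ := congrArg ((EquivMor.wedge (E n)).pullFunctor Z).map (a.comm n)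
    rw [Functor.map_comp, Functor.map_comp] at h₂
    refine (Category.assoc _ _ _).symm.trans ((congrArg (· ≫ _) h₁).trans ?_)
    exact (Category.assoc _ _ _).trans ((congrArg (_ ≫ ·) h₂).trans (Category.assoc _ _ _).symm)⟩
  map_id c := PCone.Hom.ext (funext fun n => ((EquivMor.wedge (E n)).pullFunctor Z).map_id _)
  map_comp a b :=
    PCone.Hom.ext (funext fun n => ((EquivMor.wedge (E n)).pullFunctor Z).map_comp _ _)

theorem faithful_evFunctor (hE : ∀ n, ((EquivMor.wedge (E n)).pullFunctor Z).Faithful) :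
    (evFunctor κ Z).Faithful where
  map_injective e := TowerCone.Hom.ext (funext fun n =>
    ((EquivMor.wedge (E n)).pullFunctor Z).map_injective (congrArg (fun x => PCone.Hom.θ x n) e))

theorem full_evFunctor (hE : ∀ n, ((EquivMor.wedge (E n)).pullFunctor Z).Faithful)
    (hE' : ∀ n, ((EquivMor.wedge (E n)).pullFunctor Z).Full) : (evFunctor κ Z).Full where
  map_surjective {c d} b := by
    let a (n : ℕ) : c.g n ⟶ d.g n :=
      ((EquivMor.wedge (E n)).pullFunctor Z).preimage (PCone.Hom.θ b n)
    have ha (n : ℕ) : ((EquivMor.wedge (E n)).pullFunctor Z).map (a n) = PCone.Hom.θ b n :=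
      Functor.map_preimage _ _
    -- Each component lifts separately because `E n` gives a universal wedge; the cone condition is
    -- checked after pulling back the wedge of `E n`, where it is that of `b`.
    refine ⟨⟨a, fun n => ((EquivMor.wedge (E n)).pullFunctor Z).map_injective ?_⟩,
      PCone.Hom.ext (funext ha)⟩
    rw [Functor.map_comp, Functor.map_comp, ha]
    have h₁ := EquivMor.wedgeSq_naturality (κ n) (a (n + 1))
    have h₂ := PCone.Hom.comm b n
    rw [← ha (n + 1)] at h₂
    refine (cancel_epi (EquivMor.wedgeSq (κ n) (c.g (n + 1))).hom).1 ?_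
    refine (Category.assoc _ _ _).symm.trans ((congrArg (· ≫ _) h₁).symm.trans ?_)
    exact (Category.assoc _ _ _).trans (h₂.trans (Category.assoc _ _ _))

variable {l : M} {ℓ : SAct V I .l l} (C : TowerCone (fun n => (υ n).ob) t ℓ.ob)
  {r : M} {ρ' : SAct V I .r r} (D : TowerCone (fun n => (ρ n).ob) h ρ'.ob) {E' : ρ'.ob ⟶ ℓ.ob}
  (κ' : ∀ n, E' ≫ C.g n ≅ D.g n ≫ E n)

/-- Two routes lead from morphisms into the vertex of `D` to weak cones of wedges: through the
wedges on the vertex of `C`, which is an equivalence by `hE'` and `hC`, or through the weak cones on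
the right-hand tower. The squares `κ'` make the routes isomorphic. The functor `evFunctor` is fully
faithful as each `E n` is universal, and essentially surjective since the composite is, so the
remaining factor is an equivalence. -/
theorem isEquivalence_pullFunctor_of_wedge
    (hκ : ∀ n, (κ' (n + 1)).hom ▷ t n ≫ (α_ _ _ _).hom ≫ D.g (n + 1) ◁ (κ n).hom ≫
      (α_ _ _ _).inv ≫ (D.φ n).hom ▷ E n = (α_ _ _ _).hom ≫ E' ◁ (C.φ n).hom ≫ (κ' n).hom)
    (hE : ∀ n, ((EquivMor.wedge (E n)).pullFunctor Z).IsEquivalence)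
    (hE' : ((EquivMor.wedge E').pullFunctor Z).IsEquivalence)
    (hC : IsVEquivalence V (C.forget.pullFunctor Z)) :
    (D.forget.pullFunctor Z).IsEquivalence := by
  have := C.isEquivalence_wedgeFunctor Z hC
  have := faithful_evFunctor κ Z fun n => inferInstance
  have := full_evFunctor κ Z (fun n => inferInstance) fun n => inferInstance
  let i : (EquivMor.wedge E').pullFunctor Z ⋙ C.wedgeFunctor Z ≅
      D.forget.pullFunctor Z ⋙ evFunctor κ Z :=
    NatIso.ofComponents (fun g => PCone.isoMk (fun n => EquivMor.wedgeSq (κ' n) g)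
      (fun n => Wedge.hom_ext fun v => by
        exact sqIso_cone g (C.forget.φ n) (D.forget.φ n) ((EquivMor.forget _ _).mapIso (κ' n))
          ((EquivMor.forget _ _).mapIso (κ' (n + 1))) ((EquivMor.forget _ _).mapIso (κ n))
          (EquivMor.ts (D.g n) v) (EquivMor.ts (D.g (n + 1)) v) (EquivMor.ts (h n) v)
          ((EquivMor.Hom.comm_ts (D.φ n).hom v).trans
            (congrArg (fun x => Iso.hom x ≫ _) (EquivMor.cmp_ts _ _ v)))
          (congrArg EquivMor.Hom.θ (hκ n)) (EquivMor.wedgeSq_app (κ' n) g v)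
          (EquivMor.wedgeSq_app (κ' (n + 1)) g v) (EquivMor.wedgeSq_app (κ n) _ v)))
      (fun θ => PCone.Hom.ext (funext fun n => EquivMor.wedgeSq_naturality (κ' n) θ))
  have : (D.forget.pullFunctor Z ⋙ evFunctor κ Z).IsEquivalence :=
    Functor.isEquivalence_of_iso i
  -- Essential surjectivity is inherited from the composite, which avoids lifting weak cones of
  -- wedges by hand.
  have : (evFunctor κ Z).EssSurj := ⟨fun c =>
    ⟨_, ⟨(D.forget.pullFunctor Z ⋙ evFunctor κ Z).objObjPreimageIso c⟩⟩⟩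
  have : (evFunctor κ Z).IsEquivalence := {}
  exact Functor.isEquivalence_of_comp_right _ (evFunctor κ Z)

end Tower

end Bicat

/-! ### Interleaved towers -/

section Interleave

open Bicategory

variable {K : Type u₂} [Bicategory.{w₂, v₂} K]

namespace TowerCone

variable {X R : ℕ → K} {l : ∀ n, X (n + 1) ⟶ R n} {E : ∀ n, R n ⟶ X n} {L : K}

/-- The weak cone on the tower of the `R n` given by a weak cone on the interleaved tower of the
`X n`. -/
def interleave (C : TowerCone X (fun n => l n ≫ E n) L) :
    TowerCone R (fun n => E (n + 1) ≫ l n) L where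
  g n := C.g (n + 1) ≫ l n
  φ n := α_ _ _ _ ≪≫ whiskerLeftIso _ (α_ _ _ _).symm ≪≫ (α_ _ _ _).symm ≪≫
    whiskerRightIso (C.φ (n + 1)) (l n)

/-- The factorization of a weak cone on the tower of the `X n` through the tower of the `R n`. -/
def interleaveIso (C : TowerCone X (fun n => l n ≫ E n) L) {Z : K} (f : Z ⟶ L) (n : ℕ) :
    f ≫ C.g n ≅ (f ≫ C.g (n + 1) ≫ l n) ≫ E n :=
  whiskerLeftIso f ((C.φ n).symm ≪≫ (α_ _ _ _).symm) ≪≫ (α_ _ _ _).symm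

/-- The condition on squares needed in `isEquivalence_pullFunctor_of_wedge`. Both sides reduce to
the same coherence isomorphism once the comparison isomorphisms at n and n + 1 have met their
inverses. -/
theorem interleaveIso_comm (C : TowerCone X (fun n => l n ≫ E n) L) {Z : K} (f : Z ⟶ L) (n : ℕ) :
    (C.interleaveIso f (n + 1)).hom ▷ (l n ≫ E n) ≫ (α_ _ _ _).hom ≫
        (f ≫ C.g (n + 2) ≫ l (n + 1)) ◁ (α_ _ _ _).inv ≫ (α_ _ _ _).inv ≫
        (((C.interleave.pullFunctor Z).obj f).φ n).hom ▷ E n =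
      (α_ _ _ _).hom ≫ f ◁ (C.φ n).hom ≫ (C.interleaveIso f n).hom := by
  simp only [interleaveIso, interleave, pullFunctor, Iso.trans_hom, Iso.symm_hom,
    whiskerLeftIso_hom, whiskerRightIso_hom]
  calc
    _ = 𝟙 ((f ≫ C.g (n + 1)) ≫ l n ≫ E n) ⊗≫ f ◁ ((C.φ (n + 1)).inv ≫ (C.φ (n + 1)).hom) ▷
        (l n ≫ E n) ⊗≫ 𝟙 ((f ≫ C.g (n + 1) ≫ l n) ≫ E n) := by bicategory
    _ = 𝟙 ((f ≫ C.g (n + 1)) ≫ l n ≫ E n) ⊗≫ f ◁ ((C.φ n).hom ≫ (C.φ n).inv) ⊗≫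
        𝟙 ((f ≫ C.g (n + 1) ≫ l n) ≫ E n) := by
      rw [Iso.inv_hom_id, Iso.hom_inv_id]; bicategory
    _ = _ := by bicategory

/-- The associativity of the composition of a weak cone with morphisms of the vertex. -/
def pullPull {Y : ℕ → K} {t : ∀ n, Y (n + 1) ⟶ Y n} (C : TowerCone Y t L) {Z Z' : K} (f : Z ⟶ Z')
    (g : Z' ⟶ L) :
    (C.pullFunctor Z).obj (f ≫ g) ≅ (((C.pullFunctor Z').obj g).pullFunctor Z).obj f :=
  isoMk (fun n => α_ _ _ _) fun n => by
    simp only [pullFunctor, Iso.trans_hom, whiskerLeftIso_hom]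
    bicategory

/-- An endomorphism that fixes the legs to the R_n also fixes those to the X_n, since the leg to X_n
factors through R_n. As the X_n determine morphisms into the limit, it is isomorphic to the
identity. -/
theorem nonempty_iso_id_of_interleave (C : TowerCone X (fun n => l n ≫ E n) L)
    (h : (C.pullFunctor L).Full) (h' : (C.pullFunctor L).Faithful) {a : L ⟶ L}
    (i : (C.interleave.pullFunctor L).obj a ≅ C.interleave) : Nonempty (a ≅ 𝟙 L) := by
  let j (n : ℕ) : a ≫ C.g (n + 1) ≫ l n ≅ C.g (n + 1) ≫ l n :=
    ⟨Hom.θ i.hom n, Hom.θ i.inv n, congrArg (fun x => Hom.θ x n) i.hom_inv_id,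
      congrArg (fun x => Hom.θ x n) i.inv_hom_id⟩
  have hj (n : ℕ) : (j (n + 1)).hom ▷ (E (n + 1) ≫ l n) ≫ (C.interleave.φ n).hom =
    ((α_ _ _ _).hom ≫ a ◁ (C.interleave.φ n).hom) ≫ (j n).hom := Hom.comm i.hom n
  -- On the n-th leg: factor through R_n, apply `j n`, and recombine.
  refine ⟨(C.pullFunctor L).preimageIso (isoMk (fun n => C.interleaveIso a n ≪≫
    whiskerRightIso (j n) (E n) ≪≫ α_ _ _ _ ≪≫ C.φ n ≪≫ (λ_ _).symm) fun n => ?_)⟩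
  have hj := hj n
  simp only [interleaveIso, interleave, pullFunctor, Iso.trans_hom, Iso.symm_hom,
    whiskerLeftIso_hom, whiskerRightIso_hom] at hj ⊢
  calc
    _ = 𝟙 ((a ≫ C.g (n + 1)) ≫ l n ≫ E n) ⊗≫ a ◁ (C.φ (n + 1)).inv ▷ (l n ≫ E n) ⊗≫
        ((j (n + 1)).hom ▷ (E (n + 1) ≫ l n) ≫ (α_ _ _ _).hom ≫ C.g (n + 2) ◁ (α_ _ _ _).inv ≫
          (α_ _ _ _).inv ≫ (C.φ (n + 1)).hom ▷ l n) ▷ E n ⊗≫ (C.φ n).hom ⊗≫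
        𝟙 (𝟙 L ≫ C.g n) := by bicategory
    _ = 𝟙 ((a ≫ C.g (n + 1)) ≫ l n ≫ E n) ⊗≫ a ◁ ((C.φ (n + 1)).inv ≫ (C.φ (n + 1)).hom) ▷
        (l n ≫ E n) ⊗≫ (j n).hom ▷ E n ⊗≫ (C.φ n).hom ⊗≫ 𝟙 (𝟙 L ≫ C.g n) := by
      rw [hj]; bicategory
    _ = 𝟙 ((a ≫ C.g (n + 1)) ≫ l n ≫ E n) ⊗≫ a ◁ ((C.φ n).hom ≫ (C.φ n).inv) ⊗≫
        (j n).hom ▷ E n ⊗≫ (C.φ n).hom ⊗≫ 𝟙 (𝟙 L ≫ C.g n) := by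
      rw [Iso.inv_hom_id, Iso.hom_inv_id]; bicategory
    _ = _ := by bicategory

end TowerCone

/-- Both `E ≫ G` and the identity become isomorphic to `E` after composition with `E`, and this
composition is fully faithful on endomorphisms of `R`. -/
theorem nonempty_iso_id_of_section {L R : K} {E : R ⟶ L} {G : L ⟶ R} (i : G ≫ E ≅ 𝟙 L)
    (h : (postcomp R E : (R ⟶ R) ⥤ (R ⟶ L)).Full)
    (h' : (postcomp R E : (R ⟶ R) ⥤ (R ⟶ L)).Faithful) : Nonempty (E ≫ G ≅ 𝟙 R) :=
  ⟨(postcomp R E).preimageIso (α_ E G E ≪≫ whiskerLeftIso E i ≪≫ ρ_ E ≪≫ (λ_ E).symm)⟩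

end Interleave

/-! ### Stability of the weak limit. -/

section Bicat

open Bicategory

variable {V : Type u'} [Category.{v'} V] [MonoidalCategory V]
variable {I : Type w} [Category.{w} I] [MonoidalCategory I] [EnrichedOrdinaryCategory V I]
variable {M : Type u₂} [Bicategory.{w₂, v₂} M] [VCatCategory V M]
variable [MonoidalClosed V] [HasLimitsOfSize.{w, w} V] [IsBase V]
variable [Bicategory.Strict M] [IsStrictMonoidal I]

/-- The evaluation at the unit on `Inv_r` of the weak limit of an interleaved tower has a
section. -/
theorem InvData.exists_section {X : ℕ → IObj V I M} (hX : ∀ n, (X n).side = .l)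
    (D : ∀ n, InvData V .r (X n)) (e : ∀ n, (D n).act.ob ⟶ X n) (he : ∀ n, e n = (D n).ev)
    {l : ∀ n, X (n + 1) ⟶ (D n).act.ob}
    {p : M} {ℓ : SAct V I .l p} (C : TowerCone X (fun n => l n ≫ e n) ℓ.ob)
    (hC : ∀ Z, IsVEquivalence V (C.forget.pullFunctor Z)) (D' : InvData V .r ℓ.ob) :
    ∃ G : ℓ.ob ⟶ D'.act.ob, Nonempty (G ≫ (D'.ev : D'.act.ob ⟶ ℓ.ob) ≅ 𝟙 ℓ.ob) := by
  obtain ⟨pt, υ, rfl⟩ := IObj.exists_eq_ob hX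
  obtain rfl : e = fun n => (D n).ev := funext he
  let ev' : D'.act.ob ⟶ ℓ.ob := D'.ev
  let E (n : ℕ) : (D n).act.ob ⟶ (υ n).ob := (D n).ev
  let κ (n : ℕ) : E (n + 1) ≫ l n ≫ E n ≅ (E (n + 1) ≫ l n) ≫ E n :=
    (α_ (E (n + 1)) (l n) (E n)).symm
  -- The cone from Inv_r(L) to the R_n, obtained by composing the evaluation with the interleaved
  -- cone, has the weak limit property in `M` for the vertex of L, the only test object needed.
  have hD := isEquivalence_pullFunctor_of_wedge κ p C
    ((C.interleave.pullFunctor D'.act.ob).obj ev') (C.interleaveIso ev') (C.interleaveIso_comm ev')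
    (fun n => ((D n).universal_ev p).isEquivalence) (D'.universal_ev p).isEquivalence (hC p)
  -- The R_n and Inv_r(L) all act on the right, so the property passes to equivariant morphisms. The
  -- source L may act on the left, and its interleaved cone factors through Inv_r(L).
  obtain ⟨G, ⟨i⟩⟩ := (TowerCone.essSurj_pullFunctor _ ℓ.ob hD).mem_essImage C.interleave
  have := (C.isVEquivalence_pullFunctor ℓ.ob (hC p)).isEquivalence
  exact ⟨G, C.nonempty_iso_id_of_interleave inferInstance inferInstance
    (C.interleave.pullPull G ev' ≪≫ i)⟩

variable {inv : ∀ (s : Side) (X : IObj V I M), InvData V s X} {A : IObj V I M}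

/-- The evaluation from Inv_r(L) to L has a section up to isomorphism. Since Inv_r(L) acts on the
right, composition with the evaluation is fully faithful on its endomorphisms, so the section is a
two-sided inverse. -/
theorem TowerLimit.isStable (L : TowerLimit inv A) : L.obj.IsStable := by
  let D := inv .r L.obj
  obtain ⟨G, ⟨i⟩⟩ : ∃ G : L.obj ⟶ D.act.ob, Nonempty (G ≫ (D.ev : D.act.ob ⟶ L.obj) ≅ 𝟙 L.obj) := by
    have h := L.isVEquivalence_pullFunctor_forget
    have ht : towerHom inv A = fun n => towerEv inv A n ≫ (inv .r (tower inv A n)).ev :=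
      funext towerHom_eq
    generalize L.cone = C at h
    generalize towerHom inv A = t at C h ht
    subst ht
    exact InvData.exists_section tower_side (fun n => inv .r (tower inv A n)) _ (fun n => rfl) C h D
  -- The mapping property of Inv_r(L) is used with Inv_r(L) itself as source; no stability is
  -- required since it already acts on the right.
  have := (D.isVEquivalence_postcomp_ev (B := D.act.ob) rfl).isEquivalence
  obtain ⟨j⟩ := nonempty_iso_id_of_section i inferInstance inferInstance
  exact ⟨D.act.ob, rfl, IObj.equivalent_of_equiv i j⟩

end Bicat

end

end StabAct

theorem mainTheorem2 {V : Type u'} [CategoryTheory.Category.{v'} V]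
    [CategoryTheory.MonoidalCategory V] [CategoryTheory.SymmetricCategory V]
    [CategoryTheory.MonoidalClosed V] [CategoryTheory.Limits.HasLimitsOfSize.{w, w} V]
    [StabAct.IsBase V]
    {I : Type w} [CategoryTheory.Category.{w} I] [CategoryTheory.MonoidalCategory I]
    [CategoryTheory.EnrichedOrdinaryCategory V I] [StabAct.IsStrictMonoidal I]
    [StabAct.IsVMonoidal V I]
    {M : Type u₂} [CategoryTheory.Bicategory.{w₂, v₂} M] [CategoryTheory.Bicategory.Strict M]
    [StabAct.VCatCategory V M]
    (inv : ∀ (s : StabAct.Side) (X : StabAct.IObj V I M), StabAct.InvData V s X)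
    (A : StabAct.IObj V I M) (L : StabAct.TowerLimit inv A) :
    StabAct.IsStabilization A L.obj L.epsInf := by
  exact ⟨L.isStable, fun B hB => L.isVEquivalence_postcompFunctor hB⟩
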